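/- **Theorem (Guarded Recursion on Dilators).** *Theory.* The primitive recursive set functions (Jensen–Karp) are generated from $x\mapsto 0$, the projections, $(x_0,x_1)\mapsto x_0\cup\{x_1\}$, the case distinction with value $x_0$ if $x_2\in x_3$ and $x_1$ otherwise, and the constant $\omega$, by composition and by recursion $R(x,\mathbf y)=H(\bigcup\{R(v,\mathbf y)\mid v\in x\},x,\mathbf y)$. The language of $\mathsf{ATR_0^{set}}$ has $\in$, $=$ and one function symbol for each such construction. Its axioms are the defining axioms of the function symbols (for recursion, including that the set $\bigcup\{R(v,\mathbf y)\mid v\in x\}$ exists), extensionality, foundation for sets, infinity, axiom beta (every well-founded relation $r$ has a function $f$ on its field with $f(y)=\{f(x)\mid (x,y)\in r\}$) and countability (every set admits an injection into $\omega$). *Dilators.* Let $\mathsf{Nat}$ be the category of the finite orders $n=\{0<\dots<n-1\}$ and order embeddings. A predilator is a set coding a functor $D$ from $\mathsf{Nat}$ to linear orders and embeddings that is monotone ($f\le g$ pointwise implies $D(f)\le D(g)$ pointwise), together with a natural transformation $\operatorname{supp}:D\Rightarrow[\cdot]^{<\omega}$ such that $\operatorname{supp}_n(\sigma)\subseteq\operatorname{rng}(f)$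 implies $\sigma\in\operatorname{rng}(D(f))$, for $f:m\to n$ and $\sigma\in D(n)$. Its trace is $\operatorname{Tr}(D)=\{(\sigma,n)\mid\sigma\in D(n),\ \operatorname{supp}_n(\sigma)=n\}$. For a linear order $X$, the order $D(X)$ consists of the pairs $(\sigma,a)$ with $a\subseteq X$ finite and $(\sigma,|a|)\in\operatorname{Tr}(D)$; one has $(\sigma,a)<(\tau,b)$ iff $D(f)(\sigma)<D(g)(\tau)$ in $D(|a\cup b|)$, where $f:|a|\to|a\cup b|$ and $g:|b|\to|a\cup b|$ are induced by the inclusions of $a$ and $b$ into $a\cup b$. A predilator $D$ is a dilator if $D(X)$ is well-founded for every well order $X$. *Predecessors.* On $\operatorname{Tr}(D)$, let $(\sigma,m)\ll(\tau,n)$ mean that $D(f)(\sigma)<D(g)(\tau)$ for all embeddings $f:m\to m+n$ and $g:n\to m+n$, and let $s\equiv t$ mean that neither $s\ll t$ nor $t\ll s$. Let $L=\operatorname{Tr}(D)/{\equiv}$, ordered by $\ll$. For $\alpha\in L$ let $D_\alpha\subseteq D$ consist of the elements $\sigma=D(e)(\sigma_0)$ such that $e:|a|\to n$ has range $a=\operatorname{supp}_n(\sigma)$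 and $(\sigma_0,|a|)\in\alpha$. Then $D\cong\sum_{\alpha\in L}D_\alpha$. For a connected summand $E=D_\alpha$ that is not isomorphic to the constant dilator $1$, and for $(\sigma,n)\in\operatorname{Tr}(E)$, let $i(\sigma)$ be the unique $i<n$ such that $f(i)<g(i)$ implies $E(f)(\sigma)<E(g)(\sigma)$ for all embeddings $f,g:n\to 2n$. For an ordinal $\gamma$, let $\{E\}^\gamma(X)$ be the set of $(\sigma,\{a_0<\dots<a_{k-1}\})\in E(\gamma+X)$ such that $i(\sigma)$ is the largest $i<k$ with $a_i<\gamma$, where $E(\gamma+f)$ provides the action on embeddings $f$, and the support is the part of $\{a_0,\dots,a_{k-1}\}$ in $X$. For an ordinal $\eta$, define a set of predilators by $$P_\eta(D)=\begin{cases}\emptyset&\text{if }L=\emptyset,\\ \{\sum_{\alpha<\mu}D_\alpha\}&\text{if }L\text{ has a biggest element }\mu\text{ and }D_\mu\cong 1,\\ \{\sum_{\alpha<\nu}D_\alpha\mid\nu\in L\}&\text{if }L\ne\emptyset\text{ has no biggest element},\\ \{(\sum_{\alpha<\mu}D_\alpha)+\{D_\mu\}^\gamma\mid\gamma<\eta\}&\text{if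 }L\text{ has a biggest element }\mu\text{ and }D_\mu\not\cong 1.\end{cases}$$ *Statement.* For every primitive recursive function symbol $H$ there is a primitive recursive function symbol $F$ such that $\mathsf{ATR_0^{set}}$ proves the following (equivalently, by completeness, such that it is true in every model of $\mathsf{ATR_0^{set}}$). For all parameters $\mathbf y$, every dilator $D$ and all ordinals $\eta$ and $\xi\le\xi'$ such that $D(\omega^{1+\eta})$ has order type below $\xi$, the sets $P_\eta(D)$ and $F(\cdot,\eta,\xi,\mathbf y)\restriction P_\eta(D)=\{\langle E,F(E,\eta,\xi,\mathbf y)\rangle\mid E\in P_\eta(D)\}$ exist, and $$F(D,\eta,\xi,\mathbf y)=F(D,\eta,\xi',\mathbf y)=H\big(F(\cdot,\eta,\xi,\mathbf y)\restriction P_\eta(D),\,D,\,\eta,\,\mathbf y\big).$$ -/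

import Mathlib

/-!
Guarded recursion on dilators, formalized as a statement about the first-order set theory
`ATR_0^set`. The language has `∈` and one function symbol for each construction of a primitive
recursive set function. All predicates below that mention a structure `M` are first-order formulas
read in `M`: they quantify over elements of `M` only.
A statement holds in the theory if it is true in every model of the theory.
-/

namespace DilRec

universe u

/-! ### The language of primitive recursive set theory -/

/-- Function symbols: one for each construction of a primitive recursive set function
(with parameter `ω`), indexed by arity. -/
inductive PRFun : ℕ → Type
  /-- `x ↦ 0` -/
  | zero : PRFun 1
  /-- `(x₀,…,xₙ) ↦ xᵢ` -/
  | proj {n : ℕ} (i : Fin n) : PRFun n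
  /-- `(x₀,x₁) ↦ x₀ ∪ {x₁}` -/
  | adj : PRFun 2
  /-- `(x₀,x₁,x₂,x₃) ↦ x₀` if `x₂ ∈ x₃`, and `x₁` otherwise -/
  | cond : PRFun 4
  /-- the constant `ω` -/
  | omega : PRFun 0
  /-- `x ↦ F(G₀(x),…,Gₘ₋₁(x))` -/
  | comp {m n : ℕ} (F : PRFun m) (G : Fin m → PRFun n) : PRFun n
  /-- `R(x,y) = H(⋃{R(v,y) | v ∈ x}, x, y)` -/
  | prec {n : ℕ} (H : PRFun (n + 2)) : PRFun (n + 1)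

/-- The only relation symbol besides equality is the binary symbol for membership. -/
inductive MemRel : ℕ → Type
  | mem : MemRel 2

/-- The language of primitive recursive set theory. -/
def PRSLang : FirstOrder.Language where
  Functions := PRFun
  Relations := MemRel

section Basic

variable {M : Type u} [PRSLang.Structure M]

/-- Interpretation of a function symbol. -/
def app {n : ℕ} (f : PRFun n) (v : Fin n → M) : M :=
  FirstOrder.Language.Structure.funMap (L := PRSLang) f v

/-- Interpretation of membership. -/
def mem (x y : M) : Prop :=
  FirstOrder.Language.Structure.RelMap (L := PRSLang) MemRel.mem ![x, y]

infix:50 " ∊ " => mem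

variable (M) in
/-- The set `ω`. -/
def om : M := app .omega ![]

variable (M) in
/-- The empty set. -/
def empt : M := app .zero ![om M]

/-- `x ∪ {y}` -/
def adjoin (x y : M) : M := app .adj ![x, y]

/-- `x ∪ {x}` -/
def succ (x : M) : M := adjoin x x

/-- `{x}` -/
def sing (x : M) : M := adjoin (empt M) x

/-- `{x, y}` -/
def upair (x y : M) : M := adjoin (sing x) y

/-- The Kuratowski pair `⟨x, y⟩ = {{x}, {x, y}}`. -/
def opair (x y : M) : M := upair (sing x) (upair x y)

/-- `f` is a function with domain `a`. -/
def IsFunOn (f a : M) : Prop :=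
  (∀ z, z ∊ f → ∃ x y, x ∊ a ∧ z = opair x y) ∧ ∀ x, x ∊ a → ∃! y, opair x y ∊ f

/-- `f` is a function from `a` to `b`. -/
def IsFun (f a b : M) : Prop :=
  IsFunOn f a ∧ ∀ x y, opair x y ∊ f → y ∊ b

end Basic

/-! ### The theories `PRSω` and `ATR_0^set` -/

/-- `M` is a model of primitive recursive set theory with infinity: the defining axioms of all
function symbols, extensionality, foundation and infinity (via the defining axiom of `ω`). -/
class PRSomega (M : Type u) [PRSLang.Structure M] : Prop where
  zero_ax : ∀ x z : M, ¬ z ∊ app .zero ![x]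
  proj_ax : ∀ {n : ℕ} (i : Fin n) (v : Fin n → M), app (.proj i) v = v i
  adj_ax : ∀ x y z : M, z ∊ app .adj ![x, y] ↔ z ∊ x ∨ z = y
  cond_ax : ∀ x₀ x₁ x₂ x₃ : M,
    (x₂ ∊ x₃ → app .cond ![x₀, x₁, x₂, x₃] = x₀) ∧
    (¬ x₂ ∊ x₃ → app .cond ![x₀, x₁, x₂, x₃] = x₁)
  omega_ax : ∀ x : M, x ∊ om M ↔ x = empt M ∨ ∃ y, y ∊ om M ∧ x = succ y
  comp_ax : ∀ {m n : ℕ} (F : PRFun m) (G : Fin m → PRFun n) (v : Fin n → M),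
    app (.comp F G) v = app F (fun i => app (G i) v)
  prec_ax : ∀ {n : ℕ} (H : PRFun (n + 2)) (x : M) (y : Fin n → M),
    ∃ w : M, (∀ z, z ∊ w ↔ ∃ v, v ∊ x ∧ z ∊ app (.prec H) (Matrix.vecCons v y)) ∧
      app (.prec H) (Matrix.vecCons x y) = app H (Matrix.vecCons w (Matrix.vecCons x y))
  extensionality : ∀ x y : M, (∀ z, z ∊ x ↔ z ∊ y) → x = y
  foundation : ∀ x : M, (∃ y, y ∊ x) → ∃ y, y ∊ x ∧ ∀ z, z ∊ x → ¬ z ∊ y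

/-- `M` is a model of `ATR_0^set`, the extension of `PRSω` by axiom beta and the axiom of
countability. -/
class ATR0set (M : Type u) [PRSLang.Structure M] : Prop extends PRSomega M where
  /-- Axiom beta: each well-founded relation `r` has a function `f` on its field with
  `f(y) = {f(x) | (x,y) ∈ r}`. -/
  beta : ∀ r : M, (∀ p, p ∊ r → ∃ x y, p = opair x y) →
    (∀ z : M, (∃ y, y ∊ z) → ∃ y, y ∊ z ∧ ∀ x, x ∊ z → ¬ opair x y ∊ r) →
    ∃ a f : M, (∀ x, x ∊ a ↔ ∃ y, opair x y ∊ r ∨ opair y x ∊ r) ∧ IsFunOn f a ∧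
      ∀ y v, opair y v ∊ f → ∀ z, z ∊ v ↔ ∃ x, opair x y ∊ r ∧ opair x z ∊ f
  /-- Each set admits an injection into `ω`. -/
  countability : ∀ x : M, ∃ g : M, IsFun g x (om M) ∧
    ∀ y z n, opair y n ∊ g → opair z n ∊ g → y = z

section Ordinals

variable {M : Type u} [PRSLang.Structure M]

/-! ### Ordinals and their arithmetic -/

def IsTrans (x : M) : Prop := ∀ y z, y ∊ x → z ∊ y → z ∊ x

/-- `x` is an ordinal: a transitive set of transitive sets. -/
def IsOrd (x : M) : Prop := IsTrans x ∧ ∀ y, y ∊ x → IsTrans y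

/-- `s = α + β`, with the recursive clause `α + b = α ∪ {α + c | c < b}`. -/
def IsAdd (α β s : M) : Prop :=
  ∃ f, IsFunOn f (succ β) ∧
    (∀ b v, opair b v ∊ f → ∀ z, z ∊ v ↔ z ∊ α ∨ ∃ c, c ∊ b ∧ opair c z ∊ f) ∧
    opair β s ∊ f

/-- `s = α · β`, with the recursive clause `α · b = ⋃ {α · c + α | c < b}`. -/
def IsMul (α β s : M) : Prop :=
  ∃ f, IsFunOn f (succ β) ∧
    (∀ b v, opair b v ∊ f →
      ∀ z, z ∊ v ↔ ∃ c w t, c ∊ b ∧ opair c w ∊ f ∧ IsAdd w α t ∧ z ∊ t) ∧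
    opair β s ∊ f

/-- `s = ω ^ β`, with the recursive clause `ω ^ b = {0} ∪ ⋃ {ω ^ c · ω | c < b}`. -/
def IsOmegaPow (β s : M) : Prop :=
  ∃ f, IsFunOn f (succ β) ∧
    (∀ b v, opair b v ∊ f →
      ∀ z, z ∊ v ↔ z = empt M ∨ ∃ c w t, c ∊ b ∧ opair c w ∊ f ∧ IsMul w (om M) t ∧ z ∊ t) ∧
    opair β s ∊ f

/-- `s = ω ^ (1 + η)` -/
def IsOmegaPowOneAdd (η s : M) : Prop :=
  ∃ δ, IsAdd (succ (empt M)) η δ ∧ IsOmegaPow δ s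

end Ordinals

/-! ### Linear orders -/

/-- An order given by a domain and a strict order relation (each by a formula in `M`). -/
structure LO (M : Type u) where
  dom : M → Prop
  lt : M → M → Prop

namespace LO

variable {M : Type u} [PRSLang.Structure M]

structure IsLinear (X : LO M) : Prop where
  lt_dom : ∀ x y, X.lt x y → X.dom x ∧ X.dom y
  irrefl : ∀ x, ¬ X.lt x x
  trans : ∀ x y z, X.lt x y → X.lt y z → X.lt x z
  tri : ∀ x y, X.dom x → X.dom y → X.lt x y ∨ x = y ∨ X.lt y x

/-- Each non-empty set of elements of `X` has a minimal element. -/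
def IsWellFounded (X : LO M) : Prop :=
  ∀ z : M, (∀ x, x ∊ z → X.dom x) → (∃ x, x ∊ z) → ∃ x, x ∊ z ∧ ∀ y, y ∊ z → ¬ X.lt y x

/-- The ordinal (or natural number) `α` as a linear order. -/
def ofOrd (α : M) : LO M where
  dom x := x ∊ α
  lt x y := x ∊ α ∧ y ∊ α ∧ x ∊ y

/-- The set `x` ordered by the set of pairs `r`. -/
def ofRel (x r : M) : LO M where
  dom y := y ∊ x
  lt y z := y ∊ x ∧ z ∊ x ∧ opair y z ∊ r

/-- The suborder `{α ∈ X | α < ν}`. -/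
def below (X : LO M) (ν : M) : LO M where
  dom x := X.dom x ∧ X.lt x ν
  lt x y := X.lt x ν ∧ X.lt y ν ∧ X.lt x y

/-- An element of the left summand of `γ + X`. -/
def inl (x : M) : M := opair (empt M) x

/-- An element of the right summand of `γ + X`. -/
def inr (x : M) : M := opair (succ (empt M)) x

/-- The sum `γ + n` of linear orders, for ordinals `γ` and `n`. -/
def add (γ n : M) : LO M where
  dom z := (∃ x, x ∊ γ ∧ z = inl x) ∨ ∃ i, i ∊ n ∧ z = inr i
  lt z w :=
    (∃ x y, x ∊ γ ∧ y ∊ γ ∧ z = inl x ∧ w = inl y ∧ x ∊ y) ∨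
    (∃ x j, x ∊ γ ∧ j ∊ n ∧ z = inl x ∧ w = inr j) ∨
    (∃ i j, i ∊ n ∧ j ∊ n ∧ z = inr i ∧ w = inr j ∧ i ∊ j)

/-- `a` is a finite subset of `X` with `|a| = n`, and `e = en_a : n → X` is the unique embedding
with range `a`. -/
def IsEn (X : LO M) (a n e : M) : Prop :=
  n ∊ om M ∧ (∀ x, x ∊ a → X.dom x) ∧ IsFun e n a ∧ (∀ x, x ∊ a → ∃ i, opair i x ∊ e) ∧
    ∀ i j x y, opair i x ∊ e → opair j y ∊ e → i ∊ j → X.lt x y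

/-- `X` is isomorphic to an ordinal below `ξ`. -/
def OtpBelow (X : LO M) (ξ : M) : Prop :=
  ∃ ζ c, ζ ∊ ξ ∧ IsFunOn c ζ ∧ (∀ z, X.dom z ↔ ∃ α, opair α z ∊ c) ∧
    ∀ α β z w, α ∊ β → opair α z ∊ c → opair β w ∊ c → X.lt z w

end LO

/-- `f` is a morphism `m → n` of the category `Nat`: `m` and `n` are natural numbers and `f` is an
order embedding. -/
def NatHom {M : Type u} [PRSLang.Structure M] (m n f : M) : Prop :=
  m ∊ om M ∧ n ∊ om M ∧ IsFun f m n ∧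
    ∀ i j x y, opair i x ∊ f → opair j y ∊ f → i ∊ j → x ∊ y

/-! ### Predilators and dilators -/

/-- The data of a predilator on `Nat` (each component by a formula in `M`):
`obj n σ` means `σ ∈ D(n)`, `lt n σ τ` means `σ < τ` in `D(n)`, `map m n f σ τ` means
`D(f)(σ) = τ` for `f : m → n`, and `supp n σ a` means `supp_n(σ) = a`. -/
structure PD (M : Type u) where
  obj : M → M → Prop
  lt : M → M → M → Prop
  map : M → M → M → M → M → Prop
  supp : M → M → M → Prop

namespace PD

variable {M : Type u} [PRSLang.Structure M]

/-- The linear order `D(n)`. -/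
def ord (P : PD M) (n : M) : LO M where
  dom := P.obj n
  lt := P.lt n

/-- `P` is a predilator: a monotone functor from `Nat` to linear orders with a natural
transformation `supp` to the finite powerset functor that satisfies the support condition. -/
structure IsPredilator (P : PD M) : Prop where
  obj_nat : ∀ n σ, P.obj n σ → n ∊ om M
  linear : ∀ n, n ∊ om M → (P.ord n).IsLinear
  lt_obj : ∀ n σ τ, P.lt n σ τ → P.obj n σ ∧ P.obj n τ
  map_hom : ∀ m n f σ τ, P.map m n f σ τ → NatHom m n f ∧ P.obj m σ ∧ P.obj n τ
  map_fun : ∀ m n f σ, NatHom m n f → P.obj m σ → ∃! τ, P.map m n f σ τ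
  map_lt : ∀ m n f σ σ' τ τ', P.map m n f σ τ → P.map m n f σ' τ' → P.lt m σ σ' → P.lt n τ τ'
  map_id : ∀ n f σ, NatHom n n f → (∀ i, i ∊ n → opair i i ∊ f) → P.obj n σ → P.map n n f σ σ
  map_comp : ∀ l m n f g h σ τ ρ, NatHom l n h →
    (∀ i j k, opair i j ∊ f → opair j k ∊ g → opair i k ∊ h) →
    P.map l m f σ τ → P.map m n g τ ρ → P.map l n h σ ρ
  monotone : ∀ m n f g σ τ τ',
    (∀ i x y, opair i x ∊ f → opair i y ∊ g → x ∊ y ∨ x = y) →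
    P.map m n f σ τ → P.map m n g σ τ' → P.lt n τ τ' ∨ τ = τ'
  supp_obj : ∀ n σ a, P.supp n σ a → P.obj n σ ∧ ∀ i, i ∊ a → i ∊ n
  supp_fun : ∀ n σ, P.obj n σ → ∃! a, P.supp n σ a
  supp_natural : ∀ m n f σ τ a b, P.map m n f σ τ → P.supp m σ a → P.supp n τ b →
    ∀ j, j ∊ b ↔ ∃ i, i ∊ a ∧ opair i j ∊ f
  support_condition : ∀ m n f σ a, NatHom m n f → P.supp n σ a →
    (∀ j, j ∊ a → ∃ i, opair i j ∊ f) → ∃ σ₀, P.map m n f σ₀ σ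

/-- The set `D` codes the data `P`: it is the tuple `⟨O, L, T, S⟩` of the graphs of
`obj`, `lt`, `map` and `supp`. -/
def Codes (D : M) (P : PD M) : Prop :=
  ∃ O L T S, D = opair O (opair L (opair T S)) ∧
    (∀ z, z ∊ O ↔ ∃ n σ, P.obj n σ ∧ z = opair n σ) ∧
    (∀ z, z ∊ L ↔ ∃ n σ τ, P.lt n σ τ ∧ z = opair n (opair σ τ)) ∧
    (∀ z, z ∊ T ↔ ∃ m n f σ τ, P.map m n f σ τ ∧
      z = opair (opair m (opair n f)) (opair σ τ)) ∧
    (∀ z, z ∊ S ↔ ∃ n σ a, P.supp n σ a ∧ z = opair (opair n σ) a)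

/-- The data coded by the set `D`. -/
def ofSet (D : M) : PD M where
  obj n σ := ∃ O L T S, D = opair O (opair L (opair T S)) ∧ opair n σ ∊ O
  lt n σ τ := ∃ O L T S, D = opair O (opair L (opair T S)) ∧ opair n (opair σ τ) ∊ L
  map m n f σ τ := ∃ O L T S, D = opair O (opair L (opair T S)) ∧
    opair (opair m (opair n f)) (opair σ τ) ∊ T
  supp n σ a := ∃ O L T S, D = opair O (opair L (opair T S)) ∧ opair (opair n σ) a ∊ S

/-- `(σ, n)` lies in the trace of `P`. -/
def Tr (P : PD M) (σ n : M) : Prop := P.obj n σ ∧ P.supp n σ n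

/-- The value `P(X)` of the extension of `P` to a linear order `X`: its elements are the pairs
`(σ, a)` with `a ⊆ X` finite and `(σ, |a|)` in the trace; `(σ, a) < (τ, b)` is
decided in `P(|a ∪ b|)`. -/
def ext (P : PD M) (X : LO M) : LO M where
  dom z := ∃ σ a n e, X.IsEn a n e ∧ P.Tr σ n ∧ z = opair σ a
  lt z w := ∃ σ τ a b c m n k ea eb ec f g σ' τ',
    z = opair σ a ∧ w = opair τ b ∧ (∀ x, x ∊ c ↔ x ∊ a ∨ x ∊ b) ∧
    X.IsEn a m ea ∧ X.IsEn b n eb ∧ X.IsEn c k ec ∧ P.Tr σ m ∧ P.Tr τ n ∧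
    NatHom m k f ∧ (∀ i j x, opair i j ∊ f → opair j x ∊ ec → opair i x ∊ ea) ∧
    NatHom n k g ∧ (∀ i j x, opair i j ∊ g → opair j x ∊ ec → opair i x ∊ eb) ∧
    P.map m k f σ σ' ∧ P.map n k g τ τ' ∧ P.lt k σ' τ'

/-- The relation `(σ, m) ≪ (τ, n)` on the trace: `P(f)(σ) < P(g)(τ)` for all embeddings
`f : m → m + n` and `g : n → m + n`. -/
def Ll (P : PD M) (s t : M) : Prop :=
  ∃ σ m τ n, s = opair σ m ∧ t = opair τ n ∧ P.Tr σ m ∧ P.Tr τ n ∧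
    ∀ N f g σ' τ', IsAdd m n N → NatHom m N f → NatHom n N g →
      P.map m N f σ σ' → P.map n N g τ τ' → P.lt N σ' τ'

/-- The linear order `L` in the decomposition `P ≅ ∑_{α ∈ L} P[α]` into connected summands: its
elements are the classes of trace elements modulo `≡`, where `s ≡ t` means that neither
`s ≪ t` nor `t ≪ s`. -/
def index (P : PD M) : LO M where
  dom α := ∃ σ n, P.Tr σ n ∧ ∀ s, s ∊ α ↔
    (∃ τ m, P.Tr τ m ∧ s = opair τ m) ∧ ¬ P.Ll s (opair σ n) ∧ ¬ P.Ll (opair σ n) s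
  lt α β :=
    (∃ σ n, P.Tr σ n ∧ ∀ s, s ∊ α ↔
      (∃ τ m, P.Tr τ m ∧ s = opair τ m) ∧ ¬ P.Ll s (opair σ n) ∧ ¬ P.Ll (opair σ n) s) ∧
    (∃ σ n, P.Tr σ n ∧ ∀ s, s ∊ β ↔
      (∃ τ m, P.Tr τ m ∧ s = opair τ m) ∧ ¬ P.Ll s (opair σ n) ∧ ¬ P.Ll (opair σ n) s) ∧
    ∃ s t, s ∊ α ∧ t ∊ β ∧ P.Ll s t

/-- `σ ∈ P[A](n)`, for `A ⊆ Tr(P)`: in the normal form `σ = P(en_a)(σ₀)` with `a = supp_n(σ)`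
we have `(σ₀, |a|) ∈ A`. -/
def RestrictObj (P : PD M) (A n σ : M) : Prop :=
  ∃ a m e σ₀, P.supp n σ a ∧ (LO.ofOrd n).IsEn a m e ∧ P.map m n e σ₀ σ ∧ opair σ₀ m ∊ A

/-- The subpredilator `P[A]` of `P` determined by `A ⊆ Tr(P)`. -/
def restrict (P : PD M) (A : M) : PD M where
  obj n σ := P.RestrictObj A n σ
  lt n σ τ := P.RestrictObj A n σ ∧ P.RestrictObj A n τ ∧ P.lt n σ τ
  map m n f σ τ := P.RestrictObj A m σ ∧ P.map m n f σ τ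
  supp n σ a := P.RestrictObj A n σ ∧ P.supp n σ a

/-- The sum `∑_{α ∈ I} Q_α`. -/
def sum (I : LO M) (Q : M → PD M) : PD M where
  obj n z := ∃ α σ, I.dom α ∧ (Q α).obj n σ ∧ z = opair α σ
  lt n z w := ∃ α σ β τ, I.dom α ∧ I.dom β ∧ (Q α).obj n σ ∧ (Q β).obj n τ ∧
    z = opair α σ ∧ w = opair β τ ∧ (I.lt α β ∨ (α = β ∧ (Q α).lt n σ τ))
  map m n f z w := ∃ α σ τ, I.dom α ∧ (Q α).map m n f σ τ ∧ z = opair α σ ∧ w = opair α τ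
  supp n z a := ∃ α σ, I.dom α ∧ (Q α).supp n σ a ∧ z = opair α σ

open Classical in
/-- The binary sum `P + Q`, indexed by `2 = {0, 1}`. -/
noncomputable def add (P Q : PD M) : PD M :=
  sum (LO.ofOrd (succ (succ (empt M)))) (fun α => if α = empt M then P else Q)

/-- The partial sum `∑_{α < ν} P[α]` of the connected summands of `P`. -/
def partialSum (P : PD M) (ν : M) : PD M := sum (P.index.below ν) P.restrict

/-- `P` is (isomorphic to) the constant dilator `1`. -/
def IsOne (P : PD M) : Prop := ∀ n, n ∊ om M → ∃! σ, P.obj n σ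

/-- `i = i(σ)` for a trace element `(σ, n)` of a connected `P ≠ 1`: for all embeddings
`f, g : n → 2n`, `f(i) < g(i)` implies `P(f)(σ) < P(g)(σ)`. -/
def IsCoeff (P : PD M) (n σ i : M) : Prop :=
  i ∊ n ∧ ∀ N f g x y σ' τ', IsAdd n n N → NatHom n N f → NatHom n N g →
    opair i x ∊ f → opair i y ∊ g → x ∊ y → P.map n N f σ σ' → P.map n N g σ τ' → P.lt N σ' τ'

/-- `z ∈ {P}^γ(n)`: `z = (σ; a_0, …, a_{k-1})` lies in `P(γ + n)` and `i(σ)` is the largest index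
`i` with `a_i < γ`. -/
def SepObj (P : PD M) (γ n z : M) : Prop :=
  n ∊ om M ∧ ∃ σ a k e i, z = opair σ a ∧ (LO.add γ n).IsEn a k e ∧ P.Tr σ k ∧
    P.IsCoeff k σ i ∧ (∃ x, x ∊ γ ∧ opair i (LO.inl x) ∊ e) ∧
    ∀ j, j ∊ k → i ∊ j → ∃ x, x ∊ n ∧ opair j (LO.inr x) ∊ e

/-- The predilator `{P}^γ`, for connected `P ≠ 1` and an ordinal `γ`: `{P}^γ(f)` is a restriction of
`P(γ + f)`, and the support of `(σ, a)` consists of the elements of `a` in the right summand. -/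
def sep (P : PD M) (γ : M) : PD M where
  obj n z := P.SepObj γ n z
  lt n z w := P.SepObj γ n z ∧ P.SepObj γ n w ∧ (P.ext (LO.add γ n)).lt z w
  map m n f z w := NatHom m n f ∧ P.SepObj γ m z ∧ P.SepObj γ n w ∧
    ∃ σ a b, z = opair σ a ∧ w = opair σ b ∧
      ∀ v, v ∊ b ↔ (∃ x, x ∊ γ ∧ v = LO.inl x ∧ v ∊ a) ∨
        ∃ i j, opair i j ∊ f ∧ LO.inr i ∊ a ∧ v = LO.inr j
  supp n z s := P.SepObj γ n z ∧ ∃ σ a, z = opair σ a ∧ ∀ i, i ∊ s ↔ i ∊ n ∧ LO.inr i ∊ a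

end PD

section Dilators

variable {M : Type u} [PRSLang.Structure M]

/-- The set `D` is a predilator. -/
def IsPredilator (D : M) : Prop :=
  PD.Codes D (PD.ofSet D) ∧ (PD.ofSet D).IsPredilator

/-- The set `D` is a dilator: a predilator such that `D(X)` is well-founded for every
well order `X`. -/
def IsDilator (D : M) : Prop :=
  IsPredilator D ∧ ∀ x r : M, (LO.ofRel x r).IsLinear → (LO.ofRel x r).IsWellFounded →
    ((PD.ofSet D).ext (LO.ofRel x r)).IsWellFounded

/-- `μ` is the biggest element of the index order of the decomposition of `P`. -/
def IsTop (P : PD M) (μ : M) : Prop :=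
  P.index.dom μ ∧ ∀ α, P.index.dom α → α = μ ∨ P.index.lt α μ

/-- `E ∈ P_η(D)`. In the three cases, `D` has type `1`, type `ω` and type `Ω` respectively; when
`D` has type `0` there is no such `E`. -/
def IsPred (η D E : M) : Prop :=
  (∃ μ, IsTop (PD.ofSet D) μ ∧ ((PD.ofSet D).restrict μ).IsOne ∧
    PD.Codes E ((PD.ofSet D).partialSum μ)) ∨
  ((¬ ∃ μ, IsTop (PD.ofSet D) μ) ∧
    ∃ ν, (PD.ofSet D).index.dom ν ∧ PD.Codes E ((PD.ofSet D).partialSum ν)) ∨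
  (∃ μ, IsTop (PD.ofSet D) μ ∧ ¬ ((PD.ofSet D).restrict μ).IsOne ∧
    ∃ γ, γ ∊ η ∧
      PD.Codes E (((PD.ofSet D).partialSum μ).add (((PD.ofSet D).restrict μ).sep γ)))

/-- `p = P_η(D)` -/
def IsPredSet (η D p : M) : Prop := ∀ E, E ∊ p ↔ IsPred η D E

/-- The set `g` is the restriction `G ↾ p = {⟨x, G(x)⟩ | x ∈ p}`. -/
def IsRestriction (G : M → M) (p g : M) : Prop :=
  ∀ z, z ∊ g ↔ ∃ x, x ∊ p ∧ z = opair x (G x)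

/-- `D(ω^{1+η})` has order type below `ξ`. -/
def HasOtpBelow (D η ξ : M) : Prop :=
  ∃ W, IsOmegaPowOneAdd η W ∧ ((PD.ofSet D).ext (LO.ofOrd W)).OtpBelow ξ

end Dilators

end DilRec

open DilRec

/-! The recursion terminates because every predecessor of D is smaller than D at one fixed well
order. Put W = ω^(1+η). For each E ∈ P_η(D) there is an embedding of E(W) into D(W) whose range lies
strictly below some b ∈ D(W). A strictly increasing map h from D(W) into an ordinal ζ therefore
yields a strictly increasing map from E(W) into the smaller ordinal h(b). So a chain of predecessors
starting at D gives a descending sequence of ordinals below ζ, where ζ < ξ is the order type of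
D(W).

The bounds arise as follows. For a partial sum below ν, any trace element of the class ν, placed on
an initial segment of ω ⊆ W, is above everything (`partialSum_bounded`). For {D_μ}^γ, the elements
live in D_μ(γ + W), and γ + W embeds into W because W is additively closed and γ ∈ W. The decisive
coefficient i(σ) of such an element stays below γ. Moving all arguments to values ≥ γ thus makes the
element larger, and as D_μ is connected, the result can be compared with a fixed trace element τ of
the class μ. With τ placed at γ+ω, γ+ω+1, …, one gets a bound for all elements at once
(`sep_bounded`). This needs ω ∈ W, which holds since γ < η makes the exponent 1+η bigger than 1.

The function symbol is obtained by recursion on ordinals instead of recursion along P_η. `stage` at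
ζ collects the values for those E in the closure of D under P_η all of whose predecessors have
received a value at an earlier stage. This makes sense for arbitrary sets. Values from different
stages and different starting points agree (`stage_unique`, `stage_transfer`). Hence once D enters
at some stage ζ < ξ, the result no longer depends on ξ and satisfies the recursion equation
(`stage_value`, `value_eq`). That D does enter is the ranking argument (`exists_rankedPred`,
`exists_mem_stage_of_ranking`).

Induction and separation are available only for primitive recursive relations with parameters. A
large portion of the proof consequently shows definability. The classes `PR` and `PRRel` express it,
closure properties are instances, and `PR.exists_union` and `PR.exists_rec` supply unions and
recursion. All notions about predilators receive equivalent forms with bounded quantifiers, so that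
the set of predecessors is a primitive recursive function (`predSet`). For the same reason the
ranking argument does not quantify over all rankings: these are carried along in pairs ⟨E, h⟩ from a
set that is closed under a primitive recursive operation. -/

set_option linter.unusedSectionVars false

namespace DilRec

universe u v

/-! ### Definability by primitive recursive set functions -/

/-- A model of primitive recursive set theory with infinity. -/
structure Model : Type (u + 1) where
  carrier : Type u
  [str : PRSLang.Structure carrier]
  [ax : PRSomega carrier]

attribute [instance] Model.str Model.ax

section PRdef

variable {C : Type v} (𝓜 : C → Type u) [∀ c, PRSLang.Structure (𝓜 c)]

/-- The family of functions `t` is given by a function symbol, uniformly in `c`; parameters may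
occur if `ok` holds. -/
class PR (ok : Prop) {n : ℕ} (t : ∀ c, (Fin n → 𝓜 c) → 𝓜 c) : Prop where
  out : ∃ k, (k = 0 ∨ ok) ∧ ∃ (F : PRFun (n + k)) (p : ∀ c, Fin k → 𝓜 c),
    ∀ c v, t c v = app F (Fin.append v (p c))

end PRdef

/-- Renaming of variables in a function symbol. -/
def PRFun.rename {a b : ℕ} (ρ : Fin a → Fin b) (F : PRFun a) : PRFun b :=
  .comp F (fun i => .proj (ρ i))

/-! ### Elementary set theory: pairs and foundation -/

section Basics

variable {M : Type u} [PRSLang.Structure M] [PRSomega M]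

theorem app_comp {m n : ℕ} (F : PRFun m) (G : Fin m → PRFun n) (v : Fin n → M) :
    app (.comp F G) v = app F (fun i => app (G i) v) := PRSomega.comp_ax F G v

theorem app_proj {n : ℕ} (i : Fin n) (v : Fin n → M) : app (.proj i) v = v i :=
  PRSomega.proj_ax i v

theorem app_rename {a b : ℕ} (ρ : Fin a → Fin b) (F : PRFun a) (v : Fin b → M) :
    app (F.rename ρ) v = app F (fun i => v (ρ i)) := by
  simp [PRFun.rename, app_comp, app_proj]

theorem ext_iff' {x y : M} : x = y ↔ ∀ z, z ∊ x ↔ z ∊ y :=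
  ⟨fun h => by simp [h], PRSomega.extensionality x y⟩

@[simp] theorem mem_empt (z : M) : ¬ z ∊ empt M := PRSomega.zero_ax _ z

@[simp] theorem mem_adjoin {x y z : M} : z ∊ adjoin x y ↔ z ∊ x ∨ z = y :=
  PRSomega.adj_ax x y z

@[simp] theorem mem_succ {x z : M} : z ∊ succ x ↔ z ∊ x ∨ z = x := mem_adjoin

@[simp] theorem mem_sing {x z : M} : z ∊ sing x ↔ z = x := by simp [sing]

@[simp] theorem mem_upair {x y z : M} : z ∊ upair x y ↔ z = x ∨ z = y := by simp [upair]

theorem sing_inj {x y : M} : sing x = sing y ↔ x = y := by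
  constructor
  · intro h
    have : x ∊ sing y := h ▸ mem_sing.2 rfl
    exact mem_sing.1 this
  · rintro rfl; rfl

theorem upair_eq_sing {x y z : M} (h : upair x y = sing z) : x = z ∧ y = z := by
  constructor
  · exact mem_sing.1 (h ▸ mem_upair.2 (Or.inl rfl))
  · exact mem_sing.1 (h ▸ mem_upair.2 (Or.inr rfl))

theorem upair_left_cancel {x y z : M} (h : upair x y = upair x z) : y = z := by
  have hy : y = x ∨ y = z := mem_upair.1 (h ▸ mem_upair.2 (Or.inr rfl))
  have hz : z = x ∨ z = y := mem_upair.1 (h ▸ mem_upair.2 (Or.inr rfl))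
  rcases hy with rfl | rfl
  · rcases hz with rfl | rfl <;> rfl
  · rfl

@[simp] theorem opair_inj {x y z w : M} : opair x y = opair z w ↔ x = z ∧ y = w := by
  constructor
  · intro h
    have h1 : sing x ∊ upair (sing z) (upair z w) := by
      have : upair (sing x) (upair x y) = upair (sing z) (upair z w) := h
      exact this ▸ mem_upair.2 (Or.inl rfl)
    have hx : x = z := by
      rcases mem_upair.1 h1 with h1 | h1
      · exact sing_inj.1 h1
      · exact (upair_eq_sing h1.symm).1.symm
    subst hx
    exact ⟨rfl, upair_left_cancel (upair_left_cancel h)⟩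
  · rintro ⟨rfl, rfl⟩; rfl

theorem exists_min {x y : M} (h : y ∊ x) : ∃ y, y ∊ x ∧ ∀ z, z ∊ x → ¬ z ∊ y :=
  PRSomega.foundation x ⟨y, h⟩

@[simp] theorem mem_irrefl (x : M) : ¬ x ∊ x := by
  intro h
  obtain ⟨y, hy, hm⟩ := exists_min (mem_sing.2 rfl : x ∊ sing x)
  rw [mem_sing] at hy; subst hy
  exact hm y (mem_sing.2 rfl) h

theorem mem_asymm {x y : M} (h : x ∊ y) : ¬ y ∊ x := by
  intro h'
  obtain ⟨z, hz, hm⟩ := exists_min (mem_upair.2 (Or.inl rfl) : x ∊ upair x y)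
  rcases mem_upair.1 hz with rfl | rfl
  · exact hm _ (mem_upair.2 (Or.inr rfl)) h'
  · exact hm _ (mem_upair.2 (Or.inl rfl)) h

@[simp] theorem succ_ne_empt (x : M) : succ x ≠ empt M := by
  intro h
  exact mem_empt x (h ▸ mem_succ.2 (Or.inr rfl))

end Basics

/-! ### Closure of definable functions under substitution, recursion and case distinction -/

section Closure

variable {C : Type v} {𝓜 : C → Type u} [∀ c, PRSLang.Structure (𝓜 c)] [∀ c, PRSomega (𝓜 c)]
variable {ok : Prop}

theorem PR.congr {n : ℕ} {t s : ∀ c, (Fin n → 𝓜 c) → 𝓜 c} (h : ∀ c v, s c v = t c v)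
    [hs : PR 𝓜 ok t] : PR 𝓜 ok s := by
  have : s = t := by funext c v; exact h c v
  exact this ▸ hs

/-- Each inner function brings its own tuple of parameters. The tuples are concatenated along
`finSigmaFinEquiv`, and each symbol is renamed to read off its own block. -/
theorem PR.comp {m n : ℕ} (F : PRFun m) (G : Fin m → ∀ c, (Fin n → 𝓜 c) → 𝓜 c)
    (h : ∀ i, PR 𝓜 ok (G i)) : PR 𝓜 ok (fun c v => app F (fun i => G i c v)) := by
  choose k hk F' p hp using fun i => (h i).out
  refine ⟨∑ i, k i, ?_, .comp F (fun i => (F' i).rename (Fin.append (fun a => Fin.castAdd _ a)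
    (fun b => Fin.natAdd n (finSigmaFinEquiv ⟨i, b⟩)))),
    fun c j => p (finSigmaFinEquiv.symm j).1 c (finSigmaFinEquiv.symm j).2, ?_⟩
  · by_cases hok : ok
    · exact Or.inr hok
    · exact Or.inl (Finset.sum_eq_zero fun i _ => (hk i).resolve_right hok)
  · intro c v
    rw [app_comp]
    congr 1
    funext i
    rw [hp, app_rename]
    congr 1
    funext j
    refine Fin.addCases (fun a => ?_) (fun b => ?_) j
    · simp
    · simp only [Fin.append_right]
      rw [Equiv.symm_apply_apply]

instance PR.var {n : ℕ} (i : Fin n) : PR 𝓜 ok (fun _ v => v i) :=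
  ⟨0, Or.inl rfl, .proj (Fin.castAdd 0 i), fun _ => Fin.elim0, fun c v => by
    rw [app_proj, Fin.append_left]⟩

/-- The parameters hidden in `t` count as further arguments, for which constant functions are
substituted. The claim then reduces to composition with a symbol. -/
theorem PR.subst {m n : ℕ} {t : ∀ c, (Fin m → 𝓜 c) → 𝓜 c} [ht : PR 𝓜 ok t]
    (G : Fin m → ∀ c, (Fin n → 𝓜 c) → 𝓜 c) (h : ∀ i, PR 𝓜 ok (G i)) :
    PR 𝓜 ok (fun c v => t c (fun i => G i c v)) := by
  obtain ⟨k, hk, F, p, hp⟩ := ht.out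
  have key : PR 𝓜 ok (fun c v => app F (fun i =>
      (Fin.append G (fun j c _ => p c j) : Fin (m + k) → ∀ c, (Fin n → 𝓜 c) → 𝓜 c) i c v)) := by
    refine PR.comp F _ fun i => ?_
    refine Fin.addCases (fun a => ?_) (fun b => ?_) i
    · rw [Fin.append_left]; exact h a
    · rw [Fin.append_right]
      refine ⟨k, hk, .proj (Fin.natAdd n b), p, fun c v => ?_⟩
      rw [app_proj, Fin.append_right]
  refine PR.congr (hs := key) fun c v => ?_
  rw [hp]
  congr 1
  funext i
  refine Fin.addCases (fun a => ?_) (fun b => ?_) i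
  · simp
  · simp

instance PR.weaken {m n : ℕ} {t : ∀ c, (Fin m → 𝓜 c) → 𝓜 c} [ht : PR 𝓜 ok t]
    (ρ : Fin m → Fin n) : PR 𝓜 ok (fun c v => t c (fun i => v (ρ i))) :=
  PR.subst _ fun _ => inferInstance

/-- Over a single model any constant is itself a parameter. The priority makes instance search
settle constant terms before it tries to decompose them. -/
instance (priority := high) PR.param {M : Type u} [PRSLang.Structure M] [PRSomega M] {n : ℕ}
    (a : M) : PR (fun _ : PUnit.{1} => M) True (n := n) (fun _ _ => a) :=
  ⟨1, Or.inr trivial, .proj (Fin.natAdd n 0), fun _ _ => a, fun c v => by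
    rw [app_proj, Fin.append_right]⟩

/-- This leads from uniform definability over all models to definability with parameters in one
model, which is what separation and induction require: the remaining arguments are frozen and become
parameters. -/
theorem PR.local {n : ℕ} (t : ∀ c, (Fin (n + 1) → 𝓜 c) → 𝓜 c) [ht : PR 𝓜 ok t] (c : C)
    (v : Fin n → 𝓜 c) :
    PR (fun _ : PUnit.{1} => 𝓜 c) True (n := 1) (fun _ w => t c (Matrix.vecCons (w 0) v)) := by
  obtain ⟨k, hk, F, p, hp⟩ := ht.out
  have : PR (fun _ : PUnit.{1} => 𝓜 c) True (n := 1) (fun _ w => app F (fun i =>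
     (Fin.append (Matrix.vecCons (fun (_ : PUnit.{1}) w => w 0) (fun i (_ : PUnit.{1}) _ => v i)) (fun j _ _ => p c j) :
       Fin (n + 1 + k) → ∀ _ : PUnit.{1}, (Fin 1 → 𝓜 c) → 𝓜 c) i PUnit.unit w)) := by
    refine PR.comp F _ fun i => ?_
    refine Fin.addCases (fun a => ?_) (fun b => ?_) i
    · rw [Fin.append_left]
      refine Fin.cases ?_ (fun j => ?_) a
      · exact PR.var 0
      · exact PR.param _
    · rw [Fin.append_right]; exact PR.param _
  refine PR.congr (hs := this) fun _ w => ?_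
  rw [hp]
  congr 1
  funext i
  refine Fin.addCases (fun a => ?_) (fun b => ?_) i
  · refine Fin.cases ?_ (fun j => ?_) a <;> simp
  · simp

theorem PR.prec {n : ℕ} (h : ∀ c, (Fin (n + 2) → 𝓜 c) → 𝓜 c) [hh : PR 𝓜 ok h] :
    ∃ R : ∀ c, (Fin (n + 1) → 𝓜 c) → 𝓜 c, PR 𝓜 ok R ∧ ∀ c x y, ∃ w,
      (∀ z, z ∊ w ↔ ∃ v, v ∊ x ∧ z ∊ R c (Matrix.vecCons v y)) ∧
      R c (Matrix.vecCons x y) = h c (Matrix.vecCons w (Matrix.vecCons x y)) := by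
  obtain ⟨k, hk, F, p, hp⟩ := hh.out
  -- Both renamings preserve the numerical position of a variable. They only rearrange the types, so
  -- that the hidden parameters count among the side variables of the recursion.
  let ρ : Fin (n + 2 + k) → Fin (n + k + 2) := Fin.addCases
    (fun i : Fin (n + 2) => Fin.cases 0 (fun i => Fin.cases 1
      (fun i : Fin n => (Fin.castAdd k i).succ.succ) i) i)
    (fun j => (Fin.natAdd n j).succ.succ)
  let ρ' : Fin (n + k + 1) → Fin (n + 1 + k) := fun i => Fin.cases (Fin.castAdd k 0)
    (fun i => Fin.addCases (fun i => Fin.castAdd k i.succ) (fun j => Fin.natAdd (n + 1) j) i) i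
  have hR : ∀ c x (y : Fin n → 𝓜 c), app ((PRFun.prec (F.rename ρ)).rename ρ')
      (Fin.append (Matrix.vecCons x y) (p c)) =
      app (.prec (F.rename ρ)) (Matrix.vecCons x (Fin.append y (p c))) := by
    intro c x y
    rw [app_rename]
    congr 1
    funext i
    refine Fin.cases ?_ (fun i => ?_) i
    · simp only [ρ', Fin.cases_zero, Matrix.cons_val_zero]
      rw [Fin.append_left]; rfl
    · refine Fin.addCases (fun a => ?_) (fun b => ?_) i
      · simp only [ρ', Fin.cases_succ, Matrix.cons_val_succ, Fin.addCases_left]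
        rw [Fin.append_left, Fin.append_left]; rfl
      · simp only [ρ', Fin.cases_succ, Matrix.cons_val_succ, Fin.addCases_right]
        rw [Fin.append_right, Fin.append_right]
  refine ⟨fun c v => app ((PRFun.prec (F.rename ρ)).rename ρ') (Fin.append v (p c)),
    ⟨k, hk, _, p, fun _ _ => rfl⟩, fun c x y => ?_⟩
  obtain ⟨w, hw, he⟩ := PRSomega.prec_ax (F.rename ρ) x (Fin.append y (p c))
  refine ⟨w, fun z => ?_, ?_⟩
  · rw [hw]; simp only [hR]
  · refine (hR c x y).trans ?_
    rw [he, hp, app_rename]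
    congr 1
    funext i
    refine Fin.addCases (fun a => ?_) (fun b => ?_) i
    · simp only [ρ, Fin.addCases_left]
      rw [Fin.append_left]
      refine Fin.cases rfl (fun a => ?_) a
      refine Fin.cases rfl (fun a => ?_) a
      simp
    · simp only [ρ, Fin.addCases_right]
      rw [Fin.append_right]
      simp

section Basic

variable {n : ℕ} {s t a b : ∀ c, (Fin n → 𝓜 c) → 𝓜 c}

instance PR.om : PR 𝓜 ok (n := n) (fun c _ => om (𝓜 c)) := by
  refine PR.congr (hs := PR.comp .omega ![] (fun i => i.elim0)) fun c v => ?_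
  rw [DilRec.om]; congr 1; funext i; exact i.elim0

instance PR.empt : PR 𝓜 ok (n := n) (fun c _ => empt (𝓜 c)) := by
  refine PR.congr (hs := PR.comp .zero ![fun c _ => DilRec.om (𝓜 c)]
    (Fin.cases PR.om fun i => i.elim0)) fun c v => ?_
  rw [DilRec.empt]; congr 1; funext i; fin_cases i; rfl

instance PR.adjoin [hs : PR 𝓜 ok s] [ht : PR 𝓜 ok t] :
    PR 𝓜 ok (fun c v => adjoin (s c v) (t c v)) := by
  refine PR.congr (hs := PR.comp .adj ![s, t]
    (Fin.cases hs (Fin.cases ht fun i => i.elim0))) fun c v => ?_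
  rw [DilRec.adjoin]; congr 1; funext i; fin_cases i <;> rfl

instance PR.succ [PR 𝓜 ok s] : PR 𝓜 ok (fun c v => succ (s c v)) :=
  PR.adjoin

instance PR.sing [PR 𝓜 ok s] : PR 𝓜 ok (fun c v => sing (s c v)) :=
  PR.adjoin (s := fun c _ => DilRec.empt (𝓜 c))

instance PR.upair [PR 𝓜 ok s] [PR 𝓜 ok t] : PR 𝓜 ok (fun c v => upair (s c v) (t c v)) :=
  PR.adjoin (s := fun c v => DilRec.sing (s c v))

instance PR.opair [PR 𝓜 ok s] [PR 𝓜 ok t] : PR 𝓜 ok (fun c v => opair (s c v) (t c v)) :=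
  PR.upair (s := fun c v => DilRec.sing (s c v)) (t := fun c v => DilRec.upair (s c v) (t c v))

open Classical in
instance PR.iteMem [hs : PR 𝓜 ok s] [ht : PR 𝓜 ok t] [ha : PR 𝓜 ok a] [hb : PR 𝓜 ok b] :
    PR 𝓜 ok (fun c v => if a c v ∊ b c v then s c v else t c v) := by
  refine PR.congr (hs := PR.comp .cond ![s, t, a, b]
    (Fin.cases hs (Fin.cases ht (Fin.cases ha (Fin.cases hb fun i => i.elim0))))) fun c v => ?_
  have h := PRSomega.cond_ax (s c v) (t c v) (a c v) (b c v)
  have e : (fun i => (![s, t, a, b] : Fin 4 → ∀ c, (Fin n → 𝓜 c) → 𝓜 c) i c v) =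
      ![s c v, t c v, a c v, b c v] := by funext i; fin_cases i <;> rfl
  rw [e]
  split_ifs with hm
  · exact (h.1 hm).symm
  · exact (h.2 hm).symm

end Basic

/-! ### Relations -/

open Classical in
/-- A relation with primitive recursive characteristic function. -/
class PRRel (𝓜 : C → Type u) [∀ c, PRSLang.Structure (𝓜 c)] (ok : Prop) {n : ℕ}
    (R : ∀ c, (Fin n → 𝓜 c) → Prop) : Prop where
  char : PR 𝓜 ok (fun c v => if R c v then succ (empt (𝓜 c)) else empt (𝓜 c))

variable {n : ℕ}

theorem PRRel.congr {R S : ∀ c, (Fin n → 𝓜 c) → Prop} (h : ∀ c v, S c v ↔ R c v)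
    [hs : PRRel 𝓜 ok R] : PRRel 𝓜 ok S := by
  have : S = R := by funext c v; exact propext (h c v)
  exact this ▸ hs

-- The values of a characteristic function are 0 and 1 = {0}. So the relation can be tested by
-- asking whether the empty set is an element of the value.
open Classical in
instance PR.ite {R : ∀ c, (Fin n → 𝓜 c) → Prop} [hR : PRRel 𝓜 ok R]
    {s t : ∀ c, (Fin n → 𝓜 c) → 𝓜 c} [PR 𝓜 ok s] [PR 𝓜 ok t] :
    PR 𝓜 ok (fun c v => if R c v then s c v else t c v) := by
  have := hR.char
  refine PR.congr (hs := PR.iteMem (s := s) (t := t) (a := fun c _ => DilRec.empt (𝓜 c))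
    (b := fun c v => if R c v then DilRec.succ (DilRec.empt (𝓜 c)) else DilRec.empt (𝓜 c)))
    fun c v => ?_
  by_cases h : R c v <;> simp [h]

instance PRRel.mem {s t : ∀ c, (Fin n → 𝓜 c) → 𝓜 c} [PR 𝓜 ok s] [PR 𝓜 ok t] :
    PRRel 𝓜 ok (fun c v => s c v ∊ t c v) := ⟨PR.iteMem⟩

instance PRRel.eq {s t : ∀ c, (Fin n → 𝓜 c) → 𝓜 c} [PR 𝓜 ok s] [PR 𝓜 ok t] :
    PRRel 𝓜 ok (fun c v => s c v = t c v) :=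
  PRRel.congr (R := fun c v => s c v ∊ sing (t c v)) fun _ _ => by simp

instance PRRel.not {R : ∀ c, (Fin n → 𝓜 c) → Prop} [hR : PRRel 𝓜 ok R] :
    PRRel 𝓜 ok (fun c v => ¬ R c v) := by
  classical
  constructor
  refine PR.congr (hs := PR.ite (R := R) (s := fun c _ => DilRec.empt (𝓜 c))
    (t := fun c _ => DilRec.succ (DilRec.empt (𝓜 c)))) fun c v => ?_
  by_cases h : R c v <;> simp [h]

instance PRRel.and {R S : ∀ c, (Fin n → 𝓜 c) → Prop} [hR : PRRel 𝓜 ok R] [hS : PRRel 𝓜 ok S] :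
    PRRel 𝓜 ok (fun c v => R c v ∧ S c v) := by
  classical
  constructor
  have := hS.char
  refine PR.congr (hs := PR.ite (R := R)
    (s := fun c v => if S c v then DilRec.succ (DilRec.empt (𝓜 c)) else DilRec.empt (𝓜 c))
    (t := fun c _ => DilRec.empt (𝓜 c))) fun c v => ?_
  by_cases h : R c v <;> simp [h]

instance PRRel.or {R S : ∀ c, (Fin n → 𝓜 c) → Prop} [hR : PRRel 𝓜 ok R] [hS : PRRel 𝓜 ok S] :
    PRRel 𝓜 ok (fun c v => R c v ∨ S c v) :=
  PRRel.congr (R := fun c v => ¬ (¬ R c v ∧ ¬ S c v)) fun _ _ => by tauto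

instance PRRel.imp {R S : ∀ c, (Fin n → 𝓜 c) → Prop} [hR : PRRel 𝓜 ok R] [hS : PRRel 𝓜 ok S] :
    PRRel 𝓜 ok (fun c v => R c v → S c v) :=
  PRRel.congr (R := fun c v => ¬ R c v ∨ S c v) fun _ _ => by tauto

instance PRRel.weaken {m : ℕ} {R : ∀ c, (Fin m → 𝓜 c) → Prop} [hR : PRRel 𝓜 ok R]
    (ρ : Fin m → Fin n) : PRRel 𝓜 ok (fun c v => R c (fun i => v (ρ i))) :=
  ⟨by
    classical
    have := hR.char
    exact PR.weaken (t := fun c v => if R c v then DilRec.succ (DilRec.empt (𝓜 c))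
      else DilRec.empt (𝓜 c)) ρ⟩

end Closure

/-! ### Set operations with primitive recursive arguments -/

section Local

variable {M : Type u} [PRSLang.Structure M] [PRSomega M]

/-- `f` is definable with parameters from `M`. -/
abbrev DefF (f : M → M) : Prop :=
  PR (fun _ : PUnit.{1} => M) True (n := 1) (fun _ v => f (v 0))

/-- `f` is definable with parameters from `M`. -/
abbrev DefF₂ (f : M → M → M) : Prop :=
  PR (fun _ : PUnit.{1} => M) True (n := 2) (fun _ v => f (v 0) (v 1))

/-- `φ` is definable with parameters from `M`. -/
abbrev DefR (φ : M → Prop) : Prop :=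
  PRRel (fun _ : PUnit.{1} => M) True (n := 1) (fun _ v => φ (v 0))

end Local

/-- The family is indexed by all models, and with `ok` false there are no parameters. So a single
symbol serves every model. -/
theorem PR.toFun {n : ℕ} {t : ∀ c : Model.{u}, (Fin n → c.carrier) → c.carrier}
    [ht : PR Model.carrier False t] : ∃ F : PRFun n, ∀ c v, t c v = app F v := by
  obtain ⟨k, hk, F, p, hp⟩ := ht.out
  rcases hk with rfl | h
  · refine ⟨F, fun c v => ?_⟩
    rw [hp]
    have : Fin.append v (p c) = v := by
      rw [show p c = Fin.elim0 from funext fun i => i.elim0, Fin.append_elim0]; rfl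
    rw [this]
  · exact h.elim

/-! ### Unions, images and separation -/

section Union

variable {C : Type v} {𝓜 : C → Type u} [∀ c, PRSLang.Structure (𝓜 c)] [∀ c, PRSomega (𝓜 c)]
variable {ok : Prop} {n : ℕ}

/-- The axioms provide unions only over values of a recursively defined function. The trick is to
recurse with an additional side variable z: for x ∈ z the value is f(x), and otherwise it is the
union of the previous values. Since z ∉ z, the value at x = z is the desired union. -/
theorem PR.exists_union (f : ∀ c, (Fin (n + 1) → 𝓜 c) → 𝓜 c) [hf : PR 𝓜 ok f] :
    ∃ U : ∀ c, (Fin (n + 1) → 𝓜 c) → 𝓜 c, PR 𝓜 ok U ∧ ∀ c z p s,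
      s ∊ U c (Matrix.vecCons z p) ↔ ∃ x, x ∊ z ∧ s ∊ f c (Matrix.vecCons x p) := by
  classical
  let g : Fin (n + 1) → Fin (n + 3) := Fin.cases 1 (fun i => i.succ.succ.succ)
  have hg : PR 𝓜 ok (fun c (w : Fin (n + 3) → 𝓜 c) =>
      if w 1 ∊ w 2 then f c (fun i => w (g i)) else w 0) := inferInstance
  obtain ⟨R, hR, hw⟩ := PR.prec (n := n + 1) _ (hh := hg)
  have hval : ∀ c x z p, x ∊ z →
      R c (Matrix.vecCons x (Matrix.vecCons z p)) = f c (Matrix.vecCons x p) := by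
    intro c x z p hx
    obtain ⟨w, -, h⟩ := hw c x (Matrix.vecCons z p)
    rw [h, if_pos (by simpa using hx)]
    congr 1
    funext i
    refine Fin.cases rfl (fun i => ?_) i
    simp [g]
  let ρ : Fin (n + 2) → Fin (n + 1) := Fin.cases 0 id
  refine ⟨fun c v => R c (fun i => v (ρ i)), PR.weaken (ht := hR) ρ, fun c z p s => ?_⟩
  have e : (fun i => Matrix.vecCons z p (ρ i)) =
      Matrix.vecCons z (Matrix.vecCons z p) := by
    funext i
    exact Fin.cases rfl (fun i => rfl) i
  obtain ⟨w, h1, h2⟩ := hw c z (Matrix.vecCons z p)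
  simp only [e]
  rw [h2, if_neg (by simp)]
  simp only [Matrix.cons_val_zero]
  rw [h1]
  refine exists_congr fun x => and_congr_right fun hx => ?_
  rw [hval _ _ _ _ hx]

end Union

section Ops

variable {M : Type u} [PRSLang.Structure M]

open Classical in
/-- `⋃ {f x | x ∈ t}` -/
noncomputable def bUnion (t : M) (f : M → M) : M :=
  if h : ∃ s, ∀ z, z ∊ s ↔ ∃ x, x ∊ t ∧ z ∊ f x then h.choose else empt M

/-- `{f x | x ∈ t}` -/
noncomputable def imag (t : M) (f : M → M) : M := bUnion t (fun x => sing (f x))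

open Classical in
/-- `{x ∈ t | φ x}` -/
noncomputable def sepr (t : M) (φ : M → Prop) : M :=
  bUnion t (fun x => if φ x then sing x else empt M)

noncomputable def sUnion (t : M) : M := bUnion t (fun x => x)

noncomputable def union₂ (x y : M) : M := sUnion (upair x y)

/-- `a × b` -/
noncomputable def prod (a b : M) : M := bUnion a (fun x => imag b (fun y => opair x y))

variable [PRSomega M]

theorem mem_bUnion_iff {t z : M} {f : M → M} (h : ∃ s, ∀ z, z ∊ s ↔ ∃ x, x ∊ t ∧ z ∊ f x) :
    z ∊ bUnion t f ↔ ∃ x, x ∊ t ∧ z ∊ f x := by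
  rw [bUnion, dif_pos h]
  exact h.choose_spec z

@[simp] theorem mem_bUnion {t z : M} {f : M → M} [hf : DefF f] :
    z ∊ bUnion t f ↔ ∃ x, x ∊ t ∧ z ∊ f x := by
  obtain ⟨U, -, hU⟩ := PR.exists_union (n := 0) _ (hf := hf)
  exact mem_bUnion_iff ⟨U PUnit.unit (Matrix.vecCons t ![]), fun z => hU PUnit.unit t ![] z⟩

end Ops

/-! ### Definability of unions, bounded quantifiers and separation -/

section Closure

variable {C : Type v} {𝓜 : C → Type u} [∀ c, PRSLang.Structure (𝓜 c)] [∀ c, PRSomega (𝓜 c)]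
variable {ok : Prop} {n : ℕ} {s t : ∀ c, (Fin n → 𝓜 c) → 𝓜 c}
  {f : ∀ c, (Fin n → 𝓜 c) → 𝓜 c → 𝓜 c} {R : ∀ c, (Fin n → 𝓜 c) → 𝓜 c → Prop}

/-- The hypothesis on `f` treats the bound variable as a new variable in position 0, which shifts
the others. All binders below use this convention, so that instance search can descend under them.
-/
instance PR.bUnion [ht : PR 𝓜 ok t]
    [hf : PR 𝓜 ok (n := n + 1) (fun c w => f c (fun i => w i.succ) (w 0))] :
    PR 𝓜 ok (fun c v => bUnion (t c v) (fun x => f c v x)) := by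
  obtain ⟨U, hU, h'⟩ := PR.exists_union _ (hf := hf)
  have h : ∀ c z p s, s ∊ U c (Matrix.vecCons z p) ↔ ∃ x, x ∊ z ∧ s ∊ f c p x := h'
  have key := PR.subst (ht := hU) (Matrix.vecCons t (fun i _ v => v i))
    (Fin.cases ht fun i => PR.var i)
  refine PR.congr (hs := key) fun c v => ?_
  have e : (fun i => (Matrix.vecCons t (fun i _ v => v i) :
      Fin (n + 1) → ∀ c, (Fin n → 𝓜 c) → 𝓜 c) i c v) = Matrix.vecCons (t c v) v := by
    funext i
    exact Fin.cases rfl (fun i => rfl) i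
  rw [ext_iff']
  intro z
  rw [e, h, mem_bUnion_iff ⟨_, fun z => h c (t c v) v z⟩]

instance PR.imag [ht : PR 𝓜 ok t]
    [hf : PR 𝓜 ok (n := n + 1) (fun c w => f c (fun i => w i.succ) (w 0))] :
    PR 𝓜 ok (fun c v => imag (t c v) (fun x => f c v x)) :=
  PR.bUnion (f := fun c v x => DilRec.sing (f c v x))

theorem PR.defF [hf : PR 𝓜 ok (n := n + 1) (fun c w => f c (fun i => w i.succ) (w 0))]
    (c : C) (v : Fin n → 𝓜 c) : DefF (f c v) :=
  PR.local _ (ht := hf) c v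

theorem PRRel.defR [hf : PRRel 𝓜 ok (n := n + 1) (fun c w => R c (fun i => w i.succ) (w 0))]
    (c : C) (v : Fin n → 𝓜 c) : DefR (R c v) := by
  classical
  exact ⟨PR.local _ (ht := hf.char) c v⟩

/-- As characteristic functions have the values 0 = ∅ and 1 = {∅}, that of a bounded existential
statement is the union of those of its instances. -/
instance PRRel.bex [ht : PR 𝓜 ok t]
    [hR : PRRel 𝓜 ok (n := n + 1) (fun c w => R c (fun i => w i.succ) (w 0))] :
    PRRel 𝓜 ok (fun c v => ∃ x, x ∊ t c v ∧ R c v x) := by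
  classical
  constructor
  have := hR.char
  refine PR.congr (hs := PR.bUnion (t := t) (f := fun c v x => if R c v x then
    DilRec.succ (DilRec.empt (𝓜 c)) else DilRec.empt (𝓜 c))) fun c v => ?_
  have := PR.defF (f := fun c v x => if R c v x then
    DilRec.succ (DilRec.empt (𝓜 c)) else DilRec.empt (𝓜 c)) (hf := hR.char) c v
  rw [ext_iff']
  intro z
  rw [mem_bUnion]
  split_ifs with h
  · obtain ⟨x, hx, hRx⟩ := h
    constructor
    · intro hz
      exact ⟨x, hx, by rwa [if_pos hRx]⟩
    · rintro ⟨y, hy, hz⟩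
      split_ifs at hz
      · exact hz
      · exact absurd hz (mem_empt z)
  · constructor
    · exact fun hz => absurd hz (mem_empt z)
    · rintro ⟨y, hy, hz⟩
      split_ifs at hz with h'
      · exact absurd ⟨y, hy, h'⟩ h
      · exact hz

instance PRRel.ball [ht : PR 𝓜 ok t]
    [hR : PRRel 𝓜 ok (n := n + 1) (fun c w => R c (fun i => w i.succ) (w 0))] :
    PRRel 𝓜 ok (fun c v => ∀ x, x ∊ t c v → R c v x) :=
  PRRel.congr (R := fun c v => ¬ ∃ x, x ∊ t c v ∧ ¬ R c v x) fun _ _ => by simp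

instance PR.sepr [ht : PR 𝓜 ok t]
    [hR : PRRel 𝓜 ok (n := n + 1) (fun c w => R c (fun i => w i.succ) (w 0))] :
    PR 𝓜 ok (fun c v => sepr (t c v) (fun x => R c v x)) := by
  classical
  exact PR.bUnion (f := fun c v x => if R c v x then DilRec.sing x else DilRec.empt (𝓜 c))

instance PR.sUnion [PR 𝓜 ok t] : PR 𝓜 ok (fun c v => sUnion (t c v)) :=
  PR.bUnion (f := fun _ _ x => x)

instance PR.union₂ [PR 𝓜 ok s] [PR 𝓜 ok t] : PR 𝓜 ok (fun c v => union₂ (s c v) (t c v)) :=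
  PR.sUnion (t := fun c v => DilRec.upair (s c v) (t c v))

instance PR.prod [PR 𝓜 ok s] [PR 𝓜 ok t] : PR 𝓜 ok (fun c v => prod (s c v) (t c v)) :=
  PR.bUnion (f := fun c v x => DilRec.imag (t c v) (fun y => DilRec.opair x y))

end Closure

/-! ### Membership in derived sets, induction on ω, transitive closure -/

section Mem

variable {M : Type u} [PRSLang.Structure M] [PRSomega M]

@[simp] theorem mem_imag {t z : M} {f : M → M} [hf : DefF f] :
    z ∊ imag t f ↔ ∃ x, x ∊ t ∧ z = f x := by
  rw [imag, mem_bUnion]; simp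

@[simp] theorem mem_sepr {t z : M} {φ : M → Prop} [hf : DefR φ] :
    z ∊ sepr t φ ↔ z ∊ t ∧ φ z := by
  classical
  rw [sepr, mem_bUnion]
  constructor
  · rintro ⟨x, hx, h⟩
    split_ifs at h with hφ
    · rw [mem_sing] at h; exact h ▸ ⟨hx, hφ⟩
    · exact absurd h (mem_empt z)
  · rintro ⟨hz, h⟩
    exact ⟨z, hz, by simp [h]⟩

@[simp] theorem mem_sUnion {t z : M} : z ∊ sUnion t ↔ ∃ x, x ∊ t ∧ z ∊ x := by
  rw [sUnion, mem_bUnion]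

@[simp] theorem mem_union₂ {x y z : M} : z ∊ union₂ x y ↔ z ∊ x ∨ z ∊ y := by
  simp [union₂]

theorem mem_prod {a b z : M} : z ∊ prod a b ↔ ∃ x y, x ∊ a ∧ y ∊ b ∧ z = opair x y := by
  simp [prod]

@[simp] theorem opair_mem_prod {a b x y : M} : opair x y ∊ prod a b ↔ x ∊ a ∧ y ∊ b := by
  rw [mem_prod]
  constructor
  · rintro ⟨x', y', hx, hy, h⟩
    rw [opair_inj] at h
    exact h.1 ▸ h.2 ▸ ⟨hx, hy⟩
  · rintro ⟨hx, hy⟩; exact ⟨x, y, hx, hy, rfl⟩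

theorem empt_mem_om : empt M ∊ om M := (PRSomega.omega_ax _).2 (Or.inl rfl)

theorem succ_mem_om {n : M} (h : n ∊ om M) : succ n ∊ om M :=
  (PRSomega.omega_ax _).2 (Or.inr ⟨n, h, rfl⟩)

/-- Induction on `ω`. -/
theorem om_induction (φ : M → Prop) [DefR φ] (h0 : φ (empt M))
    (hs : ∀ n, n ∊ om M → φ n → φ (succ n)) : ∀ n, n ∊ om M → φ n := by
  intro n hn
  by_contra hc
  obtain ⟨m, hm, hmin⟩ := exists_min (mem_sepr.2 ⟨hn, hc⟩ : n ∊ sepr (om M) fun x => ¬ φ x)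
  obtain ⟨hm, hφ⟩ := mem_sepr.1 hm
  rcases (PRSomega.omega_ax m).1 hm with rfl | ⟨k, hk, rfl⟩
  · exact hφ h0
  · refine hφ (hs k hk (by_contra fun h => ?_))
    exact hmin k (mem_sepr.2 ⟨hk, h⟩) (mem_succ.2 (Or.inr rfl))

/-- Recursion on m produces sets that contain x, all sets from previous levels and the elements of
these. The union over m ∈ ω is transitive, as elements of a set from level m appear at level m + 1.
-/
theorem exists_trclFun : ∃ F : PRFun 1, ∀ c : Model.{u}, ∀ x : c.carrier,
    x ∊ app F ![x] ∧ IsTrans (app F ![x]) := by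
  have hh : PR Model.carrier.{u} False (n := 3) (fun c v => union₂ (sing (v 2))
      (union₂ (v 0) (sUnion (v 0)))) := inferInstance
  obtain ⟨R, hR, hw⟩ := PR.prec (n := 1) _ (hh := hh)
  have hR' : PR Model.carrier.{u} False (n := 2)
      (fun c v => R c (fun i => v (![0, 1] i))) := PR.weaken _
  have e : ∀ (c : Model.{u}) (v : Fin 2 → c.carrier), (fun i => v (![0, 1] i)) = ![v 0, v 1] := by
    intro c v; funext i; fin_cases i <;> rfl
  simp only [e] at hR'
  have hU : PR Model.carrier.{u} False (n := 1)
      (fun c v => bUnion (om c.carrier) (fun m => R c ![m, v 0])) := by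
    exact PR.bUnion (f := fun c v m => R c ![m, v 0]) (hf := hR')
  obtain ⟨F, hF⟩ := hU.toFun
  refine ⟨F, fun c x => ?_⟩
  have hd : DefF (fun m => R c ![m, x]) := PR.local _ (ht := hR) c ![x]
  rw [← hF]
  have hmem : ∀ z, z ∊ bUnion (om c.carrier) (fun m => R c ![m, x]) ↔
      ∃ m, m ∊ om c.carrier ∧ z ∊ R c ![m, x] := fun z => mem_bUnion
  constructor
  · refine (hmem x).2 ⟨empt _, empt_mem_om, ?_⟩
    obtain ⟨w, -, h⟩ := hw c (empt _) ![x]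
    rw [h]; simp
  · intro y z hy hz
    obtain ⟨m, hm, hy⟩ := (hmem y).1 hy
    refine (hmem z).2 ⟨succ m, succ_mem_om hm, ?_⟩
    obtain ⟨w, h1, h⟩ := hw c (succ m) ![x]
    rw [h]
    simp only [mem_union₂, mem_sUnion, Matrix.cons_val_zero]
    exact Or.inr (Or.inr ⟨y, (h1 y).2 ⟨m, by simp, hy⟩, hz⟩)

/-- A function symbol that yields a transitive set containing its argument. -/
noncomputable def trclFun : PRFun 1 := exists_trclFun.{u}.choose

/-- A transitive set containing `x`. -/
noncomputable def trcl (x : M) : M := app trclFun.{u} ![x]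

theorem self_mem_trcl (x : M) : x ∊ trcl x := (exists_trclFun.choose_spec ⟨M⟩ x).1

theorem trcl_trans {x y z : M} (hy : y ∊ trcl x) (hz : z ∊ y) : z ∊ trcl x :=
  (exists_trclFun.choose_spec ⟨M⟩ x).2 y z hy hz

theorem mem_trcl {x y : M} (hy : y ∊ x) : y ∊ trcl x := trcl_trans (self_mem_trcl x) hy

theorem trcl_opair {x y z : M} (h : opair x y ∊ trcl z) : x ∊ trcl z ∧ y ∊ trcl z := by
  have h2 : upair x y ∊ trcl z := trcl_trans h (mem_upair.2 (Or.inr rfl))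
  exact ⟨trcl_trans h2 (mem_upair.2 (Or.inl rfl)), trcl_trans h2 (mem_upair.2 (Or.inr rfl))⟩

theorem mem_trcl_opair {f x y : M} (h : opair x y ∊ f) : x ∊ trcl f ∧ y ∊ trcl f :=
  trcl_opair (mem_trcl h)

/-- Set induction for definable properties. -/
theorem mem_induction (φ : M → Prop) [DefR φ] (h : ∀ x, (∀ y, y ∊ x → φ y) → φ x) (x : M) :
    φ x := by
  by_contra hc
  obtain ⟨m, hm, hmin⟩ := exists_min
    (mem_sepr.2 ⟨self_mem_trcl x, hc⟩ : x ∊ sepr (trcl x) fun x => ¬ φ x)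
  obtain ⟨hm, hφ⟩ := mem_sepr.1 hm
  refine hφ (h m fun y hy => by_contra fun hn => ?_)
  exact hmin y (mem_sepr.2 ⟨trcl_trans hm hy, hn⟩) hy

end Mem

/-! ### Recursion on the set of previous values -/

section Recursion

variable {M : Type u} [PRSLang.Structure M]

open Classical in
/-- The function defined by the recursion `R(x) = h({R(y) | y ∈ x}, x)`. -/
noncomputable def recI (h : M → M → M) : M → M :=
  if H : ∃ R : M → M, DefF R ∧ ∀ x, R x = h (imag x R) x then H.choose else fun _ => empt M

variable [PRSomega M]

theorem recI_unique {h : M → M → M} {R R' : M → M} [hR : DefF R] [hR' : DefF R']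
    (h1 : ∀ x, R x = h (imag x R) x) (h2 : ∀ x, R' x = h (imag x R') x) : R = R' := by
  funext x
  refine mem_induction (fun x => R x = R' x) (fun x ih => ?_) x
  rw [h1, h2]
  congr 1
  rw [ext_iff']
  intro z
  simp only [mem_imag]
  exact exists_congr fun y => and_congr_right fun hy => by rw [ih y hy]

variable {C : Type v} {𝓜 : C → Type u} [∀ c, PRSLang.Structure (𝓜 c)] [∀ c, PRSomega (𝓜 c)]
variable {ok : Prop} {n : ℕ}

/-- The recursion of the language only hands down the union of the previous values, which loses
information. If one recurses with the singletons {R(v)}, this union is precisely the set of values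
R(v). -/
theorem PR.exists_rec (h : ∀ c, (Fin (n + 2) → 𝓜 c) → 𝓜 c) [hh : PR 𝓜 ok h] :
    ∃ R : ∀ c, (Fin (n + 1) → 𝓜 c) → 𝓜 c, PR 𝓜 ok R ∧ ∀ c x y,
      R c (Matrix.vecCons x y) = h c (Matrix.vecCons
        (DilRec.imag x (fun v => R c (Matrix.vecCons v y))) (Matrix.vecCons x y)) := by
  obtain ⟨S, hS, hw⟩ := PR.prec (n := n) (𝓜 := 𝓜) (ok := ok)
    (fun c v => DilRec.sing (h c v))
  have h1 : PR 𝓜 ok (n := n + 1) (fun c v => DilRec.bUnion (v 0)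
      (fun x => S c (Matrix.vecCons x (fun i => v i.succ)))) := by
    have : PR 𝓜 ok (n := n + 1 + 1) (fun c w =>
        S c (Matrix.vecCons (w 0) (fun i => w i.succ.succ))) := by
      refine PR.congr (hs := PR.weaken (ht := hS) (Fin.cases 0 fun i => i.succ.succ)) fun c w => ?_
      congr 1; funext i; exact Fin.cases rfl (fun i => rfl) i
    exact PR.bUnion (f := fun c v x => S c (Matrix.vecCons x (fun i => v i.succ)))
  have h2 : PR 𝓜 ok (n := n + 1) (fun c v => h c (Matrix.vecCons (DilRec.bUnion (v 0)
      (fun x => S c (Matrix.vecCons x (fun i => v i.succ)))) v)) := by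
    refine PR.congr (hs := PR.subst (ht := hh) (Matrix.vecCons _ fun i _ v => v i)
      (Fin.cases h1 fun i => PR.var i)) fun c v => ?_
    congr 1; funext i; exact Fin.cases rfl (fun i => rfl) i
  refine ⟨_, h2, ?_⟩
  have hS' : ∀ c x (y : Fin n → 𝓜 c), S c (Matrix.vecCons x y) =
      DilRec.sing (h c (Matrix.vecCons (DilRec.bUnion x (fun x => S c (Matrix.vecCons x y)))
        (Matrix.vecCons x y))) := by
    intro c x y
    obtain ⟨w, hw1, hw2⟩ := hw c x y
    rw [hw2]
    have hd := PR.local S (ht := hS) c y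
    congr 4
    rw [ext_iff']
    intro z
    rw [hw1, mem_bUnion]
  intro c x y
  congr 2
  have hd := PR.local S (ht := hS) c y
  have hd2 := PR.local _ (ht := h2) c y
  rw [ext_iff']
  intro z
  rw [mem_imag]
  simp only [Matrix.cons_val_zero, Matrix.cons_val_succ]
  rw [mem_bUnion]
  refine exists_congr fun v => and_congr_right fun _ => ?_
  rw [hS', mem_sing]

theorem recI_spec {h : M → M → M} [hh : DefF₂ h] :
    DefF (recI h) ∧ ∀ x, recI h x = h (imag x (recI h)) x := by
  obtain ⟨R, hR, he⟩ := PR.exists_rec (n := 0) _ (hh := hh)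
  have H : ∃ R : M → M, DefF R ∧ ∀ x, R x = h (imag x R) x :=
    ⟨fun x => R PUnit.unit (Matrix.vecCons x ![]), PR.local _ (ht := hR) PUnit.unit ![],
      fun x => he PUnit.unit x ![]⟩
  rw [recI, dif_pos H]
  exact H.choose_spec

theorem recI_eq {h : M → M → M} [hh : DefF₂ h] (x : M) : recI h x = h (imag x (recI h)) x :=
  recI_spec.2 x

theorem PR.local₂ (t : ∀ c, (Fin (n + 2) → 𝓜 c) → 𝓜 c) [ht : PR 𝓜 ok t] (c : C)
    (v : Fin n → 𝓜 c) :
    DefF₂ (fun x y => t c (Matrix.vecCons x (Matrix.vecCons y v))) := by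
  obtain ⟨k, hk, F, p, hp⟩ := ht.out
  have : PR (fun _ : PUnit.{1} => 𝓜 c) True (n := 2) (fun _ w => app F (fun i =>
     (Fin.append (Matrix.vecCons (fun (_ : PUnit.{1}) w => w 0) (Matrix.vecCons
      (fun (_ : PUnit.{1}) w => w 1) (fun i (_ : PUnit.{1}) _ => v i))) (fun j _ _ => p c j) :
       Fin (n + 2 + k) → ∀ _ : PUnit.{1}, (Fin 2 → 𝓜 c) → 𝓜 c) i PUnit.unit w)) := by
    refine PR.comp F _ fun i => ?_
    refine Fin.addCases (fun a => ?_) (fun b => ?_) i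
    · rw [Fin.append_left]
      refine Fin.cases ?_ (Fin.cases ?_ fun j => ?_) a
      · exact PR.var 0
      · exact PR.var 1
      · exact PR.param _
    · rw [Fin.append_right]; exact PR.param _
  refine PR.congr (hs := this) fun _ w => (hp _ _).trans ?_
  congr 1
  funext i
  refine Fin.addCases (fun a => ?_) (fun b => ?_) i
  · refine Fin.cases ?_ (Fin.cases ?_ fun j => ?_) a <;> simp
  · simp

/-- `recI` is a choice among solutions that are definable with parameters. By set induction such a
solution is unique, so the choice agrees with the function given by the symbol. -/
instance PR.recI {h : ∀ c, (Fin n → 𝓜 c) → 𝓜 c → 𝓜 c → 𝓜 c}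
    {t : ∀ c, (Fin n → 𝓜 c) → 𝓜 c} [ht : PR 𝓜 ok t]
    [hh : PR 𝓜 ok (n := n + 2) (fun c u => h c (fun i => u i.succ.succ) (u 0) (u 1))] :
    PR 𝓜 ok (fun c v => recI (fun w x => h c v w x) (t c v)) := by
  obtain ⟨R, hR, he⟩ := PR.exists_rec _ (hh := hh)
  have key := PR.subst (ht := hR) (Matrix.vecCons t (fun i _ v => v i))
    (Fin.cases ht fun i => PR.var i)
  refine PR.congr (hs := key) fun c v => ?_
  have e : (fun i => (Matrix.vecCons t (fun i _ v => v i) :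
      Fin (n + 1) → ∀ c, (Fin n → 𝓜 c) → 𝓜 c) i c v) = Matrix.vecCons (t c v) v := by
    funext i
    exact Fin.cases rfl (fun i => rfl) i
  have hd : DefF (fun x => R c (Matrix.vecCons x v)) :=
    PR.local R (ht := hR) c v
  have hd2 : DefF₂ (h c v) := PR.local₂ _ (ht := hh) c v
  have := recI_spec (h := h c v)
  have hd3 := this.1
  rw [e]
  exact congrFun (recI_unique (h := h c v) this.2 (fun x => he c x v)) (t c v)

instance PR.trcl {t : ∀ c, (Fin n → 𝓜 c) → 𝓜 c} [ht : PR 𝓜 ok t] :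
    PR 𝓜 ok (fun c v => trcl (t c v)) := by
  refine PR.congr (hs := PR.comp trclFun ![t] (Fin.cases ht fun i => i.elim0)) fun c v => ?_
  rw [DilRec.trcl]; congr 1; funext i; fin_cases i; rfl

end Recursion

/-! ### Functions as sets -/

section Functions

variable {M : Type u} [PRSLang.Structure M]

/-- The value of the function `f` at `x`. -/
noncomputable def ap (f x : M) : M := sUnion (sepr (trcl f) (fun y => opair x y ∊ f))

/-- `{⟨x, φ x⟩ | x ∈ a}` -/
noncomputable def lam (a : M) (φ : M → M) : M := imag a (fun x => opair x (φ x))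

/-- The first component of a pair. -/
noncomputable def fst (z : M) : M :=
  sUnion (sepr (trcl z) (fun x => ∃ y, y ∊ trcl z ∧ z = opair x y))

/-- The second component of a pair. -/
noncomputable def snd (z : M) : M :=
  sUnion (sepr (trcl z) (fun y => ∃ x, x ∊ trcl z ∧ z = opair x y))

variable [PRSomega M]

theorem ap_eq {f x y : M} (h : opair x y ∊ f) (hu : ∀ y', opair x y' ∊ f → y' = y) :
    ap f x = y := by
  rw [ext_iff']
  intro z
  simp only [ap, mem_sUnion, mem_sepr]
  constructor
  · rintro ⟨w, ⟨-, hw⟩, hz⟩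
    exact hu w hw ▸ hz
  · intro hz
    exact ⟨y, ⟨(mem_trcl_opair h).2, h⟩, hz⟩

theorem IsFunOn.opair_iff {f a x y : M} (h : IsFunOn f a) :
    opair x y ∊ f ↔ x ∊ a ∧ y = ap f x := by
  have key : ∀ x, x ∊ a → ∃ y, opair x y ∊ f ∧ ap f x = y ∧ ∀ y', opair x y' ∊ f → y' = y := by
    intro x hx
    obtain ⟨y, hy, hu⟩ := h.2 x hx
    exact ⟨y, hy, ap_eq hy hu, hu⟩
  constructor
  · intro hxy
    obtain ⟨x', y', hx, he⟩ := h.1 _ hxy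
    rw [opair_inj] at he
    obtain ⟨rfl, rfl⟩ := he
    obtain ⟨y', -, h2, h3⟩ := key x hx
    exact ⟨hx, h2 ▸ h3 y hxy⟩
  · rintro ⟨hx, rfl⟩
    obtain ⟨y', h1, h2, -⟩ := key x hx
    exact h2 ▸ h1

theorem IsFunOn.eq_lam {f a : M} (h : IsFunOn f a) : f = lam a (ap f) := by
  rw [ext_iff']
  intro z
  have : DefF (ap f) := by unfold ap; infer_instance
  simp only [lam, mem_imag]
  constructor
  · intro hz
    obtain ⟨x, y, hx, rfl⟩ := h.1 z hz
    exact ⟨x, hx, by rw [(h.opair_iff.1 hz).2]⟩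
  · rintro ⟨x, hx, rfl⟩
    exact h.opair_iff.2 ⟨hx, rfl⟩

@[simp] theorem fst_opair (x y : M) : fst (opair x y) = x := by
  rw [ext_iff']
  intro z
  simp only [fst, mem_sUnion, mem_sepr, opair_inj]
  have := trcl_opair (self_mem_trcl (opair x y))
  constructor
  · rintro ⟨_, ⟨-, w, -, rfl, rfl⟩, hz⟩; exact hz
  · intro hz; exact ⟨x, ⟨this.1, y, this.2, rfl, rfl⟩, hz⟩

@[simp] theorem snd_opair (x y : M) : snd (opair x y) = y := by
  rw [ext_iff']
  intro z
  simp only [snd, mem_sUnion, mem_sepr, opair_inj]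
  have := trcl_opair (self_mem_trcl (opair x y))
  constructor
  · rintro ⟨_, ⟨-, w, -, rfl, rfl⟩, hz⟩; exact hz
  · intro hz; exact ⟨y, ⟨this.2, x, this.1, rfl, rfl⟩, hz⟩

theorem opair_mem_lam {a x y : M} {φ : M → M} [DefF φ] :
    opair x y ∊ lam a φ ↔ x ∊ a ∧ y = φ x := by
  have : DefF (fun x => opair x (φ x)) := PR.opair (s := fun _ v => v 0) (t := fun _ v => φ (v 0))
  simp only [lam, mem_imag, opair_inj]
  constructor
  · rintro ⟨x', hx, rfl, rfl⟩; exact ⟨hx, rfl⟩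
  · rintro ⟨hx, rfl⟩; exact ⟨x, hx, rfl, rfl⟩

theorem mem_lam {a z : M} {φ : M → M} [DefF φ] : z ∊ lam a φ ↔ ∃ x, x ∊ a ∧ z = opair x (φ x) := by
  have : DefF (fun x => opair x (φ x)) := PR.opair (s := fun _ v => v 0) (t := fun _ v => φ (v 0))
  simp only [lam, mem_imag]

theorem isFunOn_lam {a : M} {φ : M → M} [DefF φ] : IsFunOn (lam a φ) a := by
  refine ⟨fun z hz => ?_, fun x hx => ⟨φ x, opair_mem_lam.2 ⟨hx, rfl⟩, fun y hy =>
    (opair_mem_lam.1 hy).2⟩⟩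
  obtain ⟨x, hx, rfl⟩ := mem_lam.1 hz
  exact ⟨x, _, hx, rfl⟩

theorem ap_lam {a x : M} {φ : M → M} [DefF φ] (hx : x ∊ a) : ap (lam a φ) x = φ x :=
  ap_eq (opair_mem_lam.2 ⟨hx, rfl⟩) fun _ h => (opair_mem_lam.1 h).2

end Functions

section Closure

variable {C : Type v} {𝓜 : C → Type u} [∀ c, PRSLang.Structure (𝓜 c)] [∀ c, PRSomega (𝓜 c)]
variable {ok : Prop} {n : ℕ} {s t r : ∀ c, (Fin n → 𝓜 c) → 𝓜 c}
  {f : ∀ c, (Fin n → 𝓜 c) → 𝓜 c → 𝓜 c}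

instance PR.ap [PR 𝓜 ok s] [PR 𝓜 ok t] : PR 𝓜 ok (fun c v => ap (s c v) (t c v)) := by
  unfold DilRec.ap; infer_instance

instance PR.lam [ht : PR 𝓜 ok t]
    [hf : PR 𝓜 ok (n := n + 1) (fun c w => f c (fun i => w i.succ) (w 0))] :
    PR 𝓜 ok (fun c v => lam (t c v) (fun x => f c v x)) :=
  PR.imag (f := fun c v x => DilRec.opair x (f c v x))

instance PR.fst [PR 𝓜 ok t] : PR 𝓜 ok (fun c v => fst (t c v)) := by
  unfold DilRec.fst; infer_instance

instance PR.snd [PR 𝓜 ok t] : PR 𝓜 ok (fun c v => snd (t c v)) := by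
  unfold DilRec.snd; infer_instance

/-- The components of a pair in f lie in the transitive closure of f, so quantifiers over arguments
and values of f can be bounded. The same device makes later definitions primitive recursive. -/
instance PRRel.isFunOn [PR 𝓜 ok s] [PR 𝓜 ok t] :
    PRRel 𝓜 ok (fun c v => IsFunOn (s c v) (t c v)) :=
  PRRel.congr (R := fun c v =>
    (∀ z, z ∊ s c v → ∃ x, x ∊ t c v ∧ ∃ y, y ∊ DilRec.trcl (s c v) ∧ z = DilRec.opair x y) ∧
    ∀ x, x ∊ t c v → ∃ y, y ∊ DilRec.trcl (s c v) ∧ (DilRec.opair x y ∊ s c v ∧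
      ∀ y', y' ∊ DilRec.trcl (s c v) → DilRec.opair x y' ∊ s c v → y' = y)) fun c v => by
    constructor
    · rintro ⟨h1, h2⟩
      refine ⟨fun z hz => ?_, fun x hx => ?_⟩
      · obtain ⟨x, y, hx, rfl⟩ := h1 z hz
        exact ⟨x, hx, y, (mem_trcl_opair hz).2, rfl⟩
      · obtain ⟨y, hy, hu⟩ := h2 x hx
        exact ⟨y, (mem_trcl_opair hy).2, hy, fun y' _ h => hu y' h⟩
    · rintro ⟨h1, h2⟩
      refine ⟨fun z hz => ?_, fun x hx => ?_⟩
      · obtain ⟨x, hx, y, -, rfl⟩ := h1 z hz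
        exact ⟨x, y, hx, rfl⟩
      · obtain ⟨y, -, hy, hu⟩ := h2 x hx
        exact ⟨y, hy, fun y' h => hu y' (mem_trcl_opair h).2 h⟩

instance PRRel.isFun [PR 𝓜 ok s] [PR 𝓜 ok t] [PR 𝓜 ok r] :
    PRRel 𝓜 ok (fun c v => IsFun (s c v) (t c v) (r c v)) :=
  PRRel.congr (R := fun c v => IsFunOn (s c v) (t c v) ∧
    ∀ x, x ∊ t c v → DilRec.ap (s c v) x ∊ r c v) fun _ _ =>
    and_congr_right fun h => by
      simp only [h.opair_iff]
      exact ⟨fun h x hx => h x _ ⟨hx, rfl⟩, by rintro h x _ ⟨hx, rfl⟩; exact h x hx⟩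

instance PRRel.isTrans [PR 𝓜 ok s] : PRRel 𝓜 ok (fun c v => IsTrans (s c v)) :=
  PRRel.congr (R := fun c v => ∀ y, y ∊ s c v → ∀ z, z ∊ y → z ∊ s c v) fun _ _ =>
    ⟨fun h y hy z hz => h y z hy hz, fun h y z hy hz => h y hy z hz⟩

instance PRRel.isOrd [PR 𝓜 ok s] : PRRel 𝓜 ok (fun c v => IsOrd (s c v)) := by
  unfold IsOrd; infer_instance

end Closure

/-! ### Ordinals -/

section Ordinals

variable {M : Type u} [PRSLang.Structure M] [PRSomega M]

theorem IsOrd.mem {α β : M} (h : IsOrd α) (hb : β ∊ α) : IsOrd β :=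
  ⟨h.2 β hb, fun y hy => h.2 y (h.1 β y hb hy)⟩

theorem IsOrd.succ {α : M} (h : IsOrd α) : IsOrd (succ α) := by
  constructor
  · intro y z hy hz
    rcases mem_succ.1 hy with hy | rfl
    · exact mem_succ.2 (Or.inl (h.1 y z hy hz))
    · exact mem_succ.2 (Or.inl hz)
  · intro y hy
    rcases mem_succ.1 hy with hy | rfl
    · exact h.2 y hy
    · exact h.1

theorem IsOrd.empt : IsOrd (empt M) :=
  ⟨fun y _ hy => absurd hy (mem_empt y), fun y hy => absurd hy (mem_empt y)⟩

theorem IsOrd.trans {α β γ : M} (h : IsOrd γ) (h1 : α ∊ β) (h2 : β ∊ γ) : α ∊ γ := h.1 β α h2 h1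

/-- A transitive subset of an ordinal is a member of it or equal to it. -/
theorem IsOrd.initial {α p : M} (h : IsOrd α) (hp : IsTrans p) (hs : ∀ x, x ∊ p → x ∊ α) :
    p ∊ α ∨ p = α := by
  by_cases he : ∃ x, x ∊ sepr α (fun x => ¬ x ∊ p)
  · obtain ⟨x, hx⟩ := he
    obtain ⟨m, hm, hmin⟩ := exists_min hx
    obtain ⟨hm, hmp⟩ := mem_sepr.1 hm
    left
    have hmsub : ∀ z, z ∊ m → z ∊ p := fun z hz => by
      by_contra hn
      exact hmin z (mem_sepr.2 ⟨h.1 m z hm hz, hn⟩) hz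
    by_cases hpm : ∃ x, x ∊ sepr p (fun x => ¬ x ∊ m)
    · -- the least such element equals `m`
      exfalso
      -- Comparability within α is shown by induction on x and, for given x, by considering a
      -- minimal counterexample y: extensionality then gives x = y.
      have comp : ∀ x, x ∊ α → x ∊ m ∨ x = m ∨ m ∊ x := by
        have := mem_induction (fun x => x ∊ α → ∀ y, y ∊ α → (x ∊ y ∨ x = y ∨ y ∊ x)) (by
          intro x ih hx
          by_contra hc
          push Not at hc
          obtain ⟨y, hy, hc⟩ := hc
          obtain ⟨y, hy', hmin⟩ := exists_min
            (mem_sepr.2 ⟨hy, hc⟩ : y ∊ sepr α (fun y => ¬ x ∊ y ∧ x ≠ y ∧ ¬ y ∊ x))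
          obtain ⟨hy, h1, h2, h3⟩ := mem_sepr.1 hy'
          apply h2
          rw [ext_iff']
          intro z
          constructor
          · intro hz
            rcases ih z hz (h.1 x z hx hz) y hy with h' | rfl | h'
            · exact h'
            · exact absurd hz h3
            · exact absurd (h.2 x hx z y hz h') h3
          · intro hz
            by_contra hzx
            refine hmin z (mem_sepr.2 ⟨h.1 y z hy hz, fun h' => h1 (h.2 y hy z x hz h'),
              fun h' => h1 (h' ▸ hz), hzx⟩) hz)
        exact fun x hx => this x hx m hm
      obtain ⟨x, hx⟩ := hpm
      obtain ⟨hxp, hxm⟩ := mem_sepr.1 hx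
      rcases comp x (hs x hxp) with h' | rfl | h'
      · exact hxm h'
      · exact hmp hxp
      · exact hmp (hp x m hxp h')
    · have : p = m := ext_iff'.2 fun z => ⟨fun hz => by_contra fun hn =>
        hpm ⟨z, mem_sepr.2 ⟨hz, hn⟩⟩, hmsub z⟩
      exact this ▸ hm
  · right
    exact ext_iff'.2 fun z => ⟨hs z, fun hz => by_contra fun hn => he ⟨z, mem_sepr.2 ⟨hz, hn⟩⟩⟩

/-- The intersection is an initial segment of both ordinals. It cannot be an element of both, since
it would then be an element of itself. -/
theorem IsOrd.tri {α β : M} (ha : IsOrd α) (hb : IsOrd β) : α ∊ β ∨ α = β ∨ β ∊ α := by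
  have ht : IsTrans (sepr α (fun x => x ∊ β)) := by
    intro y z hy hz
    obtain ⟨h1, h2⟩ := mem_sepr.1 hy
    exact mem_sepr.2 ⟨ha.1 y z h1 hz, hb.1 y z h2 hz⟩
  rcases ha.initial ht (fun x hx => (mem_sepr.1 hx).1) with h1 | h1 <;>
  rcases hb.initial ht (fun x hx => (mem_sepr.1 hx).2) with h2 | h2
  · exact absurd (mem_sepr.2 ⟨h1, h2⟩) (mem_irrefl _)
  · exact Or.inr (Or.inr (h2 ▸ h1))
  · exact Or.inl (h1 ▸ h2)
  · exact Or.inr (Or.inl (h1 ▸ h2))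

theorem IsOrd.subset_of_mem_succ {α β x : M} (hb : IsOrd β) (h : α ∊ DilRec.succ β)
    (hx : x ∊ α) : x ∊ β := by
  rcases mem_succ.1 h with h | rfl
  · exact hb.trans hx h
  · exact hx

theorem IsOrd.mem_succ_of_not_mem {α β : M} (ha : IsOrd α) (hb : IsOrd β) (h : ¬ β ∊ α) :
    α ∊ DilRec.succ β := by
  rcases ha.tri hb with h' | h' | h'
  · exact mem_succ.2 (Or.inl h')
  · exact mem_succ.2 (Or.inr h')
  · exact absurd h' h

theorem IsOrd.succ_mem_succ {α β : M} (hb : IsOrd β) (h : α ∊ β) :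
    DilRec.succ α ∊ DilRec.succ β := by
  refine (hb.mem h).succ.mem_succ_of_not_mem hb fun h' => ?_
  rcases mem_succ.1 h' with h' | rfl
  · exact mem_asymm h h'
  · exact mem_irrefl _ h

theorem IsOrd.of_succ_mem_succ {α β : M} (h : DilRec.succ α ∊ DilRec.succ β)
    (hb : IsOrd β) : α ∊ β :=
  hb.subset_of_mem_succ h (mem_succ.2 (Or.inr rfl))

theorem om_trans {m n : M} (hn : n ∊ om M) (hm : m ∊ n) : m ∊ om M := by
  refine om_induction (fun n => ∀ m, m ∊ n → m ∊ om M) ?_ ?_ n hn m hm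
  · intro m hm; exact absurd hm (mem_empt m)
  · intro n hn ih m hm
    rcases mem_succ.1 hm with hm | rfl
    · exact ih m hm
    · exact hn

theorem isOrd_of_mem_om {n : M} (hn : n ∊ om M) : IsOrd n :=
  om_induction (fun n => IsOrd n) IsOrd.empt (fun _ _ h => h.succ) n hn

theorem isOrd_om : IsOrd (om M) :=
  ⟨fun _ _ hy hz => om_trans hy hz, fun _ hy => (isOrd_of_mem_om hy).1⟩

theorem om_cases {n : M} (hn : n ∊ om M) : n = empt M ∨ ∃ k, k ∊ om M ∧ n = succ k :=
  (PRSomega.omega_ax n).1 hn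

@[simp] theorem sUnion_succ {α : M} (h : IsOrd α) : sUnion (succ α) = α := by
  rw [ext_iff']
  intro z
  simp only [mem_sUnion, mem_succ]
  constructor
  · rintro ⟨y, hy | rfl, hz⟩
    · exact h.1 y z hy hz
    · exact hz
  · intro hz; exact ⟨α, Or.inr rfl, hz⟩

/-! ### Ordinal addition -/

/-- `α + β` -/
noncomputable def oadd {M : Type u} [PRSLang.Structure M] (α β : M) : M :=
  recI (fun w _ => union₂ α w) β

instance PR.oadd {C : Type v} {𝓜 : C → Type u} [∀ c, PRSLang.Structure (𝓜 c)]
    [∀ c, PRSomega (𝓜 c)] {ok : Prop} {n : ℕ} {s t : ∀ c, (Fin n → 𝓜 c) → 𝓜 c} [PR 𝓜 ok s]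
    [PR 𝓜 ok t] : PR 𝓜 ok (fun c v => oadd (s c v) (t c v)) :=
  PR.recI (h := fun c v w _ => DilRec.union₂ (s c v) w)

theorem mem_oadd {α β z : M} : z ∊ oadd α β ↔ z ∊ α ∨ ∃ c, c ∊ β ∧ z = oadd α c := by
  have h : ∀ β, oadd α β = union₂ α (imag β (oadd α)) := fun β => recI_eq β
  rw [h, mem_union₂, mem_imag]

theorem oadd_mem {α β c : M} (h : c ∊ β) : oadd α c ∊ oadd α β := mem_oadd.2 (Or.inr ⟨c, h, rfl⟩)

@[simp] theorem oadd_empt (α : M) : oadd α (empt M) = α := by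
  rw [ext_iff']; intro z; simp [mem_oadd]

theorem oadd_succ (α β : M) : oadd α (succ β) = succ (oadd α β) := by
  rw [ext_iff']; intro z
  simp only [mem_oadd, mem_succ]
  constructor
  · rintro (h | ⟨c, h | rfl, rfl⟩)
    · exact Or.inl (Or.inl h)
    · exact Or.inl (Or.inr ⟨c, h, rfl⟩)
    · exact Or.inr rfl
  · rintro ((h | ⟨c, h, rfl⟩) | rfl)
    · exact Or.inl h
    · exact Or.inr ⟨c, Or.inl h, rfl⟩
    · exact Or.inr ⟨β, Or.inr rfl, rfl⟩

theorem isOrd_oadd {α β : M} (ha : IsOrd α) (hb : IsOrd β) : IsOrd (oadd α β) := by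
  refine mem_induction (fun β => IsOrd β → IsOrd (oadd α β)) ?_ β hb
  intro β ih hb
  constructor
  · intro y z hy hz
    rcases mem_oadd.1 hy with hy | ⟨c, hc, rfl⟩
    · exact mem_oadd.2 (Or.inl (ha.1 y z hy hz))
    · rcases mem_oadd.1 hz with hz | ⟨d, hd, rfl⟩
      · exact mem_oadd.2 (Or.inl hz)
      · exact oadd_mem (hb.1 c d hc hd)
  · intro y hy
    rcases mem_oadd.1 hy with hy | ⟨c, hc, rfl⟩
    · exact ha.2 y hy
    · exact (ih c hc (hb.mem hc)).1

theorem oadd_mem_om {m n : M} (hm : m ∊ om M) (hn : n ∊ om M) : oadd m n ∊ om M := by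
  refine om_induction (fun n => oadd m n ∊ om M) ?_ ?_ n hn
  · simpa using hm
  · intro n _ ih
    rw [oadd_succ]; exact succ_mem_om ih

/-- The function that witnesses `IsAdd` is unique by set induction. Transitivity of β ensures that
the recursion stays inside the domain `succ β`. -/
theorem isAdd_iff {α β s : M} (hb : IsTrans β) : IsAdd α β s ↔ s = oadd α β := by
  constructor
  · rintro ⟨f, hf, hr, hs⟩
    have key : ∀ b, b ∊ succ β → ap f b = oadd α b := by
      refine mem_induction (fun b => b ∊ succ β → ap f b = oadd α b) ?_
      intro b ih hbm
      have hsub : ∀ c, c ∊ b → c ∊ succ β := by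
        intro c hc
        rcases mem_succ.1 hbm with h | rfl
        · exact mem_succ.2 (Or.inl (hb b c h hc))
        · exact mem_succ.2 (Or.inl hc)
      rw [ext_iff']
      intro z
      rw [hr b _ (hf.opair_iff.2 ⟨hbm, rfl⟩), mem_oadd]
      refine or_congr_right (exists_congr fun c => and_congr_right fun hc => ?_)
      rw [hf.opair_iff, ih c hc (hsub c hc)]
      simp [hsub c hc]
    have := hf.opair_iff.1 hs
    rw [this.2, key β this.1]
  · rintro rfl
    have hd : DefF (oadd α) := PR.oadd (s := fun _ _ => α) (t := fun _ v => v 0)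
    refine ⟨lam (succ β) (oadd α), isFunOn_lam, ?_, opair_mem_lam.2 ⟨by simp, rfl⟩⟩
    intro b v hbv z
    obtain ⟨hbm, rfl⟩ := opair_mem_lam.1 hbv
    have hsub : ∀ c, c ∊ b → c ∊ succ β := by
      intro c hc
      rcases mem_succ.1 hbm with h | rfl
      · exact mem_succ.2 (Or.inl (hb b c h hc))
      · exact mem_succ.2 (Or.inl hc)
    rw [mem_oadd]
    refine or_congr_right (exists_congr fun c => and_congr_right fun hc => ?_)
    rw [opair_mem_lam]
    simp [hsub c hc]

end Ordinals

/-! ### Finite sets -/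

section Finite

variable {M : Type u} [PRSLang.Structure M]

/-- The subsets of `X` with at most `k` elements, for `k ∈ ω`. -/
noncomputable def finLevel (X k : M) : M :=
  recI (fun w _ => union₂ (sing (empt M))
    (union₂ (sUnion w) (bUnion (sUnion w) (fun s => imag X (fun x => adjoin s x))))) k

/-- The set of finite subsets of `X`. -/
noncomputable def finSets (X : M) : M := bUnion (om M) (fun k => finLevel X k)

variable {C : Type v} {𝓜 : C → Type u} [∀ c, PRSLang.Structure (𝓜 c)] [∀ c, PRSomega (𝓜 c)]
variable {ok : Prop} {n : ℕ} {s t : ∀ c, (Fin n → 𝓜 c) → 𝓜 c}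

instance PR.finLevel [PR 𝓜 ok s] [PR 𝓜 ok t] :
    PR 𝓜 ok (fun c v => finLevel (s c v) (t c v)) :=
  PR.recI (h := fun c v w _ => DilRec.union₂ (DilRec.sing (DilRec.empt (𝓜 c)))
    (DilRec.union₂ (DilRec.sUnion w) (DilRec.bUnion (DilRec.sUnion w)
      (fun y => DilRec.imag (s c v) (fun x => DilRec.adjoin y x)))))

instance PR.finSets [PR 𝓜 ok s] : PR 𝓜 ok (fun c v => finSets (s c v)) :=
  PR.bUnion (f := fun c v k => DilRec.finLevel (s c v) k)

variable [PRSomega M]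

theorem mem_finLevel {X k s : M} : s ∊ finLevel X k ↔ s = empt M ∨
    ∃ j, j ∊ k ∧ (s ∊ finLevel X j ∨ ∃ y x, y ∊ finLevel X j ∧ x ∊ X ∧ s = adjoin y x) := by
  have h : finLevel X k = union₂ (sing (empt M)) (union₂ (sUnion (imag k (finLevel X)))
    (bUnion (sUnion (imag k (finLevel X))) (fun s => imag X (fun x => adjoin s x)))) :=
    recI_eq (h := fun w _ => union₂ (sing (empt M))
    (union₂ (sUnion w) (bUnion (sUnion w) (fun s => imag X (fun x => adjoin s x))))) k
  have hd : DefF (finLevel X) := PR.finLevel (s := fun _ _ => X) (t := fun _ v => v 0)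
  rw [h]
  simp only [mem_union₂, mem_sing, mem_sUnion, mem_bUnion, mem_imag]
  constructor
  · rintro (h | ⟨_, ⟨j, hj, rfl⟩, h⟩ | ⟨y, ⟨_, ⟨j, hj, rfl⟩, hy⟩, x, hx, h⟩)
    · exact Or.inl h
    · exact Or.inr ⟨j, hj, Or.inl h⟩
    · exact Or.inr ⟨j, hj, Or.inr ⟨y, x, hy, hx, h⟩⟩
  · rintro (h | ⟨j, hj, h | ⟨y, x, hy, hx, h⟩⟩)
    · exact Or.inl h
    · exact Or.inr (Or.inl ⟨_, ⟨j, hj, rfl⟩, h⟩)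
    · exact Or.inr (Or.inr ⟨y, ⟨_, ⟨j, hj, rfl⟩, hy⟩, x, hx, h⟩)

theorem empt_mem_finSets (X : M) : empt M ∊ finSets X :=
  mem_bUnion.2 ⟨empt M, empt_mem_om, mem_finLevel.2 (Or.inl rfl)⟩

theorem adjoin_mem_finSets {X s x : M} (h : s ∊ finSets X) (hx : x ∊ X) :
    adjoin s x ∊ finSets X := by
  obtain ⟨k, hk, hs⟩ := mem_bUnion.1 h
  exact mem_bUnion.2 ⟨succ k, succ_mem_om hk,
    mem_finLevel.2 (Or.inr ⟨k, by simp, Or.inr ⟨s, x, hs, hx, rfl⟩⟩)⟩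

theorem imag_succ {n : M} {φ : M → M} [DefF φ] : imag (succ n) φ = adjoin (imag n φ) (φ n) := by
  rw [ext_iff']; intro z
  simp only [mem_imag, mem_adjoin, mem_succ]
  constructor
  · rintro ⟨x, h | rfl, rfl⟩
    · exact Or.inl ⟨x, h, rfl⟩
    · exact Or.inr rfl
  · rintro (⟨x, h, rfl⟩ | rfl)
    · exact ⟨x, Or.inl h, rfl⟩
    · exact ⟨n, Or.inr rfl, rfl⟩

theorem imag_empt {φ : M → M} [DefF φ] : imag (empt M) φ = empt M := by
  rw [ext_iff']; intro z; simp

theorem imag_mem_finSets {n Y : M} {φ : M → M} [hφ : DefF φ] (hn : n ∊ om M)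
    (h : ∀ i, i ∊ n → φ i ∊ Y) : imag n φ ∊ finSets Y := by
  have hd : DefR (fun m => (∀ i, i ∊ m → i ∊ n) → imag m φ ∊ finSets Y) := by
    have : PR (fun _ : PUnit.{1} => M) True (n := 1) (fun _ v => imag (v 0) φ) :=
      PR.imag (f := fun _ _ x => φ x) (hf := PR.weaken (ht := hφ) fun _ => 0)
    infer_instance
  refine om_induction (fun m => (∀ i, i ∊ m → i ∊ n) → imag m φ ∊ finSets Y) ?_ ?_ n hn
    fun i h => h
  · intro _; rw [imag_empt]; exact empt_mem_finSets Y
  · intro m _ ih hs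
    rw [imag_succ]
    exact adjoin_mem_finSets (ih fun i hi => hs i (mem_succ.2 (Or.inl hi)))
      (h m (hs m (by simp)))

theorem mem_finSets_of_isFunOn {e n Y : M} (hn : n ∊ om M) (he : IsFunOn e n)
    (h : ∀ i, i ∊ n → opair i (ap e i) ∊ Y) : e ∊ finSets Y := by
  rw [he.eq_lam]
  exact imag_mem_finSets (φ := fun i => opair i (ap e i)) hn h

end Finite

/-! ### Definable linear orders and enumerations of finite subsets -/

section LOPR

variable {C : Type v} {𝓜 : C → Type u} [∀ c, PRSLang.Structure (𝓜 c)] [∀ c, PRSomega (𝓜 c)]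

/-- The linear orders `X c v` have primitive recursive domain and order. -/
class LOPR (𝓜 : C → Type u) [∀ c, PRSLang.Structure (𝓜 c)] (ok : Prop) {n : ℕ}
    (X : ∀ c, (Fin n → 𝓜 c) → LO (𝓜 c)) : Prop where
  dom : PRRel 𝓜 ok (n := n + 1) (fun c w => (X c (fun i => w i.succ)).dom (w 0))
  lt : PRRel 𝓜 ok (n := n + 2) (fun c w => (X c (fun i => w i.succ.succ)).lt (w 0) (w 1))

variable {ok : Prop} {n m : ℕ} {X : ∀ c, (Fin n → 𝓜 c) → LO (𝓜 c)}
  {s t r : ∀ c, (Fin n → 𝓜 c) → 𝓜 c}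

theorem PRRel.subst {R : ∀ c, (Fin m → 𝓜 c) → Prop} [ht : PRRel 𝓜 ok R]
    (G : Fin m → ∀ c, (Fin n → 𝓜 c) → 𝓜 c) (h : ∀ i, PR 𝓜 ok (G i)) :
    PRRel 𝓜 ok (fun c v => R c (fun i => G i c v)) := by
  classical
  exact ⟨PR.subst (ht := ht.char) G h⟩

instance PRRel.loDom [hX : LOPR 𝓜 ok X] [hs : PR 𝓜 ok s] :
    PRRel 𝓜 ok (fun c v => (X c v).dom (s c v)) :=
  PRRel.subst (ht := hX.dom) (Matrix.vecCons s fun i _ v => v i)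
    (Fin.cases hs fun i => PR.var i)

instance PRRel.loLt [hX : LOPR 𝓜 ok X] [hs : PR 𝓜 ok s] [ht : PR 𝓜 ok t] :
    PRRel 𝓜 ok (fun c v => (X c v).lt (s c v) (t c v)) :=
  PRRel.subst (ht := hX.lt) (Matrix.vecCons s (Matrix.vecCons t fun i _ v => v i))
    (Fin.cases hs (Fin.cases ht fun i => PR.var i))

instance LOPR.weaken [hX : LOPR 𝓜 ok X] (ρ : Fin n → Fin m) :
    LOPR 𝓜 ok (fun c v => X c (fun i => v (ρ i))) where
  dom := PRRel.subst (ht := hX.dom) (Fin.cases (fun _ v => v 0) fun i _ v => v (ρ i).succ)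
    (Fin.cases (PR.var _) fun _ => PR.var _)
  lt := PRRel.subst (ht := hX.lt) (Fin.cases (fun _ v => v 0) (Fin.cases (fun _ v => v 1)
    fun i _ v => v (ρ i).succ.succ))
    (Fin.cases (PR.var _) (Fin.cases (PR.var _) fun _ => PR.var _))

instance LOPR.ofOrd [PR 𝓜 ok s] : LOPR 𝓜 ok (fun c v => LO.ofOrd (s c v)) where
  dom := PRRel.mem (s := fun _ w => w 0) (t := fun c w => s c (fun i => w i.succ))
  lt := by unfold LO.ofOrd; infer_instance

instance PR.inl [PR 𝓜 ok s] : PR 𝓜 ok (fun c v => LO.inl (s c v)) := by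
  unfold LO.inl; infer_instance

instance PR.inr [PR 𝓜 ok s] : PR 𝓜 ok (fun c v => LO.inr (s c v)) := by
  unfold LO.inr; infer_instance

instance LOPR.add [PR 𝓜 ok s] [PR 𝓜 ok t] : LOPR 𝓜 ok (fun c v => LO.add (s c v) (t c v)) where
  dom := by unfold LO.add; infer_instance
  lt := PRRel.congr (R := fun c w =>
    let γ := s c (fun i => w i.succ.succ)
    let n := t c (fun i => w i.succ.succ)
    (∃ x, x ∊ γ ∧ ∃ y, y ∊ γ ∧ w 0 = LO.inl x ∧ w 1 = LO.inl y ∧ x ∊ y) ∨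
    (∃ x, x ∊ γ ∧ ∃ j, j ∊ n ∧ w 0 = LO.inl x ∧ w 1 = LO.inr j) ∨
    (∃ i, i ∊ n ∧ ∃ j, j ∊ n ∧ w 0 = LO.inr i ∧ w 1 = LO.inr j ∧ i ∊ j)) fun c w => by
    simp only [LO.add, exists_and_left]

end LOPR

/-! ### Enumerations of finite sets and morphisms between natural numbers -/

section En

variable {M : Type u} [PRSLang.Structure M] [PRSomega M]

/-- `X` is definable with parameters from `M`. -/
abbrev DefLO (X : LO M) : Prop := LOPR (fun _ : PUnit.{1} => M) True (n := 0) (fun _ _ => X)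

instance LOPR.param (X : LO M) [hX : DefLO X] {n : ℕ} :
    LOPR (fun _ : PUnit.{1} => M) True (n := n) (fun _ _ => X) :=
  LOPR.weaken (hX := hX) Fin.elim0

theorem LO.IsEn.opair_iff {X : LO M} {a n e i x : M} (h : X.IsEn a n e) :
    opair i x ∊ e ↔ i ∊ n ∧ x = ap e i := h.2.2.1.1.opair_iff

theorem LO.isEn_iff {X : LO M} {a n e : M} : X.IsEn a n e ↔ n ∊ om M ∧ (∀ x, x ∊ a → X.dom x) ∧
    IsFun e n a ∧ (∀ x, x ∊ a → ∃ i, i ∊ n ∧ x = ap e i) ∧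
    ∀ i, i ∊ n → ∀ j, j ∊ n → i ∊ j → X.lt (ap e i) (ap e j) := by
  unfold LO.IsEn
  refine and_congr_right fun _ => and_congr_right fun _ => and_congr_right fun h => ?_
  simp only [h.1.opair_iff]
  refine and_congr_right fun _ => ⟨fun h i hi j hj hij => h i j _ _ ⟨hi, rfl⟩ ⟨hj, rfl⟩ hij, ?_⟩
  rintro h i j _ _ ⟨hi, rfl⟩ ⟨hj, rfl⟩ hij
  exact h i hi j hj hij

variable {X Y : LO M} {a b n m e e' : M}

theorem LO.IsEn.nat (h : X.IsEn a n e) : n ∊ om M := h.1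
theorem LO.IsEn.ap_mem (h : X.IsEn a n e) {i : M} (hi : i ∊ n) : ap e i ∊ a :=
  h.2.2.1.2 _ _ (h.opair_iff.2 ⟨hi, rfl⟩)
theorem LO.IsEn.ap_dom (h : X.IsEn a n e) {i : M} (hi : i ∊ n) : X.dom (ap e i) :=
  h.2.1 _ (h.ap_mem hi)
theorem LO.IsEn.surj (h : X.IsEn a n e) {x : M} (hx : x ∊ a) : ∃ i, i ∊ n ∧ x = ap e i :=
  (LO.isEn_iff.1 h).2.2.2.1 x hx
theorem LO.IsEn.mono (h : X.IsEn a n e) {i j : M} (hi : i ∊ n) (hj : j ∊ n) (hij : i ∊ j) :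
    X.lt (ap e i) (ap e j) := (LO.isEn_iff.1 h).2.2.2.2 i hi j hj hij
theorem LO.IsEn.mem_iff (h : X.IsEn a n e) {x : M} : x ∊ a ↔ ∃ i, i ∊ n ∧ x = ap e i :=
  ⟨h.surj, by rintro ⟨i, hi, rfl⟩; exact h.ap_mem hi⟩
theorem LO.IsEn.isFunOn (h : X.IsEn a n e) : IsFunOn e n := h.2.2.1.1

theorem LO.IsEn.inj (h : X.IsEn a n e) (hX : X.IsLinear) {i j : M} (hi : i ∊ n) (hj : j ∊ n)
    (hij : ap e i = ap e j) : i = j := by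
  rcases (isOrd_of_mem_om (om_trans h.nat hi)).tri (isOrd_of_mem_om (om_trans h.nat hj)) with
    h' | h' | h'
  · exact absurd (h.mono hi hj h') (by rw [hij]; exact hX.irrefl _)
  · exact h'
  · exact absurd (h.mono hj hi h') (by rw [hij]; exact hX.irrefl _)

theorem LO.IsEn.reflect (h : X.IsEn a n e) (hX : X.IsLinear) {i j : M} (hi : i ∊ n) (hj : j ∊ n)
    (hij : X.lt (ap e i) (ap e j)) : i ∊ j := by
  rcases (isOrd_of_mem_om (om_trans h.nat hi)).tri (isOrd_of_mem_om (om_trans h.nat hj)) with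
    h' | h' | h'
  · exact h'
  · exact absurd hij (by rw [h']; exact hX.irrefl _)
  · exact absurd (hX.trans _ _ _ hij (h.mono hj hi h')) (hX.irrefl _)

theorem LO.isEn_lam {φ : M → M} [DefF φ] (hn : n ∊ om M) (hd : ∀ i, i ∊ n → X.dom (φ i))
    (hm : ∀ i j, i ∊ n → j ∊ n → i ∊ j → X.lt (φ i) (φ j))
    (ha : ∀ x, x ∊ a ↔ ∃ i, i ∊ n ∧ x = φ i) : X.IsEn a n (lam n φ) := by
  refine LO.isEn_iff.2 ⟨hn, ?_, ⟨isFunOn_lam, ?_⟩, ?_, ?_⟩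
  · intro x hx
    obtain ⟨i, hi, rfl⟩ := (ha x).1 hx
    exact hd i hi
  · intro x y h
    obtain ⟨hx, rfl⟩ := opair_mem_lam.1 h
    exact (ha _).2 ⟨x, hx, rfl⟩
  · intro x hx
    obtain ⟨i, hi, rfl⟩ := (ha x).1 hx
    exact ⟨i, hi, (ap_lam hi).symm⟩
  · intro i hi j hj hij
    rw [ap_lam hi, ap_lam hj]
    exact hm i j hi hj hij

theorem NatHom.opair_iff {f i j : M} (h : NatHom m n f) : opair i j ∊ f ↔ i ∊ m ∧ j = ap f i :=
  h.2.2.1.1.opair_iff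

theorem natHom_iff {f : M} : NatHom m n f ↔ m ∊ om M ∧ n ∊ om M ∧ IsFun f m n ∧
    ∀ i, i ∊ m → ∀ j, j ∊ m → i ∊ j → ap f i ∊ ap f j := by
  unfold NatHom
  refine and_congr_right fun _ => and_congr_right fun _ => and_congr_right fun h => ?_
  simp only [h.1.opair_iff]
  refine ⟨fun h i hi j hj hij => h i j _ _ ⟨hi, rfl⟩ ⟨hj, rfl⟩ hij, ?_⟩
  rintro h i j _ _ ⟨hi, rfl⟩ ⟨hj, rfl⟩ hij
  exact h i hi j hj hij

theorem NatHom.ap_mem {f i : M} (h : NatHom m n f) (hi : i ∊ m) : ap f i ∊ n :=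
  h.2.2.1.2 _ _ (h.opair_iff.2 ⟨hi, rfl⟩)

theorem NatHom.mono {f i j : M} (h : NatHom m n f) (hi : i ∊ m) (hj : j ∊ m) (hij : i ∊ j) :
    ap f i ∊ ap f j := (natHom_iff.1 h).2.2.2 i hi j hj hij

theorem natHom_lam {φ : M → M} [DefF φ] (hm : m ∊ om M) (hn : n ∊ om M)
    (hd : ∀ i, i ∊ m → φ i ∊ n) (h : ∀ i j, i ∊ m → j ∊ m → i ∊ j → φ i ∊ φ j) :
    NatHom m n (lam m φ) := by
  refine natHom_iff.2 ⟨hm, hn, ⟨isFunOn_lam, ?_⟩, ?_⟩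
  · intro x y h
    obtain ⟨hx, rfl⟩ := opair_mem_lam.1 h
    exact hd x hx
  · intro i hi j hj hij
    rw [ap_lam hi, ap_lam hj]
    exact h i j hi hj hij

theorem IsFunOn.ext {f g : M} (hf : IsFunOn f a) (hg : IsFunOn g a)
    (h : ∀ x, x ∊ a → ap f x = ap g x) : f = g := by
  rw [hf.eq_lam, hg.eq_lam, ext_iff']
  intro z
  rw [mem_lam, mem_lam]
  exact exists_congr fun x => and_congr_right fun hx => by rw [h x hx]

theorem isLinear_ofOrd {α : M} (h : IsOrd α) : (LO.ofOrd α).IsLinear where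
  lt_dom := fun _ _ h => ⟨h.1, h.2.1⟩
  irrefl := fun x h => mem_irrefl x h.2.2
  trans := fun _ _ z h1 h2 => ⟨h1.1, h2.2.1, (h.mem h2.2.1).1 _ _ h2.2.2 h1.2.2⟩
  tri := fun x y hx hy => by
    rcases (h.mem hx).tri (h.mem hy) with h' | h' | h'
    · exact Or.inl ⟨hx, hy, h'⟩
    · exact Or.inr (Or.inl h')
    · exact Or.inr (Or.inr ⟨hy, hx, h'⟩)

theorem NatHom.isEn {f : M} (h : NatHom m n f) : (LO.ofOrd n).IsEn (imag m (ap f)) m f := by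
  refine LO.isEn_iff.2 ⟨h.1, ?_, ⟨h.2.2.1.1, ?_⟩, ?_, ?_⟩
  · intro x hx
    obtain ⟨i, hi, rfl⟩ := mem_imag.1 hx
    exact h.ap_mem hi
  · intro x y hxy
    obtain ⟨hx, rfl⟩ := h.opair_iff.1 hxy
    exact mem_imag.2 ⟨x, hx, rfl⟩
  · intro x hx; exact mem_imag.1 hx
  · intro i hi j hj hij
    exact ⟨h.ap_mem hi, h.ap_mem hj, h.mono hi hj hij⟩

theorem LO.IsEn.natHom {N : M} (hN : N ∊ om M) (h : (LO.ofOrd N).IsEn a n e) : NatHom n N e := by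
  refine natHom_iff.2 ⟨h.nat, hN, ⟨h.isFunOn, ?_⟩, fun i hi j hj hij => (h.mono hi hj hij).2.2⟩
  intro x y hxy
  obtain ⟨hx, rfl⟩ := h.opair_iff.1 hxy
  exact h.ap_dom hx

theorem NatHom.inj {f i j : M} (h : NatHom m n f) (hi : i ∊ m) (hj : j ∊ m)
    (hij : ap f i = ap f j) : i = j :=
  h.isEn.inj (isLinear_ofOrd (isOrd_of_mem_om h.2.1)) hi hj hij

/-- Embeddings of natural numbers are inflationary. -/
theorem NatHom.not_ap_mem {f i : M} (h : NatHom m n f) (hi : i ∊ m) : ¬ ap f i ∊ i := by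
  intro hlt
  obtain ⟨j, hj, hmin⟩ := exists_min
    (mem_sepr.2 ⟨hi, hlt⟩ : i ∊ sepr m (fun i => ap f i ∊ i))
  obtain ⟨hj, hlt⟩ := mem_sepr.1 hj
  have hj' : ap f j ∊ m := (isOrd_of_mem_om h.1).1 _ _ hj hlt
  exact hmin _ (mem_sepr.2 ⟨hj', h.mono hj' hj hlt⟩) hlt

/-- The composition `g ∘ f` as a set, for functions on `m`. -/
noncomputable def compFun {M : Type u} [PRSLang.Structure M] (m g f : M) : M :=
  lam m (fun i => ap g (ap f i))

theorem NatHom.comp {l f g : M} (hf : NatHom l m f) (hg : NatHom m n g) :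
    NatHom l n (compFun l g f) :=
  natHom_lam hf.1 hg.2.1 (fun _ hi => hg.ap_mem (hf.ap_mem hi))
    fun _ _ hi hj hij => hg.mono (hf.ap_mem hi) (hf.ap_mem hj) (hf.mono hi hj hij)

theorem ap_compFun {f g i : M} (hi : i ∊ m) : ap (compFun m g f) i = ap g (ap f i) := ap_lam hi

theorem natHom_id (hm : m ∊ om M) (hn : n ∊ om M) (h : ∀ i, i ∊ m → i ∊ n) :
    NatHom m n (lam m fun i => i) :=
  natHom_lam hm hn h fun _ _ _ _ h => h

/-- An enumeration factors through the enumeration of a larger set. -/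
theorem LO.IsEn.factor {c k ec : M} (hX : X.IsLinear) (ha : X.IsEn a m e) (hc : X.IsEn c k ec)
    (hs : ∀ x, x ∊ a → x ∊ c) : ∃ f, NatHom m k f ∧ ∀ i, i ∊ m → ap ec (ap f i) = ap e i := by
  -- By injectivity of `ec` the separated set is a singleton, so its union is the index sought. This
  -- replaces a choice by an explicit definition, as is needed to form the map as a set.
  have key : ∀ i, i ∊ m → sUnion (sepr k (fun j => ap ec j = ap e i)) ∊ k ∧
      ap ec (sUnion (sepr k (fun j => ap ec j = ap e i))) = ap e i := by
    intro i hi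
    obtain ⟨j, hj, he⟩ := hc.surj (hs _ (ha.ap_mem hi))
    have : sUnion (sepr k (fun j => ap ec j = ap e i)) = j := by
      rw [ext_iff']
      intro z
      simp only [mem_sUnion, mem_sepr]
      constructor
      · rintro ⟨j', ⟨hj', he'⟩, hz⟩
        exact hc.inj hX hj' hj (he'.trans he) ▸ hz
      · intro hz; exact ⟨j, ⟨hj, he.symm⟩, hz⟩
    rw [this]
    exact ⟨hj, he.symm⟩
  refine ⟨lam m fun i => sUnion (sepr k (fun j => ap ec j = ap e i)),
    natHom_lam ha.nat hc.nat (fun i hi => (key i hi).1) ?_, ?_⟩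
  · intro i j hi hj hij
    refine hc.reflect hX (key i hi).1 (key j hj).1 ?_
    rw [(key i hi).2, (key j hj).2]
    exact ha.mono hi hj hij
  · intro i hi
    rw [ap_lam hi]; exact (key i hi).2

/-- The enumeration of a finite subset of a linear order is unique. -/
theorem LO.IsEn.unique (hX : X.IsLinear) (h : X.IsEn a n e) (h' : X.IsEn a m e') :
    n = m ∧ e = e' := by
  have key : ∀ {n m e e' : M}, X.IsEn a n e → X.IsEn a m e' →
      ∀ i, i ∊ n → i ∊ m ∧ ap e i = ap e' i := by
    intro n m e e' h h' i hi
    -- The two enumerations factor through each other. As embeddings of natural numbers are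
    -- inflationary, i ≤ f(i) ≤ g(f(i)) = i, so that f is the identity.
    obtain ⟨f, hf, hfe⟩ := h.factor hX h' fun _ h => h
    obtain ⟨g, hg, hge⟩ := h'.factor hX h fun _ h => h
    have hgf : ap g (ap f i) = i :=
      h.inj hX (hg.ap_mem (hf.ap_mem hi)) hi (by rw [hge _ (hf.ap_mem hi), hfe _ hi])
    have h1 := hf.not_ap_mem hi
    have h2 := hg.not_ap_mem (hf.ap_mem hi)
    rw [hgf] at h2
    have hfi : ap f i = i := by
      rcases (isOrd_of_mem_om (om_trans hf.1 hi)).tri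
        (isOrd_of_mem_om (om_trans hf.2.1 (hf.ap_mem hi))) with h3 | h3 | h3
      · exact absurd h3 h2
      · exact h3.symm
      · exact absurd h3 h1
    exact ⟨hfi ▸ hf.ap_mem hi, by rw [← hfe i hi, hfi]⟩
  have hnm : n = m := ext_iff'.2 fun z =>
    ⟨fun hz => (key h h' z hz).1, fun hz => (key h' h z hz).1⟩
  subst hnm
  exact ⟨rfl, IsFunOn.ext h.isFunOn h'.isFunOn fun x hx => (key h h' x hx).2⟩

theorem LO.isEn_empt (X : LO M) : X.IsEn (empt M) (empt M) (lam (empt M) fun i => i) :=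
  LO.isEn_lam empt_mem_om (fun _ hi => absurd hi (mem_empt _)) (fun _ _ hi => absurd hi (mem_empt _))
    (by simp)

end En

section EnPR

variable {C : Type v} {𝓜 : C → Type u} [∀ c, PRSLang.Structure (𝓜 c)] [∀ c, PRSomega (𝓜 c)]
variable {ok : Prop} {n : ℕ} {X : ∀ c, (Fin n → 𝓜 c) → LO (𝓜 c)}
  {s t r : ∀ c, (Fin n → 𝓜 c) → 𝓜 c}

instance PRRel.isEn [LOPR 𝓜 ok X] [PR 𝓜 ok s] [PR 𝓜 ok t] [PR 𝓜 ok r] :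
    PRRel 𝓜 ok (fun c v => (X c v).IsEn (s c v) (t c v) (r c v)) := by
  simp only [LO.isEn_iff]; infer_instance

instance PRRel.natHom [PR 𝓜 ok s] [PR 𝓜 ok t] [PR 𝓜 ok r] :
    PRRel 𝓜 ok (fun c v => NatHom (s c v) (t c v) (r c v)) := by
  simp only [natHom_iff]; infer_instance

end EnPR

/-! ### Finiteness of unions and subsets -/

section Union

variable {M : Type u} [PRSLang.Structure M] [PRSomega M] {X : LO M} {a b c n m k e e' x : M}

/-- The theory has no power sets. Instead, `finSets` bounds the quantifiers over finite subsets and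
their enumerations, which is what renders statements about them primitive recursive. -/
theorem LO.IsEn.mem_finSets (h : X.IsEn a n e) {Y : M} (hY : ∀ x, x ∊ a → x ∊ Y) :
    a ∊ finSets Y ∧ e ∊ finSets (prod (om M) Y) := by
  constructor
  · have : a = imag n (ap e) := ext_iff'.2 fun z => by rw [mem_imag]; exact h.mem_iff
    rw [this]
    exact imag_mem_finSets h.nat fun i hi => hY _ (h.ap_mem hi)
  · exact mem_finSets_of_isFunOn h.nat h.isFunOn fun i hi =>
      opair_mem_prod.2 ⟨om_trans h.nat hi, hY _ (h.ap_mem hi)⟩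

theorem NatHom.mem_finSets {f : M} (h : NatHom m n f) : f ∊ finSets (prod (om M) (om M)) :=
  mem_finSets_of_isFunOn h.1 h.2.2.1.1 fun _ hi =>
    opair_mem_prod.2 ⟨om_trans h.1 hi, om_trans h.2.1 (h.ap_mem hi)⟩

open Classical in
/-- Insertion of one element into an enumeration. -/
theorem LO.IsEn.insert [hd : DefLO X] (hX : X.IsLinear) (h : X.IsEn a n e) (hx : X.dom x)
    (hxa : ¬ x ∊ a) : ∃ e', X.IsEn (adjoin a x) (succ n) e' := by
  have hn := isOrd_of_mem_om h.nat
  -- The set of indices of elements below x is an initial segment of n, hence a number; it is the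
  -- position at which x gets inserted.
  let p := sepr n (fun i => X.lt (ap e i) x)
  have hp : ∀ i, i ∊ p ↔ i ∊ n ∧ X.lt (ap e i) x := fun i => mem_sepr
  have hpn : p ∊ succ n := by
    refine mem_succ.2 (hn.initial ?_ fun x hx => ((hp x).1 hx).1)
    intro y z hy hz
    obtain ⟨h1, h2⟩ := (hp y).1 hy
    have hz' := hn.trans hz h1
    exact (hp z).2 ⟨hz', hX.trans _ _ _ (h.mono hz' h1 hz) h2⟩
  have hpo : IsOrd p := hn.succ.mem hpn
  have hgt : ∀ i, i ∊ n → ¬ i ∊ p → X.lt x (ap e i) := by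
    intro i hi hip
    rcases hX.tri _ _ hx (h.ap_dom hi) with h' | h' | h'
    · exact h'
    · exact absurd (h' ▸ h.ap_mem hi) hxa
    · exact absurd ((hp i).2 ⟨hi, h'⟩) hip
  -- Beyond position p the old enumeration is shifted by one; on successors, `sUnion` is the
  -- predecessor.
  let φ : M → M := fun i => if i ∊ p then ap e i else if i = p then x else ap e (sUnion i)
  have h1 : ∀ i, i ∊ p → φ i = ap e i := fun i hi => if_pos hi
  have h2 : φ p = x := by simp [φ]
  have h3 : ∀ i, i ∊ n → ¬ i ∊ p → φ (succ i) = ap e i := by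
    intro i hi hip
    have h4 : ¬ succ i ∊ p := fun h' => hip (hpo.trans (mem_succ.2 (Or.inr rfl)) h')
    have h5 : succ i ≠ p := fun h' => hip (h' ▸ mem_succ.2 (Or.inr rfl))
    simp only [φ, if_neg h4, if_neg h5, sUnion_succ (hn.mem hi)]
  have hcase : ∀ i, i ∊ succ n → i ∊ p ∨ i = p ∨ ∃ j, j ∊ n ∧ ¬ j ∊ p ∧ i = succ j := by
    intro i hi
    rcases (hn.succ.mem hi).tri hpo with h' | h' | h'
    · exact Or.inl h'
    · exact Or.inr (Or.inl h')
    · right; right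
      rcases om_cases (om_trans (succ_mem_om h.nat) hi) with rfl | ⟨j, hj, rfl⟩
      · exact absurd h' (mem_empt p)
      · refine ⟨j, hn.of_succ_mem_succ hi, fun hjp => ?_, rfl⟩
        rcases mem_succ.1 h' with h' | rfl
        · exact mem_asymm hjp h'
        · exact mem_irrefl _ hjp
  have hdφ : DefF φ := by unfold φ; infer_instance
  refine ⟨lam (succ n) φ, LO.isEn_lam (succ_mem_om h.nat) ?_ ?_ ?_⟩
  · intro i hi
    rcases hcase i hi with h' | rfl | ⟨j, hj, hjp, rfl⟩
    · rw [h1 i h']; exact h.ap_dom ((hp i).1 h').1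
    · rw [h2]; exact hx
    · rw [h3 j hj hjp]; exact h.ap_dom hj
  · intro i j hi hj hij
    rcases hcase i hi with hi' | rfl | ⟨i, hi', hip, rfl⟩ <;>
    rcases hcase j hj with hj' | rfl | ⟨j, hj', hjp, rfl⟩
    · rw [h1 i hi', h1 j hj']
      exact h.mono ((hp i).1 hi').1 ((hp j).1 hj').1 hij
    · rw [h1 i hi', h2]; exact ((hp i).1 hi').2
    · rw [h1 i hi', h3 j hj' hjp]
      exact hX.trans _ _ _ ((hp i).1 hi').2 (hgt j hj' hjp)
    · exact absurd hij (mem_asymm hj')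
    · exact absurd hij (mem_irrefl _)
    · rw [h2, h3 j hj' hjp]; exact hgt j hj' hjp
    · exact absurd (hpo.trans (mem_succ.2 (Or.inr rfl)) (hpo.trans hij hj')) hip
    · exact absurd (hpo.trans (mem_succ.2 (Or.inr rfl)) hij) hip
    · rw [h3 i hi' hip, h3 j hj' hjp]
      refine h.mono hi' hj' ?_
      rcases mem_succ.1 hij with h' | rfl
      · exact (hn.mem hj').trans (mem_succ.2 (Or.inr rfl)) h'
      · exact mem_succ.2 (Or.inr rfl)
  · intro z
    rw [mem_adjoin, h.mem_iff]
    constructor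
    · rintro (⟨i, hi, rfl⟩ | rfl)
      · by_cases hip : i ∊ p
        · exact ⟨i, mem_succ.2 (Or.inl hi), (h1 i hip).symm⟩
        · exact ⟨succ i, hn.succ_mem_succ hi, (h3 i hi hip).symm⟩
      · exact ⟨p, hpn, h2.symm⟩
    · rintro ⟨i, hi, rfl⟩
      rcases hcase i hi with h' | rfl | ⟨j, hj, hjp, rfl⟩
      · exact Or.inl ⟨i, ((hp i).1 h').1, h1 i h'⟩
      · exact Or.inr h2
      · exact Or.inl ⟨j, hj, h3 j hj hjp⟩

/-- Finite subsets are closed under unions, with a bound on the cardinality. -/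
theorem LO.IsEn.union [hd : DefLO X] (hX : X.IsLinear) (ha : X.IsEn a m e) (hb : X.IsEn b n e') :
    ∃ k ec, k ∊ succ (oadd m n) ∧ X.IsEn (union₂ a b) k ec := by
  -- The elements of b are added one after the other. The new enumeration is bounded by `finSets`,
  -- since induction on ω applies only to a primitive recursive statement.
  have key : ∀ i, i ∊ om M → i ∊ succ n → ∃ k, k ∊ succ (oadd m i) ∧
      ∃ ec, ec ∊ finSets (prod (om M) (union₂ a b)) ∧
        X.IsEn (union₂ a (imag i (fun j => ap e' j))) k ec := by
    refine om_induction _ ?_ ?_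
    · intro _
      refine ⟨m, by simp, e, (ha.mem_finSets fun x hx => mem_union₂.2 (Or.inl hx)).2, ?_⟩
      rw [imag_empt, show union₂ a (empt M) = a from ext_iff'.2 fun z => by simp]
      exact ha
    · intro i hi ih hin
      have hnO := isOrd_of_mem_om hb.nat
      have hin' : i ∊ n := hnO.of_succ_mem_succ hin
      obtain ⟨k, hk, ec, -, hec⟩ := ih (mem_succ.2 (Or.inl hin'))
      have hadd : IsOrd (oadd m i) := isOrd_oadd (isOrd_of_mem_om ha.nat) (isOrd_of_mem_om hi)
      have he : union₂ a (imag (succ i) (fun j => ap e' j)) =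
          adjoin (union₂ a (imag i (fun j => ap e' j))) (ap e' i) := by
        rw [imag_succ, ext_iff']; intro z; simp [or_assoc]
      have hsub : ∀ x, x ∊ union₂ a (imag (succ i) (fun j => ap e' j)) → x ∊ union₂ a b := by
        intro x hx
        rw [mem_union₂, mem_imag] at hx
        rw [mem_union₂]
        rcases hx with hx | ⟨j, hj, rfl⟩
        · exact Or.inl hx
        · exact Or.inr (hb.ap_mem (hnO.subset_of_mem_succ hin hj))
      rw [oadd_succ]
      by_cases hx : ap e' i ∊ union₂ a (imag i (fun j => ap e' j))
      · have he' : union₂ a (imag (succ i) (fun j => ap e' j)) =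
            union₂ a (imag i (fun j => ap e' j)) := by
          rw [he, ext_iff']; intro z
          rw [mem_adjoin]
          exact ⟨fun h => h.elim id fun h => h ▸ hx, Or.inl⟩
        rw [he'] at hsub ⊢
        exact ⟨k, mem_succ.2 (Or.inl hk), ec, (hec.mem_finSets hsub).2, hec⟩
      · rw [he] at hsub ⊢
        obtain ⟨ec', hec'⟩ := hec.insert hX (hb.ap_dom hin') hx
        exact ⟨succ k, hadd.succ.succ_mem_succ hk, ec', (hec'.mem_finSets hsub).2, hec'⟩
  obtain ⟨k, hk, ec, -, h⟩ := key n hb.nat (by simp)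
  refine ⟨k, ec, hk, ?_⟩
  have : imag n (fun j => ap e' j) = b := ext_iff'.2 fun z => by rw [mem_imag]; exact hb.mem_iff.symm
  rwa [this] at h

/-- Subsets of finite sets are finite. -/
theorem LO.IsEn.subset [hd : DefLO X] (hX : X.IsLinear) (ha : X.IsEn a n e)
    (hs : ∀ x, x ∊ b → x ∊ a) : ∃ k ec, X.IsEn b k ec := by
  -- The elements of a are examined in order, and those in b are inserted.
  have key : ∀ i, i ∊ om M → i ∊ succ n → ∃ k, k ∊ om M ∧
      ∃ ec, ec ∊ finSets (prod (om M) a) ∧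
        X.IsEn (sepr b (fun x => ∃ j, j ∊ i ∧ x = ap e j)) k ec := by
    refine om_induction _ ?_ ?_
    · intro _
      rw [show sepr b (fun x => ∃ j, j ∊ empt M ∧ x = ap e j) = empt M from
        ext_iff'.2 fun z => by rw [mem_sepr]; simp]
      have := LO.isEn_empt X
      exact ⟨_, empt_mem_om, _, (this.mem_finSets fun x hx => absurd hx (mem_empt x)).2, this⟩
    · intro i hi ih hin
      have hnO := isOrd_of_mem_om ha.nat
      have hin' : i ∊ n := hnO.of_succ_mem_succ hin
      obtain ⟨k, hk, ec, -, hec⟩ := ih (mem_succ.2 (Or.inl hin'))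
      by_cases hx : ap e i ∊ b
      · obtain ⟨ec', hec'⟩ := hec.insert hX (ha.ap_dom hin') (by
          intro h
          obtain ⟨-, j, hj, he⟩ := mem_sepr.1 h
          rw [ha.inj hX hin' (hnO.trans hj hin') he] at hj
          exact mem_irrefl _ hj)
        have he : sepr b (fun x => ∃ j, j ∊ succ i ∧ x = ap e j) =
            adjoin (sepr b (fun x => ∃ j, j ∊ i ∧ x = ap e j)) (ap e i) := by
          rw [ext_iff']; intro z
          rw [mem_adjoin, mem_sepr, mem_sepr]
          simp only [mem_succ]
          constructor
          · rintro ⟨hz, j, hj | rfl, rfl⟩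
            · exact Or.inl ⟨hz, j, hj, rfl⟩
            · exact Or.inr rfl
          · rintro (⟨hz, j, hj, rfl⟩ | rfl)
            · exact ⟨hz, j, Or.inl hj, rfl⟩
            · exact ⟨hx, i, Or.inr rfl, rfl⟩
        rw [he]
        refine ⟨_, hec'.nat, ec', (hec'.mem_finSets fun x hx => ?_).2, hec'⟩
        rw [← he] at hx
        exact hs x (mem_sepr.1 hx).1
      · have he : sepr b (fun x => ∃ j, j ∊ succ i ∧ x = ap e j) =
            sepr b (fun x => ∃ j, j ∊ i ∧ x = ap e j) := by
          rw [ext_iff']; intro z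
          rw [mem_sepr, mem_sepr]
          simp only [mem_succ]
          refine and_congr_right fun hz => ⟨?_, ?_⟩
          · rintro ⟨j, hj | rfl, rfl⟩
            · exact ⟨j, hj, rfl⟩
            · exact absurd hz hx
          · rintro ⟨j, hj, rfl⟩
            exact ⟨j, Or.inl hj, rfl⟩
        rw [he]
        exact ⟨k, hk, ec, (hec.mem_finSets fun x hx => hs x (mem_sepr.1 hx).1).2, hec⟩
  obtain ⟨k, -, ec, -, h⟩ := key n ha.nat (by simp)
  refine ⟨k, ec, ?_⟩
  have : sepr b (fun x => ∃ j, j ∊ n ∧ x = ap e j) = b := ext_iff'.2 fun z => by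
    rw [mem_sepr]
    exact ⟨fun h => h.1, fun h => ⟨h, ha.surj (hs z h)⟩⟩
  rwa [this] at h

end Union

namespace PD

variable {M : Type u} [PRSLang.Structure M] [PRSomega M] {P : PD M}

/-! ### Basic properties of predilators -/

namespace IsPredilator

variable {l m n f g h σ σ' τ τ' ρ : M}

theorem map_unique (hP : P.IsPredilator) (h1 : P.map m n f σ τ) (h2 : P.map m n f σ τ') :
    τ = τ' :=
  (hP.map_fun m n f σ (hP.map_hom _ _ _ _ _ h1).1 (hP.map_hom _ _ _ _ _ h1).2.1).unique h1 h2

theorem exists_map (hP : P.IsPredilator) (hf : NatHom m n f) (hσ : P.obj m σ) :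
    ∃ τ, P.map m n f σ τ := (hP.map_fun m n f σ hf hσ).exists

theorem lt_irrefl (hP : P.IsPredilator) : ¬ P.lt n σ σ := fun h =>
  (hP.linear n (hP.obj_nat n σ (hP.lt_obj _ _ _ h).1)).irrefl σ h

theorem lt_trans (hP : P.IsPredilator) (h1 : P.lt n σ τ) (h2 : P.lt n τ ρ) : P.lt n σ ρ :=
  (hP.linear n (hP.obj_nat n σ (hP.lt_obj _ _ _ h1).1)).trans _ _ _ h1 h2

theorem lt_tri (hP : P.IsPredilator) (h1 : P.obj n σ) (h2 : P.obj n τ) :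
    P.lt n σ τ ∨ σ = τ ∨ P.lt n τ σ :=
  (hP.linear n (hP.obj_nat n σ h1)).tri _ _ h1 h2

theorem map_inj (hP : P.IsPredilator) (h1 : P.map m n f σ τ) (h2 : P.map m n f σ' τ) :
    σ = σ' := by
  rcases hP.lt_tri (hP.map_hom _ _ _ _ _ h1).2.1 (hP.map_hom _ _ _ _ _ h2).2.1 with h | h | h
  · exact absurd (hP.map_lt _ _ _ _ _ _ _ h1 h2 h) hP.lt_irrefl
  · exact h
  · exact absurd (hP.map_lt _ _ _ _ _ _ _ h2 h1 h) hP.lt_irrefl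

theorem map_lt_iff (hP : P.IsPredilator) (h1 : P.map m n f σ τ) (h2 : P.map m n f σ' τ') :
    P.lt n τ τ' ↔ P.lt m σ σ' := by
  refine ⟨fun h => ?_, hP.map_lt _ _ _ _ _ _ _ h1 h2⟩
  rcases hP.lt_tri (hP.map_hom _ _ _ _ _ h1).2.1 (hP.map_hom _ _ _ _ _ h2).2.1 with h' | rfl | h'
  · exact h'
  · exact absurd (hP.map_unique h1 h2 ▸ h) hP.lt_irrefl
  · exact absurd (hP.lt_trans h (hP.map_lt _ _ _ _ _ _ _ h2 h1 h')) hP.lt_irrefl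

theorem map_comp' (hP : P.IsPredilator) (hh : NatHom l n h)
    (he : ∀ i, i ∊ l → ap h i = ap g (ap f i)) (h1 : P.map l m f σ τ) (h2 : P.map m n g τ ρ) :
    P.map l n h σ ρ := by
  refine hP.map_comp l m n f g h σ τ ρ hh (fun i j k hij hjk => ?_) h1 h2
  obtain ⟨hi, rfl⟩ := (hP.map_hom _ _ _ _ _ h1).1.opair_iff.1 hij
  obtain ⟨hj, rfl⟩ := (hP.map_hom _ _ _ _ _ h2).1.opair_iff.1 hjk
  exact hh.opair_iff.2 ⟨hi, (he i hi).symm⟩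

theorem map_comp_compFun (hP : P.IsPredilator) (h1 : P.map l m f σ τ) (h2 : P.map m n g τ ρ) :
    P.map l n (compFun l g f) σ ρ :=
  hP.map_comp' ((hP.map_hom _ _ _ _ _ h1).1.comp (hP.map_hom _ _ _ _ _ h2).1)
    (fun _ hi => ap_compFun hi) h1 h2

theorem map_factor (hP : P.IsPredilator) (hg : NatHom m n g)
    (he : ∀ i, i ∊ l → ap h i = ap g (ap f i)) (h1 : P.map l m f σ τ) (h2 : P.map l n h σ ρ) :
    P.map m n g τ ρ := by
  obtain ⟨ρ', h3⟩ := hP.exists_map hg (hP.map_hom _ _ _ _ _ h1).2.2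
  rwa [hP.map_unique h2 (hP.map_comp' (hP.map_hom _ _ _ _ _ h2).1 he h1 h3)]

theorem map_id' (hP : P.IsPredilator) (hσ : P.obj n σ) : P.map n n (lam n fun i => i) σ σ :=
  hP.map_id n _ σ (natHom_id (hP.obj_nat n σ hσ) (hP.obj_nat n σ hσ) fun _ h => h)
    (fun _ hi => opair_mem_lam.2 ⟨hi, rfl⟩) hσ

theorem tr_nat (hP : P.IsPredilator) (h : P.Tr σ n) : n ∊ om M := hP.obj_nat _ _ h.1

theorem supp_unique (hP : P.IsPredilator) {a b : M} (h1 : P.supp n σ a) (h2 : P.supp n σ b) :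
    a = b := (hP.supp_fun n σ (hP.supp_obj _ _ _ h1).1).unique h1 h2

/-- The support of `P(f)(σ)`, for `σ` in the trace, is the range of `f`. -/
theorem supp_map (hP : P.IsPredilator) (hσ : P.Tr σ m) (h : P.map m n f σ τ) :
    P.supp n τ (imag m (ap f)) := by
  obtain ⟨b, hb, -⟩ := hP.supp_fun n τ (hP.map_hom _ _ _ _ _ h).2.2
  have : imag m (ap f) = b := by
    rw [ext_iff']; intro z
    rw [hP.supp_natural _ _ _ _ _ _ _ h hσ.2 hb, mem_imag]
    simp only [(hP.map_hom _ _ _ _ _ h).1.opair_iff]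
    exact ⟨fun ⟨i, hi, hz⟩ => ⟨i, hi, hi, hz⟩, fun ⟨i, hi, _, hz⟩ => ⟨i, hi, hz⟩⟩
  exact this ▸ hb

/-- Normal forms. -/
theorem exists_normalForm (hP : P.IsPredilator) (hσ : P.obj n σ) : ∃ a m e σ₀, P.supp n σ a ∧
    (LO.ofOrd n).IsEn a m e ∧ P.map m n e σ₀ σ ∧ P.Tr σ₀ m := by
  obtain ⟨a, ha, -⟩ := hP.supp_fun n σ hσ
  have hn := hP.obj_nat n σ hσ
  have hlin := isLinear_ofOrd (isOrd_of_mem_om hn)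
  have hen := (natHom_id hn hn fun _ h => h).isEn
  obtain ⟨m, e, he⟩ := hen.subset hlin (b := a) fun x hx =>
    mem_imag.2 ⟨x, (hP.supp_obj _ _ _ ha).2 x hx, (ap_lam (φ := fun i => i) ((hP.supp_obj _ _ _ ha).2 x hx)).symm⟩
  have hom := he.natHom hn
  obtain ⟨σ₀, hσ₀⟩ := hP.support_condition m n e σ a hom ha fun j hj => by
    obtain ⟨i, hi, rfl⟩ := he.surj hj
    exact ⟨i, hom.opair_iff.2 ⟨hi, rfl⟩⟩
  have hobj := (hP.map_hom _ _ _ _ _ hσ₀).2.1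
  obtain ⟨a₀, ha₀, -⟩ := hP.supp_fun m σ₀ hobj
  refine ⟨a, m, e, σ₀, ha, he, hσ₀, hobj, ?_⟩
  -- By naturality e maps the support of σ₀ onto the support of σ, which is the whole range of e.
  -- Since e is injective, the support of σ₀ is all of m.
  have : a₀ = m := ext_iff'.2 fun i => by
    refine ⟨(hP.supp_obj _ _ _ ha₀).2 i, fun hi => ?_⟩
    obtain ⟨i', hi', hii⟩ := (hP.supp_natural _ _ _ _ _ _ _ hσ₀ ha₀ ha (ap e i)).1 (he.ap_mem hi)
    obtain ⟨h1, h2⟩ := hom.opair_iff.1 hii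
    rwa [hom.inj hi h1 h2]
  exact this ▸ ha₀

end IsPredilator

/-! ### Values of the extension of a predilator at a linear order -/

/-- The set `c` is enumerated by `ec : k → X`, and `σ'` is the value of `(σ, a)` in `P(k)`. -/
def Val (P : PD M) (X : LO M) (k ec σ a σ' : M) : Prop :=
  ∃ m ea f, X.IsEn a m ea ∧ P.Tr σ m ∧ NatHom m k f ∧
    (∀ i, i ∊ m → ap ec (ap f i) = ap ea i) ∧ P.map m k f σ σ'

variable {X Y : LO M} {a b c k m n ea eb ec f g h σ τ σ' τ' : M}

theorem ext_dom_iff : (P.ext X).dom (opair σ a) ↔ ∃ n e, X.IsEn a n e ∧ P.Tr σ n := by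
  constructor
  · rintro ⟨σ', a', n, e, h1, h2, h3⟩
    obtain ⟨rfl, rfl⟩ := opair_inj.1 h3
    exact ⟨n, e, h1, h2⟩
  · rintro ⟨n, e, h1, h2⟩; exact ⟨σ, a, n, e, h1, h2, rfl⟩

theorem exists_val (hP : P.IsPredilator) (hX : X.IsLinear) (hc : X.IsEn c k ec)
    (h : (P.ext X).dom (opair σ a)) (hs : ∀ x, x ∊ a → x ∊ c) :
    ∃ σ', P.Val X k ec σ a σ' := by
  obtain ⟨n, e, he, hT⟩ := ext_dom_iff.1 h
  obtain ⟨f, hf, hfe⟩ := he.factor hX hc hs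
  obtain ⟨σ', hσ'⟩ := hP.exists_map hf hT.1
  exact ⟨σ', n, e, f, he, hT, hf, hfe, hσ'⟩

theorem Val.obj (hP : P.IsPredilator) (h : P.Val X k ec σ a σ') : P.obj k σ' := by
  obtain ⟨m, ea, f, -, -, -, -, h⟩ := h
  exact (hP.map_hom _ _ _ _ _ h).2.2

theorem Val.mem (hc : X.IsEn c k ec) (h : P.Val X k ec σ a σ') {x : M} (hx : x ∊ a) : x ∊ c := by
  obtain ⟨m, ea, f, h1, -, hf, hfe, -⟩ := h
  obtain ⟨i, hi, rfl⟩ := h1.surj hx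
  rw [← hfe i hi]
  exact hc.ap_mem (hf.ap_mem hi)

/-- Passing to a larger finite set. -/
theorem Val.extend (hP : P.IsPredilator) (hX : X.IsLinear) {c' k' ec' ρ : M}
    (hc' : X.IsEn c' k' ec') (hh : NatHom k k' h)
    (hhe : ∀ i, i ∊ k → ap ec' (ap h i) = ap ec i) (h1 : P.Val X k ec σ a σ')
    (h2 : P.Val X k' ec' σ a ρ) : P.map k k' h σ' ρ := by
  obtain ⟨m, ea, f, ha, hT, hf, hfe, hm⟩ := h1
  obtain ⟨m', ea', f', ha', hT', hf', hfe', hm'⟩ := h2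
  obtain ⟨rfl, rfl⟩ := ha.unique hX ha'
  refine hP.map_factor hh (fun i hi => ?_) hm hm'
  refine hc'.inj hX (hf'.ap_mem hi) (hh.ap_mem (hf.ap_mem hi)) ?_
  rw [hfe' i hi, hhe _ (hf.ap_mem hi), hfe i hi]

/-- The order of P(X) is defined via the finite set a ∪ b. This set embeds into c, and the induced
map between values of P preserves and reflects the order, so any finite superset gives the same
answer. -/
theorem ext_lt_iff [DefLO X] (hP : P.IsPredilator) (hX : X.IsLinear) (hc : X.IsEn c k ec)
    (h1 : P.Val X k ec σ a σ') (h2 : P.Val X k ec τ b τ') :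
    (P.ext X).lt (opair σ a) (opair τ b) ↔ P.lt k σ' τ' := by
  have key : ∀ {c₀ k₀ ec₀ σ₀ τ₀}, (∀ x, x ∊ c₀ ↔ x ∊ a ∨ x ∊ b) → X.IsEn c₀ k₀ ec₀ →
      P.Val X k₀ ec₀ σ a σ₀ → P.Val X k₀ ec₀ τ b τ₀ → (P.lt k σ' τ' ↔ P.lt k₀ σ₀ τ₀) := by
    intro c₀ k₀ ec₀ σ₀ τ₀ hc₀ he hs ht
    obtain ⟨h, hh, hhe⟩ := he.factor hX hc fun x hx =>
      ((hc₀ x).1 hx).elim (fun hx => h1.mem hc hx) (fun hx => h2.mem hc hx)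
    exact hP.map_lt_iff (hs.extend hP hX hc hh hhe h1) (ht.extend hP hX hc hh hhe h2)
  constructor
  · rintro ⟨σ₁, τ₁, a', b', c₀, m, n, k₀, ea, eb, ec₀, f, g, σ₀, τ₀, e1, e2, hc₀, ha, hb, hec, hT1,
      hT2, hf, hfe, hg, hge, hm1, hm2, hlt⟩
    obtain ⟨rfl, rfl⟩ := opair_inj.1 e1
    obtain ⟨rfl, rfl⟩ := opair_inj.1 e2
    refine (key hc₀ hec ⟨m, ea, f, ha, hT1, hf, fun i hi => ?_, hm1⟩
      ⟨n, eb, g, hb, hT2, hg, fun i hi => ?_, hm2⟩).2 hlt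
    · exact (ha.opair_iff.1 (hfe i _ _ (hf.opair_iff.2 ⟨hi, rfl⟩)
        (hec.opair_iff.2 ⟨hf.ap_mem hi, rfl⟩))).2
    · exact (hb.opair_iff.1 (hge i _ _ (hg.opair_iff.2 ⟨hi, rfl⟩)
        (hec.opair_iff.2 ⟨hg.ap_mem hi, rfl⟩))).2
  · intro hlt
    obtain ⟨m, ea, f₁, ha, hT1, -⟩ := id h1
    obtain ⟨n, eb, g₁, hb, hT2, -⟩ := id h2
    obtain ⟨k₀, ec₀, -, hec⟩ := ha.union hX hb
    obtain ⟨f, hf, hfe⟩ := ha.factor hX hec fun x hx => mem_union₂.2 (Or.inl hx)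
    obtain ⟨g, hg, hge⟩ := hb.factor hX hec fun x hx => mem_union₂.2 (Or.inr hx)
    obtain ⟨σ₀, hσ₀⟩ := hP.exists_map hf hT1.1
    obtain ⟨τ₀, hτ₀⟩ := hP.exists_map hg hT2.1
    have hlt' := (key (fun x => mem_union₂) hec ⟨m, ea, f, ha, hT1, hf, hfe, hσ₀⟩
      ⟨n, eb, g, hb, hT2, hg, hge, hτ₀⟩).1 hlt
    refine ⟨σ, τ, a, b, _, m, n, k₀, ea, eb, ec₀, f, g, σ₀, τ₀, rfl, rfl, fun x => mem_union₂, ha,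
      hb, hec, hT1, hT2, hf, fun i j x hij hjx => ?_, hg, fun i j x hij hjx => ?_, hσ₀, hτ₀, hlt'⟩
    · obtain ⟨hi, rfl⟩ := hf.opair_iff.1 hij
      obtain ⟨hj, rfl⟩ := hec.opair_iff.1 hjx
      exact ha.opair_iff.2 ⟨hi, hfe i hi⟩
    · obtain ⟨hi, rfl⟩ := hg.opair_iff.1 hij
      obtain ⟨hj, rfl⟩ := hec.opair_iff.1 hjx
      exact hb.opair_iff.2 ⟨hi, hge i hi⟩

/-- The support of the common value σ' is the range of both morphisms, which must therefore
coincide. The rest is injectivity of P(f). -/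
theorem Val.inj (hP : P.IsPredilator) (h1 : P.Val X k ec σ a σ') (h2 : P.Val X k ec τ b σ') : σ = τ ∧ a = b := by
  obtain ⟨m, ea, f, ha, hT, hf, hfe, hm⟩ := h1
  obtain ⟨n, eb, g, hb, hT', hg, hge, hm'⟩ := h2
  have hs := hP.supp_unique (hP.supp_map hT hm) (hP.supp_map hT' hm')
  have hen := hs ▸ hf.isEn
  obtain ⟨rfl, rfl⟩ := hen.unique (isLinear_ofOrd (isOrd_of_mem_om hf.2.1)) hg.isEn
  refine ⟨hP.map_inj hm hm', ext_iff'.2 fun x => ?_⟩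
  rw [ha.mem_iff, hb.mem_iff]
  exact exists_congr fun i => and_congr_right fun hi => by rw [← hfe i hi, ← hge i hi]

theorem exists_opair_of_ext_dom {z : M} (h : (P.ext X).dom z) : ∃ σ a, z = opair σ a := by
  obtain ⟨σ, a, n, e, -, -, rfl⟩ := h
  exact ⟨σ, a, rfl⟩

theorem ext_lt_dom {z w : M} (h : (P.ext X).lt z w) : (P.ext X).dom z ∧ (P.ext X).dom w := by
  obtain ⟨σ, τ, a, b, c, m, n, k, ea, eb, ec, f, g, σ', τ', rfl, rfl, -, ha, hb, -, h1, h2, -⟩ := h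
  exact ⟨⟨σ, a, m, ea, ha, h1, rfl⟩, ⟨τ, b, n, eb, hb, h2, rfl⟩⟩

/-- `P(X)` is a linear order. -/
theorem isLinear_ext [DefLO X] (hP : P.IsPredilator) (hX : X.IsLinear) :
    (P.ext X).IsLinear := by
  have two : ∀ {σ a τ b}, (P.ext X).dom (opair σ a) → (P.ext X).dom (opair τ b) →
      ∃ c k ec σ' τ', X.IsEn c k ec ∧ P.Val X k ec σ a σ' ∧ P.Val X k ec τ b τ' := by
    intro σ a τ b h1 h2
    obtain ⟨m, ea, ha, -⟩ := ext_dom_iff.1 h1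
    obtain ⟨n, eb, hb, -⟩ := ext_dom_iff.1 h2
    obtain ⟨k, ec, -, hc⟩ := ha.union hX hb
    obtain ⟨σ', hσ'⟩ := exists_val hP hX hc h1 fun x hx => mem_union₂.2 (Or.inl hx)
    obtain ⟨τ', hτ'⟩ := exists_val hP hX hc h2 fun x hx => mem_union₂.2 (Or.inr hx)
    exact ⟨_, k, ec, σ', τ', hc, hσ', hτ'⟩
  refine ⟨fun x y h => ext_lt_dom h, fun z h => ?_, fun x y z h1 h2 => ?_, fun x y hx hy => ?_⟩
  · obtain ⟨σ, a, rfl⟩ := exists_opair_of_ext_dom (ext_lt_dom h).1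
    obtain ⟨c, k, ec, σ', τ', hc, hσ, -⟩ := two (ext_lt_dom h).1 (ext_lt_dom h).1
    exact hP.lt_irrefl ((ext_lt_iff hP hX hc hσ hσ).1 h)
  · obtain ⟨σ, a, rfl⟩ := exists_opair_of_ext_dom (ext_lt_dom h1).1
    obtain ⟨τ, b, rfl⟩ := exists_opair_of_ext_dom (ext_lt_dom h1).2
    obtain ⟨ρ, c, rfl⟩ := exists_opair_of_ext_dom (ext_lt_dom h2).2
    obtain ⟨m, ea, ha, -⟩ := ext_dom_iff.1 (ext_lt_dom h1).1
    obtain ⟨n, eb, hb, -⟩ := ext_dom_iff.1 (ext_lt_dom h1).2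
    obtain ⟨l, ec, hc, -⟩ := ext_dom_iff.1 (ext_lt_dom h2).2
    obtain ⟨k₁, e₁, -, hab⟩ := ha.union hX hb
    obtain ⟨k, e, -, he⟩ := hab.union hX hc
    obtain ⟨σ', hσ⟩ := exists_val hP hX he (ext_lt_dom h1).1 fun x hx => by simp [hx]
    obtain ⟨τ', hτ⟩ := exists_val hP hX he (ext_lt_dom h1).2 fun x hx => by simp [hx]
    obtain ⟨ρ', hρ⟩ := exists_val hP hX he (ext_lt_dom h2).2 fun x hx => by simp [hx]
    exact (ext_lt_iff hP hX he hσ hρ).2 (hP.lt_trans ((ext_lt_iff hP hX he hσ hτ).1 h1)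
      ((ext_lt_iff hP hX he hτ hρ).1 h2))
  · obtain ⟨σ, a, rfl⟩ := exists_opair_of_ext_dom hx
    obtain ⟨τ, b, rfl⟩ := exists_opair_of_ext_dom hy
    obtain ⟨c, k, ec, σ', τ', hc, hσ, hτ⟩ := two hx hy
    rw [ext_lt_iff hP hX hc hσ hτ, ext_lt_iff hP hX hc hτ hσ]
    rcases hP.lt_tri (hσ.obj hP) (hτ.obj hP) with h | rfl | h
    · exact Or.inl h
    · obtain ⟨rfl, rfl⟩ := hσ.inj hP hτ
      exact Or.inr (Or.inl rfl)
    · exact Or.inr (Or.inr h)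

/-! ### Functoriality of the extension -/

theorem _root_.DilRec.LO.IsEn.map {φ : M → M} [hφ : DefF φ] (hd : ∀ x, X.dom x → Y.dom (φ x))
    (hl : ∀ x y, X.lt x y → Y.lt (φ x) (φ y)) (h : X.IsEn a n ea) :
    Y.IsEn (imag a φ) n (lam n fun i => φ (ap ea i)) := by
  have : DefF (fun i => φ (ap ea i)) :=
    PR.subst (ht := hφ) (fun _ _ v => ap ea (v 0)) fun _ => inferInstance
  refine LO.isEn_lam h.nat (fun i hi => hd _ (h.ap_dom hi))
    (fun i j hi hj hij => hl _ _ (h.mono hi hj hij)) fun x => ?_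
  rw [mem_imag]
  constructor
  · rintro ⟨y, hy, rfl⟩
    obtain ⟨i, hi, rfl⟩ := h.surj hy
    exact ⟨i, hi, rfl⟩
  · rintro ⟨i, hi, rfl⟩
    exact ⟨_, h.ap_mem hi, rfl⟩

theorem Val.map {φ : M → M} [hφ : DefF φ] (hd : ∀ x, X.dom x → Y.dom (φ x))
    (hl : ∀ x y, X.lt x y → Y.lt (φ x) (φ y)) (h : P.Val X k ec σ a σ') :
    P.Val Y k (lam k fun i => φ (ap ec i)) σ (imag a φ) σ' := by
  obtain ⟨m, ea, f, ha, hT, hf, hfe, hm⟩ := h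
  have : ∀ ec, DefF (fun i => φ (ap ec i)) := fun ec =>
    PR.subst (ht := hφ) (fun _ _ v => ap ec (v 0)) fun _ => inferInstance
  refine ⟨m, _, f, ha.map hd hl, hT, hf, fun i hi => ?_, hm⟩
  rw [ap_lam (hf.ap_mem hi), ap_lam hi, hfe i hi]

/-- The comparison is decided at one pair of values in P(k). The same pair decides it for the image
sets, because an embedding does not change the relative position of a and b. -/
theorem ext_lt_map [DefLO X] [DefLO Y] (hP : P.IsPredilator) (hX : X.IsLinear) (hY : Y.IsLinear)
    {φ : M → M} [hφ : DefF φ] (hd : ∀ x, X.dom x → Y.dom (φ x))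
    (hl : ∀ x y, X.lt x y → Y.lt (φ x) (φ y))
    (h : (P.ext X).lt (opair σ a) (opair τ b)) :
    (P.ext Y).lt (opair σ (imag a φ)) (opair τ (imag b φ)) := by
  obtain ⟨m, ea, ha, -⟩ := ext_dom_iff.1 (ext_lt_dom h).1
  obtain ⟨n, eb, hb, -⟩ := ext_dom_iff.1 (ext_lt_dom h).2
  obtain ⟨k, ec, -, hc⟩ := ha.union hX hb
  obtain ⟨σ', hσ⟩ := exists_val hP hX hc (ext_lt_dom h).1 fun x hx => mem_union₂.2 (Or.inl hx)
  obtain ⟨τ', hτ⟩ := exists_val hP hX hc (ext_lt_dom h).2 fun x hx => mem_union₂.2 (Or.inr hx)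
  rw [ext_lt_iff hP hX hc hσ hτ] at h
  exact (ext_lt_iff hP hY (hc.map hd hl) (hσ.map hd hl) (hτ.map hd hl)).2 h

/-- Comparisons in `P(X)` are decided in `P(m + n)`. -/
theorem exists_common [DefLO X] (hP : P.IsPredilator) (hX : X.IsLinear) (ha : X.IsEn a m ea)
    (hb : X.IsEn b n eb) (hσ : P.Tr σ m) (hτ : P.Tr τ n) :
    ∃ f g σ' τ', NatHom m (oadd m n) f ∧ NatHom n (oadd m n) g ∧ P.map m (oadd m n) f σ σ' ∧
      P.map n (oadd m n) g τ τ' ∧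
      (∀ i j, i ∊ m → j ∊ n → X.lt (ap ea i) (ap eb j) → ap f i ∊ ap g j) ∧
      ((P.ext X).lt (opair σ a) (opair τ b) ↔ P.lt (oadd m n) σ' τ') := by
  obtain ⟨k, ec, hk, hc⟩ := ha.union hX hb
  obtain ⟨f, hf, hfe⟩ := ha.factor hX hc fun x hx => mem_union₂.2 (Or.inl hx)
  obtain ⟨g, hg, hge⟩ := hb.factor hX hc fun x hx => mem_union₂.2 (Or.inr hx)
  obtain ⟨σ₀, hσ₀⟩ := hP.exists_map hf hσ.1
  obtain ⟨τ₀, hτ₀⟩ := hP.exists_map hg hτ.1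
  -- Since |a ∪ b| ≤ m + n, one can pass to m + n along an inclusion. This is the number that
  -- appears in the definitions of ≪ and of i(σ).
  have hN := oadd_mem_om ha.nat hb.nat
  have hι := natHom_id hc.nat hN fun x => (isOrd_of_mem_om hN).subset_of_mem_succ hk
  obtain ⟨σ', hσ'⟩ := hP.exists_map hι (hP.map_hom _ _ _ _ _ hσ₀).2.2
  obtain ⟨τ', hτ'⟩ := hP.exists_map hι (hP.map_hom _ _ _ _ _ hτ₀).2.2
  refine ⟨_, _, σ', τ', hf.comp hι, hg.comp hι, hP.map_comp_compFun hσ₀ hσ',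
    hP.map_comp_compFun hτ₀ hτ', fun i j hi hj hij => ?_, ?_⟩
  · rw [ap_compFun hi, ap_compFun hj, ap_lam (hf.ap_mem hi), ap_lam (hg.ap_mem hj)]
    exact hc.reflect hX (hf.ap_mem hi) (hg.ap_mem hj) (by rwa [hfe i hi, hge j hj])
  · rw [hP.map_lt_iff hσ' hτ']
    exact ext_lt_iff hP hX hc ⟨m, ea, f, ha, hσ, hf, hfe, hσ₀⟩ ⟨n, eb, g, hb, hτ, hg, hge, hτ₀⟩

theorem ext_lt_of_ll [DefLO X] (hP : P.IsPredilator) (hX : X.IsLinear) (ha : X.IsEn a m ea)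
    (hb : X.IsEn b n eb) (h : P.Ll (opair σ m) (opair τ n)) :
    (P.ext X).lt (opair σ a) (opair τ b) := by
  obtain ⟨σ', m', τ', n', e1, e2, hσ, hτ, h⟩ := h
  obtain ⟨rfl, rfl⟩ := opair_inj.1 e1
  obtain ⟨rfl, rfl⟩ := opair_inj.1 e2
  obtain ⟨f, g, σ', τ', hf, hg, h1, h2, -, h3⟩ := exists_common hP hX ha hb hσ hτ
  exact h3.2 (h _ f g σ' τ' ((isAdd_iff (isOrd_of_mem_om hb.nat).1).2 rfl) hf hg h1 h2)

/-- The condition on i(σ) only speaks about embeddings into n + n, but by `exists_common` these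
suffice to compare elements over an arbitrary linear order. -/
theorem ext_lt_of_isCoeff [DefLO X] (hP : P.IsPredilator) (hX : X.IsLinear) (ha : X.IsEn a n ea)
    (hb : X.IsEn b n eb) (hσ : P.Tr σ n) {i : M} (h : P.IsCoeff n σ i)
    (hi : X.lt (ap ea i) (ap eb i)) : (P.ext X).lt (opair σ a) (opair σ b) := by
  obtain ⟨f, g, σ', τ', hf, hg, h1, h2, h3, h4⟩ := exists_common hP hX ha hb hσ hσ
  exact h4.2 (h.2 _ f g _ _ σ' τ' ((isAdd_iff (isOrd_of_mem_om hb.nat).1).2 rfl) hf hg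
    (hf.opair_iff.2 ⟨h.1, rfl⟩) (hg.opair_iff.2 ⟨h.1, rfl⟩) (h3 _ _ h.1 h.1 hi) h1 h2)

/-- Monotonicity of P on morphisms applies after both sets have been embedded into their union. In
case of equality the sets agree because normal forms are unique. -/
theorem ext_monotone [DefLO X] (hP : P.IsPredilator) (hX : X.IsLinear) (ha : X.IsEn a n ea)
    (hb : X.IsEn b n eb) (hσ : P.Tr σ n) (h : ∀ i, i ∊ n → ¬ X.lt (ap eb i) (ap ea i)) :
    (P.ext X).lt (opair σ a) (opair σ b) ∨ a = b := by
  obtain ⟨k, ec, -, hc⟩ := ha.union hX hb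
  obtain ⟨f, hf, hfe⟩ := ha.factor hX hc fun x hx => mem_union₂.2 (Or.inl hx)
  obtain ⟨g, hg, hge⟩ := hb.factor hX hc fun x hx => mem_union₂.2 (Or.inr hx)
  obtain ⟨σ₀, hσ₀⟩ := hP.exists_map hf hσ.1
  obtain ⟨τ₀, hτ₀⟩ := hP.exists_map hg hσ.1
  have hv1 : P.Val X k ec σ a σ₀ := ⟨n, ea, f, ha, hσ, hf, hfe, hσ₀⟩
  have hv2 : P.Val X k ec σ b τ₀ := ⟨n, eb, g, hb, hσ, hg, hge, hτ₀⟩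
  have hfg : ∀ i x y, opair i x ∊ f → opair i y ∊ g → x ∊ y ∨ x = y := by
    intro i x y hx hy
    obtain ⟨hi, rfl⟩ := hf.opair_iff.1 hx
    obtain ⟨-, rfl⟩ := hg.opair_iff.1 hy
    rcases (isOrd_of_mem_om (om_trans hc.nat (hf.ap_mem hi))).tri
      (isOrd_of_mem_om (om_trans hc.nat (hg.ap_mem hi))) with h' | h' | h'
    · exact Or.inl h'
    · exact Or.inr h'
    · refine absurd ?_ (h i hi)
      rw [← hfe i hi, ← hge i hi]
      exact hc.mono (hg.ap_mem hi) (hf.ap_mem hi) h'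
  rcases hP.monotone _ _ _ _ _ _ _ hfg hσ₀ hτ₀ with h' | rfl
  · exact Or.inl ((ext_lt_iff hP hX hc hv1 hv2).2 h')
  · exact Or.inr (hv1.inj hP hv2).2

/-! ### The relation `≪` -/

theorem val_ofOrd (hσ : P.Tr σ m) (hf : NatHom m n f) (h : P.map m n f σ σ') :
    (LO.ofOrd n).IsEn (imag n fun i => ap (lam n fun i => i) i) n (lam n fun i => i) ∧
      P.Val (LO.ofOrd n) n (lam n fun i => i) σ (imag m (ap f)) σ' := by
  refine ⟨(natHom_id hf.2.1 hf.2.1 fun _ h => h).isEn, m, f, f, hf.isEn, hσ, hf, fun i hi => ?_, h⟩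
  rw [ap_lam (hf.ap_mem hi)]

theorem lt_iff_ext_lt (hP : P.IsPredilator) (hσ : P.Tr σ m) (hτ : P.Tr τ n)
    (hf : P.map m k f σ σ') (hg : P.map n k g τ τ') : P.lt k σ' τ' ↔
      (P.ext (LO.ofOrd k)).lt (opair σ (imag m (ap f))) (opair τ (imag n (ap g))) := by
  have hf' := (hP.map_hom _ _ _ _ _ hf).1
  have hg' := (hP.map_hom _ _ _ _ _ hg).1
  exact (ext_lt_iff hP (isLinear_ofOrd (isOrd_of_mem_om hf'.2.1)) (val_ofOrd hσ hf' hf).1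
    (val_ofOrd hσ hf' hf).2 (val_ofOrd hτ hg' hg).2).symm

theorem Ll.tr {s t : M} (h : P.Ll s t) : (∃ σ m, P.Tr σ m ∧ s = opair σ m) ∧
    ∃ τ n, P.Tr τ n ∧ t = opair τ n := by
  obtain ⟨σ, m, τ, n, rfl, rfl, hσ, hτ, -⟩ := h
  exact ⟨⟨σ, m, hσ, rfl⟩, ⟨τ, n, hτ, rfl⟩⟩

/-- The definition of ≪ considers the target m + n only. Viewing P(k) as the extension of P
evaluated at the order k shows that no other target matters. -/
theorem Ll.lt (hP : P.IsPredilator) (h : P.Ll (opair σ m) (opair τ n))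
    (hf : P.map m k f σ σ') (hg : P.map n k g τ τ') : P.lt k σ' τ' := by
  have hf' := (hP.map_hom _ _ _ _ _ hf).1
  have hg' := (hP.map_hom _ _ _ _ _ hg).1
  obtain ⟨⟨_, _, hσ, e1⟩, _, _, hτ, e2⟩ := h.tr
  obtain ⟨rfl, rfl⟩ := opair_inj.1 e1
  obtain ⟨rfl, rfl⟩ := opair_inj.1 e2
  rw [lt_iff_ext_lt hP hσ hτ hf hg]
  exact ext_lt_of_ll hP (isLinear_ofOrd (isOrd_of_mem_om hf'.2.1)) hf'.isEn hg'.isEn h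

theorem ll_iff (hP : P.IsPredilator) (hσ : P.Tr σ m) (hτ : P.Tr τ n) :
    P.Ll (opair σ m) (opair τ n) ↔
      ∀ N f g σ' τ', P.map m N f σ σ' → P.map n N g τ τ' → P.lt N σ' τ' :=
  ⟨fun h _ _ _ _ _ h1 h2 => h.lt hP h1 h2, fun h =>
    ⟨σ, m, τ, n, rfl, rfl, hσ, hτ, fun N f g σ' τ' _ _ _ h1 h2 => h N f g σ' τ' h1 h2⟩⟩

theorem exists_of_not_ll (hP : P.IsPredilator) (hσ : P.Tr σ m) (hτ : P.Tr τ n)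
    (h : ¬ P.Ll (opair σ m) (opair τ n)) : ∃ N f g σ' τ', P.map m N f σ σ' ∧ P.map n N g τ τ' ∧
      (P.lt N τ' σ' ∨ τ' = σ') := by
  rw [ll_iff hP hσ hτ] at h
  push Not at h
  obtain ⟨N, f, g, σ', τ', h1, h2, h3⟩ := h
  refine ⟨N, f, g, σ', τ', h1, h2, ?_⟩
  rcases hP.lt_tri (hP.map_hom _ _ _ _ _ h1).2.2 (hP.map_hom _ _ _ _ _ h2).2.2 with h | h | h
  · exact absurd h h3
  · exact Or.inr h.symm
  · exact Or.inl h

theorem ll_irrefl (hP : P.IsPredilator) {s : M} : ¬ P.Ll s s := by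
  intro h
  obtain ⟨⟨σ, m, hσ, rfl⟩, -⟩ := h.tr
  exact hP.lt_irrefl (h.lt hP (hP.map_id' hσ.1) (hP.map_id' hσ.1))

/-- Given copies of σ and ρ over N, one enlarges N to N + n to create space for a copy of τ, which
then lies between them. Inclusions reflect the order, so the inequality holds over N. -/
theorem ll_trans (hP : P.IsPredilator) {s t r : M} (h1 : P.Ll s t) (h2 : P.Ll t r) :
    P.Ll s r := by
  obtain ⟨⟨σ, m, hσ, rfl⟩, ⟨τ, n, hτ, rfl⟩⟩ := h1.tr
  obtain ⟨-, ⟨ρ, l, hρ, rfl⟩⟩ := h2.tr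
  rw [ll_iff hP hσ hρ]
  intro N f g σ' ρ' hf hg
  have hN := (hP.map_hom _ _ _ _ _ hf).1.2.1
  have hn := hP.tr_nat hτ
  have hNn := oadd_mem_om hN hn
  have hι : NatHom N (oadd N n) (lam N fun i => i) :=
    natHom_id hN hNn fun i hi => mem_oadd.2 (Or.inl hi)
  have hκ : NatHom n (oadd N n) (lam n fun i => oadd N i) :=
    natHom_lam hn hNn (fun i hi => oadd_mem hi) fun i j _ _ hij => oadd_mem hij
  obtain ⟨σ₁, hσ₁⟩ := hP.exists_map hι (hP.map_hom _ _ _ _ _ hf).2.2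
  obtain ⟨ρ₁, hρ₁⟩ := hP.exists_map hι (hP.map_hom _ _ _ _ _ hg).2.2
  obtain ⟨τ₁, hτ₁⟩ := hP.exists_map hκ hτ.1
  rw [← hP.map_lt_iff hσ₁ hρ₁]
  exact hP.lt_trans (h1.lt hP (hP.map_comp_compFun hf hσ₁) hτ₁)
    (h2.lt hP hτ₁ (hP.map_comp_compFun hg hρ₁))

/-- The relation `≪` is negatively transitive. -/
theorem ll_cotrans (hP : P.IsPredilator) {s t r : M} (h : P.Ll s r)
    (ht : ∃ τ n, P.Tr τ n ∧ t = opair τ n) : P.Ll s t ∨ P.Ll t r := by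
  obtain ⟨⟨σ, m, hσ, rfl⟩, ⟨ρ, l, hρ, rfl⟩⟩ := h.tr
  obtain ⟨τ, n, hτ, rfl⟩ := ht
  by_contra hc
  push Not at hc
  obtain ⟨N, f, g, σ', τ', hf, hg, h1⟩ := exists_of_not_ll hP hσ hτ hc.1
  obtain ⟨K, g', e, τ₁, ρ', hg', he, h2⟩ := exists_of_not_ll hP hτ hρ hc.2
  -- The failures of s ≪ t and t ≪ r are witnessed over N and K. Both are placed into K + N, with K
  -- first, so that the copy τ₃ of τ from K is pointwise below the copy τ₂ from N. Then ρ₃ ≤ τ₃ ≤ τ₂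
  -- ≤ σ₂ by monotonicity, while s ≪ r gives σ₂ < ρ₃.
  have hN := (hP.map_hom _ _ _ _ _ hf).1.2.1
  have hK := (hP.map_hom _ _ _ _ _ he).1.2.1
  have hKN := oadd_mem_om hK hN
  have hι : NatHom K (oadd K N) (lam K fun i => i) :=
    natHom_id hK hKN fun i hi => mem_oadd.2 (Or.inl hi)
  have hκ : NatHom N (oadd K N) (lam N fun i => oadd K i) :=
    natHom_lam hN hKN (fun i hi => oadd_mem hi) fun i j _ _ hij => oadd_mem hij
  obtain ⟨σ₂, hσ₂⟩ := hP.exists_map hκ (hP.map_hom _ _ _ _ _ hf).2.2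
  obtain ⟨τ₂, hτ₂⟩ := hP.exists_map hκ (hP.map_hom _ _ _ _ _ hg).2.2
  obtain ⟨τ₃, hτ₃⟩ := hP.exists_map hι (hP.map_hom _ _ _ _ _ hg').2.2
  obtain ⟨ρ₃, hρ₃⟩ := hP.exists_map hι (hP.map_hom _ _ _ _ _ he).2.2
  have hlt := h.lt hP (hP.map_comp_compFun hf hσ₂) (hP.map_comp_compFun he hρ₃)
  have hgN := (hP.map_hom _ _ _ _ _ hg).1
  have hgK := (hP.map_hom _ _ _ _ _ hg').1
  have hmono : P.lt (oadd K N) τ₃ τ₂ ∨ τ₃ = τ₂ := by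
    refine hP.monotone n (oadd K N) (compFun n (lam K fun i => i) g')
      (compFun n (lam N fun i => oadd K i) g) τ τ₃ τ₂ ?_
      (hP.map_comp_compFun hg' hτ₃) (hP.map_comp_compFun hg hτ₂)
    intro i x y hx hy
    obtain ⟨hi, rfl⟩ := (hgK.comp hι).opair_iff.1 hx
    obtain ⟨-, rfl⟩ := (hgN.comp hκ).opair_iff.1 hy
    rw [ap_compFun hi, ap_compFun hi, ap_lam (hgK.ap_mem hi), ap_lam (hgN.ap_mem hi)]
    exact Or.inl (mem_oadd.2 (Or.inl (hgK.ap_mem hi)))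
  have h1' : P.lt (oadd K N) τ₂ σ₂ ∨ τ₂ = σ₂ := by
    rcases h1 with h1 | rfl
    · exact Or.inl (hP.map_lt _ _ _ _ _ _ _ hτ₂ hσ₂ h1)
    · exact Or.inr (hP.map_unique hτ₂ hσ₂)
  have h2' : P.lt (oadd K N) ρ₃ τ₃ ∨ ρ₃ = τ₃ := by
    rcases h2 with h2 | rfl
    · exact Or.inl (hP.map_lt _ _ _ _ _ _ _ hρ₃ hτ₃ h2)
    · exact Or.inr (hP.map_unique hρ₃ hτ₃)
  have htr : ∀ {x y z}, P.lt (oadd K N) x y → (P.lt (oadd K N) y z ∨ y = z) →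
      P.lt (oadd K N) x z := fun {x y z} h h' => h'.elim (hP.lt_trans h) fun h' => h' ▸ h
  exact hP.lt_irrefl (htr (htr (htr hlt h2') hmono) h1')

end PD

namespace PD

variable {M : Type u} [PRSLang.Structure M] [PRSomega M] {P : PD M}
variable {k m n f σ τ σ' τ' A : M}

/-! ### The index order -/

/-- Negative transitivity of ≪ makes ≡ transitive, so that a class can be described by means of any
of its elements. -/
theorem index_mem_iff (hP : P.IsPredilator) {α s t : M} (hα : P.index.dom α) (ht : t ∊ α) :
    s ∊ α ↔ (∃ τ m, P.Tr τ m ∧ s = opair τ m) ∧ ¬ P.Ll s t ∧ ¬ P.Ll t s := by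
  obtain ⟨σ, n, hσ, hm⟩ := hα
  obtain ⟨hTt, h1, h2⟩ := (hm t).1 ht
  rw [hm]
  refine and_congr_right fun hTs => ?_
  have hr : ∃ τ m, P.Tr τ m ∧ opair σ n = opair τ m := ⟨σ, n, hσ, rfl⟩
  constructor
  · rintro ⟨h3, h4⟩
    exact ⟨fun h => (ll_cotrans hP h hr).elim h3 h2, fun h => (ll_cotrans hP h hr).elim h1 h4⟩
  · rintro ⟨h3, h4⟩
    exact ⟨fun h => (ll_cotrans hP h hTt).elim h3 h1, fun h => (ll_cotrans hP h hTt).elim h2 h4⟩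

theorem index_exists_mem (hP : P.IsPredilator) {α : M} (hα : P.index.dom α) :
    ∃ σ n, P.Tr σ n ∧ opair σ n ∊ α := by
  obtain ⟨σ, n, hσ, hm⟩ := hα
  exact ⟨σ, n, hσ, (hm _).2 ⟨⟨σ, n, hσ, rfl⟩, ll_irrefl hP, ll_irrefl hP⟩⟩

theorem index_lt_dom {α β : M} (h : P.index.lt α β) : P.index.dom α ∧ P.index.dom β :=
  ⟨h.1, h.2.1⟩

/-- Independence of representatives: one instance of ≪ between two classes can be moved to other
elements by negative transitivity, since elements of the same class are incomparable. -/
theorem ll_of_index_lt (hP : P.IsPredilator) {α β s t : M} (h : P.index.lt α β) (hs : s ∊ α)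
    (ht : t ∊ β) : P.Ll s t := by
  obtain ⟨hα, hβ, s', t', hs', ht', hl⟩ := h
  have h1 := (index_mem_iff hP hα hs').1 hs
  have h2 := (index_mem_iff hP hβ ht').1 ht
  rcases ll_cotrans hP hl h1.1 with h | h
  · exact absurd h h1.2.2
  · rcases ll_cotrans hP h h2.1 with h | h
    · exact h
    · exact absurd h h2.2.1

theorem isLinear_index (hP : P.IsPredilator) : P.index.IsLinear where
  lt_dom := fun _ _ h => index_lt_dom h
  irrefl := fun α h => by
    obtain ⟨σ, n, hσ, hm⟩ := index_exists_mem hP h.1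
    exact ll_irrefl hP (ll_of_index_lt hP h hm hm)
  trans := fun α β γ h1 h2 => by
    obtain ⟨_, _, _, ha⟩ := index_exists_mem hP h1.1
    obtain ⟨_, _, _, hb⟩ := index_exists_mem hP h1.2.1
    obtain ⟨_, _, _, hc⟩ := index_exists_mem hP h2.2.1
    exact ⟨h1.1, h2.2.1, _, _, ha, hc,
      ll_trans hP (ll_of_index_lt hP h1 ha hb) (ll_of_index_lt hP h2 hb hc)⟩
  tri := fun α β hα hβ => by
    obtain ⟨σ, m, hσ, ha⟩ := index_exists_mem hP hα
    obtain ⟨τ, n, hτ, hb⟩ := index_exists_mem hP hβ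
    by_cases h1 : P.Ll (opair σ m) (opair τ n)
    · exact Or.inl ⟨hα, hβ, _, _, ha, hb, h1⟩
    by_cases h2 : P.Ll (opair τ n) (opair σ m)
    · exact Or.inr (Or.inr ⟨hβ, hα, _, _, hb, ha, h2⟩)
    · have hb' : opair τ n ∊ α := (index_mem_iff hP hα ha).2 ⟨⟨_, _, hτ, rfl⟩, h2, h1⟩
      refine Or.inr (Or.inl (ext_iff'.2 fun s => ?_))
      rw [index_mem_iff hP hα hb', index_mem_iff hP hβ hb]

theorem _root_.DilRec.LO.IsLinear.below {X : LO M} (hX : X.IsLinear) (ν : M) :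
    (X.below ν).IsLinear where
  lt_dom := fun _ _ h => ⟨⟨(hX.lt_dom _ _ h.1).1, h.1⟩, ⟨(hX.lt_dom _ _ h.2.1).1, h.2.1⟩⟩
  irrefl := fun x h => hX.irrefl x h.2.2
  trans := fun _ _ _ h1 h2 => ⟨h1.1, h2.2.1, hX.trans _ _ _ h1.2.2 h2.2.2⟩
  tri := fun x y hx hy => by
    rcases hX.tri x y hx.1 hy.1 with h | h | h
    · exact Or.inl ⟨hx.2, hy.2, h⟩
    · exact Or.inr (Or.inl h)
    · exact Or.inr (Or.inr ⟨hy.2, hx.2, h⟩)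

/-- The restriction of an order to a subclass. -/
theorem _root_.DilRec.LO.IsLinear.sub {X : LO M} (hX : X.IsLinear) (φ : M → Prop)
    (hφ : ∀ x, φ x → X.dom x) :
    (⟨φ, fun x y => φ x ∧ φ y ∧ X.lt x y⟩ : LO M).IsLinear where
  lt_dom := fun _ _ h => ⟨h.1, h.2.1⟩
  irrefl := fun x h => hX.irrefl x h.2.2
  trans := fun _ _ _ h1 h2 => ⟨h1.1, h2.2.1, hX.trans _ _ _ h1.2.2 h2.2.2⟩
  tri := fun x y hx hy => by
    rcases hX.tri x y (hφ x hx) (hφ y hy) with h | h | h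
    · exact Or.inl ⟨hx, hy, h⟩
    · exact Or.inr (Or.inl h)
    · exact Or.inr (Or.inr ⟨hy, hx, h⟩)

/-! ### Subpredilators -/

/-- Normal forms are unique, so membership in the subpredilator can be read off from whichever one
is at hand. -/
theorem restrictObj_iff (hP : P.IsPredilator) {a e σ₀ : M} (ha : P.supp n σ a)
    (he : (LO.ofOrd n).IsEn a m e) (hm : P.map m n e σ₀ σ) :
    P.RestrictObj A n σ ↔ opair σ₀ m ∊ A := by
  constructor
  · rintro ⟨a', m', e', σ₁, ha', he', hm', hA⟩
    obtain rfl := hP.supp_unique ha ha'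
    obtain ⟨rfl, rfl⟩ := he.unique
      (isLinear_ofOrd (isOrd_of_mem_om (hP.map_hom _ _ _ _ _ hm).1.2.1)) he'
    rwa [hP.map_inj hm hm']
  · exact fun h => ⟨a, m, e, σ₀, ha, he, hm, h⟩

/-- Applying P(f) changes the support but not the trace element in the normal form. -/
theorem restrictObj_map (hP : P.IsPredilator) (h : P.map m n f σ τ) :
    P.RestrictObj A m σ ↔ P.RestrictObj A n τ := by
  obtain ⟨a, k, e, σ₀, ha, he, hm, hT⟩ := hP.exists_normalForm (hP.map_hom _ _ _ _ _ h).2.1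
  have hm' := hP.map_comp_compFun hm h
  have hh := (hP.map_hom _ _ _ _ _ hm').1
  rw [restrictObj_iff hP ha he hm, restrictObj_iff hP (hP.supp_map hT hm') hh.isEn hm']

theorem RestrictObj.obj (hP : P.IsPredilator) (h : P.RestrictObj A n σ) : P.obj n σ := by
  obtain ⟨a, m, e, σ₁, ha, -⟩ := h
  exact (hP.supp_obj _ _ _ ha).1

theorem isPredilator_restrict (hP : P.IsPredilator) (A : M) : (P.restrict A).IsPredilator where
  obj_nat := fun n σ h => hP.obj_nat n σ (h.obj hP)
  linear := fun n hn => (hP.linear n hn).sub (P.RestrictObj A n) fun σ h => h.obj hP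
  lt_obj := fun n σ τ h => ⟨h.1, h.2.1⟩
  map_hom := fun m n f σ τ h =>
    ⟨(hP.map_hom _ _ _ _ _ h.2).1, h.1, (restrictObj_map hP h.2).1 h.1⟩
  map_fun := fun m n f σ hf hσ => by
    obtain ⟨τ, hτ, hu⟩ := hP.map_fun m n f σ hf (hσ.obj hP)
    exact ⟨τ, ⟨hσ, hτ⟩, fun τ' h => hu τ' h.2⟩
  map_lt := fun m n f σ σ' τ τ' h1 h2 h => ⟨(restrictObj_map hP h1.2).1 h1.1,
    (restrictObj_map hP h2.2).1 h2.1, hP.map_lt _ _ _ _ _ _ _ h1.2 h2.2 h.2.2⟩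
  map_id := fun n f σ hf hi hσ => ⟨hσ, hP.map_id n f σ hf hi (hσ.obj hP)⟩
  map_comp := fun l m n f g h σ τ ρ hh hi h1 h2 =>
    ⟨h1.1, hP.map_comp l m n f g h σ τ ρ hh hi h1.2 h2.2⟩
  monotone := fun m n f g σ τ τ' hfg h1 h2 => by
    rcases hP.monotone m n f g σ τ τ' hfg h1.2 h2.2 with h | h
    · exact Or.inl ⟨(restrictObj_map hP h1.2).1 h1.1, (restrictObj_map hP h2.2).1 h2.1, h⟩
    · exact Or.inr h
  supp_obj := fun n σ a h => ⟨h.1, (hP.supp_obj n σ a h.2).2⟩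
  supp_fun := fun n σ h => by
    obtain ⟨a, ha, hu⟩ := hP.supp_fun n σ (h.obj hP)
    exact ⟨a, ⟨h, ha⟩, fun b hb => hu b hb.2⟩
  supp_natural := fun m n f σ τ a b h1 h2 h3 =>
    hP.supp_natural m n f σ τ a b h1.2 h2.2 h3.2
  support_condition := fun m n f σ a hf ha hs => by
    obtain ⟨σ₀, h⟩ := hP.support_condition m n f σ a hf ha.2 hs
    exact ⟨σ₀, (restrictObj_map hP h).2 ha.1, h⟩

theorem tr_restrict_iff (hP : P.IsPredilator) :
    (P.restrict A).Tr σ n ↔ P.Tr σ n ∧ opair σ n ∊ A := by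
  have key : P.Tr σ n → (P.RestrictObj A n σ ↔ opair σ n ∊ A) := fun h => by
    have hn := hP.tr_nat h
    have hid := natHom_id hn hn fun _ h => h
    have hmap := hP.map_id' h.1
    exact restrictObj_iff hP (hP.supp_map h hmap) hid.isEn hmap
  constructor
  · rintro ⟨h1, -, h2⟩
    have hT : P.Tr σ n := ⟨h1.obj hP, h2⟩
    exact ⟨hT, (key hT).1 h1⟩
  · rintro ⟨hT, hA⟩
    have := (key hT).2 hA
    exact ⟨this, this, hT.2⟩

/-! ### Sums -/

theorem isPredilator_sum {I : LO M} {Q : M → PD M} (hI : I.IsLinear)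
    (hQ : ∀ α, I.dom α → (Q α).IsPredilator) : (sum I Q).IsPredilator where
  obj_nat := by
    rintro n _ ⟨α, σ, hα, h, rfl⟩
    exact (hQ α hα).obj_nat n σ h
  linear := fun n hn => by
    refine ⟨?_, ?_, ?_, ?_⟩
    · rintro _ _ ⟨α, σ, β, τ, hα, hβ, hσ, hτ, rfl, rfl, -⟩
      exact ⟨⟨α, σ, hα, hσ, rfl⟩, ⟨β, τ, hβ, hτ, rfl⟩⟩
    · rintro _ ⟨α, σ, β, τ, hα, hβ, hσ, hτ, rfl, e, h⟩
      obtain ⟨rfl, rfl⟩ := opair_inj.1 e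
      rcases h with h | ⟨-, h⟩
      · exact hI.irrefl _ h
      · exact (hQ α hα).lt_irrefl h
    · rintro _ _ _ ⟨α, σ, β, τ, hα, hβ, hσ, hτ, rfl, rfl, h⟩
        ⟨β', τ', γ, ρ, hβ', hγ, hτ', hρ, e, rfl, h'⟩
      obtain ⟨rfl, rfl⟩ := opair_inj.1 e
      refine ⟨α, σ, γ, ρ, hα, hγ, hσ, hρ, rfl, rfl, ?_⟩
      rcases h with h | ⟨rfl, h⟩ <;> rcases h' with h' | ⟨rfl, h'⟩
      · exact Or.inl (hI.trans _ _ _ h h')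
      · exact Or.inl h
      · exact Or.inl h'
      · exact Or.inr ⟨rfl, (hQ _ hα).lt_trans h h'⟩
    · rintro _ _ ⟨α, σ, hα, hσ, rfl⟩ ⟨β, τ, hβ, hτ, rfl⟩
      rcases hI.tri α β hα hβ with h | rfl | h
      · exact Or.inl ⟨α, σ, β, τ, hα, hβ, hσ, hτ, rfl, rfl, Or.inl h⟩
      · rcases (hQ α hα).lt_tri hσ hτ with h | rfl | h
        · exact Or.inl ⟨α, σ, α, τ, hα, hβ, hσ, hτ, rfl, rfl, Or.inr ⟨rfl, h⟩⟩
        · exact Or.inr (Or.inl rfl)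
        · exact Or.inr (Or.inr ⟨α, τ, α, σ, hα, hα, hτ, hσ, rfl, rfl, Or.inr ⟨rfl, h⟩⟩)
      · exact Or.inr (Or.inr ⟨β, τ, α, σ, hβ, hα, hτ, hσ, rfl, rfl, Or.inl h⟩)
  lt_obj := by
    rintro n _ _ ⟨α, σ, β, τ, hα, hβ, hσ, hτ, rfl, rfl, -⟩
    exact ⟨⟨α, σ, hα, hσ, rfl⟩, ⟨β, τ, hβ, hτ, rfl⟩⟩
  map_hom := by
    rintro m n f _ _ ⟨α, σ, τ, hα, h, rfl, rfl⟩
    obtain ⟨h1, h2, h3⟩ := (hQ α hα).map_hom _ _ _ _ _ h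
    exact ⟨h1, ⟨α, σ, hα, h2, rfl⟩, ⟨α, τ, hα, h3, rfl⟩⟩
  map_fun := by
    rintro m n f _ hf ⟨α, σ, hα, hσ, rfl⟩
    obtain ⟨τ, hτ, hu⟩ := (hQ α hα).map_fun m n f σ hf hσ
    refine ⟨opair α τ, ⟨α, σ, τ, hα, hτ, rfl, rfl⟩, ?_⟩
    rintro _ ⟨α', σ', τ', hα', hτ', e, rfl⟩
    obtain ⟨rfl, rfl⟩ := opair_inj.1 e
    rw [hu τ' hτ']
  map_lt := by
    rintro m n f _ _ _ _ ⟨α, σ, τ, hα, h1, rfl, rfl⟩ ⟨α', σ', τ', hα', h2, rfl, rfl⟩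
      ⟨β, ρ, β', ρ', hβ, hβ', hρ, hρ', e1, e2, h⟩
    obtain ⟨rfl, rfl⟩ := opair_inj.1 e1
    obtain ⟨rfl, rfl⟩ := opair_inj.1 e2
    refine ⟨α, τ, α', τ', hα, hα', ((hQ α hα).map_hom _ _ _ _ _ h1).2.2,
      ((hQ α' hα').map_hom _ _ _ _ _ h2).2.2, rfl, rfl, ?_⟩
    rcases h with h | ⟨rfl, h⟩
    · exact Or.inl h
    · exact Or.inr ⟨rfl, (hQ α hα).map_lt _ _ _ _ _ _ _ h1 h2 h⟩
  map_id := by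
    rintro n f _ hf hi ⟨α, σ, hα, hσ, rfl⟩
    exact ⟨α, σ, σ, hα, (hQ α hα).map_id n f σ hf hi hσ, rfl, rfl⟩
  map_comp := by
    rintro l m n f g h _ _ _ hh hi ⟨α, σ, τ, hα, h1, rfl, rfl⟩ ⟨α', τ', ρ, hα', h2, e, rfl⟩
    obtain ⟨rfl, rfl⟩ := opair_inj.1 e
    exact ⟨α, σ, ρ, hα, (hQ α hα).map_comp l m n f g h σ τ ρ hh hi h1 h2, rfl, rfl⟩
  monotone := by
    rintro m n f g _ _ _ hfg ⟨α, σ, τ, hα, h1, rfl, rfl⟩ ⟨α', σ', τ', hα', h2, e, rfl⟩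
    obtain ⟨rfl, rfl⟩ := opair_inj.1 e
    rcases (hQ α hα).monotone m n f g σ τ τ' hfg h1 h2 with h | rfl
    · exact Or.inl ⟨α, τ, α, τ', hα, hα, ((hQ α hα).map_hom _ _ _ _ _ h1).2.2,
        ((hQ α hα).map_hom _ _ _ _ _ h2).2.2, rfl, rfl, Or.inr ⟨rfl, h⟩⟩
    · exact Or.inr rfl
  supp_obj := by
    rintro n _ a ⟨α, σ, hα, h, rfl⟩
    exact ⟨⟨α, σ, hα, ((hQ α hα).supp_obj _ _ _ h).1, rfl⟩, ((hQ α hα).supp_obj _ _ _ h).2⟩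
  supp_fun := by
    rintro n _ ⟨α, σ, hα, hσ, rfl⟩
    obtain ⟨a, ha, hu⟩ := (hQ α hα).supp_fun n σ hσ
    refine ⟨a, ⟨α, σ, hα, ha, rfl⟩, ?_⟩
    rintro b ⟨α', σ', hα', hb, e⟩
    obtain ⟨rfl, rfl⟩ := opair_inj.1 e
    exact hu b hb
  supp_natural := by
    rintro m n f _ _ a b ⟨α, σ, τ, hα, h, rfl, rfl⟩ ⟨α', σ', hα', ha, e⟩ ⟨α'', τ', hα'', hb, e'⟩
    obtain ⟨rfl, rfl⟩ := opair_inj.1 e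
    obtain ⟨rfl, rfl⟩ := opair_inj.1 e'
    exact (hQ α hα).supp_natural m n f σ τ a b h ha hb
  support_condition := by
    rintro m n f _ a hf ⟨α, σ, hα, ha, rfl⟩ hs
    obtain ⟨σ₀, h⟩ := (hQ α hα).support_condition m n f σ a hf ha hs
    exact ⟨opair α σ₀, α, σ₀, σ, hα, h, rfl, rfl⟩

theorem isPredilator_partialSum (hP : P.IsPredilator) (ν : M) : (P.partialSum ν).IsPredilator :=
  isPredilator_sum ((isLinear_index hP).below ν) fun α _ => isPredilator_restrict hP α

theorem two_mem_om : succ (succ (empt M)) ∊ om M := succ_mem_om (succ_mem_om empt_mem_om)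

theorem isPredilator_add {Q : PD M} (hP : P.IsPredilator) (hQ : Q.IsPredilator) :
    (P.add Q).IsPredilator :=
  isPredilator_sum (isLinear_ofOrd (isOrd_of_mem_om two_mem_om)) fun α _ => by
    split_ifs <;> assumption

/-! ### Separation of variables -/

section Sep

open LO

variable {γ : M}

@[simp] theorem inl_inj {x y : M} : inl x = inl y ↔ x = y := by simp [inl]
@[simp] theorem inr_inj {x y : M} : inr x = inr y ↔ x = y := by simp [inr]
@[simp] theorem inl_ne_inr {x y : M} : inl x ≠ inr y := by
  intro h
  exact succ_ne_empt _ (opair_inj.1 h).1.symm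
@[simp] theorem inr_ne_inl {x y : M} : inr x ≠ inl y := fun h => inl_ne_inr h.symm

theorem isLinear_add (hγ : IsOrd γ) (hn : IsOrd n) : (LO.add γ n).IsLinear where
  lt_dom := by
    rintro _ _ (⟨x, y, hx, hy, rfl, rfl, -⟩ | ⟨x, j, hx, hj, rfl, rfl⟩ | ⟨i, j, hi, hj, rfl, rfl, -⟩)
    · exact ⟨Or.inl ⟨x, hx, rfl⟩, Or.inl ⟨y, hy, rfl⟩⟩
    · exact ⟨Or.inl ⟨x, hx, rfl⟩, Or.inr ⟨j, hj, rfl⟩⟩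
    · exact ⟨Or.inr ⟨i, hi, rfl⟩, Or.inr ⟨j, hj, rfl⟩⟩
  irrefl := by
    rintro _ (⟨x, y, hx, hy, rfl, e, h⟩ | ⟨x, j, hx, hj, rfl, e⟩ | ⟨i, j, hi, hj, rfl, e, h⟩)
    · exact mem_irrefl x (inl_inj.1 e ▸ h)
    · exact inl_ne_inr e
    · exact mem_irrefl i (inr_inj.1 e ▸ h)
  trans := by
    rintro _ _ _ (⟨x, y, hx, hy, rfl, rfl, h⟩ | ⟨x, j, hx, hj, rfl, rfl⟩ | ⟨i, j, hi, hj, rfl, rfl, h⟩)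
      (⟨x', y', hx', hy', e, rfl, h'⟩ | ⟨x', j', hx', hj', e, rfl⟩ | ⟨i', j', hi', hj', e, rfl, h'⟩)
    · exact Or.inl ⟨x, y', hx, hy', rfl, rfl, (hγ.mem hy').trans (inl_inj.1 e ▸ h) h'⟩
    · exact Or.inr (Or.inl ⟨x, j', hx, hj', rfl, rfl⟩)
    · exact absurd e inl_ne_inr
    · exact absurd e inr_ne_inl
    · exact absurd e inr_ne_inl
    · exact Or.inr (Or.inl ⟨x, j', hx, hj', rfl, rfl⟩)
    · exact absurd e inr_ne_inl
    · exact absurd e inr_ne_inl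
    · exact Or.inr (Or.inr ⟨i, j', hi, hj', rfl, rfl, (hn.mem hj').trans (inr_inj.1 e ▸ h) h'⟩)
  tri := by
    rintro _ _ (⟨x, hx, rfl⟩ | ⟨i, hi, rfl⟩) (⟨y, hy, rfl⟩ | ⟨j, hj, rfl⟩)
    · rcases (hγ.mem hx).tri (hγ.mem hy) with h | rfl | h
      · exact Or.inl (Or.inl ⟨x, y, hx, hy, rfl, rfl, h⟩)
      · exact Or.inr (Or.inl rfl)
      · exact Or.inr (Or.inr (Or.inl ⟨y, x, hy, hx, rfl, rfl, h⟩))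
    · exact Or.inl (Or.inr (Or.inl ⟨x, j, hx, hj, rfl, rfl⟩))
    · exact Or.inr (Or.inr (Or.inr (Or.inl ⟨y, i, hy, hi, rfl, rfl⟩)))
    · rcases (hn.mem hi).tri (hn.mem hj) with h | rfl | h
      · exact Or.inl (Or.inr (Or.inr ⟨i, j, hi, hj, rfl, rfl, h⟩))
      · exact Or.inr (Or.inl rfl)
      · exact Or.inr (Or.inr (Or.inr (Or.inr ⟨j, i, hj, hi, rfl, rfl, h⟩)))

theorem add_lt_inl {x y : M} : (LO.add γ n).lt (inl x) (inl y) ↔ x ∊ γ ∧ y ∊ γ ∧ x ∊ y := by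
  constructor
  · rintro (⟨x', y', hx, hy, e1, e2, h⟩ | ⟨x, j, hx, hj, e1, e2⟩ | ⟨i, j, hi, hj, e1, e2, h⟩)
    · rw [inl_inj] at e1 e2; subst e1 e2; exact ⟨hx, hy, h⟩
    · exact absurd e2 inl_ne_inr
    · exact absurd e2 inl_ne_inr
  · rintro ⟨hx, hy, h⟩; exact Or.inl ⟨x, y, hx, hy, rfl, rfl, h⟩

theorem add_lt_inr {x y : M} : (LO.add γ n).lt (inr x) (inr y) ↔ x ∊ n ∧ y ∊ n ∧ x ∊ y := by
  constructor
  · rintro (⟨x', y', hx, hy, e1, e2, h⟩ | ⟨x, j, hx, hj, e1, e2⟩ | ⟨i, j, hi, hj, e1, e2, h⟩)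
    · exact absurd e2 inr_ne_inl
    · exact absurd e1 inr_ne_inl
    · rw [inr_inj] at e1 e2; subst e1 e2; exact ⟨hi, hj, h⟩
  · rintro ⟨hx, hy, h⟩; exact Or.inr (Or.inr ⟨x, y, hx, hy, rfl, rfl, h⟩)

theorem add_lt_inl_inr {x y : M} (hx : x ∊ γ) (hy : y ∊ n) : (LO.add γ n).lt (inl x) (inr y) :=
  Or.inr (Or.inl ⟨x, y, hx, hy, rfl, rfl⟩)

@[simp] theorem add_dom_inl {x : M} : (LO.add γ n).dom (inl x) ↔ x ∊ γ := by
  simp [LO.add]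

@[simp] theorem add_dom_inr {x : M} : (LO.add γ n).dom (inr x) ↔ x ∊ n := by
  simp [LO.add]

open Classical in
/-- The function `γ + f`. -/
noncomputable def sumMap {M : Type u} [PRSLang.Structure M] (f v : M) : M :=
  if fst v = empt M then v else inr (ap f (snd v))

instance PR.sumMap {C : Type v} {𝓜 : C → Type u} [∀ c, PRSLang.Structure (𝓜 c)]
    [∀ c, PRSomega (𝓜 c)] {ok : Prop} {n : ℕ} {s t : ∀ c, (Fin n → 𝓜 c) → 𝓜 c}
    [PR 𝓜 ok s] [PR 𝓜 ok t] : PR 𝓜 ok (fun c v => sumMap (s c v) (t c v)) := by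
  unfold PD.sumMap; infer_instance

@[simp] theorem sumMap_inl (f x : M) : sumMap f (inl x) = inl x := by simp [sumMap, inl]
@[simp] theorem sumMap_inr (f x : M) : sumMap f (inr x) = inr (ap f x) := by
  simp [sumMap, inr]

theorem sumMap_dom (hf : NatHom m n f) {x : M} (hx : (LO.add γ m).dom x) :
    (LO.add γ n).dom (sumMap f x) := by
  rcases hx with ⟨x, hx, rfl⟩ | ⟨i, hi, rfl⟩
  · simpa using hx
  · simpa using hf.ap_mem hi

theorem sumMap_lt (hf : NatHom m n f) {x y : M} (h : (LO.add γ m).lt x y) :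
    (LO.add γ n).lt (sumMap f x) (sumMap f y) := by
  rcases h with ⟨x, y, hx, hy, rfl, rfl, h⟩ | ⟨x, j, hx, hj, rfl, rfl⟩ | ⟨i, j, hi, hj, rfl, rfl, h⟩
  · rw [sumMap_inl, sumMap_inl]; exact add_lt_inl.2 ⟨hx, hy, h⟩
  · rw [sumMap_inl, sumMap_inr]; exact add_lt_inl_inr hx (hf.ap_mem hj)
  · rw [sumMap_inr, sumMap_inr]
    exact add_lt_inr.2 ⟨hf.ap_mem hi, hf.ap_mem hj, hf.mono hi hj h⟩

theorem mem_imag_sumMap (hf : NatHom m n f) {a v : M} (ha : ∀ x, x ∊ a → (LO.add γ m).dom x) :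
    v ∊ imag a (sumMap f) ↔ (∃ x, x ∊ γ ∧ v = inl x ∧ v ∊ a) ∨
      ∃ i j, opair i j ∊ f ∧ inr i ∊ a ∧ v = inr j := by
  rw [mem_imag]
  constructor
  · rintro ⟨x, hx, rfl⟩
    rcases ha x hx with ⟨x, hx', rfl⟩ | ⟨i, hi, rfl⟩
    · left; exact ⟨x, hx', sumMap_inl f x, by rwa [sumMap_inl]⟩
    · right; exact ⟨i, ap f i, hf.opair_iff.2 ⟨hi, rfl⟩, hx, sumMap_inr f i⟩
  · rintro (⟨x, hx, rfl, h⟩ | ⟨i, j, hij, hi, rfl⟩)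
    · exact ⟨_, h, (sumMap_inl f x).symm⟩
    · obtain ⟨-, rfl⟩ := hf.opair_iff.1 hij
      exact ⟨_, hi, (sumMap_inr f i).symm⟩

theorem sepObj_dom {a : M} (h : P.SepObj γ n (opair σ a)) : ∀ x, x ∊ a → (LO.add γ n).dom x := by
  obtain ⟨-, σ', a', k, e, i, e1, he, -⟩ := h
  obtain ⟨rfl, rfl⟩ := opair_inj.1 e1
  exact he.2.1

theorem SepObj.ext_dom {z : M} (h : P.SepObj γ n z) : (P.ext (LO.add γ n)).dom z := by
  obtain ⟨-, σ', a', k, e, i, rfl, he, hT, -⟩ := h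
  exact ext_dom_iff.2 ⟨k, e, he, hT⟩

theorem SepObj.exists_opair {z : M} (h : P.SepObj γ n z) : ∃ σ a, z = opair σ a :=
  exists_opair_of_ext_dom h.ext_dom

theorem sepObj_iff {a : M} : P.SepObj γ n (opair σ a) ↔ n ∊ om M ∧ ∃ k e i,
    (LO.add γ n).IsEn a k e ∧ P.Tr σ k ∧ P.IsCoeff k σ i ∧ (∃ x, x ∊ γ ∧ ap e i = inl x) ∧
      ∀ j, j ∊ k → i ∊ j → ∃ x, x ∊ n ∧ ap e j = inr x := by
  refine and_congr_right fun _ => ⟨?_, ?_⟩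
  · rintro ⟨σ', a', k, e, i, e1, he, hT, hi, ⟨x, hx, hxe⟩, h⟩
    obtain ⟨rfl, rfl⟩ := opair_inj.1 e1
    refine ⟨k, e, i, he, hT, hi, ⟨x, hx, (he.opair_iff.1 hxe).2.symm⟩, fun j hj hij => ?_⟩
    obtain ⟨x, hx, hxe⟩ := h j hj hij
    exact ⟨x, hx, (he.opair_iff.1 hxe).2.symm⟩
  · rintro ⟨k, e, i, he, hT, hi, ⟨x, hx, hxe⟩, h⟩
    refine ⟨σ, a, k, e, i, rfl, he, hT, hi, ⟨x, hx, he.opair_iff.2 ⟨hi.1, hxe.symm⟩⟩,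
      fun j hj hij => ?_⟩
    obtain ⟨x, hx, hxe⟩ := h j hj hij
    exact ⟨x, hx, he.opair_iff.2 ⟨hj, hxe.symm⟩⟩

theorem SepObj.map {a : M} (hf : NatHom m n f) (h : P.SepObj γ m (opair σ a)) :
    P.SepObj γ n (opair σ (imag a (sumMap f))) := by
  obtain ⟨-, k, e, i, he, hT, hi, ⟨x, hx, hxe⟩, h⟩ := sepObj_iff.1 h
  refine sepObj_iff.2 ⟨hf.2.1, k, _, i, he.map (fun x => sumMap_dom hf) (fun x y => sumMap_lt hf),
    hT, hi, ⟨x, hx, ?_⟩, fun j hj hij => ?_⟩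
  · rw [ap_lam hi.1, hxe, sumMap_inl]
  · obtain ⟨x, hx, hxe⟩ := h j hj hij
    exact ⟨_, hf.ap_mem hx, by rw [ap_lam hj, hxe, sumMap_inr]⟩

theorem sep_map_iff {a w : M} (hf : NatHom m n f) (h : P.SepObj γ m (opair σ a)) :
    (P.sep γ).map m n f (opair σ a) w ↔ w = opair σ (imag a (sumMap f)) := by
  constructor
  · rintro ⟨-, -, -, σ', a', b, e1, rfl, hb⟩
    obtain ⟨rfl, rfl⟩ := opair_inj.1 e1
    rw [opair_inj]
    exact ⟨rfl, ext_iff'.2 fun v => by rw [hb, mem_imag_sumMap hf (sepObj_dom h)]⟩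
  · rintro rfl
    exact ⟨hf, h, h.map hf, σ, a, _, rfl, rfl, fun v => mem_imag_sumMap hf (sepObj_dom h)⟩

theorem sep_map_cases {z w : M} (h : (P.sep γ).map m n f z w) : NatHom m n f ∧ ∃ σ a,
    P.SepObj γ m (opair σ a) ∧ P.SepObj γ n (opair σ (imag a (sumMap f))) ∧
      z = opair σ a ∧ w = opair σ (imag a (sumMap f)) := by
  have hf := h.1
  obtain ⟨σ, a, rfl⟩ := h.2.1.exists_opair
  have hw := (sep_map_iff hf h.2.1).1 h
  subst hw
  exact ⟨hf, σ, a, h.2.1, h.2.2.1, rfl, rfl⟩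

theorem sep_supp_iff {a s : M} : (P.sep γ).supp n (opair σ a) s ↔
    P.SepObj γ n (opair σ a) ∧ ∀ i, i ∊ s ↔ i ∊ n ∧ inr i ∊ a := by
  refine and_congr_right fun _ => ⟨?_, fun h => ⟨σ, a, rfl, h⟩⟩
  rintro ⟨σ', a', e, h⟩
  obtain ⟨rfl, rfl⟩ := opair_inj.1 e
  exact h

/-- The arguments of the given element are pulled back along γ + f. Those in γ are fixed by this
map, and those in the right summand belong to the support and hence to the range of f. Both summands
are respected, so the condition on i(σ) is inherited. -/
theorem sep_support_condition (hγ : IsOrd γ) {a s : M}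
    (hf : NatHom m n f) (hz : P.SepObj γ n (opair σ a)) (hs : ∀ i, i ∊ s ↔ i ∊ n ∧ inr i ∊ a)
    (h : ∀ j, j ∊ s → ∃ i, opair i j ∊ f) : ∃ z₀, (P.sep γ).map m n f z₀ (opair σ a) := by
  obtain ⟨hn, k, e, i, he, hT, hi, ⟨x, hx, hxe⟩, hj⟩ := sepObj_iff.1 hz
  have hXm := isLinear_add hγ (isOrd_of_mem_om hf.1)
  have hXn := isLinear_add hγ (isOrd_of_mem_om hf.2.1)
  let V := union₂ (imag γ fun x => inl x) (imag m fun x => inr x)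
  have hV : ∀ v, v ∊ V ↔ (LO.add γ m).dom v := by
    intro v
    rw [mem_union₂, mem_imag, mem_imag]; rfl
  -- The preimage of the j-th argument is unique because γ + f is an embedding, so it equals the
  -- union of the set of preimages in V.
  let ψ : M → M := fun j => sUnion (sepr V (fun v => sumMap f v = ap e j))
  have hψ : ∀ j, j ∊ k → (LO.add γ m).dom (ψ j) ∧ sumMap f (ψ j) = ap e j := by
    intro j hj
    have : ∃ v, (LO.add γ m).dom v ∧ sumMap f v = ap e j := by
      have hea := he.ap_mem hj
      rcases he.ap_dom hj with ⟨y, hy, hye⟩ | ⟨y, hy, hye⟩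
      · exact ⟨inl y, by simpa using hy, by rw [hye, sumMap_inl]⟩
      · obtain ⟨l, hl⟩ := h y ((hs y).2 ⟨hy, hye ▸ hea⟩)
        obtain ⟨hlm, rfl⟩ := hf.opair_iff.1 hl
        exact ⟨inr l, by simpa using hlm, by rw [hye, sumMap_inr]⟩
    obtain ⟨v, hv, hve⟩ := this
    have hv' : ψ j = v := by
      rw [ext_iff']; intro z
      simp only [ψ, mem_sUnion, mem_sepr]
      constructor
      · rintro ⟨w, ⟨hw, hwe⟩, hz⟩
        have : w = v := by
          rcases hXm.tri w v ((hV w).1 hw) hv with h | h | h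
          · exact absurd (sumMap_lt hf h) (by rw [hwe, hve]; exact hXn.irrefl _)
          · exact h
          · exact absurd (sumMap_lt hf h) (by rw [hwe, hve]; exact hXn.irrefl _)
        exact this ▸ hz
      · intro hz; exact ⟨v, ⟨(hV v).2 hv, hve⟩, hz⟩
    rw [hv']; exact ⟨hv, hve⟩
  have hlt : ∀ i j, i ∊ k → j ∊ k → i ∊ j → (LO.add γ m).lt (ψ i) (ψ j) := by
    intro i j hi hj hij
    have h1 := he.mono hi hj hij
    rcases hXm.tri _ _ (hψ i hi).1 (hψ j hj).1 with h | h | h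
    · exact h
    · rw [← (hψ i hi).2, ← (hψ j hj).2, h] at h1
      exact absurd h1 (hXn.irrefl _)
    · have := sumMap_lt hf h
      rw [(hψ i hi).2, (hψ j hj).2] at this
      exact absurd (hXn.trans _ _ _ h1 this) (hXn.irrefl _)
  have hen : (LO.add γ m).IsEn (imag k ψ) k (lam k ψ) :=
    LO.isEn_lam he.nat (fun i hi => (hψ i hi).1) hlt fun x => mem_imag
  have hcase : ∀ {v}, (LO.add γ m).dom v → (∀ y, sumMap f v = inl y → v = inl y) ∧
      (∀ y, sumMap f v = inr y → ∃ l, l ∊ m ∧ v = inr l) := by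
    intro v hv
    rcases hv with ⟨y, hy, rfl⟩ | ⟨l, hl, rfl⟩
    · simp
    · simp [hl]
  have hz₀ : P.SepObj γ m (opair σ (imag k ψ)) := by
    refine sepObj_iff.2 ⟨hf.1, k, _, i, hen, hT, hi, ⟨x, hx, ?_⟩, fun j hjk hij => ?_⟩
    · rw [ap_lam hi.1]
      exact (hcase (hψ i hi.1).1).1 x ((hψ i hi.1).2.trans hxe)
    · obtain ⟨y, hy, hye⟩ := hj j hjk hij
      rw [ap_lam hjk]
      exact (hcase (hψ j hjk).1).2 y ((hψ j hjk).2.trans hye)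
  refine ⟨_, (sep_map_iff hf hz₀).2 (opair_inj.2 ⟨rfl, ext_iff'.2 fun v => ?_⟩)⟩
  rw [he.mem_iff, mem_imag]
  constructor
  · rintro ⟨j, hj, rfl⟩
    exact ⟨ψ j, mem_imag.2 ⟨j, hj, rfl⟩, (hψ j hj).2.symm⟩
  · rintro ⟨w, hw, rfl⟩
    obtain ⟨j, hj, rfl⟩ := mem_imag.1 hw
    exact ⟨j, hj, (hψ j hj).2⟩

theorem isPredilator_sep (hP : P.IsPredilator) (hγ : IsOrd γ) : (P.sep γ).IsPredilator where
  obj_nat := fun n σ h => h.1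
  linear := fun n hn =>
    (isLinear_ext hP (isLinear_add hγ (isOrd_of_mem_om hn))).sub (P.SepObj γ n)
      fun z h => h.ext_dom
  lt_obj := fun n z w h => ⟨h.1, h.2.1⟩
  map_hom := fun m n f z w h => ⟨h.1, h.2.1, h.2.2.1⟩
  map_fun := fun m n f z hf hz => by
    obtain ⟨σ, a, rfl⟩ := SepObj.exists_opair hz
    exact ⟨_, (sep_map_iff hf hz).2 rfl, fun w hw => (sep_map_iff hf hz).1 hw⟩
  map_lt := fun m n f z z' w w' h1 h2 h => by
    obtain ⟨hf, σ, a, h3, h4, rfl, rfl⟩ := sep_map_cases h1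
    obtain ⟨-, τ, b, h5, h6, rfl, rfl⟩ := sep_map_cases h2
    exact ⟨h4, h6, ext_lt_map hP (isLinear_add hγ (isOrd_of_mem_om hf.1))
      (isLinear_add hγ (isOrd_of_mem_om hf.2.1)) (fun x => sumMap_dom hf)
      (fun x y => sumMap_lt hf) h.2.2⟩
  map_id := fun n f z hf hi hz => by
    obtain ⟨σ, a, rfl⟩ := SepObj.exists_opair hz
    refine (sep_map_iff hf hz).2 (opair_inj.2 ⟨rfl, ext_iff'.2 fun v => ?_⟩)
    have hap : ∀ i, i ∊ n → ap f i = i := fun i hin => (hf.opair_iff.1 (hi i hin)).2.symm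
    have key : ∀ x, x ∊ a → sumMap f x = x := by
      intro x hx
      rcases sepObj_dom hz x hx with ⟨y, hy, rfl⟩ | ⟨i, hin, rfl⟩
      · simp
      · simp [hap i hin]
    rw [mem_imag]
    exact ⟨fun hv => ⟨v, hv, (key v hv).symm⟩, by rintro ⟨x, hx, rfl⟩; rwa [key x hx]⟩
  map_comp := fun l m n f g h z w r hh hi h1 h2 => by
    obtain ⟨hf, σ, a, h3, h4, rfl, rfl⟩ := sep_map_cases h1
    obtain ⟨hg, τ, b, h5, h6, e, rfl⟩ := sep_map_cases h2
    obtain ⟨rfl, rfl⟩ := opair_inj.1 e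
    refine (sep_map_iff hh h3).2 (opair_inj.2 ⟨rfl, ext_iff'.2 fun v => ?_⟩)
    have key : ∀ x, x ∊ a → sumMap h x = sumMap g (sumMap f x) := by
      intro x hx
      rcases sepObj_dom h3 x hx with ⟨y, hy, rfl⟩ | ⟨i, hin, rfl⟩
      · simp
      · have := hi i _ _ (hf.opair_iff.2 ⟨hin, rfl⟩) (hg.opair_iff.2 ⟨hf.ap_mem hin, rfl⟩)
        simp [(hh.opair_iff.1 this).2]
    simp only [mem_imag]
    constructor
    · rintro ⟨_, ⟨x, hx, rfl⟩, rfl⟩; exact ⟨x, hx, (key x hx).symm⟩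
    · rintro ⟨x, hx, rfl⟩; exact ⟨_, ⟨x, hx, rfl⟩, key x hx⟩
  monotone := fun m n f g z w w' hfg h1 h2 => by
    obtain ⟨hf, σ, a, h3, h4, rfl, rfl⟩ := sep_map_cases h1
    obtain ⟨hg, τ, b, h5, h6, e, rfl⟩ := sep_map_cases h2
    obtain ⟨rfl, rfl⟩ := opair_inj.1 e
    obtain ⟨-, k, e, i, he, hT, -⟩ := sepObj_iff.1 h3
    have hX := isLinear_add hγ (isOrd_of_mem_om hf.2.1)
    rcases ext_monotone hP hX (he.map (fun x => sumMap_dom hf) (fun x y => sumMap_lt hf))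
      (he.map (fun x => sumMap_dom hg) (fun x y => sumMap_lt hg)) hT (fun j hj hlt => by
        rw [ap_lam hj, ap_lam hj] at hlt
        rcases he.ap_dom hj with ⟨y, hy, hye⟩ | ⟨l, hl, hle⟩
        · rw [hye, sumMap_inl, sumMap_inl] at hlt
          exact hX.irrefl _ hlt
        · rw [hle, sumMap_inr, sumMap_inr, add_lt_inr] at hlt
          rcases hfg l _ _ (hf.opair_iff.2 ⟨hl, rfl⟩) (hg.opair_iff.2 ⟨hl, rfl⟩) with h | h
          · exact mem_asymm h hlt.2.2
          · exact mem_irrefl _ (h ▸ hlt.2.2)) with h | h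
    · exact Or.inl ⟨h4, h6, h⟩
    · exact Or.inr (by rw [h])
  supp_obj := fun n z s h => by
    obtain ⟨σ, a, rfl⟩ := SepObj.exists_opair h.1
    rw [sep_supp_iff] at h
    exact ⟨h.1, fun i hi => ((h.2 i).1 hi).1⟩
  supp_fun := fun n z h => by
    obtain ⟨σ, a, rfl⟩ := SepObj.exists_opair h
    refine ⟨sepr n (fun i => inr i ∊ a), sep_supp_iff.2 ⟨h, fun i => mem_sepr⟩, fun s hs => ?_⟩
    exact ext_iff'.2 fun i => by rw [(sep_supp_iff.1 hs).2, mem_sepr]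
  supp_natural := fun m n f z w s t h1 h2 h3 j => by
    obtain ⟨hf, σ, a, h4, h5, rfl, rfl⟩ := sep_map_cases h1
    rw [sep_supp_iff] at h2 h3
    rw [h3.2, mem_imag_sumMap hf (sepObj_dom h4)]
    constructor
    · rintro ⟨hj, ⟨x, -, e, -⟩ | ⟨i, j', hij, hi, e⟩⟩
      · exact absurd e inr_ne_inl
      · rw [inr_inj] at e; subst e
        exact ⟨i, (h2.2 i).2 ⟨(hf.opair_iff.1 hij).1, hi⟩, hij⟩
    · rintro ⟨i, hi, hij⟩
      obtain ⟨him, rfl⟩ := hf.opair_iff.1 hij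
      exact ⟨hf.ap_mem him, Or.inr ⟨i, _, hij, ((h2.2 i).1 hi).2, rfl⟩⟩
  support_condition := fun m n f z s hf hs h => by
    obtain ⟨σ, a, rfl⟩ := SepObj.exists_opair hs.1
    rw [sep_supp_iff] at hs
    exact sep_support_condition hγ hf hs.1 hs.2 h

end Sep

end PD

/-! ### Primitive recursive families of predilators -/

section SetOf

variable {M : Type u} [PRSLang.Structure M]

open Classical in
/-- The set `{x | φ x}`, if it exists. -/
noncomputable def setOf (φ : M → Prop) : M :=
  if h : ∃ s, ∀ x, x ∊ s ↔ φ x then h.choose else empt M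

variable [PRSomega M]

theorem mem_setOf_of_exists {φ : M → Prop} (h : ∃ s, ∀ x, x ∊ s ↔ φ x) {x : M} :
    x ∊ setOf φ ↔ φ x := by
  rw [setOf, dif_pos h]
  exact h.choose_spec x

theorem setOf_eq {φ : M → Prop} {s : M} (h : ∀ x, x ∊ s ↔ φ x) : setOf φ = s :=
  ext_iff'.2 fun x => by rw [mem_setOf_of_exists ⟨s, h⟩, h]

variable {C : Type v} {𝓜 : C → Type u} [∀ c, PRSLang.Structure (𝓜 c)] [∀ c, PRSomega (𝓜 c)]
variable {ok : Prop} {n : ℕ} {R : ∀ c, (Fin n → 𝓜 c) → 𝓜 c → Prop}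

theorem setOf_eq_sepr (t : ∀ c, (Fin n → 𝓜 c) → 𝓜 c)
    (hb : ∀ c v x, R c v x → x ∊ t c v)
    [hR : PRRel 𝓜 ok (n := n + 1) (fun c w => R c (fun i => w i.succ) (w 0))] (c : C)
    (v : Fin n → 𝓜 c) : setOf (R c v) = sepr (t c v) (R c v) := by
  have := PRRel.defR (hf := hR) c v
  exact setOf_eq fun x => by
    rw [mem_sepr]
    exact ⟨fun h => h.2, fun h => ⟨hb _ _ _ h, h⟩⟩

/-- A class that is included in a definable set is itself a set, by separation, and depends
primitive recursively on the variables. -/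
theorem PR.setOf_of_bound (t : ∀ c, (Fin n → 𝓜 c) → 𝓜 c) [ht : PR 𝓜 ok t]
    (hb : ∀ c v x, R c v x → x ∊ t c v)
    [hR : PRRel 𝓜 ok (n := n + 1) (fun c w => R c (fun i => w i.succ) (w 0))] :
    PR 𝓜 ok (fun c v => setOf (R c v)) :=
  PR.congr (t := fun c v => DilRec.sepr (t c v) (fun x => R c v x))
    fun c v => setOf_eq_sepr (ok := ok) t hb c v

end SetOf

section PDPR

variable {C : Type v} {𝓜 : C → Type u} [∀ c, PRSLang.Structure (𝓜 c)] [∀ c, PRSomega (𝓜 c)]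

/-- The arguments of the relations of `P` lie in the set `B`. -/
def PD.BoundedBy {M : Type u} [PRSLang.Structure M] (P : PD M) (B : M) : Prop :=
  (∀ n σ, P.obj n σ → n ∊ B ∧ σ ∊ B) ∧ (∀ n σ τ, P.lt n σ τ → n ∊ B ∧ σ ∊ B ∧ τ ∊ B) ∧
  (∀ m n f σ τ, P.map m n f σ τ → m ∊ B ∧ n ∊ B ∧ f ∊ B ∧ σ ∊ B ∧ τ ∊ B) ∧
  ∀ n σ a, P.supp n σ a → n ∊ B ∧ σ ∊ B ∧ a ∊ B

/-- The data `P c v` have primitive recursive components and are bounded by sets. -/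
class PDPR (𝓜 : C → Type u) [∀ c, PRSLang.Structure (𝓜 c)] (ok : Prop) {n : ℕ}
    (P : ∀ c, (Fin n → 𝓜 c) → PD (𝓜 c)) : Prop where
  obj : PRRel 𝓜 ok (n := n + 2) (fun c w => (P c (fun i => w i.succ.succ)).obj (w 0) (w 1))
  lt : PRRel 𝓜 ok (n := n + 3)
    (fun c w => (P c (fun i => w i.succ.succ.succ)).lt (w 0) (w 1) (w 2))
  map : PRRel 𝓜 ok (n := n + 5) (fun c w =>
    (P c (fun i => w i.succ.succ.succ.succ.succ)).map (w 0) (w 1) (w 2) (w 3) (w 4))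
  supp : PRRel 𝓜 ok (n := n + 3)
    (fun c w => (P c (fun i => w i.succ.succ.succ)).supp (w 0) (w 1) (w 2))
  bound : ∃ B : ∀ c, (Fin n → 𝓜 c) → 𝓜 c, PR 𝓜 ok B ∧ ∀ c v, (P c v).BoundedBy (B c v)

/-- The orders `X c v` are bounded by sets. -/
class LOBD (𝓜 : C → Type u) [∀ c, PRSLang.Structure (𝓜 c)] (ok : Prop) {n : ℕ}
    (X : ∀ c, (Fin n → 𝓜 c) → LO (𝓜 c)) : Prop where
  bound : ∃ B : ∀ c, (Fin n → 𝓜 c) → 𝓜 c, PR 𝓜 ok B ∧ ∀ c v x, (X c v).dom x → x ∊ B c v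

variable {ok : Prop} {n m : ℕ} {X : ∀ c, (Fin n → 𝓜 c) → LO (𝓜 c)}
  {P P' : ∀ c, (Fin n → 𝓜 c) → PD (𝓜 c)} {r s t a b d : ∀ c, (Fin n → 𝓜 c) → 𝓜 c}

instance LOBD.ofOrd [hs : PR 𝓜 ok s] : LOBD 𝓜 ok (fun c v => LO.ofOrd (s c v)) where
  bound := ⟨s, hs, fun _ _ _ h => h⟩

instance LOBD.below [hX : LOBD 𝓜 ok X] : LOBD 𝓜 ok (fun c v => (X c v).below (s c v)) where
  bound := by
    obtain ⟨B, hB, h⟩ := hX.bound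
    exact ⟨B, hB, fun c v x hx => h _ _ _ hx.1⟩

instance LOPR.below [hX : LOPR 𝓜 ok X] [PR 𝓜 ok s] :
    LOPR 𝓜 ok (fun c v => (X c v).below (s c v)) where
  dom := by unfold LO.below; infer_instance
  lt := by unfold LO.below; infer_instance

instance PRRel.pdObj [hP : PDPR 𝓜 ok P] [hs : PR 𝓜 ok s] [ht : PR 𝓜 ok t] :
    PRRel 𝓜 ok (fun c v => (P c v).obj (s c v) (t c v)) :=
  PRRel.subst (ht := hP.obj) (Matrix.vecCons s (Matrix.vecCons t fun i _ v => v i))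
    (Fin.cases hs (Fin.cases ht fun i => PR.var i))

instance PRRel.pdLt [hP : PDPR 𝓜 ok P] [hs : PR 𝓜 ok s] [ht : PR 𝓜 ok t] [hr : PR 𝓜 ok r] :
    PRRel 𝓜 ok (fun c v => (P c v).lt (s c v) (t c v) (r c v)) :=
  PRRel.subst (ht := hP.lt)
    (Matrix.vecCons s (Matrix.vecCons t (Matrix.vecCons r fun i _ v => v i)))
    (Fin.cases hs (Fin.cases ht (Fin.cases hr fun i => PR.var i)))

instance PRRel.pdSupp [hP : PDPR 𝓜 ok P] [hs : PR 𝓜 ok s] [ht : PR 𝓜 ok t] [hr : PR 𝓜 ok r] :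
    PRRel 𝓜 ok (fun c v => (P c v).supp (s c v) (t c v) (r c v)) :=
  PRRel.subst (ht := hP.supp)
    (Matrix.vecCons s (Matrix.vecCons t (Matrix.vecCons r fun i _ v => v i)))
    (Fin.cases hs (Fin.cases ht (Fin.cases hr fun i => PR.var i)))

instance PRRel.pdMap [hP : PDPR 𝓜 ok P] [hs : PR 𝓜 ok s] [ht : PR 𝓜 ok t] [hr : PR 𝓜 ok r]
    [ha : PR 𝓜 ok a] [hb : PR 𝓜 ok b] :
    PRRel 𝓜 ok (fun c v => (P c v).map (s c v) (t c v) (r c v) (a c v) (b c v)) :=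
  PRRel.subst (ht := hP.map) (Matrix.vecCons s (Matrix.vecCons t (Matrix.vecCons r
    (Matrix.vecCons a (Matrix.vecCons b fun i _ v => v i)))))
    (Fin.cases hs (Fin.cases ht (Fin.cases hr (Fin.cases ha (Fin.cases hb fun i => PR.var i)))))

instance PDPR.weaken [hP : PDPR 𝓜 ok P] (ρ : Fin n → Fin m) :
    PDPR 𝓜 ok (fun c v => P c (fun i => v (ρ i))) where
  obj := PRRel.subst (ht := hP.obj) (Fin.cases (fun _ v => v 0) (Fin.cases (fun _ v => v 1)
    fun i _ v => v (ρ i).succ.succ))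
    (Fin.cases (PR.var _) (Fin.cases (PR.var _) fun _ => PR.var _))
  lt := PRRel.subst (ht := hP.lt) (Fin.cases (fun _ v => v 0) (Fin.cases (fun _ v => v 1)
    (Fin.cases (fun _ v => v 2) fun i _ v => v (ρ i).succ.succ.succ)))
    (Fin.cases (PR.var _) (Fin.cases (PR.var _) (Fin.cases (PR.var _) fun _ => PR.var _)))
  supp := PRRel.subst (ht := hP.supp) (Fin.cases (fun _ v => v 0) (Fin.cases (fun _ v => v 1)
    (Fin.cases (fun _ v => v 2) fun i _ v => v (ρ i).succ.succ.succ)))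
    (Fin.cases (PR.var _) (Fin.cases (PR.var _) (Fin.cases (PR.var _) fun _ => PR.var _)))
  map := PRRel.subst (ht := hP.map) (Fin.cases (fun _ v => v 0) (Fin.cases (fun _ v => v 1)
    (Fin.cases (fun _ v => v 2) (Fin.cases (fun _ v => v 3) (Fin.cases (fun _ v => v 4)
    fun i _ v => v (ρ i).succ.succ.succ.succ.succ)))))
    (Fin.cases (PR.var _) (Fin.cases (PR.var _) (Fin.cases (PR.var _) (Fin.cases (PR.var _)
      (Fin.cases (PR.var _) fun _ => PR.var _)))))
  bound := by
    obtain ⟨B, hB, h⟩ := hP.bound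
    exact ⟨fun c v => B c (fun i => v (ρ i)), inferInstance, fun c v => h _ _⟩

/-! ### Coded predilators -/

namespace PD

variable {M : Type u} [PRSLang.Structure M]

/-- `D` is a quadruple. -/
def IsQuad (D : M) : Prop := D = opair (fst D) (opair (fst (snd D)) (opair (fst (snd (snd D)))
  (snd (snd (snd D)))))

variable [PRSomega M]

theorem ofSet_obj {D n σ : M} : (ofSet D).obj n σ ↔ IsQuad D ∧ opair n σ ∊ fst D := by
  constructor
  · rintro ⟨O, L, T, S, rfl, h⟩; simpa [IsQuad] using h
  · rintro ⟨h1, h2⟩; exact ⟨_, _, _, _, h1, h2⟩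

theorem ofSet_lt {D n σ τ : M} :
    (ofSet D).lt n σ τ ↔ IsQuad D ∧ opair n (opair σ τ) ∊ fst (snd D) := by
  constructor
  · rintro ⟨O, L, T, S, rfl, h⟩; simpa [IsQuad] using h
  · rintro ⟨h1, h2⟩; exact ⟨_, _, _, _, h1, h2⟩

theorem ofSet_map {D m n f σ τ : M} : (ofSet D).map m n f σ τ ↔ IsQuad D ∧
    opair (opair m (opair n f)) (opair σ τ) ∊ fst (snd (snd D)) := by
  constructor
  · rintro ⟨O, L, T, S, rfl, h⟩; simpa [IsQuad] using h
  · rintro ⟨h1, h2⟩; exact ⟨_, _, _, _, h1, h2⟩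

theorem ofSet_supp {D n σ a : M} : (ofSet D).supp n σ a ↔ IsQuad D ∧
    opair (opair n σ) a ∊ snd (snd (snd D)) := by
  constructor
  · rintro ⟨O, L, T, S, rfl, h⟩; simpa [IsQuad] using h
  · rintro ⟨h1, h2⟩; exact ⟨_, _, _, _, h1, h2⟩

theorem IsQuad.mem_trcl {D : M} (h : IsQuad D) : fst D ∊ trcl D ∧ fst (snd D) ∊ trcl D ∧
    fst (snd (snd D)) ∊ trcl D ∧ snd (snd (snd D)) ∊ trcl D := by
  have h0 := self_mem_trcl D
  rw [show (D ∊ trcl D) = (opair (fst D) (opair (fst (snd D)) (opair (fst (snd (snd D)))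
    (snd (snd (snd D))))) ∊ trcl D) from congrArg (· ∊ trcl D) h] at h0
  exact ⟨(trcl_opair h0).1, (trcl_opair (trcl_opair h0).2).1,
    (trcl_opair (trcl_opair (trcl_opair h0).2).2).1,
    (trcl_opair (trcl_opair (trcl_opair h0).2).2).2⟩

/-- Decoding yields literally the same data, not merely isomorphic ones. Facts about sums,
restrictions and separations therefore transfer to their codes by substitution. -/
theorem ofSet_eq_of_codes {D : M} {P : PD M} (h : Codes D P) : ofSet D = P := by
  obtain ⟨O, L, T, S, rfl, hO, hL, hT, hS⟩ := h
  obtain ⟨obj, lt, map, supp⟩ := P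
  rw [show ofSet (opair O (opair L (opair T S))) =
    ⟨(ofSet (opair O (opair L (opair T S)))).obj, (ofSet (opair O (opair L (opair T S)))).lt,
     (ofSet (opair O (opair L (opair T S)))).map, (ofSet (opair O (opair L (opair T S)))).supp⟩
     from rfl]
  have hq : IsQuad (opair O (opair L (opair T S))) := by simp [IsQuad]
  congr
  · funext n σ
    rw [eq_iff_iff, ofSet_obj, fst_opair, hO]
    exact ⟨by rintro ⟨-, _, _, h, e⟩; obtain ⟨rfl, rfl⟩ := opair_inj.1 e; exact h,
      fun h => ⟨hq, _, _, h, rfl⟩⟩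
  · funext n σ τ
    rw [eq_iff_iff, ofSet_lt, snd_opair, fst_opair, hL]
    exact ⟨by rintro ⟨-, _, _, _, h, e⟩; simp only [opair_inj] at e
              obtain ⟨rfl, rfl, rfl⟩ := e; exact h,
      fun h => ⟨hq, _, _, _, h, rfl⟩⟩
  · funext m n f σ τ
    rw [eq_iff_iff, ofSet_map, snd_opair, snd_opair, fst_opair, hT]
    exact ⟨by rintro ⟨-, _, _, _, _, _, h, e⟩; simp only [opair_inj] at e
              obtain ⟨⟨rfl, rfl, rfl⟩, rfl, rfl⟩ := e; exact h,
      fun h => ⟨hq, _, _, _, _, _, h, rfl⟩⟩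
  · funext n σ a
    rw [eq_iff_iff, ofSet_supp, snd_opair, snd_opair, snd_opair, hS]
    exact ⟨by rintro ⟨-, _, _, _, h, e⟩; simp only [opair_inj] at e
              obtain ⟨⟨rfl, rfl⟩, rfl⟩ := e; exact h,
      fun h => ⟨hq, _, _, _, h, rfl⟩⟩

theorem Codes.unique {D D' : M} {P : PD M} (h : Codes D P) (h' : Codes D' P) : D = D' := by
  obtain ⟨O, L, T, S, rfl, hO, hL, hT, hS⟩ := h
  obtain ⟨O', L', T', S', rfl, hO', hL', hT', hS'⟩ := h'
  simp only [opair_inj]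
  exact ⟨ext_iff'.2 fun z => by rw [hO, hO'], ext_iff'.2 fun z => by rw [hL, hL'],
    ext_iff'.2 fun z => by rw [hT, hT'], ext_iff'.2 fun z => by rw [hS, hS']⟩

/-- The set that codes `P`. -/
noncomputable def code {M : Type u} [PRSLang.Structure M] (P : PD M) : M :=
  opair (setOf fun z => ∃ n σ, P.obj n σ ∧ z = opair n σ)
    (opair (setOf fun z => ∃ n σ τ, P.lt n σ τ ∧ z = opair n (opair σ τ))
      (opair (setOf fun z => ∃ m n f σ τ, P.map m n f σ τ ∧
        z = opair (opair m (opair n f)) (opair σ τ))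
        (setOf fun z => ∃ n σ a, P.supp n σ a ∧ z = opair (opair n σ) a)))

end PD

instance PRRel.isQuad [PR 𝓜 ok s] : PRRel 𝓜 ok (fun c v => PD.IsQuad (s c v)) := by
  unfold PD.IsQuad; infer_instance

instance PDPR.ofSet [PR 𝓜 ok d] : PDPR 𝓜 ok (fun c v => PD.ofSet (d c v)) where
  obj := by simp only [PD.ofSet_obj]; infer_instance
  lt := by simp only [PD.ofSet_lt]; infer_instance
  map := by simp only [PD.ofSet_map]; infer_instance
  supp := by simp only [PD.ofSet_supp]; infer_instance
  bound := by
    refine ⟨fun c v => trcl (d c v), inferInstance, fun c v => ⟨?_, ?_, ?_, ?_⟩⟩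
    · intro n σ h
      obtain ⟨hq, h⟩ := PD.ofSet_obj.1 h
      exact trcl_opair (trcl_trans hq.mem_trcl.1 h)
    · intro n σ τ h
      obtain ⟨hq, h⟩ := PD.ofSet_lt.1 h
      have h1 := trcl_opair (trcl_trans hq.mem_trcl.2.1 h)
      exact ⟨h1.1, trcl_opair h1.2⟩
    · intro m n f σ τ h
      obtain ⟨hq, h⟩ := PD.ofSet_map.1 h
      have h1 := trcl_opair (trcl_trans hq.mem_trcl.2.2.1 h)
      have h2 := trcl_opair h1.1
      exact ⟨h2.1, (trcl_opair h2.2).1, (trcl_opair h2.2).2, trcl_opair h1.2⟩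
    · intro n σ a h
      obtain ⟨hq, h⟩ := PD.ofSet_supp.1 h
      have h1 := trcl_opair (trcl_trans hq.mem_trcl.2.2.2 h)
      exact ⟨(trcl_opair h1.1).1, (trcl_opair h1.1).2, h1.2⟩

section Code

/-- The set B that bounds the arguments gives a bound on the quantifiers, and iterated products of B
bound the four graphs. So these graphs are sets and arise by separation. -/
theorem PDPR.code_aux [hP : PDPR 𝓜 ok P] :
    PR 𝓜 ok (fun c v => PD.code (P c v)) ∧ ∀ c v, PD.Codes (PD.code (P c v)) (P c v) := by
  obtain ⟨B, hB, hb⟩ := hP.bound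
  have e1 : ∀ c (v : Fin n → 𝓜 c) z, (∃ n σ, (P c v).obj n σ ∧ z = opair n σ) ↔
      ∃ n, n ∊ B c v ∧ ∃ σ, σ ∊ B c v ∧ (P c v).obj n σ ∧ z = opair n σ := fun c v z =>
    ⟨fun ⟨n, σ, h, e⟩ => ⟨n, ((hb c v).1 _ _ h).1, σ, ((hb c v).1 _ _ h).2, h, e⟩,
      fun ⟨n, _, σ, _, h, e⟩ => ⟨n, σ, h, e⟩⟩
  have e2 : ∀ c (v : Fin n → 𝓜 c) z, (∃ n σ τ, (P c v).lt n σ τ ∧ z = opair n (opair σ τ)) ↔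
      ∃ n, n ∊ B c v ∧ ∃ σ, σ ∊ B c v ∧ ∃ τ, τ ∊ B c v ∧ (P c v).lt n σ τ ∧
        z = opair n (opair σ τ) := fun c v z =>
    ⟨fun ⟨n, σ, τ, h, e⟩ => ⟨n, ((hb c v).2.1 _ _ _ h).1, σ, ((hb c v).2.1 _ _ _ h).2.1, τ,
      ((hb c v).2.1 _ _ _ h).2.2, h, e⟩, fun ⟨n, _, σ, _, τ, _, h, e⟩ => ⟨n, σ, τ, h, e⟩⟩
  have e3 : ∀ c (v : Fin n → 𝓜 c) z, (∃ m n f σ τ, (P c v).map m n f σ τ ∧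
        z = opair (opair m (opair n f)) (opair σ τ)) ↔
      ∃ m, m ∊ B c v ∧ ∃ n, n ∊ B c v ∧ ∃ f, f ∊ B c v ∧ ∃ σ, σ ∊ B c v ∧ ∃ τ, τ ∊ B c v ∧
        (P c v).map m n f σ τ ∧ z = opair (opair m (opair n f)) (opair σ τ) := fun c v z =>
    ⟨fun ⟨m, n, f, σ, τ, h, e⟩ => by
      obtain ⟨h1, h2, h3, h4, h5⟩ := (hb c v).2.2.1 _ _ _ _ _ h
      exact ⟨m, h1, n, h2, f, h3, σ, h4, τ, h5, h, e⟩,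
      fun ⟨m, _, n, _, f, _, σ, _, τ, _, h, e⟩ => ⟨m, n, f, σ, τ, h, e⟩⟩
  have e4 : ∀ c (v : Fin n → 𝓜 c) z, (∃ n σ a, (P c v).supp n σ a ∧ z = opair (opair n σ) a) ↔
      ∃ n, n ∊ B c v ∧ ∃ σ, σ ∊ B c v ∧ ∃ a, a ∊ B c v ∧ (P c v).supp n σ a ∧
        z = opair (opair n σ) a := fun c v z =>
    ⟨fun ⟨n, σ, τ, h, e⟩ => ⟨n, ((hb c v).2.2.2 _ _ _ h).1, σ, ((hb c v).2.2.2 _ _ _ h).2.1, τ,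
      ((hb c v).2.2.2 _ _ _ h).2.2, h, e⟩, fun ⟨n, _, σ, _, τ, _, h, e⟩ => ⟨n, σ, τ, h, e⟩⟩
  have b1 : ∀ c (v : Fin n → 𝓜 c) z, (∃ n, n ∊ B c v ∧ ∃ σ, σ ∊ B c v ∧ (P c v).obj n σ ∧
      z = opair n σ) → z ∊ prod (B c v) (B c v) := by
    rintro c v _ ⟨n, hn, σ, hσ, -, rfl⟩; simp [hn, hσ]
  have b2 : ∀ c (v : Fin n → 𝓜 c) z, (∃ n, n ∊ B c v ∧ ∃ σ, σ ∊ B c v ∧ ∃ τ, τ ∊ B c v ∧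
      (P c v).lt n σ τ ∧ z = opair n (opair σ τ)) → z ∊ prod (B c v) (prod (B c v) (B c v)) := by
    rintro c v _ ⟨n, hn, σ, hσ, τ, hτ, -, rfl⟩; simp [hn, hσ, hτ]
  have b3 : ∀ c (v : Fin n → 𝓜 c) z, (∃ m, m ∊ B c v ∧ ∃ n, n ∊ B c v ∧ ∃ f, f ∊ B c v ∧ ∃ σ,
      σ ∊ B c v ∧ ∃ τ, τ ∊ B c v ∧
        (P c v).map m n f σ τ ∧ z = opair (opair m (opair n f)) (opair σ τ)) →
      z ∊ prod (prod (B c v) (prod (B c v) (B c v))) (prod (B c v) (B c v)) := by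
    rintro c v _ ⟨m, hm, n, hn, f, hf, σ, hσ, τ, hτ, -, rfl⟩; simp [hm, hn, hf, hσ, hτ]
  have b4 : ∀ c (v : Fin n → 𝓜 c) z, (∃ n, n ∊ B c v ∧ ∃ σ, σ ∊ B c v ∧ ∃ a, a ∊ B c v ∧
      (P c v).supp n σ a ∧ z = opair (opair n σ) a) → z ∊ prod (prod (B c v) (B c v)) (B c v) := by
    rintro c v _ ⟨n, hn, σ, hσ, τ, hτ, -, rfl⟩; simp [hn, hσ, hτ]
  unfold PD.code
  simp only [e1, e2, e3, e4]
  have h1 := PR.setOf_of_bound (𝓜 := 𝓜) (ok := ok) _ b1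
  have h2 := PR.setOf_of_bound (𝓜 := 𝓜) (ok := ok) _ b2
  have h3 := PR.setOf_of_bound (𝓜 := 𝓜) (ok := ok) _ b3
  have h4 := PR.setOf_of_bound (𝓜 := 𝓜) (ok := ok) _ b4
  refine ⟨inferInstance, fun c v => ⟨_, _, _, _, rfl, ?_, ?_, ?_, ?_⟩⟩
  · intro z
    rw [e1, setOf_eq_sepr (ok := ok) _ b1]
    have := PRRel.defR (𝓜 := 𝓜) (ok := ok) (R := fun c v z => ∃ n, n ∊ B c v ∧ ∃ σ, σ ∊ B c v ∧
      (P c v).obj n σ ∧ z = opair n σ) c v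
    rw [mem_sepr]
    exact ⟨fun h => h.2, fun h => ⟨b1 _ _ _ h, h⟩⟩
  · intro z
    rw [e2, setOf_eq_sepr (ok := ok) _ b2]
    have := PRRel.defR (𝓜 := 𝓜) (ok := ok) (R := fun c v z => ∃ n, n ∊ B c v ∧ ∃ σ, σ ∊ B c v ∧
      ∃ τ, τ ∊ B c v ∧ (P c v).lt n σ τ ∧ z = opair n (opair σ τ)) c v
    rw [mem_sepr]
    exact ⟨fun h => h.2, fun h => ⟨b2 _ _ _ h, h⟩⟩
  · intro z
    rw [e3, setOf_eq_sepr (ok := ok) _ b3]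
    have := PRRel.defR (𝓜 := 𝓜) (ok := ok) (R := fun c v z => ∃ m, m ∊ B c v ∧ ∃ n, n ∊ B c v ∧
      ∃ f, f ∊ B c v ∧ ∃ σ, σ ∊ B c v ∧ ∃ τ, τ ∊ B c v ∧ (P c v).map m n f σ τ ∧
      z = opair (opair m (opair n f)) (opair σ τ)) c v
    rw [mem_sepr]
    exact ⟨fun h => h.2, fun h => ⟨b3 _ _ _ h, h⟩⟩
  · intro z
    rw [e4, setOf_eq_sepr (ok := ok) _ b4]
    have := PRRel.defR (𝓜 := 𝓜) (ok := ok) (R := fun c v z => ∃ n, n ∊ B c v ∧ ∃ σ, σ ∊ B c v ∧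
      ∃ a, a ∊ B c v ∧ (P c v).supp n σ a ∧ z = opair (opair n σ) a) c v
    rw [mem_sepr]
    exact ⟨fun h => h.2, fun h => ⟨b4 _ _ _ h, h⟩⟩

instance PR.code [PDPR 𝓜 ok P] : PR 𝓜 ok (fun c v => PD.code (P c v)) := PDPR.code_aux.1

theorem PDPR.codes [PDPR 𝓜 ok P] (c : C) (v : Fin n → 𝓜 c) :
    PD.Codes (PD.code (P c v)) (P c v) := (PDPR.code_aux (ok := ok)).2 c v

end Code

end PDPR

end DilRec

set_option synthInstance.maxSize 2000
set_option synthInstance.maxHeartbeats 200000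

namespace DilRec

universe u v

/-! ### Primitive recursive operations on predilators -/

section Operations

open PD LO

theorem eq_opair_iff {M : Type u} [PRSLang.Structure M] [PRSomega M] {φ : M → M → Prop} {z : M} :
    (∃ x y, z = opair x y ∧ φ x y) ↔ z = opair (fst z) (snd z) ∧ φ (fst z) (snd z) := by
  constructor
  · rintro ⟨x, y, rfl, h⟩; simpa using h
  · rintro ⟨h1, h2⟩; exact ⟨_, _, h1, h2⟩

theorem eq_opair_iff' {M : Type u} [PRSLang.Structure M] [PRSomega M] {φ : M → M → Prop} {z : M} :
    (∃ x y, φ x y ∧ z = opair x y) ↔ z = opair (fst z) (snd z) ∧ φ (fst z) (snd z) := by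
  simp only [and_comm (a := φ _ _), eq_opair_iff]

variable {C : Type v} {𝓜 : C → Type u} [∀ c, PRSLang.Structure (𝓜 c)] [∀ c, PRSomega (𝓜 c)]
variable {ok : Prop} {n m : ℕ} {X : ∀ c, (Fin n → 𝓜 c) → LO (𝓜 c)}
  {P P' : ∀ c, (Fin n → 𝓜 c) → PD (𝓜 c)} {r s t a b d : ∀ c, (Fin n → 𝓜 c) → 𝓜 c}

theorem PDPR.subst {P : ∀ c, (Fin m → 𝓜 c) → PD (𝓜 c)} [hP : PDPR 𝓜 ok P]
    (G : Fin m → ∀ c, (Fin n → 𝓜 c) → 𝓜 c) (h : ∀ i, PR 𝓜 ok (G i)) :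
    PDPR 𝓜 ok (fun c v => P c (fun i => G i c v)) where
  obj := PRRel.subst (ht := hP.obj) (Fin.cases (fun _ v => v 0) (Fin.cases (fun _ v => v 1)
    fun i c v => G i c fun j => v j.succ.succ))
    (Fin.cases (PR.var _) (Fin.cases (PR.var _) fun i => PR.weaken (ht := h i) _))
  lt := PRRel.subst (ht := hP.lt) (Fin.cases (fun _ v => v 0) (Fin.cases (fun _ v => v 1)
    (Fin.cases (fun _ v => v 2) fun i c v => G i c fun j => v j.succ.succ.succ)))
    (Fin.cases (PR.var _) (Fin.cases (PR.var _) (Fin.cases (PR.var _) fun i =>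
      PR.weaken (ht := h i) _)))
  supp := PRRel.subst (ht := hP.supp) (Fin.cases (fun _ v => v 0) (Fin.cases (fun _ v => v 1)
    (Fin.cases (fun _ v => v 2) fun i c v => G i c fun j => v j.succ.succ.succ)))
    (Fin.cases (PR.var _) (Fin.cases (PR.var _) (Fin.cases (PR.var _) fun i =>
      PR.weaken (ht := h i) _)))
  map := PRRel.subst (ht := hP.map) (Fin.cases (fun _ v => v 0) (Fin.cases (fun _ v => v 1)
    (Fin.cases (fun _ v => v 2) (Fin.cases (fun _ v => v 3) (Fin.cases (fun _ v => v 4)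
    fun i c v => G i c fun j => v j.succ.succ.succ.succ.succ)))))
    (Fin.cases (PR.var _) (Fin.cases (PR.var _) (Fin.cases (PR.var _) (Fin.cases (PR.var _)
      (Fin.cases (PR.var _) fun i => PR.weaken (ht := h i) _)))))
  bound := by
    obtain ⟨B, hB, hb⟩ := hP.bound
    exact ⟨fun c v => B c (fun i => G i c v), PR.subst (ht := hB) G h, fun c v => hb _ _⟩

/-- The renaming `ρ` is arbitrary, so that this can be put into the local context and be used by
instance search below any number of binders. The next lemma plays the same role for functions. -/
theorem PDPR.inst {Q : ∀ c, (Fin n → 𝓜 c) → 𝓜 c → PD (𝓜 c)}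
    (hQ : PDPR 𝓜 ok (n := n + 1) (fun c w => Q c (fun i => w i.succ) (w 0)))
    (ρ : Fin n → Fin m) (s : ∀ c, (Fin m → 𝓜 c) → 𝓜 c) [hs : PR 𝓜 ok s] :
    PDPR 𝓜 ok (fun c w => Q c (fun i => w (ρ i)) (s c w)) :=
  PDPR.subst (hP := hQ) (Matrix.vecCons s fun i _ v => v (ρ i))
    (Fin.cases hs fun _ => PR.var _)

theorem PR.inst₂ {q : ∀ c, (Fin n → 𝓜 c) → 𝓜 c → 𝓜 c → 𝓜 c}
    (hq : PR 𝓜 ok (n := n + 2) (fun c w => q c (fun i => w i.succ.succ) (w 1) (w 0)))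
    (ρ : Fin n → Fin m) (s t : ∀ c, (Fin m → 𝓜 c) → 𝓜 c) [hs : PR 𝓜 ok s] [ht : PR 𝓜 ok t] :
    PR 𝓜 ok (fun c w => q c (fun i => w (ρ i)) (s c w) (t c w)) :=
  PR.subst (ht := hq) (Matrix.vecCons t (Matrix.vecCons s fun i _ v => v (ρ i)))
    (Fin.cases ht (Fin.cases hs fun _ => PR.var _))

instance PRRel.tr [PDPR 𝓜 ok P] [PR 𝓜 ok s] [PR 𝓜 ok t] :
    PRRel 𝓜 ok (fun c v => (P c v).Tr (s c v) (t c v)) := by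
  unfold PD.Tr; infer_instance

/-- The only quantifier that is not bounded by B concerns the sum N of m and n, and N is determined
as `oadd m n`. -/
instance PRRel.ll [hP : PDPR 𝓜 ok P] [PR 𝓜 ok s] [PR 𝓜 ok t] :
    PRRel 𝓜 ok (fun c v => (P c v).Ll (s c v) (t c v)) := by
  obtain ⟨B, hB, hb⟩ := hP.bound
  refine PRRel.congr (R := fun c v =>
    s c v = DilRec.opair (DilRec.fst (s c v)) (DilRec.snd (s c v)) ∧
    t c v = DilRec.opair (DilRec.fst (t c v)) (DilRec.snd (t c v)) ∧
    (P c v).Tr (DilRec.fst (s c v)) (DilRec.snd (s c v)) ∧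
    (P c v).Tr (DilRec.fst (t c v)) (DilRec.snd (t c v)) ∧
    ∀ f, f ∊ B c v → ∀ g, g ∊ B c v → ∀ σ', σ' ∊ B c v → ∀ τ', τ' ∊ B c v →
      NatHom (DilRec.snd (s c v)) (DilRec.oadd (DilRec.snd (s c v)) (DilRec.snd (t c v))) f →
      NatHom (DilRec.snd (t c v)) (DilRec.oadd (DilRec.snd (s c v)) (DilRec.snd (t c v))) g →
      (P c v).map (DilRec.snd (s c v)) (DilRec.oadd (DilRec.snd (s c v)) (DilRec.snd (t c v))) f
        (DilRec.fst (s c v)) σ' →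
      (P c v).map (DilRec.snd (t c v)) (DilRec.oadd (DilRec.snd (s c v)) (DilRec.snd (t c v))) g
        (DilRec.fst (t c v)) τ' →
      (P c v).lt (DilRec.oadd (DilRec.snd (s c v)) (DilRec.snd (t c v))) σ' τ') fun c v => ?_
  constructor
  · rintro ⟨σ, m, τ, n, h1, h2, hσ, hτ, h⟩
    simp only [h1, h2, fst_opair, snd_opair, true_and]
    refine ⟨hσ, hτ, fun f _ g _ σ' _ τ' _ hf hg => h _ f g σ' τ' ?_ hf hg⟩
    exact (isAdd_iff (isOrd_of_mem_om hg.1).1).2 rfl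
  · rintro ⟨h1, h2, hσ, hτ, h⟩
    refine ⟨_, _, _, _, h1, h2, hσ, hτ, fun N f g σ' τ' hN hf hg hf' hg' => ?_⟩
    have e := (isAdd_iff (isOrd_of_mem_om hg.1).1).1 hN
    subst e
    have b1 := (hb c v).2.2.1 _ _ _ _ _ hf'
    have b2 := (hb c v).2.2.1 _ _ _ _ _ hg'
    exact h _ b1.2.2.1 _ b2.2.2.1 _ b1.2.2.2.2 _ b2.2.2.2.2 hf hg hf' hg'

/-- An element of the index order is a set of trace elements. To quantify over such sets without
power sets, one computes the class from a representative and quantifies over representatives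
instead. -/
theorem index_dom_aux [hP : PDPR 𝓜 ok P] : ∃ cl : ∀ c, (Fin n → 𝓜 c) → 𝓜 c → 𝓜 c → 𝓜 c,
    PR 𝓜 ok (n := n + 2) (fun c w => cl c (fun i => w i.succ.succ) (w 1) (w 0)) ∧
    ∀ c v σ m x, (∀ s, s ∊ x ↔ (∃ τ k, (P c v).Tr τ k ∧ s = opair τ k) ∧
      ¬ (P c v).Ll s (opair σ m) ∧ ¬ (P c v).Ll (opair σ m) s) ↔ x = cl c v σ m := by
  obtain ⟨B, hB, hb⟩ := hP.bound
  refine ⟨fun c v σ m => DilRec.sepr (DilRec.prod (B c v) (B c v)) fun s =>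
    (s = DilRec.opair (DilRec.fst s) (DilRec.snd s) ∧
      (P c v).Tr (DilRec.fst s) (DilRec.snd s)) ∧
      ¬ (P c v).Ll s (DilRec.opair σ m) ∧ ¬ (P c v).Ll (DilRec.opair σ m) s, inferInstance,
    fun c v σ m x => ?_⟩
  have hd : DefR fun s => (s = DilRec.opair (DilRec.fst s) (DilRec.snd s) ∧
      (P c v).Tr (DilRec.fst s) (DilRec.snd s)) ∧
      ¬ (P c v).Ll s (DilRec.opair σ m) ∧ ¬ (P c v).Ll (DilRec.opair σ m) s :=
    PRRel.defR (𝓜 := 𝓜) (ok := ok) (n := n + 2) (R := fun c w s =>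
      (s = DilRec.opair (DilRec.fst s) (DilRec.snd s) ∧
      (P c (fun i => w i.succ.succ)).Tr (DilRec.fst s) (DilRec.snd s)) ∧
      ¬ (P c (fun i => w i.succ.succ)).Ll s (DilRec.opair (w 1) (w 0)) ∧
      ¬ (P c (fun i => w i.succ.succ)).Ll (DilRec.opair (w 1) (w 0)) s) c
      (Matrix.vecCons m (Matrix.vecCons σ v))
  simp only [eq_opair_iff']
  rw [ext_iff']
  refine forall_congr' fun s => ?_
  rw [mem_sepr (φ := fun s => (s = DilRec.opair (DilRec.fst s) (DilRec.snd s) ∧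
      (P c v).Tr (DilRec.fst s) (DilRec.snd s)) ∧
      ¬ (P c v).Ll s (DilRec.opair σ m) ∧ ¬ (P c v).Ll (DilRec.opair σ m) s)]
  rw [and_iff_right_of_imp (a := s ∊ _)]
  rintro ⟨⟨h1, h2, -⟩, -⟩
  rw [h1]
  exact opair_mem_prod.2 ((hb c v).1 _ _ h2).symm

instance LOPR.index [hP : PDPR 𝓜 ok P] : LOPR 𝓜 ok (fun c v => (P c v).index) := by
  obtain ⟨B, hB, hb⟩ := hP.bound
  obtain ⟨cl, hcl, hc⟩ := index_dom_aux (ok := ok) (P := P)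
  have hcl' := fun {m} (ρ : Fin n → Fin m) (s t) [PR 𝓜 ok s] [PR 𝓜 ok t] =>
    PR.inst₂ hcl ρ s t
  have hdom : PRRel 𝓜 ok (n := n + 1) fun c w => (P c fun i => w i.succ).index.dom (w 0) := by
    simp only [PD.index, hc]
    refine PRRel.congr (R := fun c w => ∃ σ, σ ∊ B c (fun i => w i.succ) ∧ ∃ k,
      k ∊ B c (fun i => w i.succ) ∧ (P c fun i => w i.succ).Tr σ k ∧
      w 0 = cl c (fun i => w i.succ) σ k) fun c w => ?_
    exact ⟨fun ⟨σ, k, h⟩ => ⟨σ, ((hb c _).1 _ _ h.1.1).2, k, ((hb c _).1 _ _ h.1.1).1, h⟩,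
      fun ⟨σ, _, k, _, h⟩ => ⟨σ, k, h⟩⟩
  refine ⟨hdom, ?_⟩
  have h0 : PRRel 𝓜 ok (n := n + 2) fun c w => (P c fun i => w i.succ.succ).index.dom (w 0) :=
    PRRel.subst (ht := hdom) (Fin.cases (fun c w => w 0) fun i c w => w i.succ.succ)
      (Fin.cases (PR.var _) fun i => PR.var _)
  have h1 : PRRel 𝓜 ok (n := n + 2) fun c w => (P c fun i => w i.succ.succ).index.dom (w 1) :=
    PRRel.subst (ht := hdom) (Fin.cases (fun c w => w 1) fun i c w => w i.succ.succ)
      (Fin.cases (PR.var _) fun i => PR.var _)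
  refine PRRel.congr (R := fun c w => (P c fun i => w i.succ.succ).index.dom (w 0) ∧
    (P c fun i => w i.succ.succ).index.dom (w 1) ∧ ∃ s, s ∊ w 0 ∧ ∃ t, t ∊ w 1 ∧
      (P c fun i => w i.succ.succ).Ll s t) fun c w => ?_
  simp only [PD.index, exists_and_left]

instance LOBD.index [hP : PDPR 𝓜 ok P] : LOBD 𝓜 ok (fun c v => (P c v).index) := by
  obtain ⟨B, hB, hb⟩ := hP.bound
  obtain ⟨cl, hcl, hc⟩ := index_dom_aux (ok := ok) (P := P)
  have hcl' := fun {m} (ρ : Fin n → Fin m) (s t) [PR 𝓜 ok s] [PR 𝓜 ok t] =>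
    PR.inst₂ hcl ρ s t
  refine ⟨fun c v => DilRec.bUnion (B c v) fun σ => DilRec.imag (B c v) fun k => cl c v σ k,
    inferInstance, fun c v x => ?_⟩
  have hd1 : ∀ σ, DefF fun k => cl c v σ k := fun σ =>
    PR.defF (𝓜 := 𝓜) (ok := ok) (n := n + 1) (f := fun c w k => cl c (fun i => w i.succ) (w 0) k)
      c (Matrix.vecCons σ v)
  have hd2 : DefF fun σ => DilRec.imag (B c v) fun k => cl c v σ k :=
    PR.defF (𝓜 := 𝓜) (ok := ok) (f := fun c v σ => DilRec.imag (B c v) fun k => cl c v σ k) c v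
  rintro ⟨σ, k, h, e⟩
  exact mem_bUnion.2 ⟨σ, ((hb c _).1 _ _ h.1).2, mem_imag.2 ⟨k, ((hb c _).1 _ _ h.1).1,
    (hc c v σ k x).1 e⟩⟩

instance PRRel.restrictObj [hP : PDPR 𝓜 ok P] [PR 𝓜 ok a] [PR 𝓜 ok s] [PR 𝓜 ok t] :
    PRRel 𝓜 ok (fun c v => (P c v).RestrictObj (a c v) (s c v) (t c v)) := by
  obtain ⟨B, hB, hb⟩ := hP.bound
  refine PRRel.congr (R := fun c v => ∃ x, x ∊ B c v ∧ ∃ m, m ∊ B c v ∧ ∃ e, e ∊ B c v ∧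
    ∃ σ₀, σ₀ ∊ B c v ∧ (P c v).supp (s c v) (t c v) x ∧ (LO.ofOrd (s c v)).IsEn x m e ∧
      (P c v).map m (s c v) e σ₀ (t c v) ∧ DilRec.opair σ₀ m ∊ a c v) fun c v => ?_
  constructor
  · rintro ⟨x, m, e, σ₀, h1, h2, h3, h4⟩
    have b1 := (hb c v).2.2.2 _ _ _ h1
    have b2 := (hb c v).2.2.1 _ _ _ _ _ h3
    exact ⟨x, b1.2.2, m, b2.1, e, b2.2.2.1, σ₀, b2.2.2.2.1, h1, h2, h3, h4⟩
  · rintro ⟨x, -, m, -, e, -, σ₀, -, h⟩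
    exact ⟨x, m, e, σ₀, h⟩

instance PDPR.restrict [hP : PDPR 𝓜 ok P] [PR 𝓜 ok a] :
    PDPR 𝓜 ok (fun c v => (P c v).restrict (a c v)) where
  obj := by unfold PD.restrict; infer_instance
  lt := by unfold PD.restrict; infer_instance
  map := by unfold PD.restrict; infer_instance
  supp := by unfold PD.restrict; infer_instance
  bound := by
    obtain ⟨B, hB, hb⟩ := hP.bound
    refine ⟨B, hB, fun c v => ⟨?_, fun n σ τ h => (hb c v).2.1 _ _ _ h.2.2,
      fun m n f σ τ h => (hb c v).2.2.1 _ _ _ _ _ h.2, fun n σ a h => (hb c v).2.2.2 _ _ _ h.2⟩⟩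
    rintro n σ ⟨a, m, e, σ₀, h1, -⟩
    have := (hb c v).2.2.2 _ _ _ h1
    exact ⟨this.1, this.2.1⟩

theorem PDPR.sum {I : ∀ c, (Fin n → 𝓜 c) → LO (𝓜 c)} {Q : ∀ c, (Fin n → 𝓜 c) → 𝓜 c → PD (𝓜 c)}
    [hI : LOPR 𝓜 ok I] [hI' : LOBD 𝓜 ok I]
    [hQ : PDPR 𝓜 ok (n := n + 1) (fun c w => Q c (fun i => w i.succ) (w 0))] :
    PDPR 𝓜 ok (fun c v => PD.sum (I c v) (Q c v)) where
  obj := by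
    have hQ' := fun {m} (ρ : Fin n → Fin m) (s) [PR 𝓜 ok s] => PDPR.inst hQ ρ s
    refine PRRel.congr (R := fun c (w : Fin (n + 2) → 𝓜 c) => w 1 = DilRec.opair (DilRec.fst (w 1)) (DilRec.snd (w 1)) ∧
      (I c fun i => w i.succ.succ).dom (DilRec.fst (w 1)) ∧
      (Q c (fun i => w i.succ.succ) (DilRec.fst (w 1))).obj (w 0) (DilRec.snd (w 1))) fun c w => ?_
    rw [← eq_opair_iff (φ := fun α σ => (I c fun i => w i.succ.succ).dom α ∧
      (Q c (fun i => w i.succ.succ) α).obj (w 0) σ)]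
    exact ⟨fun ⟨α, σ, h1, h2, h3⟩ => ⟨α, σ, h3, h1, h2⟩, fun ⟨α, σ, h3, h1, h2⟩ =>
      ⟨α, σ, h1, h2, h3⟩⟩
  lt := by
    have hQ' := fun {m} (ρ : Fin n → Fin m) (s) [PR 𝓜 ok s] => PDPR.inst hQ ρ s
    refine PRRel.congr (R := fun c (w : Fin (n + 3) → 𝓜 c) => w 1 = DilRec.opair (DilRec.fst (w 1)) (DilRec.snd (w 1)) ∧
      w 2 = DilRec.opair (DilRec.fst (w 2)) (DilRec.snd (w 2)) ∧
      (I c fun i => w i.succ.succ.succ).dom (DilRec.fst (w 1)) ∧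
      (I c fun i => w i.succ.succ.succ).dom (DilRec.fst (w 2)) ∧
      (Q c (fun i => w i.succ.succ.succ) (DilRec.fst (w 1))).obj (w 0) (DilRec.snd (w 1)) ∧
      (Q c (fun i => w i.succ.succ.succ) (DilRec.fst (w 2))).obj (w 0) (DilRec.snd (w 2)) ∧
      ((I c fun i => w i.succ.succ.succ).lt (DilRec.fst (w 1)) (DilRec.fst (w 2)) ∨
        (DilRec.fst (w 1) = DilRec.fst (w 2) ∧
        (Q c (fun i => w i.succ.succ.succ) (DilRec.fst (w 1))).lt (w 0) (DilRec.snd (w 1))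
          (DilRec.snd (w 2))))) fun c w => ?_
    constructor
    · rintro ⟨α, σ, β, τ, hα, hβ, hσ, hτ, e1, e2, h⟩
      simp only [e1, e2, fst_opair, snd_opair, true_and]
      exact ⟨hα, hβ, hσ, hτ, h⟩
    · rintro ⟨e1, e2, hα, hβ, hσ, hτ, h⟩
      exact ⟨_, _, _, _, hα, hβ, hσ, hτ, e1, e2, h⟩
  map := by
    have hQ' := fun {m} (ρ : Fin n → Fin m) (s) [PR 𝓜 ok s] => PDPR.inst hQ ρ s
    refine PRRel.congr (R := fun c (w : Fin (n + 5) → 𝓜 c) => w 3 = DilRec.opair (DilRec.fst (w 3)) (DilRec.snd (w 3)) ∧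
      w 4 = DilRec.opair (DilRec.fst (w 3)) (DilRec.snd (w 4)) ∧
      (I c fun i => w i.succ.succ.succ.succ.succ).dom (DilRec.fst (w 3)) ∧
      (Q c (fun i => w i.succ.succ.succ.succ.succ) (DilRec.fst (w 3))).map (w 0) (w 1) (w 2)
        (DilRec.snd (w 3)) (DilRec.snd (w 4))) fun c w => ?_
    constructor
    · rintro ⟨α, σ, τ, hα, h, e1, e2⟩
      simp only [e1, e2, fst_opair, snd_opair, true_and]
      exact ⟨hα, h⟩
    · rintro ⟨e1, e2, hα, h⟩
      exact ⟨_, _, _, hα, h, e1, e2⟩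
  supp := by
    have hQ' := fun {m} (ρ : Fin n → Fin m) (s) [PR 𝓜 ok s] => PDPR.inst hQ ρ s
    refine PRRel.congr (R := fun c (w : Fin (n + 3) → 𝓜 c) => w 1 = DilRec.opair (DilRec.fst (w 1)) (DilRec.snd (w 1)) ∧
      (I c fun i => w i.succ.succ.succ).dom (DilRec.fst (w 1)) ∧
      (Q c (fun i => w i.succ.succ.succ) (DilRec.fst (w 1))).supp (w 0) (DilRec.snd (w 1)) (w 2)) fun c w => ?_
    rw [← eq_opair_iff (φ := fun α σ => (I c fun i => w i.succ.succ.succ).dom α ∧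
      (Q c (fun i => w i.succ.succ.succ) α).supp (w 0) σ (w 2))]
    exact ⟨fun ⟨α, σ, h1, h2, h3⟩ => ⟨α, σ, h3, h1, h2⟩, fun ⟨α, σ, h3, h1, h2⟩ =>
      ⟨α, σ, h1, h2, h3⟩⟩
  bound := by
    obtain ⟨J, hJ, hj⟩ := hI'.bound
    obtain ⟨B, hB, hb⟩ := hQ.bound
    have hB' : ∀ {m} (ρ : Fin n → Fin m) (s) [PR 𝓜 ok s],
        PR 𝓜 ok fun c w => B c (Matrix.vecCons (s c w) fun i => w (ρ i)) := fun ρ s hs =>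
      PR.congr (hs := PR.subst (ht := hB) (Matrix.vecCons s fun i _ v => v (ρ i))
        (Fin.cases hs fun _ => PR.var _)) fun c w => by
          congr 1; funext i; cases i using Fin.cases <;> rfl
    -- The first part of each union bounds the arguments m, n, f and the supports; the second one
    -- bounds the elements of the sum, which are pairs with an index.
    refine ⟨fun c v => DilRec.bUnion (J c v) fun α => DilRec.union₂ (B c (Matrix.vecCons α v))
      (DilRec.imag (B c (Matrix.vecCons α v)) fun x => DilRec.opair α x),
      inferInstance, fun c v => ?_⟩
    have hd1 : ∀ α : 𝓜 c, DefF fun x => DilRec.opair α x := fun α => inferInstance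
    have hd2 : DefF fun α => DilRec.union₂ (B c (Matrix.vecCons α v))
      (DilRec.imag (B c (Matrix.vecCons α v)) fun x => DilRec.opair α x) :=
      PR.defF (𝓜 := 𝓜) (ok := ok) (f := fun c v α => DilRec.union₂ (B c (Matrix.vecCons α v))
        (DilRec.imag (B c (Matrix.vecCons α v)) fun x => DilRec.opair α x)) c v
    have hb' : ∀ α, (Q c v α).BoundedBy (B c (Matrix.vecCons α v)) := fun α =>
      hb c (Matrix.vecCons α v)
    have k1 : ∀ {α x}, (I c v).dom α → x ∊ B c (Matrix.vecCons α v) → x ∊ DilRec.bUnion (J c v)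
        fun α => DilRec.union₂ (B c (Matrix.vecCons α v))
        (DilRec.imag (B c (Matrix.vecCons α v)) fun x => DilRec.opair α x) := fun hα hx =>
      mem_bUnion.2 ⟨_, hj _ _ _ hα, mem_union₂.2 (Or.inl hx)⟩
    have k2 : ∀ {α x}, (I c v).dom α → x ∊ B c (Matrix.vecCons α v) → opair α x ∊
        DilRec.bUnion (J c v) fun α => DilRec.union₂ (B c (Matrix.vecCons α v))
        (DilRec.imag (B c (Matrix.vecCons α v)) fun x => DilRec.opair α x) := fun hα hx =>
      mem_bUnion.2 ⟨_, hj _ _ _ hα, mem_union₂.2 (Or.inr (mem_imag.2 ⟨_, hx, rfl⟩))⟩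
    refine ⟨?_, ?_, ?_, ?_⟩
    · rintro n _ ⟨α, σ, hα, h, rfl⟩
      have h1 := (hb' α).1 _ _ h
      exact ⟨k1 hα h1.1, k2 hα h1.2⟩
    · rintro n _ _ ⟨α, σ, β, τ, hα, hβ, hσ, hτ, rfl, rfl, -⟩
      exact ⟨k1 hα ((hb' α).1 _ _ hσ).1, k2 hα ((hb' α).1 _ _ hσ).2,
        k2 hβ ((hb' β).1 _ _ hτ).2⟩
    · rintro m n f _ _ ⟨α, σ, τ, hα, h, rfl, rfl⟩
      have h1 := (hb' α).2.2.1 _ _ _ _ _ h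
      exact ⟨k1 hα h1.1, k1 hα h1.2.1, k1 hα h1.2.2.1, k2 hα h1.2.2.2.1, k2 hα h1.2.2.2.2⟩
    · rintro n _ a ⟨α, σ, hα, h, rfl⟩
      have h1 := (hb' α).2.2.2 _ _ _ h
      exact ⟨k1 hα h1.1, k2 hα h1.2.1, k1 hα h1.2.2⟩

open Classical in
theorem PDPR.ite {R : ∀ c, (Fin n → 𝓜 c) → Prop} [hR : PRRel 𝓜 ok R] [hP : PDPR 𝓜 ok P]
    [hP' : PDPR 𝓜 ok P'] : PDPR 𝓜 ok (fun c v => if R c v then P c v else P' c v) where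
  obj := PRRel.congr (R := fun c w => (R c (fun i => w i.succ.succ) ∧
      (P c fun i => w i.succ.succ).obj (w 0) (w 1)) ∨ (¬ R c (fun i => w i.succ.succ) ∧
      (P' c fun i => w i.succ.succ).obj (w 0) (w 1))) fun c w => by split_ifs with h <;> simp [h]
  lt := PRRel.congr (R := fun c w => (R c (fun i => w i.succ.succ.succ) ∧
      (P c fun i => w i.succ.succ.succ).lt (w 0) (w 1) (w 2)) ∨
      (¬ R c (fun i => w i.succ.succ.succ) ∧
      (P' c fun i => w i.succ.succ.succ).lt (w 0) (w 1) (w 2))) fun c w => by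
    split_ifs with h <;> simp [h]
  map := PRRel.congr (R := fun c w => (R c (fun i => w i.succ.succ.succ.succ.succ) ∧
      (P c fun i => w i.succ.succ.succ.succ.succ).map (w 0) (w 1) (w 2) (w 3) (w 4)) ∨
      (¬ R c (fun i => w i.succ.succ.succ.succ.succ) ∧
      (P' c fun i => w i.succ.succ.succ.succ.succ).map (w 0) (w 1) (w 2) (w 3) (w 4)))
      fun c w => by split_ifs with h <;> simp [h]
  supp := PRRel.congr (R := fun c w => (R c (fun i => w i.succ.succ.succ) ∧
      (P c fun i => w i.succ.succ.succ).supp (w 0) (w 1) (w 2)) ∨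
      (¬ R c (fun i => w i.succ.succ.succ) ∧
      (P' c fun i => w i.succ.succ.succ).supp (w 0) (w 1) (w 2))) fun c w => by
    split_ifs with h <;> simp [h]
  bound := by
    obtain ⟨B, hB, hb⟩ := hP.bound
    obtain ⟨B', hB', hb'⟩ := hP'.bound
    refine ⟨fun c v => DilRec.union₂ (B c v) (B' c v), inferInstance, fun c v => ?_⟩
    dsimp only
    split_ifs
    · obtain ⟨h1, h2, h3, h4⟩ := hb c v
      refine ⟨fun _ _ h => ?_, fun _ _ _ h => ?_, fun _ _ _ _ _ h => ?_, fun _ _ _ h => ?_⟩ <;>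
        simp only [mem_union₂]
      · simp [h1 _ _ h]
      · simp [h2 _ _ _ h]
      · simp [h3 _ _ _ _ _ h]
      · simp [h4 _ _ _ h]
    · obtain ⟨h1, h2, h3, h4⟩ := hb' c v
      refine ⟨fun _ _ h => ?_, fun _ _ _ h => ?_, fun _ _ _ _ _ h => ?_, fun _ _ _ h => ?_⟩ <;>
        simp only [mem_union₂]
      · simp [h1 _ _ h]
      · simp [h2 _ _ _ h]
      · simp [h3 _ _ _ _ _ h]
      · simp [h4 _ _ _ h]

instance PDPR.add [hP : PDPR 𝓜 ok P] [hP' : PDPR 𝓜 ok P'] :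
    PDPR 𝓜 ok (fun c v => (P c v).add (P' c v)) := by
  unfold PD.add
  exact PDPR.sum (hQ := PDPR.ite (P := fun c w => P c fun i => w i.succ)
    (P' := fun c w => P' c fun i => w i.succ))

instance PDPR.partialSum [hP : PDPR 𝓜 ok P] [PR 𝓜 ok s] :
    PDPR 𝓜 ok (fun c v => (P c v).partialSum (s c v)) := by
  unfold PD.partialSum
  exact PDPR.sum (hQ := PDPR.restrict (P := fun c w => P c fun i => w i.succ) (a := fun c w => w 0))

instance PRRel.isOne [hP : PDPR 𝓜 ok P] : PRRel 𝓜 ok (fun c v => (P c v).IsOne) := by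
  obtain ⟨B, hB, hb⟩ := hP.bound
  refine PRRel.congr (R := fun c v => ∀ n, n ∊ DilRec.om (𝓜 c) → ∃ σ, σ ∊ B c v ∧
    (P c v).obj n σ ∧ ∀ τ, τ ∊ B c v → (P c v).obj n τ → τ = σ) fun c v => ?_
  refine forall_congr' fun n => forall_congr' fun _ => ?_
  exact ⟨fun ⟨σ, h1, h2⟩ => ⟨σ, ((hb c v).1 _ _ h1).2, h1, fun τ _ h => h2 τ h⟩,
    fun ⟨σ, _, h1, h2⟩ => ⟨σ, h1, fun τ h => h2 τ ((hb c v).1 _ _ h).2 h⟩⟩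

theorem isCoeff_iff {M : Type u} [PRSLang.Structure M] [PRSomega M] {P : PD M} {B n σ i : M}
    (hb : P.BoundedBy B) : P.IsCoeff n σ i ↔ i ∊ n ∧ ∀ f, f ∊ B → ∀ g, g ∊ B → ∀ σ', σ' ∊ B →
      ∀ τ', τ' ∊ B → NatHom n (oadd n n) f → NatHom n (oadd n n) g → ap f i ∊ ap g i →
        P.map n (oadd n n) f σ σ' → P.map n (oadd n n) g σ τ' → P.lt (oadd n n) σ' τ' := by
  refine and_congr_right fun hi => ⟨?_, ?_⟩
  · intro h f _ g _ σ' _ τ' _ hf hg hl hf' hg'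
    exact h _ f g _ _ σ' τ' ((isAdd_iff (isOrd_of_mem_om hf.1).1).2 rfl) hf hg
      (hf.opair_iff.2 ⟨hi, rfl⟩) (hg.opair_iff.2 ⟨hi, rfl⟩) hl hf' hg'
  · intro h N f g x y σ' τ' hN hf hg hx hy hxy hf' hg'
    have e := (isAdd_iff (isOrd_of_mem_om hf.1).1).1 hN
    subst e
    obtain ⟨-, rfl⟩ := hf.opair_iff.1 hx
    obtain ⟨-, rfl⟩ := hg.opair_iff.1 hy
    have b1 := hb.2.2.1 _ _ _ _ _ hf'
    have b2 := hb.2.2.1 _ _ _ _ _ hg'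
    exact h _ b1.2.2.1 _ b2.2.2.1 _ b1.2.2.2.2 _ b2.2.2.2.2 hf hg hxy hf' hg'

instance PRRel.isCoeff [hP : PDPR 𝓜 ok P] [PR 𝓜 ok a] [PR 𝓜 ok s] [PR 𝓜 ok t] :
    PRRel 𝓜 ok (fun c v => (P c v).IsCoeff (a c v) (s c v) (t c v)) := by
  obtain ⟨B, hB, hb⟩ := hP.bound
  simp only [fun c v => isCoeff_iff (hb c v)]
  infer_instance

end Operations

end DilRec

set_option synthInstance.maxSize 2000
set_option synthInstance.maxHeartbeats 200000

namespace DilRec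

universe u v

/-! ### Extensions, separation of variables and predecessor sets are primitive recursive -/

section Separated

open PD LO

section Model

variable {M : Type u} [PRSLang.Structure M] [PRSomega M] {P : PD M} {X : LO M} {B f g h z w : M}

theorem forall_comp_iff : (∀ i j x, opair i j ∊ f → opair j x ∊ g → opair i x ∊ h) ↔
    ∀ i, i ∊ trcl f → ∀ j, j ∊ trcl f → ∀ x, x ∊ trcl g → opair i j ∊ f → opair j x ∊ g →
      opair i x ∊ h :=
  ⟨fun H i _ j _ x _ => H i j x, fun H i j x h1 h2 =>
    H i (mem_trcl_opair h1).1 j (mem_trcl_opair h1).2 x (mem_trcl_opair h2).2 h1 h2⟩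

/-- The set a is a component of z, and an enumeration of it is a finite subset of ω × a. This leaves
bounded quantifiers only; the next two statements follow the same pattern. -/
theorem PD.ext_dom_iff_bounded : (P.ext X).dom z ↔ z = opair (fst z) (snd z) ∧ ∃ n, n ∊ om M ∧
    ∃ e, e ∊ finSets (prod (om M) (snd z)) ∧ X.IsEn (snd z) n e ∧ P.Tr (fst z) n := by
  constructor
  · rintro ⟨σ, a, n, e, h1, h2, rfl⟩
    simp only [fst_opair, snd_opair, true_and]
    exact ⟨n, h1.nat, e, (h1.mem_finSets fun _ h => h).2, h1, h2⟩
  · rintro ⟨hz, n, -, e, -, h1, h2⟩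
    exact ⟨_, _, n, e, h1, h2, hz⟩

theorem PD.ext_lt_iff_bounded (hb : P.BoundedBy B) : (P.ext X).lt z w ↔
    z = opair (fst z) (snd z) ∧ w = opair (fst w) (snd w) ∧
    ∃ m, m ∊ om M ∧ ∃ n, n ∊ om M ∧ ∃ k, k ∊ om M ∧
    ∃ ea, ea ∊ finSets (prod (om M) (snd z)) ∧ ∃ eb, eb ∊ finSets (prod (om M) (snd w)) ∧
    ∃ ec, ec ∊ finSets (prod (om M) (union₂ (snd z) (snd w))) ∧
    ∃ f, f ∊ B ∧ ∃ g, g ∊ B ∧ ∃ σ', σ' ∊ B ∧ ∃ τ', τ' ∊ B ∧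
    X.IsEn (snd z) m ea ∧ X.IsEn (snd w) n eb ∧ X.IsEn (union₂ (snd z) (snd w)) k ec ∧
    P.Tr (fst z) m ∧ P.Tr (fst w) n ∧
    NatHom m k f ∧ (∀ i j x, opair i j ∊ f → opair j x ∊ ec → opair i x ∊ ea) ∧
    NatHom n k g ∧ (∀ i j x, opair i j ∊ g → opair j x ∊ ec → opair i x ∊ eb) ∧
    P.map m k f (fst z) σ' ∧ P.map n k g (fst w) τ' ∧ P.lt k σ' τ' := by
  constructor
  · rintro ⟨σ, τ, a, b, c, m, n, k, ea, eb, ec, f, g, σ', τ', rfl, rfl, hc, ha, hb', hc', h1, h2,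
      h3, h4, h5, h6, h7, h8, h9⟩
    have e : c = union₂ a b := ext_iff'.2 fun x => by rw [hc, mem_union₂]
    subst e
    simp only [fst_opair, snd_opair, true_and]
    have b1 := hb.2.2.1 _ _ _ _ _ h7
    have b2 := hb.2.2.1 _ _ _ _ _ h8
    exact ⟨m, ha.nat, n, hb'.nat, k, hc'.nat, ea, (ha.mem_finSets fun _ h => h).2, eb,
      (hb'.mem_finSets fun _ h => h).2, ec, (hc'.mem_finSets fun _ h => h).2, f, b1.2.2.1, g,
      b2.2.2.1, σ', b1.2.2.2.2, τ', b2.2.2.2.2, ha, hb', hc', h1, h2, h3, h4, h5, h6, h7, h8, h9⟩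
  · rintro ⟨hz, hw, m, -, n, -, k, -, ea, -, eb, -, ec, -, f, -, g, -, σ', -, τ', -, h⟩
    exact ⟨_, _, _, _, _, m, n, k, ea, eb, ec, f, g, σ', τ', hz, hw, fun x => mem_union₂, h⟩

theorem PD.sepObj_iff_bounded {γ n : M} : P.SepObj γ n z ↔ n ∊ om M ∧ z = opair (fst z) (snd z) ∧
    ∃ k, k ∊ om M ∧ ∃ e, e ∊ finSets (prod (om M) (snd z)) ∧ ∃ i, i ∊ k ∧
    (LO.add γ n).IsEn (snd z) k e ∧ P.Tr (fst z) k ∧ P.IsCoeff k (fst z) i ∧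
    (∃ x, x ∊ γ ∧ opair i (inl x) ∊ e) ∧
      ∀ j, j ∊ k → i ∊ j → ∃ x, x ∊ n ∧ opair j (inr x) ∊ e := by
  refine and_congr_right fun _ => ⟨?_, ?_⟩
  · rintro ⟨σ, a, k, e, i, rfl, h1, h2, h3, h4⟩
    simp only [fst_opair, snd_opair, true_and]
    exact ⟨k, h1.nat, e, (h1.mem_finSets fun _ h => h).2, i, h3.1, h1, h2, h3, h4⟩
  · rintro ⟨hz, k, -, e, -, i, -, h⟩
    exact ⟨_, _, k, e, i, hz, h⟩

theorem PD.sep_map_iff' {γ m n : M} : (P.sep γ).map m n f z w ↔ NatHom m n f ∧ P.SepObj γ m z ∧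
    w = opair (fst z) (imag (snd z) (sumMap f)) := by
  constructor
  · intro h
    obtain ⟨h1, σ, a, h2, -, rfl, rfl⟩ := sep_map_cases h
    simp only [fst_opair, snd_opair]
    exact ⟨h1, h2, trivial⟩
  · rintro ⟨h1, h2, h3⟩
    obtain ⟨σ, a, rfl⟩ := h2.exists_opair
    rw [fst_opair, snd_opair] at h3
    exact (sep_map_iff h1 h2).2 h3

theorem PD.sep_supp_iff' {γ n s : M} : (P.sep γ).supp n z s ↔ P.SepObj γ n z ∧
    s = sepr n (fun i => inr i ∊ snd z) := by
  constructor
  · intro h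
    obtain ⟨σ, a, rfl⟩ := h.1.exists_opair
    obtain ⟨h1, h2⟩ := sep_supp_iff.1 h
    exact ⟨h1, ext_iff'.2 fun i => by rw [h2, mem_sepr, snd_opair]⟩
  · rintro ⟨h1, rfl⟩
    obtain ⟨σ, a, rfl⟩ := h1.exists_opair
    exact sep_supp_iff.2 ⟨h1, fun i => by rw [mem_sepr, snd_opair]⟩

theorem existsUnique_bounded {φ : M → Prop} (hb : ∀ x, φ x → x ∊ B) :
    (∃! x, φ x) ↔ ∃ x, x ∊ B ∧ φ x ∧ ∀ y, y ∊ B → φ y → y = x :=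
  ⟨fun ⟨x, h1, h2⟩ => ⟨x, hb _ h1, h1, fun y _ h => h2 y h⟩,
    fun ⟨x, _, h1, h2⟩ => ⟨x, h1, fun y h => h2 y (hb _ h) h⟩⟩

/-- Being a predilator has to be a primitive recursive property, because the induction over ranked
predecessors below refers to it. Where a morphism or a number is not known to occur in the data, as
in the totality of the action on morphisms, it is bounded by ω and by the finite subsets of ω × ω
rather than by B. -/
theorem PD.isPredilator_iff_bounded (hb : P.BoundedBy B) : P.IsPredilator ↔
    (∀ n, n ∊ B → ∀ σ, σ ∊ B → P.obj n σ → n ∊ om M) ∧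
    (∀ n, n ∊ om M → (∀ x, x ∊ B → ∀ y, y ∊ B → P.lt n x y → P.obj n x ∧ P.obj n y) ∧
      (∀ x, x ∊ B → ¬ P.lt n x x) ∧
      (∀ x, x ∊ B → ∀ y, y ∊ B → ∀ z, z ∊ B → P.lt n x y → P.lt n y z → P.lt n x z) ∧
      (∀ x, x ∊ B → ∀ y, y ∊ B → P.obj n x → P.obj n y → P.lt n x y ∨ x = y ∨ P.lt n y x)) ∧
    (∀ n, n ∊ B → ∀ σ, σ ∊ B → ∀ τ, τ ∊ B → P.lt n σ τ → P.obj n σ ∧ P.obj n τ) ∧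
    (∀ m, m ∊ B → ∀ n, n ∊ B → ∀ f, f ∊ B → ∀ σ, σ ∊ B → ∀ τ, τ ∊ B → P.map m n f σ τ →
      NatHom m n f ∧ P.obj m σ ∧ P.obj n τ) ∧
    (∀ m, m ∊ B → ∀ n, n ∊ om M → ∀ f, f ∊ finSets (prod (om M) (om M)) → ∀ σ, σ ∊ B →
      NatHom m n f → P.obj m σ → ∃ τ, τ ∊ B ∧ P.map m n f σ τ ∧
        ∀ τ', τ' ∊ B → P.map m n f σ τ' → τ' = τ) ∧
    (∀ m, m ∊ B → ∀ n, n ∊ B → ∀ f, f ∊ B → ∀ σ, σ ∊ B → ∀ σ', σ' ∊ B → ∀ τ, τ ∊ B → ∀ τ', τ' ∊ B →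
      P.map m n f σ τ → P.map m n f σ' τ' → P.lt m σ σ' → P.lt n τ τ') ∧
    (∀ n, n ∊ B → ∀ f, f ∊ finSets (prod (om M) (om M)) → ∀ σ, σ ∊ B → NatHom n n f →
      (∀ i, i ∊ n → opair i i ∊ f) → P.obj n σ → P.map n n f σ σ) ∧
    (∀ l, l ∊ B → ∀ m, m ∊ B → ∀ n, n ∊ B → ∀ f, f ∊ B → ∀ g, g ∊ B →
      ∀ h, h ∊ finSets (prod (om M) (om M)) → ∀ σ, σ ∊ B → ∀ τ, τ ∊ B → ∀ ρ, ρ ∊ B →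
      NatHom l n h → (∀ i, i ∊ trcl f → ∀ j, j ∊ trcl f → ∀ k, k ∊ trcl g → opair i j ∊ f →
        opair j k ∊ g → opair i k ∊ h) →
      P.map l m f σ τ → P.map m n g τ ρ → P.map l n h σ ρ) ∧
    (∀ m, m ∊ B → ∀ n, n ∊ B → ∀ f, f ∊ B → ∀ g, g ∊ B → ∀ σ, σ ∊ B → ∀ τ, τ ∊ B → ∀ τ', τ' ∊ B →
      (∀ i, i ∊ trcl f → ∀ x, x ∊ trcl f → ∀ y, y ∊ trcl g → opair i x ∊ f → opair i y ∊ g →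
        x ∊ y ∨ x = y) →
      P.map m n f σ τ → P.map m n g σ τ' → P.lt n τ τ' ∨ τ = τ') ∧
    (∀ n, n ∊ B → ∀ σ, σ ∊ B → ∀ a, a ∊ B → P.supp n σ a → P.obj n σ ∧ ∀ i, i ∊ a → i ∊ n) ∧
    (∀ n, n ∊ B → ∀ σ, σ ∊ B → P.obj n σ → ∃ a, a ∊ B ∧ P.supp n σ a ∧
      ∀ b, b ∊ B → P.supp n σ b → b = a) ∧
    (∀ m, m ∊ B → ∀ n, n ∊ B → ∀ f, f ∊ B → ∀ σ, σ ∊ B → ∀ τ, τ ∊ B → ∀ a, a ∊ B → ∀ b, b ∊ B →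
      P.map m n f σ τ → P.supp m σ a → P.supp n τ b →
      (∀ j, j ∊ b → ∃ i, i ∊ a ∧ opair i j ∊ f) ∧
        ∀ i, i ∊ a → ∀ j, j ∊ trcl f → opair i j ∊ f → j ∊ b) ∧
    (∀ m, m ∊ om M → ∀ n, n ∊ B → ∀ f, f ∊ finSets (prod (om M) (om M)) → ∀ σ, σ ∊ B →
      ∀ a, a ∊ B → NatHom m n f → P.supp n σ a →
      (∀ j, j ∊ a → ∃ i, i ∊ trcl f ∧ opair i j ∊ f) → ∃ σ₀, σ₀ ∊ B ∧ P.map m n f σ₀ σ) := by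
  obtain ⟨bo, bl, bm, bs⟩ := hb
  constructor
  · intro hP
    refine ⟨fun n _ σ _ => hP.obj_nat n σ, fun n hn => ⟨fun x _ y _ => hP.lt_obj n x y,
      fun x _ => (hP.linear n hn).irrefl x, fun x _ y _ z _ => (hP.linear n hn).trans x y z,
      fun x _ y _ => (hP.linear n hn).tri x y⟩, fun n _ σ _ τ _ => hP.lt_obj n σ τ,
      fun m _ n _ f _ σ _ τ _ => hP.map_hom m n f σ τ, fun m _ n _ f _ σ _ h1 h2 =>
      (existsUnique_bounded fun τ h => (bm _ _ _ _ _ h).2.2.2.2).1 (hP.map_fun m n f σ h1 h2),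
      fun m _ n _ f _ σ _ σ' _ τ _ τ' _ => hP.map_lt m n f σ σ' τ τ',
      fun n _ f _ σ _ => hP.map_id n f σ,
      fun l _ m _ n _ f _ g _ h _ σ _ τ _ ρ _ h1 h2 =>
        hP.map_comp l m n f g h σ τ ρ h1 (forall_comp_iff.2 h2),
      fun m _ n _ f _ g _ σ _ τ _ τ' _ h => hP.monotone m n f g σ τ τ' fun i x y h1 h2 =>
        h i (mem_trcl_opair h1).1 x (mem_trcl_opair h1).2 y (mem_trcl_opair h2).2 h1 h2,
      fun n _ σ _ a _ => hP.supp_obj n σ a, fun n _ σ _ h =>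
      (existsUnique_bounded fun τ h => (bs _ _ _ h).2.2).1 (hP.supp_fun n σ h), ?_, ?_⟩
    · intro m _ n _ f _ σ _ τ _ a _ b _ h1 h2 h3
      have := hP.supp_natural m n f σ τ a b h1 h2 h3
      exact ⟨fun j hj => (this j).1 hj, fun i hi j _ hij => (this j).2 ⟨i, hi, hij⟩⟩
    · intro m _ n _ f _ σ _ a _ h1 h2 h3
      obtain ⟨σ₀, h⟩ := hP.support_condition m n f σ a h1 h2 fun j hj =>
        let ⟨i, _, h⟩ := h3 j hj; ⟨i, h⟩
      exact ⟨σ₀, (bm _ _ _ _ _ h).2.2.2.1, h⟩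
  · rintro ⟨h1, h2, h3, h4, h5, h6, h7, h8, h9, h10, h11, h12, h13⟩
    refine ⟨fun n σ h => h1 n (bo _ _ h).1 σ (bo _ _ h).2 h, fun n hn => ?_, ?_, ?_, ?_, ?_, ?_, ?_,
      ?_, ?_, ?_, ?_, ?_⟩
    · obtain ⟨k1, k2, k3, k4⟩ := h2 n hn
      exact ⟨fun x y h => k1 x (bl _ _ _ h).2.1 y (bl _ _ _ h).2.2 h,
        fun x h => k2 x (bl _ _ _ h).2.1 h,
        fun x y z h h' => k3 x (bl _ _ _ h).2.1 y (bl _ _ _ h).2.2 z (bl _ _ _ h').2.2 h h',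
        fun x y h h' => k4 x (bo _ _ h).2 y (bo _ _ h').2 h h'⟩
    · exact fun n σ τ h => h3 n (bl _ _ _ h).1 σ (bl _ _ _ h).2.1 τ (bl _ _ _ h).2.2 h
    · intro m n f σ τ h
      obtain ⟨b1, b2, b3, b4, b5⟩ := bm _ _ _ _ _ h
      exact h4 m b1 n b2 f b3 σ b4 τ b5 h
    · intro m n f σ hf h
      exact (existsUnique_bounded fun τ h => (bm _ _ _ _ _ h).2.2.2.2).2
        (h5 m (bo _ _ h).1 n hf.2.1 f hf.mem_finSets σ (bo _ _ h).2 hf h)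
    · intro m n f σ σ' τ τ' h h'
      obtain ⟨b1, b2, b3, b4, b5⟩ := bm _ _ _ _ _ h
      obtain ⟨-, -, -, b6, b7⟩ := bm _ _ _ _ _ h'
      exact h6 m b1 n b2 f b3 σ b4 σ' b6 τ b5 τ' b7 h h'
    · exact fun n f σ hf hi h => h7 n (bo _ _ h).1 f hf.mem_finSets σ (bo _ _ h).2 hf hi h
    · intro l m n f g h σ τ ρ hh hc h h'
      obtain ⟨b1, b2, b3, b4, b5⟩ := bm _ _ _ _ _ h
      obtain ⟨-, b6, b7, -, b8⟩ := bm _ _ _ _ _ h'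
      exact h8 l b1 m b2 n b6 f b3 g b7 _ hh.mem_finSets σ b4 τ b5 ρ b8 hh (forall_comp_iff.1 hc)
        h h'
    · intro m n f g σ τ τ' hc h h'
      obtain ⟨b1, b2, b3, b4, b5⟩ := bm _ _ _ _ _ h
      obtain ⟨-, b6, b7, -, b8⟩ := bm _ _ _ _ _ h'
      exact h9 m b1 n b2 f b3 g b7 σ b4 τ b5 τ' b8 (fun i _ x _ y _ => hc i x y) h h'
    · exact fun n σ a h => h10 n (bs _ _ _ h).1 σ (bs _ _ _ h).2.1 a (bs _ _ _ h).2.2 h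
    · exact fun n σ h => (existsUnique_bounded fun τ h => (bs _ _ _ h).2.2).2
        (h11 n (bo _ _ h).1 σ (bo _ _ h).2 h)
    · intro m n f σ τ a b h h' h''
      obtain ⟨b1, b2, b3, b4, b5⟩ := bm _ _ _ _ _ h
      obtain ⟨k1, k2⟩ := h12 m b1 n b2 f b3 σ b4 τ b5 a (bs _ _ _ h').2.2 b (bs _ _ _ h'').2.2 h h' h''
      exact fun j => ⟨k1 j, fun ⟨i, hi, hij⟩ => k2 i hi j (mem_trcl_opair hij).2 hij⟩
    · intro m n f σ a hf h hs
      obtain ⟨b1, b2, b3⟩ := bs _ _ _ h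
      obtain ⟨σ₀, -, h⟩ := h13 m hf.1 n b1 f hf.mem_finSets σ b2 a b3 hf h fun j hj =>
        let ⟨i, h⟩ := hs j hj; ⟨i, (mem_trcl_opair h).1, h⟩
      exact ⟨σ₀, h⟩

end Model

variable {C : Type v} {𝓜 : C → Type u} [∀ c, PRSLang.Structure (𝓜 c)] [∀ c, PRSomega (𝓜 c)]
variable {ok : Prop} {n m : ℕ} {X : ∀ c, (Fin n → 𝓜 c) → LO (𝓜 c)}
  {P P' : ∀ c, (Fin n → 𝓜 c) → PD (𝓜 c)} {r s t a b d : ∀ c, (Fin n → 𝓜 c) → 𝓜 c}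

instance LOPR.ext [hP : PDPR 𝓜 ok P] [hX : LOPR 𝓜 ok X] :
    LOPR 𝓜 ok (fun c v => (P c v).ext (X c v)) where
  dom := by simp only [ext_dom_iff_bounded]; infer_instance
  lt := by
    obtain ⟨B, hB, hb⟩ := hP.bound
    have key := fun c v z w => ext_lt_iff_bounded (X := X c v) (z := z) (w := w) (hb c v)
    simp only [forall_comp_iff] at key
    simp only [key]
    infer_instance

instance LOBD.ext [hP : PDPR 𝓜 ok P] [hX : LOBD 𝓜 ok X] :
    LOBD 𝓜 ok (fun c v => (P c v).ext (X c v)) where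
  bound := by
    obtain ⟨B, hB, hb⟩ := hP.bound
    obtain ⟨D, hD, hd⟩ := hX.bound
    refine ⟨fun c v => DilRec.prod (B c v) (DilRec.finSets (D c v)), inferInstance, fun c v z h => ?_⟩
    obtain ⟨σ, a, n, e, h1, h2, rfl⟩ := h
    exact opair_mem_prod.2 ⟨((hb c v).1 _ _ h2.1).2,
      (h1.mem_finSets fun x hx => hd c v x (h1.2.1 x hx)).1⟩

instance PRRel.sepObj [hP : PDPR 𝓜 ok P] [PR 𝓜 ok a] [PR 𝓜 ok s] [PR 𝓜 ok t] :
    PRRel 𝓜 ok (fun c v => (P c v).SepObj (a c v) (s c v) (t c v)) := by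
  simp only [sepObj_iff_bounded]; infer_instance

instance PDPR.sep [hP : PDPR 𝓜 ok P] [ha : PR 𝓜 ok a] :
    PDPR 𝓜 ok (fun c v => (P c v).sep (a c v)) where
  obj := by unfold PD.sep; infer_instance
  lt := by unfold PD.sep; infer_instance
  map := by simp only [sep_map_iff']; infer_instance
  supp := by simp only [sep_supp_iff']; infer_instance
  bound := by
    obtain ⟨B, hB, hb⟩ := hP.bound
    -- An element over any n ∈ ω is a trace element together with a finite subset of γ + n ⊆ γ + ω.
    -- Hence a single set bounds the elements for all n, and S collects their supports.
    let Z : ∀ c, (Fin n → 𝓜 c) → 𝓜 c := fun c v => DilRec.prod (B c v) (DilRec.finSets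
      (DilRec.union₂ (DilRec.imag (a c v) fun x => LO.inl x)
        (DilRec.imag (DilRec.om (𝓜 c)) fun x => LO.inr x)))
    have hZ : PR 𝓜 ok Z := by unfold Z; infer_instance
    let S : ∀ c, (Fin n → 𝓜 c) → 𝓜 c := fun c v => DilRec.imag (DilRec.prod (DilRec.om (𝓜 c)) (Z c v))
      fun p => DilRec.sepr (DilRec.fst p) fun i => LO.inr i ∊ DilRec.snd (DilRec.snd p)
    have hS : PR 𝓜 ok S := by unfold S; infer_instance
    have k1 : ∀ {c v n z}, (P c v).SepObj (a c v) n z → n ∊ om (𝓜 c) ∧ z ∊ Z c v := by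
      rintro c v n _ ⟨hn, σ, b, k, e, i, rfl, h1, h2, -⟩
      refine ⟨hn, opair_mem_prod.2 ⟨((hb c v).1 _ _ h2.1).2, (h1.mem_finSets fun x hx => ?_).1⟩⟩
      rw [mem_union₂, mem_imag, mem_imag]
      rcases h1.2.1 x hx with h | ⟨i, hi, rfl⟩
      · exact Or.inl h
      · exact Or.inr ⟨i, om_trans hn hi, rfl⟩
    refine ⟨fun c v => DilRec.union₂ (DilRec.om _) (DilRec.union₂ (Z c v) (DilRec.union₂ (S c v)
      (DilRec.finSets (DilRec.prod (DilRec.om _) (DilRec.om _))))), inferInstance,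
      fun c v => ⟨?_, ?_, ?_, ?_⟩⟩
    · intro n z h
      have := k1 h
      simp [this.1, this.2]
    · rintro n z w ⟨h1, h2, -⟩
      have h3 := k1 h1
      have h4 := k1 h2
      simp [h3.1, h3.2, h4.2]
    · rintro m n f z w ⟨h0, h1, h2, -⟩
      have h3 := k1 h1
      have h4 := k1 h2
      simp [h3.1, h3.2, h4.2, h4.1, h0.mem_finSets]
    · intro n z x h
      obtain ⟨h1, rfl⟩ := sep_supp_iff'.1 h
      have h2 := k1 h1
      have h3 : DilRec.sepr n (fun i => LO.inr i ∊ DilRec.snd z) ∊ S c v :=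
        mem_imag.2 ⟨opair n z, opair_mem_prod.2 h2, by simp⟩
      simp [h2.1, h2.2, h3]

instance PRRel.isPredilator_data [hP : PDPR 𝓜 ok P] :
    PRRel 𝓜 ok (fun c v => (P c v).IsPredilator) := by
  obtain ⟨B, hB, hb⟩ := hP.bound
  simp only [fun c v => isPredilator_iff_bounded (hb c v)]
  infer_instance

/-- Codes are unique by extensionality, so the unbounded condition of being a code becomes an
equation with a primitive recursive term. -/
theorem PD.codes_iff [PDPR 𝓜 ok P] {c : C} {v : Fin n → 𝓜 c} {D : 𝓜 c} :
    Codes D (P c v) ↔ D = code (P c v) :=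
  ⟨fun h => h.unique (PDPR.codes (ok := ok) c v), fun h => h ▸ PDPR.codes (ok := ok) c v⟩

instance PRRel.isPredilator [hd : PR 𝓜 ok d] : PRRel 𝓜 ok (fun c v => IsPredilator (d c v)) := by
  unfold IsPredilator
  have : ∀ c v, Codes (d c v) (PD.ofSet (d c v)) ↔ d c v = PD.code (PD.ofSet (d c v)) := fun c v =>
    codes_iff (ok := ok) (P := fun c v => PD.ofSet (d c v))
  simp only [this]
  infer_instance

theorem LOPR.mem_setOf_dom [hX : LOPR 𝓜 ok X] [hX' : LOBD 𝓜 ok X] {c : C} {v : Fin n → 𝓜 c}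
    {x : 𝓜 c} : x ∊ DilRec.setOf (X c v).dom ↔ (X c v).dom x := by
  obtain ⟨B, hB, hb⟩ := hX'.bound
  have := hX.dom
  rw [setOf_eq_sepr (ok := ok) (R := fun c v x => (X c v).dom x) B hb]
  have := PRRel.defR (𝓜 := 𝓜) (ok := ok) (R := fun c v x => (X c v).dom x) c v
  rw [mem_sepr]
  exact ⟨fun h => h.2, fun h => ⟨hb _ _ _ h, h⟩⟩

instance PR.setOf_dom [hX : LOPR 𝓜 ok X] [hX' : LOBD 𝓜 ok X] :
    PR 𝓜 ok (fun c v => DilRec.setOf (X c v).dom) := by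
  obtain ⟨B, hB, hb⟩ := hX'.bound
  have := hX.dom
  exact PR.setOf_of_bound (R := fun c v x => (X c v).dom x) B hb

instance PRRel.isTop [hP : PDPR 𝓜 ok P] [PR 𝓜 ok s] :
    PRRel 𝓜 ok (fun c v => IsTop (P c v) (s c v)) := by
  refine PRRel.congr (R := fun c v => (P c v).index.dom (s c v) ∧ ∀ α,
    α ∊ DilRec.setOf (P c v).index.dom → α = s c v ∨ (P c v).index.lt α (s c v)) fun c v => ?_
  refine and_congr_right fun _ => ?_
  simp only [LOPR.mem_setOf_dom (𝓜 := 𝓜) (ok := ok) (X := fun c v => (P c v).index)]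

/-- The set `P_η(D)` of predecessors. -/
noncomputable def predSet {M : Type u} [PRSLang.Structure M] (η D : M) : M :=
  union₂ (imag (sepr (setOf (PD.ofSet D).index.dom) fun μ => IsTop (PD.ofSet D) μ ∧
      ((PD.ofSet D).restrict μ).IsOne) fun μ => code ((PD.ofSet D).partialSum μ))
    (union₂ (imag (sepr (setOf (PD.ofSet D).index.dom) fun _ =>
        ¬ ∃ μ, μ ∊ setOf (PD.ofSet D).index.dom ∧ IsTop (PD.ofSet D) μ)
        fun ν => code ((PD.ofSet D).partialSum ν))
      (bUnion (sepr (setOf (PD.ofSet D).index.dom) fun μ => IsTop (PD.ofSet D) μ ∧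
        ¬ ((PD.ofSet D).restrict μ).IsOne) fun μ => imag η fun γ =>
          code (((PD.ofSet D).partialSum μ).add (((PD.ofSet D).restrict μ).sep γ))))

instance PR.predSet [PR 𝓜 ok s] [PR 𝓜 ok d] : PR 𝓜 ok (fun c v => predSet (s c v) (d c v)) := by
  unfold DilRec.predSet
  infer_instance

/-- In `predSet` each case distinction is part of a separation over the index order, so that exactly
the set for the applicable case can be non-empty. When the index order is empty, all three sets are.
-/
theorem mem_predSet {M : Type u} [PRSLang.Structure M] [PRSomega M] {η D E : M} :
    E ∊ predSet η D ↔ IsPred η D E := by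
  have hI : ∀ {μ}, μ ∊ setOf (PD.ofSet D).index.dom ↔ (PD.ofSet D).index.dom μ :=
    LOPR.mem_setOf_dom (𝓜 := fun _ : PUnit.{1} => M) (ok := True) (n := 0)
      (X := fun _ _ => (PD.ofSet D).index) (c := ⟨⟩) (v := Fin.elim0)
  have hc : ∀ ν, Codes E ((PD.ofSet D).partialSum ν) ↔ E = code ((PD.ofSet D).partialSum ν) :=
    fun ν => codes_iff (𝓜 := fun _ : PUnit.{1} => M) (ok := True) (n := 0)
      (P := fun _ _ => (PD.ofSet D).partialSum ν) (c := ⟨⟩) (v := Fin.elim0)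
  have hc' : ∀ μ γ, Codes E (((PD.ofSet D).partialSum μ).add (((PD.ofSet D).restrict μ).sep γ)) ↔
      E = code (((PD.ofSet D).partialSum μ).add (((PD.ofSet D).restrict μ).sep γ)) :=
    fun μ γ => codes_iff (𝓜 := fun _ : PUnit.{1} => M) (ok := True) (n := 0)
      (P := fun _ _ => ((PD.ofSet D).partialSum μ).add (((PD.ofSet D).restrict μ).sep γ))
      (c := ⟨⟩) (v := Fin.elim0)
  have hT : ∀ {μ}, IsTop (PD.ofSet D) μ → (PD.ofSet D).index.dom μ := fun h => h.1
  unfold predSet IsPred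
  simp only [mem_union₂, mem_imag, mem_bUnion, mem_sepr]
  simp only [hI, hc, hc']
  refine or_congr ⟨?_, ?_⟩ (or_congr ⟨?_, ?_⟩ ⟨?_, ?_⟩)
  · rintro ⟨μ, ⟨-, h1, h2⟩, h3⟩; exact ⟨μ, h1, h2, h3⟩
  · rintro ⟨μ, h1, h2, h3⟩; exact ⟨μ, ⟨hT h1, h1, h2⟩, h3⟩
  · rintro ⟨ν, ⟨h1, h2⟩, h3⟩
    exact ⟨fun ⟨μ, h⟩ => h2 ⟨μ, hT h, h⟩, ν, h1, h3⟩
  · rintro ⟨h2, ν, h1, h3⟩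
    exact ⟨ν, ⟨h1, fun ⟨μ, _, h⟩ => h2 ⟨μ, h⟩⟩, h3⟩
  · rintro ⟨μ, ⟨-, h1, h2⟩, γ, h3⟩; exact ⟨μ, h1, h2, γ, h3⟩
  · rintro ⟨μ, h1, h2, γ, h3⟩; exact ⟨μ, ⟨hT h1, h1, h2⟩, γ, h3⟩

end Separated

end DilRec

set_option synthInstance.maxSize 2000
set_option synthInstance.maxHeartbeats 200000

namespace DilRec

universe u v

/-! ### Ordinal multiplication and powers of `ω` -/

section Arithmetic

/-- `α · β` -/
noncomputable def omul {M : Type u} [PRSLang.Structure M] (α β : M) : M :=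
  recI (fun w _ => bUnion w fun y => oadd y α) β

/-- `ω ^ β` -/
noncomputable def opow {M : Type u} [PRSLang.Structure M] (β : M) : M :=
  recI (fun w _ => union₂ (sing (empt M)) (bUnion w fun y => omul y (om M))) β

section Closure

variable {C : Type v} {𝓜 : C → Type u} [∀ c, PRSLang.Structure (𝓜 c)]
    [∀ c, PRSomega (𝓜 c)] {ok : Prop} {n : ℕ} {s t : ∀ c, (Fin n → 𝓜 c) → 𝓜 c}

instance PR.omul [PR 𝓜 ok s] [PR 𝓜 ok t] : PR 𝓜 ok (fun c v => omul (s c v) (t c v)) :=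
  PR.recI (h := fun c v w _ => DilRec.bUnion w fun y => DilRec.oadd y (s c v))

instance PR.opow [PR 𝓜 ok t] : PR 𝓜 ok (fun c v => opow (t c v)) :=
  PR.recI (h := fun c _ w _ => DilRec.union₂ (DilRec.sing (DilRec.empt (𝓜 c)))
    (DilRec.bUnion w fun y => DilRec.omul y (DilRec.om (𝓜 c))))

end Closure

variable {M : Type u} [PRSLang.Structure M] [PRSomega M] {α β γ δ s x y z f m n : M}

theorem mem_omul : z ∊ omul α β ↔ ∃ c, c ∊ β ∧ z ∊ oadd (omul α c) α := by
  have h : ∀ β, omul α β = bUnion (imag β (omul α)) fun y => oadd y α := fun β => recI_eq β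
  rw [h, mem_bUnion]
  simp only [mem_imag]
  exact ⟨fun ⟨_, ⟨c, hc, rfl⟩, hz⟩ => ⟨c, hc, hz⟩, fun ⟨c, hc, hz⟩ => ⟨_, ⟨c, hc, rfl⟩, hz⟩⟩

theorem mem_opow : z ∊ opow β ↔ z = empt M ∨ ∃ c, c ∊ β ∧ z ∊ omul (opow c) (om M) := by
  have h : ∀ β, opow β = union₂ (sing (empt M)) (bUnion (imag β opow) fun y : M => omul y (om M)) :=
    fun β => recI_eq β
  rw [h, mem_union₂, mem_sing, mem_bUnion]
  simp only [mem_imag]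
  exact or_congr_right ⟨fun ⟨_, ⟨c, hc, rfl⟩, hz⟩ => ⟨c, hc, hz⟩,
    fun ⟨c, hc, hz⟩ => ⟨_, ⟨c, hc, rfl⟩, hz⟩⟩

theorem mem_succ_of_mem (hb : IsTrans β) (h : x ∊ succ β) (hy : y ∊ x) : y ∊ succ β := by
  rcases mem_succ.1 h with h | rfl
  · exact mem_succ.2 (Or.inl (hb _ _ h hy))
  · exact mem_succ.2 (Or.inl hy)

/-- As for addition, the recursion clauses pin down the witnessing function on all of `succ β` by
set induction. -/
theorem isMul_iff (ha : IsTrans α) (hb : IsTrans β) : IsMul α β s ↔ s = omul α β := by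
  have key : ∀ f b, IsFunOn f (succ β) → b ∊ succ β → (∀ c, c ∊ b → ap f c = omul α c) →
      ∀ z, (∃ c w t, c ∊ b ∧ opair c w ∊ f ∧ IsAdd w α t ∧ z ∊ t) ↔ z ∊ omul α b := by
    intro f b hf hb' ih z
    rw [mem_omul]
    refine exists_congr fun c => ?_
    simp only [isAdd_iff ha]
    constructor
    · rintro ⟨w, t, hc, hw, rfl, hz⟩
      rw [hf.opair_iff] at hw
      rw [← ih c hc, ← hw.2]
      exact ⟨hc, hz⟩
    · rintro ⟨hc, hz⟩
      exact ⟨_, _, hc, hf.opair_iff.2 ⟨mem_succ_of_mem hb hb' hc, (ih c hc).symm⟩, rfl, hz⟩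
  have hd : DefF (omul α) := PR.omul (s := fun _ _ => α) (t := fun _ v => v 0)
  constructor
  · rintro ⟨f, hf, hr, hs⟩
    have hv : ∀ b, b ∊ succ β → ap f b = omul α b := by
      refine mem_induction (fun b => b ∊ succ β → ap f b = omul α b) fun b ih hbm => ?_
      rw [ext_iff']
      intro z
      rw [hr b _ (hf.opair_iff.2 ⟨hbm, rfl⟩)]
      exact key f b hf hbm (fun c hc => ih c hc (mem_succ_of_mem hb hbm hc)) z
    have := hf.opair_iff.1 hs
    rw [this.2, hv β this.1]
  · rintro rfl
    refine ⟨lam (succ β) (omul α), isFunOn_lam, ?_, opair_mem_lam.2 ⟨by simp, rfl⟩⟩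
    intro b v hbv z
    obtain ⟨hbm, rfl⟩ := opair_mem_lam.1 hbv
    exact (key _ b isFunOn_lam hbm (fun c hc => ap_lam (mem_succ_of_mem hb hbm hc)) z).symm

theorem isOrd_bUnion {φ : M → M} [DefF φ] (h : ∀ c, c ∊ β → IsOrd (φ c)) :
    IsOrd (bUnion β φ) := by
  constructor
  · intro y z hy hz
    obtain ⟨c, hc, hy⟩ := mem_bUnion.1 hy
    exact mem_bUnion.2 ⟨c, hc, (h c hc).1 y z hy hz⟩
  · intro y hy
    obtain ⟨c, hc, hy⟩ := mem_bUnion.1 hy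
    exact (h c hc).2 y hy

theorem isOrd_omul (ha : IsOrd α) : IsOrd (omul α β) := by
  refine mem_induction (fun β => IsOrd (omul α β)) (fun β ih => ?_) β
  rw [show omul α β = bUnion β fun c => oadd (omul α c) α from
    ext_iff'.2 fun z => by rw [mem_omul, mem_bUnion]]
  exact isOrd_bUnion fun c hc => isOrd_oadd (ih c hc) ha

theorem isOrd_opow : IsOrd (opow β) := by
  refine mem_induction (fun β => IsOrd (opow β)) (fun β ih => ?_) β
  have hU : IsOrd (bUnion β fun c => omul (opow c) (om M)) :=
    isOrd_bUnion fun c hc => isOrd_omul (ih c hc)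
  have h : ∀ z, z ∊ opow β ↔ z = empt M ∨ z ∊ bUnion β fun c => omul (opow c) (om M) := fun z => by
    rw [mem_opow, mem_bUnion]
  constructor
  · intro y z hy hz
    rcases (h y).1 hy with rfl | hy
    · exact absurd hz (mem_empt z)
    · exact (h z).2 (Or.inr (hU.1 y z hy hz))
  · intro y hy
    rcases (h y).1 hy with rfl | hy
    · exact IsOrd.empt.1
    · exact hU.2 y hy

theorem eq_opow_of_isOmegaPow (hb : IsTrans β) (h : IsOmegaPow β s) : s = opow β := by
  obtain ⟨f, hf, hr, hs⟩ := h
  have hv : ∀ b, b ∊ succ β → ap f b = opow b := by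
    refine mem_induction (fun b => b ∊ succ β → ap f b = opow b) fun b ih hbm => ?_
    rw [ext_iff']
    intro z
    rw [hr b _ (hf.opair_iff.2 ⟨hbm, rfl⟩), mem_opow]
    refine or_congr_right (exists_congr fun c => ⟨?_, ?_⟩)
    · rintro ⟨w, t, hc, hw, ht, hz⟩
      have hw := (hf.opair_iff.1 hw).2
      rw [ih c hc (mem_succ_of_mem hb hbm hc)] at hw
      subst hw
      rw [isMul_iff isOrd_opow.1 isOrd_om.1] at ht
      subst ht
      exact ⟨hc, hz⟩
    · rintro ⟨hc, hz⟩
      have hc' := mem_succ_of_mem hb hbm hc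
      exact ⟨opow c, _, hc, hf.opair_iff.2 ⟨hc', (ih c hc hc').symm⟩,
        (isMul_iff isOrd_opow.1 isOrd_om.1).2 rfl, hz⟩
  have := hf.opair_iff.1 hs
  rw [this.2, hv β this.1]

theorem IsOrd.mem_succ_of_subset (ha : IsOrd α) (hb : IsOrd β) (h : ∀ x, x ∊ α → x ∊ β) :
    α ∊ DilRec.succ β :=
  ha.mem_succ_of_not_mem hb fun h' => mem_irrefl _ (h _ h')

theorem empt_oadd (β : M) : oadd (empt M) β = β := by
  refine mem_induction (fun β => oadd (empt M) β = β) (fun β ih => ?_) β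
  rw [ext_iff']
  intro z
  rw [mem_oadd]
  constructor
  · rintro (h | ⟨c, hc, rfl⟩)
    · exact absurd h (mem_empt z)
    · rwa [ih c hc]
  · exact fun h => Or.inr ⟨z, h, (ih z h).symm⟩

theorem oadd_assoc (α β γ : M) : oadd (oadd α β) γ = oadd α (oadd β γ) := by
  refine mem_induction (fun γ => oadd (oadd α β) γ = oadd α (oadd β γ)) (fun γ ih => ?_) γ
  rw [ext_iff']
  intro z
  rw [mem_oadd, mem_oadd (β := oadd β γ)]
  constructor
  · rintro (h | ⟨d, hd, rfl⟩)
    · rcases mem_oadd.1 h with h | ⟨e, he, rfl⟩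
      · exact Or.inl h
      · exact Or.inr ⟨e, mem_oadd.2 (Or.inl he), rfl⟩
    · exact Or.inr ⟨_, oadd_mem hd, ih d hd⟩
  · rintro (h | ⟨e, he, rfl⟩)
    · exact Or.inl (mem_oadd.2 (Or.inl h))
    · rcases mem_oadd.1 he with he | ⟨d, hd, rfl⟩
      · exact Or.inl (oadd_mem he)
      · exact Or.inr ⟨d, hd, (ih d hd).symm⟩

theorem oadd_subset_left (ha : IsOrd α) (hb : IsOrd β) (hc : IsOrd γ) (h : ∀ x, x ∊ α → x ∊ β) :
    ∀ x, x ∊ oadd α γ → x ∊ oadd β γ := by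
  refine mem_induction (fun γ => IsOrd γ → ∀ x, x ∊ oadd α γ → x ∊ oadd β γ)
    (fun γ ih hc x hx => ?_) γ hc
  rcases mem_oadd.1 hx with hx | ⟨d, hd, rfl⟩
  · exact mem_oadd.2 (Or.inl (h x hx))
  · have hd' := hc.mem hd
    rcases mem_succ.1 ((isOrd_oadd ha hd').mem_succ_of_subset (isOrd_oadd hb hd') (ih d hd hd'))
      with h | h
    · exact (isOrd_oadd hb hc).trans h (oadd_mem hd)
    · exact h ▸ oadd_mem hd

theorem subset_oadd_left (ha : IsOrd α) (hb : IsOrd β) : ∀ x, x ∊ β → x ∊ oadd α β := by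
  have := oadd_subset_left IsOrd.empt ha hb fun x hx => absurd hx (mem_empt x)
  rwa [empt_oadd] at this

theorem omul_subset (hb : IsTrans β) (h : γ ∊ β) : ∀ x, x ∊ omul α γ → x ∊ omul α β := by
  intro x hx
  obtain ⟨c, hc, hx⟩ := mem_omul.1 hx
  exact mem_omul.2 ⟨c, hb _ _ h hc, hx⟩

theorem omul_succ (ha : IsOrd α) (hb : IsTrans β) : omul α (succ β) = oadd (omul α β) α := by
  rw [ext_iff']
  intro z
  rw [mem_omul]
  constructor
  · rintro ⟨c, hc, hz⟩
    rcases mem_succ.1 hc with hc | rfl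
    · exact oadd_subset_left (isOrd_omul ha) (isOrd_omul ha) ha (omul_subset hb hc) z hz
    · exact hz
  · exact fun h => ⟨β, by simp, h⟩

theorem omul_empt : omul α (empt M) = empt M :=
  ext_iff'.2 fun z => by rw [mem_omul]; simp

theorem omul_oadd (ha : IsOrd α) (hm : m ∊ om M) (hn : n ∊ om M) :
    oadd (omul α m) (omul α n) = omul α (oadd m n) := by
  refine om_induction (fun n => oadd (omul α m) (omul α n) = omul α (oadd m n)) ?_ ?_ n hn
  · rw [omul_empt, oadd_empt, oadd_empt]
  · intro n hn ih
    rw [oadd_succ, omul_succ ha (isOrd_of_mem_om hn).1,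
      omul_succ ha (isOrd_of_mem_om (oadd_mem_om hm hn)).1, ← oadd_assoc, ih]

/-- If x < α·(m+1) and y < α·(n+1), then x + y < α·(m+1) + α·(n+1) = α·(m+n+2) by finite
distributivity. -/
theorem oadd_mem_omul_om (ha : IsOrd α) (hx : x ∊ omul α (om M)) (hy : y ∊ omul α (om M)) :
    oadd x y ∊ omul α (om M) := by
  obtain ⟨m, hm, hx⟩ := mem_omul.1 hx
  obtain ⟨n, hn, hy⟩ := mem_omul.1 hy
  rw [← omul_succ ha (isOrd_of_mem_om hm).1] at hx
  rw [← omul_succ ha (isOrd_of_mem_om hn).1] at hy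
  have hO : ∀ k : M, IsOrd (omul α k) := fun k => isOrd_omul ha
  have h := oadd_subset_left ((hO _).mem hx) (hO (succ m)) (hO (succ n))
    (fun z hz => (hO _).trans hz hx) _ (oadd_mem hy)
  rw [omul_oadd ha (succ_mem_om hm) (succ_mem_om hn)] at h
  exact omul_subset isOrd_om.1 (oadd_mem_om (succ_mem_om hm) (succ_mem_om hn)) _ h

theorem empt_mem_opow (β : M) : empt M ∊ opow β := mem_opow.2 (Or.inl rfl)

theorem omul_om_subset (ha : IsOrd α) (hb : IsOrd β) (h : ∀ x, x ∊ α → x ∊ β) (hn : n ∊ om M) :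
    ∀ x, x ∊ omul α n → x ∊ omul β n := by
  refine om_induction (fun n => ∀ x, x ∊ omul α n → x ∊ omul β n) ?_ ?_ n hn
  · intro x hx; rwa [omul_empt] at hx ⊢
  · intro n hn ih x hx
    have hn' := (isOrd_of_mem_om hn).1
    rw [omul_succ ha hn'] at hx
    rw [omul_succ hb hn']
    have h1 := oadd_subset_left (isOrd_omul ha) (isOrd_omul hb) ha ih x hx
    rcases mem_oadd.1 h1 with h1 | ⟨c, hc, rfl⟩
    · exact mem_oadd.2 (Or.inl h1)
    · exact oadd_mem (h c hc)

theorem opow_subset (hb : IsTrans β) (h : γ ∊ β) : ∀ x, x ∊ opow γ → x ∊ opow β := by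
  intro x hx
  rcases mem_opow.1 hx with h' | ⟨c, hc, hx⟩
  · exact mem_opow.2 (Or.inl h')
  · exact mem_opow.2 (Or.inr ⟨c, hb _ _ h hc, hx⟩)

/-- Each non-zero element lies below some ω^c·ω with c < β. Both summands can be brought below ω^c·ω
for the larger of the two exponents, and that product is closed under addition. -/
theorem oadd_mem_opow (hb : IsOrd β) (hx : x ∊ opow β) (hy : y ∊ opow β) : oadd x y ∊ opow β := by
  rcases mem_opow.1 hx with rfl | ⟨c, hc, hx⟩
  · rwa [empt_oadd]
  rcases mem_opow.1 hy with rfl | ⟨d, hd, hy⟩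
  · rw [oadd_empt]
    exact mem_opow.2 (Or.inr ⟨c, hc, hx⟩)
  have mono : ∀ {c d x}, IsOrd d → c ∊ d → x ∊ omul (opow c) (om M) → x ∊ omul (opow d) (om M) := by
    intro c d x hd hcd hx
    obtain ⟨k, hk, hx⟩ := mem_omul.1 hx
    rw [← omul_succ isOrd_opow (isOrd_of_mem_om hk).1] at hx
    exact omul_subset isOrd_om.1 (succ_mem_om hk) _
      (omul_om_subset isOrd_opow isOrd_opow (opow_subset hd.1 hcd) (succ_mem_om hk) _ hx)
  rcases (hb.mem hc).tri (hb.mem hd) with h | rfl | h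
  · exact mem_opow.2 (Or.inr ⟨d, hd, oadd_mem_omul_om isOrd_opow (mono (hb.mem hd) h hx) hy⟩)
  · exact mem_opow.2 (Or.inr ⟨c, hc, oadd_mem_omul_om isOrd_opow hx hy⟩)
  · exact mem_opow.2 (Or.inr ⟨c, hc, oadd_mem_omul_om isOrd_opow hx (mono (hb.mem hc) h hy)⟩)

theorem opow_mem_opow (h : γ ∊ β) : opow γ ∊ opow β := by
  refine mem_opow.2 (Or.inr ⟨γ, h, mem_omul.2 ⟨succ (empt M), succ_mem_om empt_mem_om, ?_⟩⟩)
  rw [omul_succ isOrd_opow IsOrd.empt.1, omul_empt, empt_oadd]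
  have := oadd_mem (α := opow γ) (empt_mem_opow γ)
  rwa [oadd_empt] at this

/-- By induction β ≤ ω^β: for x < β one has x ≤ ω^x < ω^β. -/
theorem subset_opow (hb : IsOrd β) : ∀ x, x ∊ β → x ∊ opow β := by
  refine mem_induction (fun β => IsOrd β → ∀ x, x ∊ β → x ∊ opow β) (fun β ih hb x hx => ?_) β hb
  have hx' := hb.mem hx
  rcases mem_succ.1 (hx'.mem_succ_of_subset isOrd_opow (ih x hx hx')) with h | h
  · exact isOrd_opow.trans h (opow_mem_opow hx)
  · have := opow_mem_opow hx
    rwa [← h] at this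

theorem opow_empt : opow (empt M) = succ (empt M) :=
  ext_iff'.2 fun z => by rw [mem_opow]; simp

theorem om_subset_opow (hb : IsOrd β) (h : empt M ∊ β) : ∀ x, x ∊ om M → x ∊ opow β := by
  refine om_induction (fun x => x ∊ opow β) (empt_mem_opow β) fun x _ ih => ?_
  have h1 := oadd_mem_opow hb ih (opow_mem_opow h)
  rwa [opow_empt, oadd_succ, oadd_empt] at h1

/-- The ordinal `W = ω^(1+η)` is additively closed and contains `ω`, `η`, and, if `η > 0`, the
element `ω`. -/
theorem IsOmegaPowOneAdd.closed {η W : M} (hη : IsOrd η) (h : IsOmegaPowOneAdd η W) :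
    IsOrd W ∧ (∀ x, x ∊ om M → x ∊ W) ∧ (∀ x, x ∊ η → x ∊ W) ∧
    (∀ x y, x ∊ W → y ∊ W → oadd x y ∊ W) ∧ ∀ x, x ∊ η → om M ∊ W := by
  obtain ⟨δ, h1, h2⟩ := h
  rw [isAdd_iff hη.1] at h1
  subst h1
  have h1 : IsOrd (succ (empt M)) := IsOrd.empt.succ
  have hδ := isOrd_oadd h1 hη
  rw [eq_opow_of_isOmegaPow hδ.1 h2]
  have h0 : empt M ∊ oadd (succ (empt M)) η := mem_oadd.2 (Or.inl (by simp))
  refine ⟨isOrd_opow, om_subset_opow hδ h0,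
    fun x hx => subset_opow hδ x (subset_oadd_left h1 hη x hx),
    fun x y => oadd_mem_opow hδ, fun x hx => ?_⟩
  have he : empt M ∊ η := by
    rcases IsOrd.empt.tri hη with h | h | h
    · exact h
    · exact absurd hx (h ▸ mem_empt x)
    · exact absurd h (mem_empt η)
  -- Since 0 < η, the exponent 1 is below 1 + η. Together with ω ≤ ω^1 this places ω strictly below
  -- W.
  have h3 : opow (succ (empt M)) ∊ opow (oadd (succ (empt M)) η) := by
    have := oadd_mem (α := succ (empt M)) he
    rw [oadd_empt] at this
    exact opow_mem_opow this
  rcases mem_succ.1 (isOrd_om.mem_succ_of_subset isOrd_opow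
    (om_subset_opow (β := succ (empt M)) h1 (by simp))) with h | h
  · exact isOrd_opow.trans h h3
  · rwa [h]

end Arithmetic

end DilRec

set_option synthInstance.maxSize 2000
set_option synthInstance.maxHeartbeats 200000

namespace DilRec

universe u v

/-! ### Predecessors embed below the given predilator -/

section Embeddings

open PD LO

variable {M : Type u} [PRSLang.Structure M] [PRSomega M] {P : PD M} {X I : LO M} {Q : M → PD M}
  {σ τ α β γ μ ν a b n m k e f s t z w η W A : M}

theorem PD.tr_sum_iff : (PD.sum I Q).Tr (opair α σ) n ↔ I.dom α ∧ (Q α).Tr σ n := by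
  constructor
  · rintro ⟨⟨α', σ', h1, h2, h3⟩, β', τ', h4, h5, h6⟩
    obtain ⟨rfl, rfl⟩ := opair_inj.1 h3
    obtain ⟨rfl, rfl⟩ := opair_inj.1 h6
    exact ⟨h1, h2, h5⟩
  · rintro ⟨h1, h2, h3⟩
    exact ⟨⟨α, σ, h1, h2, rfl⟩, α, σ, h1, h3, rfl⟩

theorem PD.exists_of_sum_ext_dom (h : ((PD.sum I Q).ext X).dom z) : ∃ α σ a,
    z = opair (opair α σ) a ∧ I.dom α ∧ ((Q α).ext X).dom (opair σ a) := by
  obtain ⟨s, a, n, e, h1, h2, rfl⟩ := h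
  obtain ⟨α, σ, h3, h4, rfl⟩ := h2.1
  obtain ⟨-, h5⟩ := tr_sum_iff.1 h2
  exact ⟨α, σ, a, rfl, h3, σ, a, n, e, h1, h5, rfl⟩

theorem PD.sum_ext_lt (h : ((PD.sum I Q).ext X).lt (opair (opair α σ) a) (opair (opair β τ) b)) :
    I.lt α β ∨ α = β ∧ ((Q α).ext X).lt (opair σ a) (opair τ b) := by
  obtain ⟨s, t, a', b', c, m, n, k, ea, eb, ec, f, g, σ', τ', e1, e2, hc, h1, h2, h3, h4, h5, h6,
    h7, h8, h9, h10, h11, h12⟩ := h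
  simp only [opair_inj] at e1 e2
  obtain ⟨rfl, rfl⟩ := e1
  obtain ⟨rfl, rfl⟩ := e2
  obtain ⟨α₁, σ₁, σ₂, -, k1, k2, rfl⟩ := h10
  obtain ⟨rfl, rfl⟩ := opair_inj.1 k2
  obtain ⟨β₁, τ₁, τ₂, -, l1, l2, rfl⟩ := h11
  obtain ⟨rfl, rfl⟩ := opair_inj.1 l2
  obtain ⟨α₃, σ₃, β₃, τ₃, -, -, -, -, e3, e4, h⟩ := h12
  obtain ⟨rfl, rfl⟩ := opair_inj.1 e3
  obtain ⟨rfl, rfl⟩ := opair_inj.1 e4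
  refine h.imp id fun ⟨e, h'⟩ => ?_
  subst e
  exact ⟨rfl, σ, τ, a, b, c, m, n, k, ea, eb, ec, f, g, _, _, rfl, rfl, hc, h1, h2, h3,
    (tr_sum_iff.1 h4).2, (tr_sum_iff.1 h5).2, h6, h7, h8, h9, k1, l1, h'⟩

theorem PD.ext_lt_of_restrict (hP : P.IsPredilator) (h : ((P.restrict A).ext X).lt z w) :
    (P.ext X).lt z w := by
  obtain ⟨s, t, a', b', c, m, n, k, ea, eb, ec, f, g, σ', τ', e1, e2, hc, h1, h2, h3, h4, h5, h6,
    h7, h8, h9, h10, h11, h12⟩ := h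
  exact ⟨s, t, a', b', c, m, n, k, ea, eb, ec, f, g, σ', τ', e1, e2, hc, h1, h2, h3,
    ((tr_restrict_iff hP).1 h4).1, ((tr_restrict_iff hP).1 h5).1, h6, h7, h8, h9, h10.2, h11.2,
    h12.2.2⟩

theorem PD.ext_dom_restrict (hP : P.IsPredilator) : ((P.restrict A).ext X).dom (opair σ a) ↔
    ∃ n e, X.IsEn a n e ∧ P.Tr σ n ∧ opair σ n ∊ A := by
  rw [ext_dom_iff]
  simp only [tr_restrict_iff hP]

/-! #### Partial sums -/

theorem PD.exists_of_partialSum_dom (hP : P.IsPredilator) (h : ((P.partialSum ν).ext X).dom z) :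
    ∃ α σ a n e, z = opair (opair α σ) a ∧ P.index.lt α ν ∧ X.IsEn a n e ∧ P.Tr σ n ∧
      opair σ n ∊ α := by
  obtain ⟨α, σ, a, rfl, h1, h2⟩ := exists_of_sum_ext_dom h
  obtain ⟨n, e, h3, h4, h5⟩ := (ext_dom_restrict hP).1 h2
  exact ⟨α, σ, a, n, e, rfl, h1.2, h3, h4, h5⟩

theorem PD.partialSum_ext_lt [DefLO X] (hP : P.IsPredilator) (hX : X.IsLinear)
    (h : ((P.partialSum ν).ext X).lt (opair (opair α σ) a) (opair (opair β τ) b)) :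
    (P.ext X).lt (opair σ a) (opair τ b) := by
  obtain ⟨h1, h2⟩ := ext_lt_dom h
  obtain ⟨α', σ', a', m, e, e1, k1, k2, k3, k4⟩ := exists_of_partialSum_dom hP h1
  obtain ⟨β', τ', b', n, f, e2, l1, l2, l3, l4⟩ := exists_of_partialSum_dom hP h2
  simp only [opair_inj] at e1 e2
  obtain ⟨⟨rfl, rfl⟩, rfl⟩ := e1
  obtain ⟨⟨rfl, rfl⟩, rfl⟩ := e2
  rcases sum_ext_lt h with h | ⟨-, h⟩
  · exact ext_lt_of_ll hP hX k2 l2 (ll_of_index_lt hP h.2.2 k4 l4)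
  · exact ext_lt_of_restrict hP h

theorem LO.IsEn.id (hn : n ∊ om M) (h : ∀ i, i ∊ n → i ∊ W) :
    (LO.ofOrd W).IsEn n n (lam n fun i => i) :=
  LO.isEn_lam hn h (fun i j hi hj hij => ⟨h i hi, h j hj, hij⟩) fun x => by simp

/-- A representative of the class ν, placed at the arguments 0, …, n−1, is a bound, because it is
above every element with trace in a smaller class, whatever the arguments are. -/
theorem PD.partialSum_bounded (hP : P.IsPredilator) (hW : IsOrd W) (hom : ∀ x, x ∊ om M → x ∊ W)
    (hν : P.index.dom ν) : ∃ τ n, P.Tr τ n ∧ (P.ext (LO.ofOrd W)).dom (opair τ n) ∧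
      ∀ α σ a, ((P.partialSum ν).ext (LO.ofOrd W)).dom (opair (opair α σ) a) →
        (P.ext (LO.ofOrd W)).lt (opair σ a) (opair τ n) := by
  obtain ⟨τ, n, h1, h2⟩ := index_exists_mem hP hν
  have hn := LO.IsEn.id (hP.tr_nat h1) fun i hi => hom i (om_trans (hP.tr_nat h1) hi)
  refine ⟨τ, n, h1, ext_dom_iff.2 ⟨_, _, hn, h1⟩, fun α σ a h => ?_⟩
  obtain ⟨α', σ', a', m, e, e1, k1, k2, k3, k4⟩ := exists_of_partialSum_dom hP h
  simp only [opair_inj] at e1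
  obtain ⟨⟨rfl, rfl⟩, rfl⟩ := e1
  exact ext_lt_of_ll hP (isLinear_ofOrd hW) k2 hn (ll_of_index_lt hP k1 k4 h2)

/-! #### Separation of variables -/

open Classical in
/-- The map `γ + n → W` that is the identity on `γ` and sends `i` to `γ + e(i)`. -/
noncomputable def shift {M : Type u} [PRSLang.Structure M] (γ e v : M) : M :=
  if fst v = empt M then snd v else oadd γ (ap e (snd v))

/-- The set of values of `shift γ e` on `a'`, where `a` is the range of `e`. -/
noncomputable def shiftSet {M : Type u} [PRSLang.Structure M] (γ a' a : M) : M :=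
  union₂ (sepr γ fun x => inl x ∊ a') (imag a fun x => oadd γ x)

section Closure

variable {C : Type v} {𝓜 : C → Type u} [∀ c, PRSLang.Structure (𝓜 c)]
    [∀ c, PRSomega (𝓜 c)] {ok : Prop} {n : ℕ} {r s t : ∀ c, (Fin n → 𝓜 c) → 𝓜 c}

instance PR.shift [PR 𝓜 ok r] [PR 𝓜 ok s] [PR 𝓜 ok t] :
    PR 𝓜 ok (fun c v => shift (r c v) (s c v) (t c v)) := by
  unfold DilRec.shift; infer_instance

instance PR.shiftSet [PR 𝓜 ok r] [PR 𝓜 ok s] [PR 𝓜 ok t] :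
    PR 𝓜 ok (fun c v => shiftSet (r c v) (s c v) (t c v)) := by
  unfold DilRec.shiftSet; infer_instance

end Closure

theorem shift_inl {x : M} : shift γ e (inl x) = x := by simp [shift, inl]

theorem shift_inr {x : M} : shift γ e (inr x) = oadd γ (ap e x) := by simp [shift, inr]

/-- `W` is an additively closed ordinal and `γ ∈ W`. -/
structure AddClosed (W γ : M) : Prop where
  ord : IsOrd W
  add : ∀ x y, x ∊ W → y ∊ W → oadd x y ∊ W
  mem : γ ∊ W

theorem shift_dom (hW : AddClosed W γ) (he : (LO.ofOrd W).IsEn a n e) {x : M}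
    (hx : (LO.add γ n).dom x) : (LO.ofOrd W).dom (shift γ e x) := by
  rcases hx with ⟨x, hx, rfl⟩ | ⟨i, hi, rfl⟩
  · rw [shift_inl]; exact hW.ord.trans hx hW.mem
  · rw [shift_inr]; exact hW.add _ _ hW.mem (he.ap_dom hi)

theorem shift_lt (hW : AddClosed W γ) (he : (LO.ofOrd W).IsEn a n e) {x y : M}
    (h : (LO.add γ n).lt x y) : (LO.ofOrd W).lt (shift γ e x) (shift γ e y) := by
  rcases h with ⟨x, y, hx, hy, rfl, rfl, h⟩ | ⟨x, j, hx, hj, rfl, rfl⟩ | ⟨i, j, hi, hj, rfl, rfl, h⟩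
  · rw [shift_inl, shift_inl]
    exact ⟨hW.ord.trans hx hW.mem, hW.ord.trans hy hW.mem, h⟩
  · rw [shift_inl, shift_inr]
    exact ⟨hW.ord.trans hx hW.mem, hW.add _ _ hW.mem (he.ap_dom hj), mem_oadd.2 (Or.inl hx)⟩
  · rw [shift_inr, shift_inr]
    exact ⟨hW.add _ _ hW.mem (he.ap_dom hi), hW.add _ _ hW.mem (he.ap_dom hj),
      oadd_mem (he.mono hi hj h).2.2⟩

/-- The image depends only on the set a and not on its enumeration, since every index below n is
used. This permits an explicit definition of the embedding on elements of E(W), which are pairs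
without an enumeration. -/
theorem imag_shift {a' : M} (he : X.IsEn a n e) (hd : ∀ x, x ∊ a' → (LO.add γ n).dom x)
    (hs : ∀ i, i ∊ n → inr i ∊ a') : imag a' (shift γ e) = shiftSet γ a' a := by
  rw [ext_iff']
  intro z
  rw [shiftSet, mem_imag, mem_union₂, mem_sepr, mem_imag]
  constructor
  · rintro ⟨x, hx, rfl⟩
    rcases hd x hx with ⟨x, hx', rfl⟩ | ⟨i, hi, rfl⟩
    · rw [shift_inl]; exact Or.inl ⟨hx', hx⟩
    · rw [shift_inr]; exact Or.inr ⟨_, he.ap_mem hi, rfl⟩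
  · rintro (⟨hx, hx'⟩ | ⟨y, hy, rfl⟩)
    · exact ⟨_, hx', shift_inl.symm⟩
    · obtain ⟨i, hi, rfl⟩ := he.surj hy
      exact ⟨_, hs i hi, shift_inr.symm⟩

theorem PD.exists_of_sep_ext_dom (h : ((P.sep γ).ext X).dom z) : ∃ σ a' a n e,
    z = opair (opair σ a') a ∧ X.IsEn a n e ∧ P.SepObj γ n (opair σ a') ∧
    ∀ i, i ∊ n → inr i ∊ a' := by
  obtain ⟨s, a, n, e, h1, h2, rfl⟩ := h
  obtain ⟨σ, a', rfl⟩ := h2.1.exists_opair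
  exact ⟨σ, a', a, n, e, rfl, h1, h2.1, fun i hi => (((sep_supp_iff.1 h2.2).2 i).1 hi).2⟩

/-- The element of `P(W)` that results from an element of `{P}^γ(W)`. -/
theorem PD.sep_shift (hW : AddClosed W γ) {a' : M} (he : (LO.ofOrd W).IsEn a n e)
    (h : P.SepObj γ n (opair σ a')) (hs : ∀ i, i ∊ n → inr i ∊ a') :
    ∃ k ea i, (LO.ofOrd W).IsEn (shiftSet γ a' a) k ea ∧ P.Tr σ k ∧ P.IsCoeff k σ i ∧
      ap ea i ∊ γ := by
  obtain ⟨-, k, e', i, h1, h2, h3, ⟨x, hx, hxe⟩, -⟩ := sepObj_iff.1 h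
  have h4 := h1.map (fun x => shift_dom hW he) (fun x y => shift_lt hW he)
  rw [imag_shift he (sepObj_dom h) hs] at h4
  refine ⟨k, _, i, h4, h2, h3, ?_⟩
  rw [ap_lam h3.1, hxe, shift_inl]
  exact hx

/-- The comparison in {P}^γ(k) is one in P(γ + k), and `shift` along the enumeration of the joint
support embeds γ + k into W. It remains to observe that shifting after γ + f is the same as shifting
along the enumeration of the smaller support. -/
theorem PD.sep_ext_lt (hP : P.IsPredilator) (hγ : IsOrd γ) (hW : AddClosed W γ) {a' b' : M}
    (h : ((P.sep γ).ext (LO.ofOrd W)).lt (opair (opair σ a') a) (opair (opair τ b') b)) :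
    (P.ext (LO.ofOrd W)).lt (opair σ (shiftSet γ a' a)) (opair τ (shiftSet γ b' b)) := by
  obtain ⟨s, t, a₁, b₁, c, m, n, k, ea, eb, ec, f, g, σ', τ', e1, e2, hc, h1, h2, h3, h4, h5, h6,
    h7, h8, h9, h10, h11, h12⟩ := h
  simp only [opair_inj] at e1 e2
  obtain ⟨rfl, rfl⟩ := e1
  obtain ⟨rfl, rfl⟩ := e2
  have k1 := (sep_map_iff h6 h4.1).1 h10
  have k2 := (sep_map_iff h8 h5.1).1 h11
  subst k1 k2
  have key : ∀ {ea f m σ a' a}, (LO.ofOrd W).IsEn a m ea → NatHom m k f →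
      (∀ i j x, opair i j ∊ f → opair j x ∊ ec → opair i x ∊ ea) → (P.sep γ).Tr (opair σ a') m →
      imag (imag a' (sumMap f)) (shift γ ec) = shiftSet γ a' a := by
    intro ea f m σ a' a h1 h6 h7 h4
    rw [← imag_shift h1 (sepObj_dom h4.1) fun i hi => (((sep_supp_iff.1 h4.2).2 i).1 hi).2]
    have hcomp : ∀ x, x ∊ a' → shift γ ec (sumMap f x) = shift γ ea x := by
      intro x hx
      rcases sepObj_dom h4.1 x hx with ⟨x, hx', rfl⟩ | ⟨i, hi, rfl⟩
      · rw [sumMap_inl, shift_inl, shift_inl]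
      · rw [sumMap_inr, shift_inr, shift_inr]
        have := h7 i _ _ (h6.opair_iff.2 ⟨hi, rfl⟩) (h3.opair_iff.2 ⟨h6.ap_mem hi, rfl⟩)
        rw [(h1.opair_iff.1 this).2]
    rw [ext_iff']
    intro z
    simp only [mem_imag]
    constructor
    · rintro ⟨_, ⟨x, hx, rfl⟩, rfl⟩
      exact ⟨x, hx, hcomp x hx⟩
    · rintro ⟨x, hx, rfl⟩
      exact ⟨_, ⟨x, hx, rfl⟩, (hcomp x hx).symm⟩
  have := ext_lt_map hP (isLinear_add hγ (isOrd_of_mem_om h6.2.1)) (isLinear_ofOrd hW.ord)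
    (fun x => shift_dom hW h3) (fun x y => shift_lt hW h3) h12.2.2
  rwa [key h1 h6 h7 h4, key h2 h8 h9 h5] at this

/-- The elements of `{P[μ]}^γ(W)` lie below an element of `P(W)` with trace in `μ`. -/
theorem PD.sep_bounded (hP : P.IsPredilator) (hW : AddClosed W γ) (hom : om M ∊ W)
    (hμ : P.index.dom μ) : ∃ τ n b eb, (LO.ofOrd W).IsEn b n eb ∧ P.Tr τ n ∧ opair τ n ∊ μ ∧
      ∀ σ a' a, (((P.restrict μ).sep γ).ext (LO.ofOrd W)).dom (opair (opair σ a') a) →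
        (P.ext (LO.ofOrd W)).lt (opair σ (shiftSet γ a' a)) (opair τ b) := by
  obtain ⟨τ, n, h1, h2⟩ := index_exists_mem hP hμ
  have hn := hP.tr_nat h1
  have homW : ∀ {x}, x ∊ om M → x ∊ W := fun hx => hW.ord.trans hx hom
  have hX := isLinear_ofOrd hW.ord
  -- The arguments γ + ω + i exceed γ + N for every natural number N. This makes the bound
  -- independent of the number N that appears below and depends on σ.
  have hb : (LO.ofOrd W).IsEn (imag n fun i => oadd γ (oadd (om M) i)) n
      (lam n fun i => oadd γ (oadd (om M) i)) :=
    LO.isEn_lam hn (fun i hi => hW.add _ _ hW.mem (hW.add _ _ hom (homW (om_trans hn hi))))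
      (fun i j hi hj hij => ⟨hW.add _ _ hW.mem (hW.add _ _ hom (homW (om_trans hn hi))),
        hW.add _ _ hW.mem (hW.add _ _ hom (homW (om_trans hn hj))), oadd_mem (oadd_mem hij)⟩)
      fun x => mem_imag
  refine ⟨τ, n, _, _, hb, h1, h2, fun σ a' a h => ?_⟩
  obtain ⟨σ₁, a₁', a₁, l, e, e1, k1, k2, k3⟩ := exists_of_sep_ext_dom h
  simp only [opair_inj] at e1
  obtain ⟨⟨rfl, rfl⟩, rfl⟩ := e1
  obtain ⟨k, ea, i, h3, h4, h5, h6⟩ := sep_shift hW k1 k2 k3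
  obtain ⟨h4', h7⟩ := (tr_restrict_iff hP).1 h4
  -- As σ and τ belong to the same class, τ ≪ σ fails, so some copy of σ is at most some copy of τ.
  obtain ⟨N, f, g, τ', σ', hf, hg, hl⟩ := exists_of_not_ll hP h1 h4'
    ((index_mem_iff hP hμ h7).1 h2).2.1
  have hf' := (hP.map_hom _ _ _ _ _ hf).1
  have hg' := (hP.map_hom _ _ _ _ _ hg).1
  have hN := hf'.2.1
  have φd : ∀ x, (LO.ofOrd N).dom x → (LO.ofOrd W).dom (oadd γ x) := fun x hx =>
    hW.add _ _ hW.mem (homW (om_trans hN hx))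
  have φl : ∀ x y, (LO.ofOrd N).lt x y → (LO.ofOrd W).lt (oadd γ x) (oadd γ y) := fun x y h =>
    ⟨φd x h.1, φd y h.2.1, oadd_mem h.2.2⟩
  have hA := hg'.isEn.map φd φl
  have hB := hf'.isEn.map φd φl
  -- The decisive argument of the given element lies below γ, while all arguments on the right are
  -- at least γ. The comparison is made in P[μ], since the coefficient i(σ) refers to the connected
  -- summand.
  have s1 : (P.ext (LO.ofOrd W)).lt (opair σ (shiftSet γ a' a))
      (opair σ (imag (imag k (ap g)) fun x => oadd γ x)) := by
    refine ext_lt_of_restrict hP (A := μ) (ext_lt_of_isCoeff (isPredilator_restrict hP μ) hX h3 hA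
      h4 h5 ⟨h3.ap_dom h5.1, hA.ap_dom h5.1, ?_⟩)
    rw [ap_lam h5.1]
    exact mem_oadd.2 (Or.inl h6)
  -- The comparison over N is moved to W along x ↦ γ + x. Equality of the values over N means
  -- equality of the pairs.
  have s2 : (P.ext (LO.ofOrd W)).lt (opair σ (imag (imag k (ap g)) fun x => oadd γ x))
      (opair τ (imag (imag n (ap f)) fun x => oadd γ x)) ∨
      opair σ (imag (imag k (ap g)) fun x => oadd γ x) =
      opair τ (imag (imag n (ap f)) fun x => oadd γ x) := by
    rcases hl with hl | rfl
    · exact Or.inl (ext_lt_map hP (isLinear_ofOrd (isOrd_of_mem_om hN)) hX φd φl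
        ((lt_iff_ext_lt hP h4' h1 hg hf).1 hl))
    · obtain ⟨rfl, e⟩ := (val_ofOrd h1 hf' hf).2.inj hP (val_ofOrd h4' hg' hg).2
      rw [e]
      exact Or.inr rfl
  -- The i-th argument γ + f(i) is below γ + (ω + i), because f(i) is finite.
  have s3 := ext_monotone hP hX hB hb h1 fun i hi h => by
    rw [ap_lam hi, ap_lam hi] at h
    have h := h.2.2
    have hfi := om_trans hN (hf'.ap_mem hi)
    exact mem_asymm h (oadd_mem (mem_oadd.2 (Or.inl hfi)))
  have hL := isLinear_ext hP hX
  rcases s2 with s2 | s2 <;> rcases s3 with s3 | s3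
  · exact hL.trans _ _ _ s1 (hL.trans _ _ _ s2 s3)
  · rw [← s3]; exact hL.trans _ _ _ s1 s2
  · rw [s2] at s1; exact hL.trans _ _ _ s1 s3
  · rw [← s3, ← s2]; exact s1

/-! #### The embeddings -/

open Classical in
/-- The embedding of `E(W)` into `D(W)`, for a predecessor `E` of `D`: the case `p = 0` is for
partial sums, and `p = {γ}` for sums that involve a separation of variables at `γ`. -/
noncomputable def embed {M : Type u} [PRSLang.Structure M] (p z : M) : M :=
  if p = empt M then opair (snd (fst z)) (snd z)
  else if fst (fst z) = empt M then opair (snd (snd (fst z))) (snd z)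
  else opair (fst (snd (fst z))) (shiftSet (sUnion p) (snd (snd (fst z))) (snd z))

instance PR.embed {C : Type v} {𝓜 : C → Type u} [∀ c, PRSLang.Structure (𝓜 c)]
    [∀ c, PRSomega (𝓜 c)] {ok : Prop} {n : ℕ} {s t : ∀ c, (Fin n → 𝓜 c) → 𝓜 c}
    [PR 𝓜 ok s] [PR 𝓜 ok t] : PR 𝓜 ok (fun c v => embed (s c v) (t c v)) := by
  unfold DilRec.embed; infer_instance

theorem embed_empt : embed (empt M) (opair (opair α σ) a) = opair σ a := by simp [embed]

theorem sing_ne_empt (x : M) : sing x ≠ empt M := fun h =>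
  mem_empt x (h ▸ mem_sing.2 rfl)

theorem sUnion_sing (x : M) : sUnion (sing x) = x :=
  ext_iff'.2 fun z => by simp [mem_sUnion]

theorem embed_sing_left : embed (sing γ) (opair (opair (empt M) (opair α σ)) a) = opair σ a := by
  simp [embed, sing_ne_empt]

theorem embed_sing_right {a' : M} : embed (sing γ) (opair (opair (succ (empt M)) (opair σ a')) a) =
    opair σ (shiftSet γ a' a) := by
  simp [embed, sing_ne_empt, sUnion_sing]

/-- `embed p` embeds `Q(X)` into `P(X)` below some bound. -/
structure EmbedsBelow (P Q : PD M) (X : LO M) (p : M) : Prop where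
  dom : ∀ z, (Q.ext X).dom z → (P.ext X).dom (embed p z)
  lt : ∀ z w, (Q.ext X).lt z w → (P.ext X).lt (embed p z) (embed p w)
  bound : ∃ e, (P.ext X).dom e ∧ ∀ z, (Q.ext X).dom z → (P.ext X).lt (embed p z) e

theorem PD.partialSum_embeds (hP : P.IsPredilator) (hW : IsOrd W) (hom : ∀ x, x ∊ om M → x ∊ W)
    (hν : P.index.dom ν) : EmbedsBelow P (P.partialSum ν) (LO.ofOrd W) (empt M) where
  dom := by
    intro z hz
    obtain ⟨α, σ, a, n, e, rfl, h1, h2, h3, h4⟩ := exists_of_partialSum_dom hP hz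
    rw [embed_empt]
    exact ext_dom_iff.2 ⟨n, e, h2, h3⟩
  lt := by
    intro z w h
    obtain ⟨h1, h2⟩ := ext_lt_dom h
    obtain ⟨α, σ, a, m, e, rfl, -⟩ := exists_of_partialSum_dom hP h1
    obtain ⟨β, τ, b, n, f, rfl, -⟩ := exists_of_partialSum_dom hP h2
    rw [embed_empt, embed_empt]
    exact partialSum_ext_lt hP (isLinear_ofOrd hW) h
  bound := by
    obtain ⟨τ, n, -, h1, h2⟩ := partialSum_bounded hP hW hom hν
    refine ⟨_, h1, fun z hz => ?_⟩
    obtain ⟨α, σ, a, n, e, rfl, -⟩ := exists_of_partialSum_dom hP hz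
    rw [embed_empt]
    exact h2 _ _ _ hz

theorem PD.exists_of_add_ext_dom {Q₁ Q₂ : PD M} (h : ((Q₁.add Q₂).ext X).dom z) :
    (∃ s a, z = opair (opair (empt M) s) a ∧ (Q₁.ext X).dom (opair s a)) ∨
    ∃ s a, z = opair (opair (succ (empt M)) s) a ∧ (Q₂.ext X).dom (opair s a) := by
  obtain ⟨α, σ, a, rfl, h1, h2⟩ := exists_of_sum_ext_dom h
  rcases mem_succ.1 h1 with h1 | rfl
  · rcases mem_succ.1 h1 with h1 | rfl
    · exact absurd h1 (mem_empt _)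
    · rw [if_pos rfl] at h2
      exact Or.inl ⟨σ, a, rfl, h2⟩
  · rw [if_neg (succ_ne_empt _)] at h2
    exact Or.inr ⟨σ, a, rfl, h2⟩

/-- Elements from the partial sum and elements with trace in μ are compared by ≪; within the two
parts the previous lemmas apply. The bound for the separated part is also a bound for the partial
sum, since its trace lies in μ. -/
theorem PD.sep_embeds (hP : P.IsPredilator) (hγ : IsOrd γ) (hW : AddClosed W γ) (hom : om M ∊ W)
    (hμ : P.index.dom μ) :
    EmbedsBelow P ((P.partialSum μ).add ((P.restrict μ).sep γ)) (LO.ofOrd W) (sing γ) := by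
  have hX := isLinear_ofOrd hW.ord
  have hR := isPredilator_restrict hP μ
  have hr : ∀ {s a}, (((P.restrict μ).sep γ).ext (LO.ofOrd W)).dom (opair s a) → ∃ σ a' k ea,
      s = opair σ a' ∧ (LO.ofOrd W).IsEn (shiftSet γ a' a) k ea ∧ P.Tr σ k ∧ opair σ k ∊ μ := by
    intro s a h
    obtain ⟨σ, a', a, n, e, e1, k1, k2, k3⟩ := exists_of_sep_ext_dom h
    obtain ⟨rfl, rfl⟩ := opair_inj.1 e1
    obtain ⟨k, ea, i, h3, h4, h5, h6⟩ := sep_shift hW k1 k2 k3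
    obtain ⟨h7, h8⟩ := (tr_restrict_iff hP).1 h4
    exact ⟨σ, a', k, ea, rfl, h3, h7, h8⟩
  refine ⟨?_, ?_, ?_⟩
  · intro z hz
    rcases exists_of_add_ext_dom hz with ⟨s, a, rfl, h⟩ | ⟨s, a, rfl, h⟩
    · obtain ⟨α, σ, a', n, e, e1, h1, h2, h3, h4⟩ := exists_of_partialSum_dom hP h
      obtain ⟨rfl, rfl⟩ := opair_inj.1 e1
      rw [embed_sing_left]
      exact ext_dom_iff.2 ⟨n, e, h2, h3⟩
    · obtain ⟨σ, a', k, ea, rfl, h1, h2, -⟩ := hr h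
      rw [embed_sing_right]
      exact ext_dom_iff.2 ⟨k, ea, h1, h2⟩
  · intro z w h
    obtain ⟨h1, h2⟩ := ext_lt_dom h
    rcases exists_of_add_ext_dom h1 with ⟨s, a, rfl, h3⟩ | ⟨s, a, rfl, h3⟩ <;>
    rcases exists_of_add_ext_dom h2 with ⟨t, b, rfl, h4⟩ | ⟨t, b, rfl, h4⟩
    · obtain ⟨α, σ, a', n, e, e1, -⟩ := exists_of_partialSum_dom hP h3
      obtain ⟨β, τ, b', m, f, e2, -⟩ := exists_of_partialSum_dom hP h4
      obtain ⟨rfl, rfl⟩ := opair_inj.1 e1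
      obtain ⟨rfl, rfl⟩ := opair_inj.1 e2
      rw [embed_sing_left, embed_sing_left]
      rcases sum_ext_lt h with h | ⟨-, h⟩
      · exact absurd h.2.2 (mem_empt _)
      · rw [if_pos rfl] at h
        exact partialSum_ext_lt hP hX h
    · obtain ⟨α, σ, a', n, e, e1, k1, k2, k3, k4⟩ := exists_of_partialSum_dom hP h3
      obtain ⟨rfl, rfl⟩ := opair_inj.1 e1
      obtain ⟨τ, b', k, eb, rfl, l1, l2, l3⟩ := hr h4
      rw [embed_sing_left, embed_sing_right]
      exact ext_lt_of_ll hP hX k2 l1 (ll_of_index_lt hP k1 k4 l3)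
    · rcases sum_ext_lt h with h | ⟨h, -⟩
      · exact absurd h.2.2 (mem_empt _)
      · exact absurd h (succ_ne_empt _)
    · obtain ⟨σ, a', k, ea, rfl, -⟩ := hr h3
      obtain ⟨τ, b', l, eb, rfl, -⟩ := hr h4
      rw [embed_sing_right, embed_sing_right]
      rcases sum_ext_lt h with h | ⟨-, h⟩
      · exact absurd h.2.2 (mem_irrefl _)
      · rw [if_neg (succ_ne_empt _)] at h
        exact ext_lt_of_restrict hP (sep_ext_lt hR hγ hW h)
  · obtain ⟨τ, n, b, eb, k1, k2, k3, k4⟩ := sep_bounded hP hW hom hμ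
    refine ⟨opair τ b, ext_dom_iff.2 ⟨n, eb, k1, k2⟩, fun z hz => ?_⟩
    rcases exists_of_add_ext_dom hz with ⟨s, a, rfl, h⟩ | ⟨s, a, rfl, h⟩
    · obtain ⟨α, σ, a', n, e, e1, h1, h2, h3, h4⟩ := exists_of_partialSum_dom hP h
      obtain ⟨rfl, rfl⟩ := opair_inj.1 e1
      rw [embed_sing_left]
      exact ext_lt_of_ll hP hX h2 k1 (ll_of_index_lt hP h1 h4 k3)
    · obtain ⟨σ, a', k, ea, rfl, -⟩ := hr h
      rw [embed_sing_right]
      exact k4 _ _ _ h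

/-- The indices of the embeddings of predecessors. -/
noncomputable def embedIndices {M : Type u} [PRSLang.Structure M] (η : M) : M :=
  adjoin (imag η fun γ => sing γ) (empt M)

instance PR.embedIndices {C : Type v} {𝓜 : C → Type u} [∀ c, PRSLang.Structure (𝓜 c)]
    [∀ c, PRSomega (𝓜 c)] {ok : Prop} {n : ℕ} {s : ∀ c, (Fin n → 𝓜 c) → 𝓜 c}
    [PR 𝓜 ok s] : PR 𝓜 ok (fun c v => embedIndices (s c v)) := by
  unfold DilRec.embedIndices; infer_instance

/-- All embeddings that are needed are given by one primitive recursive function with an index from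
the set `embedIndices η`. This is what allows the ranking argument to run inside a set. -/
theorem IsPred.isPredilator_and_embeds {D E : M} (hη : IsOrd η) (hW : IsOmegaPowOneAdd η W)
    (hD : IsPredilator D) (h : IsPred η D E) : IsPredilator E ∧
      ∃ p, p ∊ embedIndices η ∧ EmbedsBelow (PD.ofSet D) (PD.ofSet E) (LO.ofOrd W) p := by
  obtain ⟨w1, w2, w3, w4, w5⟩ := hW.closed hη
  have hP := hD.2
  have key : ∀ {Q p}, Codes E Q → Q.IsPredilator → p ∊ embedIndices η →
      EmbedsBelow (PD.ofSet D) Q (LO.ofOrd W) p → IsPredilator E ∧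
      ∃ p, p ∊ embedIndices η ∧ EmbedsBelow (PD.ofSet D) (PD.ofSet E) (LO.ofOrd W) p := by
    intro Q p h1 h2 h3 h4
    obtain rfl := ofSet_eq_of_codes h1
    exact ⟨⟨h1, h2⟩, p, h3, h4⟩
  have h0 : empt M ∊ embedIndices η := mem_adjoin.2 (Or.inr rfl)
  rcases h with ⟨μ, h1, -, h2⟩ | ⟨-, ν, h1, h2⟩ | ⟨μ, h1, -, γ, hγ, h2⟩
  · exact key h2 (isPredilator_partialSum hP μ) h0 (partialSum_embeds hP w1 w2 h1.1)
  · exact key h2 (isPredilator_partialSum hP ν) h0 (partialSum_embeds hP w1 w2 h1)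
  · exact key h2 (isPredilator_add (isPredilator_partialSum hP μ)
      (isPredilator_sep (isPredilator_restrict hP μ) (hη.mem hγ)))
      (mem_adjoin.2 (Or.inl (mem_imag.2 ⟨γ, hγ, rfl⟩)))
      (sep_embeds hP (hη.mem hγ) ⟨w1, w4, w3 γ hγ⟩ (w5 γ hγ) h1.1)

end Embeddings

end DilRec

set_option synthInstance.maxSize 2000
set_option synthInstance.maxHeartbeats 200000

namespace DilRec

universe u v

/-! ### Recursion along a well-founded family of predecessor sets -/

section GuardedRecursion

section Defs

variable {M : Type u} [PRSLang.Structure M]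

/-- The closure of `{s}` under the elements of `N x`. -/
noncomputable def closure (N : M → M) (s : M) : M :=
  bUnion (om M) (recI fun w _ => adjoin (bUnion (sUnion w) N) s)

/-- The pairs `⟨E, G(g, E)⟩` for `E` in the closure of `{s}` under `p`, where `g` is the restriction
to `p E` of the union of the stages at elements of `ζ`, when this is defined on all of `p E`. -/
noncomputable def stage (p : M → M) (G : M → M → M) (s ζ : M) : M :=
  recI (fun w _ => imag (sepr (closure p s) fun E =>
    ∀ x, x ∊ p E → ∃ z, z ∊ sUnion w ∧ z = opair x (snd z)) fun E =>
      opair E (G (lam (p E) (ap (sUnion w))) E)) ζ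

/-- The union of the stages at elements of `ζ`. -/
noncomputable def below (p : M → M) (G : M → M → M) (s ζ : M) : M :=
  bUnion ζ (stage p G s)

/-- The value at `E` of the recursion along `p` with step `G`, computed in `ζ` stages. -/
noncomputable def value (p : M → M) (G : M → M → M) (E ζ : M) : M :=
  G (lam (p E) (ap (below p G E ζ))) E

end Defs

section Closure

variable {C : Type v} {𝓜 : C → Type u} [∀ c, PRSLang.Structure (𝓜 c)] [∀ c, PRSomega (𝓜 c)]
  {ok : Prop} {n m : ℕ} {s t : ∀ c, (Fin n → 𝓜 c) → 𝓜 c}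
  {p : ∀ c, (Fin n → 𝓜 c) → 𝓜 c → 𝓜 c} {G : ∀ c, (Fin n → 𝓜 c) → 𝓜 c → 𝓜 c → 𝓜 c}

theorem PR.inst (hp : PR 𝓜 ok (n := n + 1) (fun c w => p c (fun i => w i.succ) (w 0)))
    (ρ : Fin n → Fin m) (s : ∀ c, (Fin m → 𝓜 c) → 𝓜 c) [hs : PR 𝓜 ok s] :
    PR 𝓜 ok (fun c w => p c (fun i => w (ρ i)) (s c w)) :=
  PR.subst (ht := hp) (Matrix.vecCons s fun i _ v => v (ρ i)) (Fin.cases hs fun _ => PR.var _)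

instance PR.closure [PR 𝓜 ok s]
    [hp : PR 𝓜 ok (n := n + 1) (fun c w => p c (fun i => w i.succ) (w 0))] :
    PR 𝓜 ok (fun c v => closure (fun x => p c v x) (s c v)) := by
  have hp' := fun {m} (ρ : Fin n → Fin m) (s) [PR 𝓜 ok s] => PR.inst hp ρ s
  unfold DilRec.closure
  infer_instance

instance PR.stage [PR 𝓜 ok s] [PR 𝓜 ok t]
    [hp : PR 𝓜 ok (n := n + 1) (fun c w => p c (fun i => w i.succ) (w 0))]
    [hG : PR 𝓜 ok (n := n + 2) (fun c w => G c (fun i => w i.succ.succ) (w 1) (w 0))] :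
    PR 𝓜 ok (fun c v => stage (fun x => p c v x) (fun g x => G c v g x) (s c v) (t c v)) := by
  have hp' := fun {m} (ρ : Fin n → Fin m) (s) [PR 𝓜 ok s] => PR.inst hp ρ s
  have hG' := fun {m} (ρ : Fin n → Fin m) (s t) [PR 𝓜 ok s] [PR 𝓜 ok t] => PR.inst₂ hG ρ s t
  unfold DilRec.stage
  infer_instance

instance PR.below [PR 𝓜 ok s] [PR 𝓜 ok t]
    [hp : PR 𝓜 ok (n := n + 1) (fun c w => p c (fun i => w i.succ) (w 0))]
    [hG : PR 𝓜 ok (n := n + 2) (fun c w => G c (fun i => w i.succ.succ) (w 1) (w 0))] :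
    PR 𝓜 ok (fun c v => below (fun x => p c v x) (fun g x => G c v g x) (s c v) (t c v)) := by
  have hp' := fun {m} (ρ : Fin n → Fin m) (s) [PR 𝓜 ok s] => PR.inst hp ρ s
  have hG' := fun {m} (ρ : Fin n → Fin m) (s t) [PR 𝓜 ok s] [PR 𝓜 ok t] => PR.inst₂ hG ρ s t
  unfold DilRec.below
  infer_instance

instance PR.value [PR 𝓜 ok s] [PR 𝓜 ok t]
    [hp : PR 𝓜 ok (n := n + 1) (fun c w => p c (fun i => w i.succ) (w 0))]
    [hG : PR 𝓜 ok (n := n + 2) (fun c w => G c (fun i => w i.succ.succ) (w 1) (w 0))] :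
    PR 𝓜 ok (fun c v => value (fun x => p c v x) (fun g x => G c v g x) (s c v) (t c v)) := by
  have hp' := fun {m} (ρ : Fin n → Fin m) (s) [PR 𝓜 ok s] => PR.inst hp ρ s
  have hG' := fun {m} (ρ : Fin n → Fin m) (s t) [PR 𝓜 ok s] [PR 𝓜 ok t] => PR.inst₂ hG ρ s t
  unfold DilRec.value
  infer_instance

end Closure

/-! ### Uniqueness and definedness of the stages -/

section Local

variable {M : Type u} [PRSLang.Structure M] [PRSomega M] {N p : M → M} {G : M → M → M}
  {D E E' s s' ζ ζ' ξ u u' x z : M}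

theorem DefF.apply {n : ℕ} {f : M → M} (hf : DefF f) (s : PUnit.{1} → (Fin n → M) → M)
    [hs : PR (fun _ : PUnit.{1} => M) True s] :
    PR (fun _ : PUnit.{1} => M) True (fun c v => f (s c v)) :=
  PR.subst (ht := hf) (fun _ => s) fun _ => hs

theorem DefF₂.apply {n : ℕ} {f : M → M → M} (hf : DefF₂ f) (s t : PUnit.{1} → (Fin n → M) → M)
    [hs : PR (fun _ : PUnit.{1} => M) True s] [ht : PR (fun _ : PUnit.{1} => M) True t] :
    PR (fun _ : PUnit.{1} => M) True (fun c v => f (s c v) (t c v)) :=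
  PR.subst (ht := hf) (Matrix.vecCons s (Matrix.vecCons t fun i => i.elim0))
    (Fin.cases hs (Fin.cases ht fun i => i.elim0))

theorem DefR.apply {n : ℕ} {φ : M → Prop} (hφ : DefR φ) (s : PUnit.{1} → (Fin n → M) → M)
    [hs : PR (fun _ : PUnit.{1} => M) True s] :
    PRRel (fun _ : PUnit.{1} => M) True (fun c v => φ (s c v)) :=
  PRRel.subst (ht := hφ) (fun _ => s) fun _ => hs

theorem mem_closure_level [hN : DefF N] {x z : M} :
    z ∊ recI (fun w _ => adjoin (bUnion (sUnion w) N) s) x ↔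
      (∃ y, y ∊ x ∧ ∃ E, E ∊ recI (fun w _ => adjoin (bUnion (sUnion w) N) s) y ∧ z ∊ N E) ∨
        z = s := by
  have hN' := fun {n} (s : PUnit.{1} → (Fin n → M) → M) [PR _ True s] => hN.apply (n := n) s
  rw [recI_eq]
  simp only [mem_adjoin, mem_bUnion, mem_sUnion, mem_imag]
  constructor
  · rintro (⟨E, ⟨_, ⟨y, hy, rfl⟩, hE⟩, hz⟩ | rfl)
    · exact Or.inl ⟨y, hy, E, hE, hz⟩
    · exact Or.inr rfl
  · rintro (⟨y, hy, E, hE, hz⟩ | rfl)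
    · exact Or.inl ⟨E, ⟨_, ⟨y, hy, rfl⟩, hE⟩, hz⟩
    · exact Or.inr rfl

theorem mem_closure [hN : DefF N] : z ∊ closure N s ↔
    ∃ k, k ∊ om M ∧ z ∊ recI (fun w _ => adjoin (bUnion (sUnion w) N) s) k := by
  have hN' := fun {n} (s : PUnit.{1} → (Fin n → M) → M) [PR _ True s] => hN.apply (n := n) s
  rw [closure, mem_bUnion]

theorem self_mem_closure [DefF N] : s ∊ closure N s :=
  mem_closure.2 ⟨_, empt_mem_om, mem_closure_level.2 (Or.inr rfl)⟩

theorem closure_step [DefF N] (h : E ∊ closure N s) (h' : E' ∊ N E) : E' ∊ closure N s := by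
  obtain ⟨k, hk, hE⟩ := mem_closure.1 h
  exact mem_closure.2 ⟨_, succ_mem_om hk, mem_closure_level.2
    (Or.inl ⟨k, mem_succ.2 (Or.inr rfl), E, hE, h'⟩)⟩

/-- The property must be primitive recursive, as the proof is by set induction on the level at which
an element enters the closure. -/
theorem closure_induction [hN : DefF N] (φ : M → Prop) [hφ : DefR φ] (h0 : φ s)
    (h1 : ∀ E E', φ E → E' ∊ N E → φ E') (h : E ∊ closure N s) : φ E := by
  have hN' := fun {n} (s : PUnit.{1} → (Fin n → M) → M) [PR _ True s] => hN.apply (n := n) s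
  have hφ' := fun {n} (s : PUnit.{1} → (Fin n → M) → M) [PR _ True s] => hφ.apply (n := n) s
  obtain ⟨k, -, hE⟩ := mem_closure.1 h
  refine mem_induction (fun k => ∀ E, E ∊ recI (fun w _ => adjoin (bUnion (sUnion w) N) s) k → φ E)
    (fun k ih E hE => ?_) k E hE
  rcases mem_closure_level.1 hE with ⟨y, hy, E', hE', h⟩ | rfl
  · exact h1 _ _ (ih y hy _ hE') h
  · exact h0

variable [hp : DefF p] [hG : DefF₂ G]

theorem mem_below : z ∊ below p G s ζ ↔ ∃ ζ', ζ' ∊ ζ ∧ z ∊ stage p G s ζ' := by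
  have hp' := fun {n} (s : PUnit.{1} → (Fin n → M) → M) [PR _ True s] => hp.apply (n := n) s
  have hG' := fun {n} (s t : PUnit.{1} → (Fin n → M) → M) [PR _ True s] [PR _ True t] => hG.apply (n := n) s t
  rw [below, mem_bUnion]

/-- The recursion refers to earlier stages only via the union of their set, which is `below`.
Definedness on p E amounts to each predecessor having an entry in some earlier stage. -/
theorem mem_stage : z ∊ stage p G s ζ ↔ ∃ E, E ∊ closure p s ∧
    (∀ x, x ∊ p E → ∃ ζ', ζ' ∊ ζ ∧ ∃ u, opair x u ∊ stage p G s ζ') ∧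
      z = opair E (G (lam (p E) (ap (below p G s ζ))) E) := by
  have hp' := fun {n} (s : PUnit.{1} → (Fin n → M) → M) [PR _ True s] => hp.apply (n := n) s
  have hG' := fun {n} (s t : PUnit.{1} → (Fin n → M) → M) [PR _ True s] [PR _ True t] => hG.apply (n := n) s t
  have e : sUnion (imag ζ (stage p G s)) = below p G s ζ := by
    rw [ext_iff']
    intro z
    simp only [mem_sUnion, mem_imag, mem_below]
    exact ⟨fun ⟨_, ⟨ζ', h, e⟩, hz⟩ => ⟨ζ', h, e ▸ hz⟩, fun ⟨ζ', h, hz⟩ => ⟨_, ⟨ζ', h, rfl⟩, hz⟩⟩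
  have e' : stage p G s ζ = imag (sepr (closure p s) fun E =>
      ∀ x, x ∊ p E → ∃ z, z ∊ below p G s ζ ∧ z = opair x (snd z)) fun E =>
        opair E (G (lam (p E) (ap (below p G s ζ))) E) := by
    conv_lhs => rw [stage, recI_eq]
    change imag (sepr (closure p s) fun E =>
      ∀ x, x ∊ p E → ∃ z, z ∊ sUnion (imag ζ (stage p G s)) ∧ z = opair x (snd z)) (fun E =>
        opair E (G (lam (p E) (ap (sUnion (imag ζ (stage p G s))))) E)) = _
    rw [e]
  rw [e', mem_imag]
  refine exists_congr fun E => ?_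
  rw [mem_sepr, and_assoc]
  refine and_congr_right fun _ => and_congr_left fun _ => forall_congr' fun x => imp_congr_right
    fun _ => ?_
  constructor
  · rintro ⟨z, hz, hx⟩
    obtain ⟨ζ', h, hz⟩ := mem_below.1 hz
    exact ⟨ζ', h, snd z, hx ▸ hz⟩
  · rintro ⟨ζ', h, u, hu⟩
    exact ⟨_, mem_below.2 ⟨ζ', h, hu⟩, by rw [snd_opair]⟩

theorem opair_mem_stage : opair E u ∊ stage p G s ζ ↔ E ∊ closure p s ∧
    (∀ x, x ∊ p E → ∃ ζ', ζ' ∊ ζ ∧ ∃ u, opair x u ∊ stage p G s ζ') ∧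
      u = G (lam (p E) (ap (below p G s ζ))) E := by
  rw [mem_stage]
  constructor
  · rintro ⟨E', h1, h2, h3⟩
    obtain ⟨rfl, h3⟩ := opair_inj.1 h3
    exact ⟨h1, h2, h3⟩
  · rintro ⟨h1, h2, h3⟩
    exact ⟨E, h1, h2, h3 ▸ rfl⟩

theorem lam_congr {a : M} {φ ψ : M → M} [DefF φ] [DefF ψ] (h : ∀ x, x ∊ a → φ x = ψ x) :
    lam a φ = lam a ψ := by
  rw [ext_iff']
  intro z
  rw [mem_lam, mem_lam]
  exact exists_congr fun x => and_congr_right fun hx => by rw [h x hx]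

/-- The values in different stages are compatible. -/
theorem stage_unique (h : opair E u ∊ stage p G s ζ) (h' : opair E u' ∊ stage p G s' ζ') :
    u = u' := by
  have hp' := fun {n} (s : PUnit.{1} → (Fin n → M) → M) [PR _ True s] => hp.apply (n := n) s
  have hG' := fun {n} (s t : PUnit.{1} → (Fin n → M) → M) [PR _ True s] [PR _ True t] => hG.apply (n := n) s t
  -- The induction statement has bounded quantifiers only: stages range over T and starting points
  -- over {s, s'}. The starting point s is admitted on both sides in order to conclude that values
  -- in the union of the stages for s are unique, so that `ap` really returns them.
  let T := trcl (upair ζ ζ')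
  have key := mem_induction (fun ζ => ζ ∊ T → ∀ z, z ∊ stage p G s ζ → ∀ s'', s'' ∊ upair s s' →
      ∀ ζ', ζ' ∊ T → ∀ z', z' ∊ stage p G s'' ζ' → fst z = fst z' → z = z')
  have main : ∀ ζ, ζ ∊ T → ∀ z, z ∊ stage p G s ζ → ∀ s'', s'' ∊ upair s s' →
      ∀ ζ', ζ' ∊ T → ∀ z', z' ∊ stage p G s'' ζ' → fst z = fst z' → z = z' := by
    refine key fun ζ ih hζ z hz s'' hs ζ' hζ' z' hz' e => ?_
    obtain ⟨E, h1, h2, rfl⟩ := mem_stage.1 hz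
    obtain ⟨E', k1, k2, rfl⟩ := mem_stage.1 hz'
    rw [fst_opair, fst_opair] at e
    subst e
    have : lam (p E) (ap (below p G s ζ)) = lam (p E) (ap (below p G s'' ζ')) := by
      refine lam_congr fun x hx => ?_
      obtain ⟨ζ₁, hζ₁, u, hu⟩ := h2 x hx
      obtain ⟨ζ₂, hζ₂, u', hu'⟩ := k2 x hx
      have cmp : ∀ s'', s'' ∊ upair s s' → ∀ ζ', ζ' ∊ T → ∀ v, opair x v ∊ below p G s'' ζ' →
          v = u := by
        intro s'' hs ζ' hζ' v hv
        obtain ⟨ζ₃, hζ₃, hv⟩ := mem_below.1 hv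
        have := ih ζ₁ hζ₁ (trcl_trans hζ hζ₁) _ hu s'' hs ζ₃ (trcl_trans hζ' hζ₃) _ hv
          (by rw [fst_opair, fst_opair])
        exact (opair_inj.1 this).2.symm
      have e1 : ap (below p G s ζ) x = u := ap_eq (mem_below.2 ⟨ζ₁, hζ₁, hu⟩)
        (cmp s (mem_upair.2 (Or.inl rfl)) ζ hζ)
      have e2 := cmp s'' hs ζ' hζ' u' (mem_below.2 ⟨ζ₂, hζ₂, hu'⟩)
      subst e2
      rw [e1, ap_eq (mem_below.2 ⟨ζ₂, hζ₂, hu'⟩) (cmp s'' hs ζ' hζ')]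
    rw [this]
  have := main ζ (mem_trcl (mem_upair.2 (Or.inl rfl))) _ h s' (mem_upair.2 (Or.inr rfl)) ζ'
    (mem_trcl (mem_upair.2 (Or.inr rfl))) _ h' (by rw [fst_opair, fst_opair])
  exact (opair_inj.1 this).2

theorem ap_below (h : opair E u ∊ stage p G s ζ) (hζ : ζ ∊ ξ) : ap (below p G s ξ) E = u := by
  refine ap_eq (mem_below.2 ⟨ζ, hζ, h⟩) fun u' h' => ?_
  obtain ⟨ζ', -, h'⟩ := mem_below.1 h'
  exact stage_unique h' h

/-- Definedness at a stage does not depend on the starting point. -/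
theorem stage_transfer (h : opair E u ∊ stage p G s ζ) (hE : E ∊ closure p s') :
    ∃ u, opair E u ∊ stage p G s' ζ := by
  have hp' := fun {n} (s : PUnit.{1} → (Fin n → M) → M) [PR _ True s] => hp.apply (n := n) s
  have hG' := fun {n} (s t : PUnit.{1} → (Fin n → M) → M) [PR _ True s] [PR _ True t] => hG.apply (n := n) s t
  have key := mem_induction (fun ζ => ∀ z, z ∊ stage p G s ζ → fst z ∊ closure p s' →
    ∃ z', z' ∊ stage p G s' ζ ∧ z' = opair (fst z) (snd z')) (fun ζ ih z hz hc => ?_) ζ _ h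
      (by rwa [fst_opair])
  · obtain ⟨z', h1, h2⟩ := key
    rw [fst_opair] at h2
    exact ⟨snd z', h2 ▸ h1⟩
  · obtain ⟨E, h1, h2, rfl⟩ := mem_stage.1 hz
    rw [fst_opair] at hc ⊢
    refine ⟨_, opair_mem_stage.2 ⟨hc, fun x hx => ?_, rfl⟩, by rw [snd_opair]⟩
    obtain ⟨ζ', hζ', u, hu⟩ := h2 x hx
    obtain ⟨z', k1, k2⟩ := ih ζ' hζ' _ hu (by rw [fst_opair]; exact closure_step hc hx)
    rw [fst_opair] at k2
    exact ⟨ζ', hζ', snd z', k2 ▸ k1⟩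

/-- The stages in `value` start at E itself, whereas the entry of E may stem from stages for another
starting point s. All predecessors of E occur before ζ for either starting point and have the same
values, so G receives the same argument. -/
theorem stage_value (h : opair E u ∊ stage p G s ζ) (hζ : ζ ∊ ξ) (hξ : IsOrd ξ) :
    value p G E ξ = u := by
  have hp' := fun {n} (s : PUnit.{1} → (Fin n → M) → M) [PR _ True s] => hp.apply (n := n) s
  have hG' := fun {n} (s t : PUnit.{1} → (Fin n → M) → M) [PR _ True s] [PR _ True t] => hG.apply (n := n) s t
  obtain ⟨h1, h2, rfl⟩ := opair_mem_stage.1 h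
  rw [value]
  congr 1
  refine lam_congr fun x hx => ?_
  obtain ⟨ζ', hζ', u, hu⟩ := h2 x hx
  obtain ⟨u', hu'⟩ := stage_transfer hu (closure_step self_mem_closure hx)
  rw [ap_below hu' (hξ.trans hζ' hζ), ap_below hu hζ', stage_unique hu' hu]

/-- The predecessors of D have entries at stages before ζ, so by `stage_value` the values read off
from the stages for D coincide with those of the function itself. -/
theorem value_eq (h : opair D u ∊ stage p G D ζ) (hζ : ζ ∊ ξ) (hξ : IsOrd ξ) :
    value p G D ξ = G (lam (p D) fun E => value p G E ξ) D := by
  have hp' := fun {n} (s : PUnit.{1} → (Fin n → M) → M) [PR _ True s] => hp.apply (n := n) s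
  have hG' := fun {n} (s t : PUnit.{1} → (Fin n → M) → M) [PR _ True s] [PR _ True t] => hG.apply (n := n) s t
  conv_lhs => rw [value]
  congr 1
  refine lam_congr fun x hx => ?_
  obtain ⟨-, h2, -⟩ := opair_mem_stage.1 h
  obtain ⟨ζ', hζ', u, hu⟩ := h2 x hx
  rw [ap_below hu (hξ.trans hζ' hζ), stage_value hu (hξ.trans hζ' hζ) hξ]

/-- The recursion is defined along a ranking: the nodes `⟨E, h⟩` in a closed set come with
`X E` such that a bound on `h ↾ X E` decreases when passing to elements of `p E`. -/
theorem exists_mem_stage_of_ranking {X : M → M} [hX : DefF X] [hN : DefF N] {d : M}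
    (hd : fst d = s) (H : ∀ z ζ, z ∊ closure N d → (∀ e, e ∊ X (fst z) → ap (snd z) e ∊ ζ) →
      ∀ E, E ∊ p (fst z) → ∃ ζ' z', ζ' ∊ ζ ∧ z' ∊ N z ∧ fst z' = E ∧
        ∀ e, e ∊ X (fst z') → ap (snd z') e ∊ ζ')
    (h : ∀ e, e ∊ X s → ap (snd d) e ∊ ζ) : ∃ u, opair s u ∊ stage p G s ζ := by
  have hp' := fun {n} (s : PUnit.{1} → (Fin n → M) → M) [PR _ True s] => hp.apply (n := n) s
  have hG' := fun {n} (s t : PUnit.{1} → (Fin n → M) → M) [PR _ True s] [PR _ True t] => hG.apply (n := n) s t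
  have hX' := fun {n} (s : PUnit.{1} → (Fin n → M) → M) [PR _ True s] => hX.apply (n := n) s
  have hN' := fun {n} (s : PUnit.{1} → (Fin n → M) → M) [PR _ True s] => hN.apply (n := n) s
  -- Quantifying over all rankings would leave the primitive recursive relations. Here the rankings
  -- are components of nodes in a fixed closed set, and the induction is on the bound ζ.
  have key := mem_induction (fun ζ => ∀ z, z ∊ closure N d →
    (∀ e, e ∊ X (fst z) → ap (snd z) e ∊ ζ) → fst z ∊ closure p s →
    ∃ z', z' ∊ stage p G s ζ ∧ z' = opair (fst z) (snd z')) (fun ζ ih z hz hb hc => ?_) ζ d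
      self_mem_closure (by rwa [hd]) (by rw [hd]; exact self_mem_closure)
  · obtain ⟨z', h1, h2⟩ := key
    rw [hd] at h2
    exact ⟨snd z', h2 ▸ h1⟩
  · refine ⟨_, opair_mem_stage.2 ⟨hc, fun E hE => ?_, rfl⟩, by rw [snd_opair]⟩
    obtain ⟨ζ', z', h1, h2, rfl, h4⟩ := H z ζ hz hb E hE
    obtain ⟨z'', k1, k2⟩ := ih ζ' h1 z' (closure_step hz h2) h4 (closure_step hc hE)
    exact ⟨ζ', h1, snd z'', k2 ▸ k1⟩

end Local

end GuardedRecursion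

end DilRec

set_option synthInstance.maxSize 2000
set_option synthInstance.maxHeartbeats 200000

namespace DilRec

universe u v

/-! ### Guarded recursion on dilators -/

section Ranking

open PD LO

section Defs

variable {M : Type u} [PRSLang.Structure M]

/-- The underlying set of `E(W)`. -/
noncomputable def extSet (W E : M) : M := setOf ((PD.ofSet E).ext (LO.ofOrd W)).dom

/-- `z = ⟨E, h⟩` where `E` is a predilator and `h` is strictly increasing on `E(W)`. -/
def IsRanked (W z : M) : Prop :=
  IsPredilator (fst z) ∧ ∀ e, e ∊ extSet W (fst z) → ∀ e', e' ∊ extSet W (fst z) →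
    ((PD.ofSet (fst z)).ext (LO.ofOrd W)).lt e e' → ap (snd z) e ∊ ap (snd z) e'

/-- The pairs `⟨E, h ∘ embed q⟩` that satisfy `IsRanked`, for `z = ⟨D, h⟩` and predecessors `E`
of `D`. -/
noncomputable def rankedPreds (η W z : M) : M :=
  sepr (imag (prod (predSet η (fst z)) (embedIndices η)) fun q =>
    opair (fst q) (lam (extSet W (fst q)) fun e => ap (snd z) (embed (snd q) e))) (IsRanked W)

end Defs

section Closure

variable {C : Type v} {𝓜 : C → Type u} [∀ c, PRSLang.Structure (𝓜 c)] [∀ c, PRSomega (𝓜 c)]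
  {ok : Prop} {n : ℕ} {r s t : ∀ c, (Fin n → 𝓜 c) → 𝓜 c}

instance PR.extSet [PR 𝓜 ok s] [PR 𝓜 ok t] : PR 𝓜 ok (fun c v => extSet (s c v) (t c v)) := by
  unfold DilRec.extSet; infer_instance

instance PRRel.isRanked [PR 𝓜 ok s] [PR 𝓜 ok t] :
    PRRel 𝓜 ok (fun c v => IsRanked (s c v) (t c v)) := by
  unfold IsRanked; infer_instance

instance PR.rankedPreds [PR 𝓜 ok r] [PR 𝓜 ok s] [PR 𝓜 ok t] :
    PR 𝓜 ok (fun c v => rankedPreds (r c v) (s c v) (t c v)) := by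
  unfold DilRec.rankedPreds; infer_instance

end Closure

variable {M : Type u} [PRSLang.Structure M] [PRSomega M] {D E η ξ ξ' ζ W z e p : M}

theorem mem_extSet : e ∊ extSet W E ↔ ((PD.ofSet E).ext (LO.ofOrd W)).dom e :=
  LOPR.mem_setOf_dom (𝓜 := fun _ : PUnit.{1} => M) (ok := True) (n := 0)
    (X := fun _ _ => (PD.ofSet E).ext (LO.ofOrd W)) (c := ⟨⟩) (v := Fin.elim0)

/-- The ranking is the inverse of the enumeration of D(W) by an ordinal ζ < ξ. Linearity makes that
enumeration injective and its inverse order preserving. -/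
theorem exists_ranking (hD : IsPredilator D) (hW : IsOrd W) (hξ : IsOrd ξ)
    (h : ((PD.ofSet D).ext (LO.ofOrd W)).OtpBelow ξ) : ∃ ζ h, ζ ∊ ξ ∧
      IsRanked W (opair D h) ∧ ∀ e, e ∊ extSet W D → ap h e ∊ ζ := by
  obtain ⟨ζ, c, hζ, hc, h1, h2⟩ := h
  have hL := isLinear_ext hD.2 (isLinear_ofOrd hW)
  have hζ' := hξ.mem hζ
  have inj : ∀ {α β e}, opair α e ∊ c → opair β e ∊ c → α = β := by
    intro α β e hα hβ
    rcases (hζ'.mem (hc.opair_iff.1 hα).1).tri (hζ'.mem (hc.opair_iff.1 hβ).1) with h | h | h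
    · exact absurd (h2 _ _ _ _ h hα hβ) (hL.irrefl _)
    · exact h
    · exact absurd (h2 _ _ _ _ h hβ hα) (hL.irrefl _)
  let h := imag c fun z => opair (snd z) (fst z)
  have hh : ∀ {α e}, opair e α ∊ h ↔ opair α e ∊ c := by
    intro α e
    rw [mem_imag]
    constructor
    · rintro ⟨z, hz, he⟩
      obtain ⟨β, e', -, rfl⟩ := hc.1 z hz
      rw [snd_opair, fst_opair, opair_inj] at he
      rw [he.1, he.2]
      exact hz
    · exact fun h => ⟨_, h, by rw [snd_opair, fst_opair]⟩
  have hap : ∀ {α e}, opair α e ∊ c → ap h e = α := fun h' =>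
    ap_eq (hh.2 h') fun β hβ => inj (hh.1 hβ) h'
  refine ⟨ζ, h, hζ, ⟨by rwa [fst_opair], fun e he e' he' hlt => ?_⟩, fun e he => ?_⟩
  · rw [fst_opair] at he he' hlt
    rw [snd_opair]
    obtain ⟨α, hα⟩ := (h1 e).1 (mem_extSet.1 he)
    obtain ⟨β, hβ⟩ := (h1 e').1 (mem_extSet.1 he')
    rw [hap hα, hap hβ]
    rcases (hζ'.mem (hc.opair_iff.1 hα).1).tri (hζ'.mem (hc.opair_iff.1 hβ).1) with h | rfl | h
    · exact h
    · rw [(hc.opair_iff.1 hα).2, (hc.opair_iff.1 hβ).2] at hlt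
      exact absurd hlt (hL.irrefl _)
    · exact absurd (hL.trans _ _ _ hlt (h2 _ _ _ _ h hβ hα)) (hL.irrefl _)
  · obtain ⟨α, hα⟩ := (h1 e).1 (mem_extSet.1 he)
    rw [hap hα]
    exact (hc.opair_iff.1 hα).1

/-- The ranking of D(W) is composed with the embedding of E(W). As the range of the embedding is
bounded by some b, the ranks of E(W) are below the rank of b, which is the new and smaller ordinal.
-/
theorem exists_rankedPred (hη : IsOrd η) (hW : IsOmegaPowOneAdd η W) (hz : IsRanked W z)
    (hb : ∀ e, e ∊ extSet W (fst z) → ap (snd z) e ∊ ζ) (hE : E ∊ predSet η (fst z)) :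
    ∃ ζ' z', ζ' ∊ ζ ∧ z' ∊ rankedPreds η W z ∧ fst z' = E ∧
      ∀ e, e ∊ extSet W (fst z') → ap (snd z') e ∊ ζ' := by
  obtain ⟨h1, q, hq, h2⟩ := (mem_predSet.1 hE).isPredilator_and_embeds hη hW hz.1
  obtain ⟨b, hb1, hb2⟩ := h2.bound
  have hap : ∀ {e}, e ∊ extSet W E →
      ap (lam (extSet W E) fun e => ap (snd z) (embed q e)) e = ap (snd z) (embed q e) :=
    fun he => ap_lam he
  refine ⟨ap (snd z) b, opair E (lam (extSet W E) fun e => ap (snd z) (embed q e)),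
    hb b (mem_extSet.2 hb1), ?_, fst_opair _ _, ?_⟩
  · refine mem_sepr.2 ⟨mem_imag.2 ⟨opair E q, opair_mem_prod.2 ⟨hE, hq⟩, ?_⟩, ?_⟩
    · rw [fst_opair, snd_opair]
    · refine ⟨by rwa [fst_opair], fun e he e' he' hlt => ?_⟩
      rw [fst_opair] at he he' hlt
      rw [snd_opair, hap he, hap he']
      exact hz.2 _ (mem_extSet.2 (h2.dom _ (mem_extSet.1 he))) _
        (mem_extSet.2 (h2.dom _ (mem_extSet.1 he'))) (h2.lt _ _ hlt)
  · intro e he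
    rw [fst_opair] at he
    rw [snd_opair, hap he]
    exact hz.2 _ (mem_extSet.2 (h2.dom _ (mem_extSet.1 he))) _ (mem_extSet.2 hb1)
      (hb2 _ (mem_extSet.1 he))

/-- For a given predecessor not every index need yield an embedding. The filter in `rankedPreds`
removes unsuitable candidates, so being ranked is an invariant on the closure, and
`exists_rankedPred` ensures that a suitable candidate remains. -/
theorem exists_mem_stage {G : M → M → M} [DefF₂ G] (hη : IsOrd η) (hξ : IsOrd ξ)
    (hD : IsPredilator D) (h : HasOtpBelow D η ξ) :
    ∃ ζ u, ζ ∊ ξ ∧ opair D u ∊ stage (predSet η) G D ζ := by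
  obtain ⟨W, hW, h⟩ := h
  obtain ⟨ζ, d, h1, h2, h3⟩ := exists_ranking hD (hW.closed hη).1 hξ h
  obtain ⟨u, hu⟩ := exists_mem_stage_of_ranking (p := predSet η) (G := G) (X := extSet W)
    (N := rankedPreds η W) (d := opair D d) (s := D) (ζ := ζ) (fst_opair _ _)
    (fun z ζ hz hb E hE => exists_rankedPred hη hW
      (closure_induction (IsRanked W) h2 (fun _ _ _ h => (mem_sepr.1 h).2) hz) hb hE)
    (fun e he => by rw [snd_opair]; exact h3 e he)
  exact ⟨ζ, u, h1, hu⟩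

end Ranking

/-! ### The function symbol F -/

section Symbol

variable {k : ℕ} (H : PRFun (k + 3))

/-- The step of the recursion that is given by `H`. -/
noncomputable def stepFun {M : Type u} [PRSLang.Structure M] (η : M) (y : Fin k → M) (g E : M) : M :=
  app H (Matrix.vecCons g (Matrix.vecCons E (Matrix.vecCons η y)))

variable {C : Type v} {𝓜 : C → Type u} [∀ c, PRSLang.Structure (𝓜 c)] [∀ c, PRSomega (𝓜 c)]
  {ok : Prop} {n : ℕ}

theorem PR.stepFun {r s t : ∀ c, (Fin n → 𝓜 c) → 𝓜 c} {y : Fin k → ∀ c, (Fin n → 𝓜 c) → 𝓜 c}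
    [hr : PR 𝓜 ok r] [hs : PR 𝓜 ok s] [ht : PR 𝓜 ok t] (hy : ∀ i, PR 𝓜 ok (y i)) :
    PR 𝓜 ok (fun c v => stepFun H (r c v) (fun i => y i c v) (s c v) (t c v)) := by
  refine PR.congr (fun c v => ?_) (hs := PR.comp H
    (Matrix.vecCons s (Matrix.vecCons t (Matrix.vecCons r y)))
    (Fin.cases hs (Fin.cases ht (Fin.cases hr hy))))
  rw [DilRec.stepFun]
  congr 1
  funext i
  exact Fin.cases rfl (Fin.cases rfl (Fin.cases rfl fun _ => rfl)) i

/-- The construction of `value` is uniform and free of parameters. Taking the family of all models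
as index yields one symbol F that works in each of them. -/
theorem exists_value_symbol : ∃ F : PRFun (k + 3), ∀ (M : Type u) [PRSLang.Structure M]
    [PRSomega M] (y : Fin k → M) (D η ξ : M),
      app F (Matrix.vecCons D (Matrix.vecCons η (Matrix.vecCons ξ y))) =
        value (predSet η) (stepFun H η y) D ξ := by
  have hG : PR Model.carrier.{u} False (n := k + 3 + 2) fun c w =>
      stepFun H (w 3) (fun i => w i.succ.succ.succ.succ.succ) (w 1) (w 0) :=
    PR.stepFun H (y := fun i c w => w i.succ.succ.succ.succ.succ) fun i => PR.var _
  have : PR Model.carrier.{u} False (n := k + 3) fun c v =>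
      value (predSet (v 1)) (stepFun H (v 1) fun i => v i.succ.succ.succ) (v 0) (v 2) :=
    PR.value (p := fun c v x => predSet (v 1) x)
      (G := fun c v g x => stepFun H (v 1) (fun i => v i.succ.succ.succ) g x) (hG := hG)
  obtain ⟨F, hF⟩ := PR.toFun (ht := this)
  refine ⟨F, fun M _ _ y D η ξ => ?_⟩
  exact (hF ⟨M⟩ _).symm

end Symbol

end DilRec

theorem mainTheorem5 {k : ℕ} (H : PRFun (k + 3)) :
    ∃ F : PRFun (k + 3),
      ∀ (M : Type*) [PRSLang.Structure M] [ATR0set M] (y : Fin k → M) (D η ξ ξ' : M),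
        IsDilator D → IsOrd η → IsOrd ξ → IsOrd ξ' → (ξ ∊ ξ' ∨ ξ = ξ') →
        HasOtpBelow D η ξ →
        app F (Matrix.vecCons D (Matrix.vecCons η (Matrix.vecCons ξ y))) =
          app F (Matrix.vecCons D (Matrix.vecCons η (Matrix.vecCons ξ' y))) ∧
        ∃ p g : M, IsPredSet η D p ∧
          IsRestriction
            (fun E => app F (Matrix.vecCons E (Matrix.vecCons η (Matrix.vecCons ξ y)))) p g ∧
          app F (Matrix.vecCons D (Matrix.vecCons η (Matrix.vecCons ξ y))) =
            app H (Matrix.vecCons g (Matrix.vecCons D (Matrix.vecCons η y))) := by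
  obtain ⟨F, hF⟩ := exists_value_symbol H
  refine ⟨F, fun M _ _ y D η ξ ξ' hD hη hξ hξ' hle h => ?_⟩
  have hG : DefF₂ (stepFun H η y) :=
    PR.stepFun H (𝓜 := fun _ : PUnit.{1} => M) (r := fun _ _ => η) (s := fun _ v => v 0)
      (t := fun _ v => v 1) (y := fun i _ _ => y i) fun i => PR.param _
  obtain ⟨ζ, u, hζ, hu⟩ := exists_mem_stage (G := stepFun H η y) hη hξ hD.1 h
  -- D enters at a stage below ξ and thus below ξ'; with either guard the value is the entry u at
  -- that stage.
  have hζ' : ζ ∊ ξ' := hle.elim (fun h => hξ'.trans hζ h) fun h => h ▸ hζ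
  have hp : ∀ {n} (s : PUnit.{1} → (Fin n → M) → M) [PR _ True s],
      PR (fun _ : PUnit.{1} => M) True fun c v => predSet η (s c v) := fun s _ => inferInstance
  have hG' := fun {n} (s t : PUnit.{1} → (Fin n → M) → M) [PR _ True s] [PR _ True t] =>
    hG.apply (n := n) s t
  rw [hF M y D η ξ, hF M y D η ξ', funext fun E => hF M y E η ξ]
  exact ⟨(stage_value hu hζ hξ).trans (stage_value hu hζ' hξ').symm, predSet η D,
    lam (predSet η D) fun E => value (predSet η) (stepFun H η y) E ξ, fun E => mem_predSet,
    fun z => mem_lam, value_eq hu hζ hξ⟩
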